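/- **Setting.** Let $\mathbb R^{1,3}$ carry $\eta=\mathrm{diag}(1,-1,-1,-1)$, let $\mathrm{dS}_3=\{x:\ x_0^2-x_1^2-x_2^2-x_3^2=-1\}$ with the induced metric $g$, let $O(1,3)$ be its isometry group, and let $\mathfrak{so}(1,3)$ be its Lie algebra of Killing fields, spanned by $J_{ij}=x_i\partial_{x^j}-x_j\partial_{x^i}$ (with $x_i=\eta_{ij}x^j$). An electromagnetic field on an open $W\subseteq\mathrm{dS}_3$ is a smooth closed real 2-form $F$ on $W$. Its admissible algebra is $\{X\in\mathfrak{so}(1,3): L_XF=0 \text{ on } W\}$. For real $\zeta,m,e$ with $e\neq0$ and a local potential $A$ (so $F_{ab}=\partial_aA_b-\partial_bA_a$) put $D_a=\nabla_a-ieA_a$ and $H=g^{ab}D_aD_b+\zeta R+m^2$ with $R=6$. A first-order symmetry operator is $\hat X=X^aD_a+ie\chi$ with $X$ a smooth real vector field, $\chi$ a smooth real function and $[H,\hat X]=qH$ for some function $q$. A vector field $X$ on $W$ is a symmetry field of $F$ if near each point of $W$ there are $A$ and $\chi$ making $X^aD_a+ie\chi$ a symmetry operator. $F$ admits a nontrivial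 first-order symmetry algebra on $W$ if it has a symmetry field that is not identically zero on $W$. **Table.** For each of the following subalgebras $G_{n,m}=\mathrm{span}(X_1,\dots,X_n)$, with $r$ as shown, $a>0$ a parameter, $\mu,\mu_1,\mu_2$ real constants, and $f_1,f_2$ smooth functions, coordinates are written $(q^1,u^1,u^2)$, $(q^1,q^2,u^1)$, $(q^1,q^2,q^3)$ for $r=1,2,3$; the list gives the basis, its coordinate expression, and the 2-forms. Write $N_1=J_{13}-J_{01}$, $N_2=J_{23}-J_{02}$. * $r=1$: $G_{1,1}$: $X_1=-J_{03}$; $G_{1,2}$: $X_1=-J_{12}$; $G_{1,3}^a$: $X_1=-(J_{12}+aJ_{03})$; $G_{1,4}$: $X_1=N_1$. Here $X_1=\partial_{q^1}$ and $F=dq^1\wedge df_1(u^1,u^2)+f_2(u^1,u^2)\,du^1\wedge du^2$. * $r=2$: $G_{2,1}$: $(N_1,N_2)$; $G_{2,2}$: $(-J_{12},-J_{03})$. $X_1=\partial_{q^1}$, $X_2=\partial_{q^2}$; $F=\mu\,dq^1\wedge dq^2+f_1(u^1)\,dq^1\wedge du^1+f_2(u^1)\,dq^2\wedge du^1$. *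 $r=2$: $G_{2,3}$: $(N_1,-J_{03})$. $X_1=\partial_{q^1}$, $X_2=-q^1\partial_{q^1}+\partial_{q^2}$; $F=e^{q^2}dq^1\wedge(f_1(u^1)dq^2+df_1(u^1))+f_2(u^1)\,dq^2\wedge du^1$. * $r=3$: $G_{3,1}$: $(N_1,N_2,-J_{03})$. $X_1=\partial_{q^1}$, $X_2=\partial_{q^2}$, $X_3=-q^1\partial_{q^1}-q^2\partial_{q^2}+\partial_{q^3}$; $F=e^{q^3}(\mu_1dq^1+\mu_2dq^2)\wedge dq^3$. * $r=2$: $G_{3,2}$: $(N_1,N_2,-J_{12})$. $X_1=\partial_{q^1}$, $X_2=\partial_{q^2}$, $X_3=-q^2\partial_{q^1}+q^1\partial_{q^2}$; $F=\mu\,dq^1\wedge dq^2$. * $r=3$: $G_{3,3}^a$: $(N_1,N_2,-(J_{12}+aJ_{03}))$. $X_1=\partial_{q^1}$, $X_2=\partial_{q^2}$, $X_3=-(aq^1+q^2)\partial_{q^1}+(q^1-aq^2)\partial_{q^2}+\partial_{q^3}$; $F=e^{aq^3}(\mu_1\cos q^3+\mu_2\sin q^3)dq^1\wedge dq^3+e^{aq^3}(\mu_1\sin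 q^3-\mu_2\cos q^3)dq^2\wedge dq^3$. * $r=2$: $G_{3,4}$: $(-J_{12},-J_{23},-J_{13})$. $X_1=\partial_{q^1}$, $X_2=\sin q^1\tan q^2\,\partial_{q^1}+\cos q^1\,\partial_{q^2}$, $X_3=\cos q^1\tan q^2\,\partial_{q^1}-\sin q^1\,\partial_{q^2}$; $F=\mu\cos(q^2)\,dq^1\wedge dq^2$. * $r=2$: $G_{3,5}$: $(-J_{01},-J_{12},-J_{02})$. $X_1=\partial_{q^1}$, $X_2=\sinh q^1\tan q^2\,\partial_{q^1}+\cosh q^1\,\partial_{q^2}$, $X_3=\cosh q^1\tan q^2\,\partial_{q^1}+\sinh q^1\,\partial_{q^2}$; $F=\mu\cos(q^2)\,dq^1\wedge dq^2$. * $r=3$: $G_{4,1}$: $(N_1,N_2,-J_{12},-J_{03})$. $X_1=\partial_{q^1}$, $X_2=\partial_{q^2}$, $X_3=-q^2\partial_{q^1}+q^1\partial_{q^2}$, $X_4=-q^1\partial_{q^1}-q^2\partial_{q^2}+\partial_{q^3}$; $F=0$. A *rectifying chart* for a row is a smooth injective immersion $\psi:\Omega\to\mathrm{dS}_3$ of an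 open set $\Omega\subseteq\mathbb R^3$ (with $\cos q^2\ne0$ on $\Omega$ for $G_{3,4},G_{3,5}$) in which the fields $X_A$ have the listed coordinate expressions. **Claim.** 1. For each row the listed $X_A$ are linearly independent and span a subalgebra of $\mathfrak{so}(1,3)$, the largest rank of $(X_A(x))_A$ over $x\in\mathrm{dS}_3$ is $r$, and the following is a rectifying chart ($x=(x^0,x^1,x^2,x^3)$): * $G_{1,1}$: $(-\sin u^1\sin u^2\sinh q^1,\ \cos u^2,\ \cos u^1\sin u^2,\ \sin u^1\sin u^2\cosh q^1)$, $0<u^1,u^2<\pi$. * $G_{1,2}$: $(\sinh u^1,\ -\cosh u^1\cos u^2\sin q^1,\ \cosh u^1\cos u^2\cos q^1,\ \cosh u^1\sin u^2)$, $|q^1|<\pi$, $|u^2|<\pi/2$. * $G_{1,3}^a$: $(-\cosh u^1\sin u^2\sinh aq^1+\sinh u^1\cosh aq^1,\ -\cosh u^1\cos u^2\sin q^1,\ \cosh u^1\cos u^2\cos q^1,\ \cosh u^1\sin u^2\cosh aq^1-\sinh u^1\sinh aq^1)$, $|q^1|<\pi$, $|u^2|<\pi/2$. * $G_{1,4}$: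 with $k=\cosh u^1\sin u^2-\sinh u^1$: $(-\tfrac12(q^1)^2k+\sinh u^1,\ q^1k,\ \cosh u^1\cos u^2,\ -\tfrac12(q^1)^2k+\cosh u^1\sin u^2)$, $|u^2|<\pi$, $k\neq0$. * $G_{2,1}$ and $G_{3,2}$: with $\rho=\tfrac12e^{-u^1}((q^1)^2+(q^2)^2)$: $(\sinh u^1-\rho,\ q^1e^{-u^1},\ q^2e^{-u^1},\ \cosh u^1-\rho)$ on $\mathbb R^3$. * $G_{2,2}$: $(-\sin u^1\sinh q^2,\ \cos u^1\cos q^1,\ \cos u^1\sin q^1,\ \sin u^1\cosh q^2)$, $|q^1|<\pi$, $0<u^1<\pi/2$. * $G_{2,3}$: $(-\cos u^1(\sinh q^2+\tfrac12(q^1)^2e^{q^2}),\ q^1e^{q^2}\cos u^1,\ \sin u^1,\ \cos u^1(\cosh q^2-\tfrac12(q^1)^2e^{q^2}))$, $|u^1|<\pi/2$. * $G_{3,3}^a$: with $\rho=\tfrac12e^{aq^3}((q^1)^2+(q^2)^2)$: $(-\sinh aq^3-\rho,\ q^1e^{aq^3},\ q^2e^{aq^3},\ \cosh aq^3-\rho)$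 on $\mathbb R^3$; $G_{3,1}$ and $G_{4,1}$: the same formula with $a=1$. * $G_{3,4}$: $(\sinh u^1,\ -\cosh u^1\sin q^1\cos q^2,\ \cosh u^1\cos q^1\cos q^2,\ \cosh u^1\sin q^2)$, $|q^1|<\pi$, $|q^2|<\pi/2$. * $G_{3,5}$: $(-\sin u^1\sinh q^1\cos q^2,\ \sin u^1\cosh q^1\cos q^2,\ \sin u^1\sin q^2,\ \cos u^1)$, $|q^2|<\pi/2$, $0<u^1<\pi$. 2. Every nonzero proper Lie subalgebra of $\mathfrak{so}(1,3)$ is $O(1,3)$-conjugate to one of the listed ones. 3. For each row and each convex open $\Omega\subseteq\mathbb R^3$ (with $\cos q^2\neq0$ on $\Omega$ for $G_{3,4},G_{3,5}$), a 2-form on $\Omega$ is smooth, closed and has zero Lie derivative along all the listed coordinate fields $X_A$ if and only if it is of the listed form on $\Omega$ for some constants $\mu$ and functions $f$ smooth on the corresponding projection of $\Omega$. 4. For each row, each rectifying chart $\psi:\Omega\to\mathrm{dS}_3$ with $\Omega$ convex and each electromagnetic field $F$ on $\psi(\Omega)$, the following are equivalent: $L_{X_A}F=0$ for all $A$; $\psi^*F$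 is of the listed form; every $X_A$ is a symmetry field of $F$. 5. Let $F$ be an electromagnetic field on a connected open $W\subseteq\mathrm{dS}_3$ that admits a nontrivial first-order symmetry algebra. Then (a) there are a row $G$ and $\tau\in O(1,3)$ such that $\tau$ carries the admissible algebra of $F$ onto an algebra containing $G$, equal to $G$ unless $F=0$ on $W$, and $\psi^*(\tau^{-1})^*F$ is of the form listed for $G$ for every rectifying chart $\psi:\Omega\to\tau(W)$ for $G$ with $\Omega$ convex; and (b) there are a row, a $\tau\in O(1,3)$ and an open dense subset $W_0$ of $W$ such that each $\tau(x)$, $x\in W_0$, lies in the image of a rectifying chart $\psi:\Omega\to\tau(W)$ for that row, with $\Omega$ convex, in which $\psi^*(\tau^{-1})^*F$ is of the form listed for that row. -/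

import Mathlib

open Set Topology
open scoped ContDiff

noncomputable section

namespace DeSitter

/-! ### Differential forms in coordinates -/

section Forms

variable {E : Type*} [NormedAddCommGroup E] [NormedSpace ℝ E]
variable {E' : Type*} [NormedAddCommGroup E'] [NormedSpace ℝ E']

/-- The wedge product of two covectors, `(α ∧ β)(v, w) = α v * β w - α w * β v`
(this formula is `wedge_apply`). -/
def wedge (α β : E →L[ℝ] ℝ) : E [⋀^Fin 2]→L[ℝ] ℝ :=
  ContinuousMultilinearMap.alternatization
    ((ContinuousMultilinearMap.mkPiAlgebra ℝ (Fin 2) ℝ).compContinuousLinearMap ![α, β])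

theorem wedge_apply (α β : E →L[ℝ] ℝ) (v w : E) :
    wedge α β ![v, w] = α v * β w - α w * β v := by
  have h : (Finset.univ : Finset (Equiv.Perm (Fin 2))) = {1, Equiv.swap 0 1} := by decide
  simp [wedge, ContinuousMultilinearMap.alternatization, Fin.prod_univ_two, h,
    Finset.sum_pair (show (1 : Equiv.Perm (Fin 2)) ≠ Equiv.swap 0 1 by decide)]
  ring

/-- The pullback `f^* θ` of a `2`-form. -/
def pullback (f : E → E') (θ : E' → E' [⋀^Fin 2]→L[ℝ] ℝ) : E → E [⋀^Fin 2]→L[ℝ] ℝ :=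
  fun x => (θ (f x)).compContinuousLinearMap (fderiv ℝ f x)

/-- The Lie derivative `L_X θ` of a `2`-form, evaluated at the point `x` on the vectors `v, w`:
`(L_X θ)_{ab} = X^c ∂_c θ_{ab} + θ_{cb} ∂_a X^c + θ_{ac} ∂_b X^c`. -/
def lieDeriv (X : E → E) (θ : E → E [⋀^Fin 2]→L[ℝ] ℝ) (x v w : E) : ℝ :=
  fderiv ℝ θ x (X x) ![v, w] + θ x ![fderiv ℝ X x v, w] + θ x ![v, fderiv ℝ X x w]

end Forms

/-! ### Minkowski space, de Sitter space and tensor calculus on it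

De Sitter space is the hyperboloid `dS` in `M`.  Functions, vector fields and forms on (a part of)
`dS` are represented by objects on `M` of which only the values at points of `dS` (and, for forms,
on vectors tangent to `dS`) are used.  To differentiate them along `dS`, they are pulled back by the
radial retraction `retr` onto `dS`. -/

/-- Minkowski space `ℝ^{1,3}` with coordinates `x 0, x 1, x 2, x 3`. -/
abbrev M : Type := Fin 4 → ℝ

/-- Coordinate space of a chart of `dS`. -/
abbrev Q : Type := Fin 3 → ℝ

/-- The diagonal of `η = diag(1, -1, -1, -1)`. -/
def eta : Fin 4 → ℝ := ![1, -1, -1, -1]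

/-- The Minkowski inner product. -/
def mink (x y : M) : ℝ := ∑ i, eta i * x i * y i

/-- De Sitter space of radius `1`. -/
def dS : Set M := {x | mink x x = -1}

/-- `W` is a (relatively) open subset of de Sitter space. -/
def IsOpenIn (W : Set M) : Prop := ∃ O : Set M, IsOpen O ∧ W = O ∩ dS

/-- The radial retraction of `{x | mink x x < 0}` onto `dS`. -/
def retr (x : M) : M := (Real.sqrt (-mink x x))⁻¹ • x

/-- Smoothness of a function on the open subset `W` of `dS`. -/
def SmoothOn {F : Type*} [NormedAddCommGroup F] [NormedSpace ℝ F] (f : M → F) (W : Set M) : Prop :=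
  ∀ x ∈ W, ContDiffAt ℝ ∞ (fun y => f (retr y)) x

/-- The pullback of a `1`-form on `dS` by the retraction.  At `x ∈ dS` this is the `1`-form
precomposed with the projection of `M` onto the tangent space of `dS` at `x`. -/
def ext₁ (A : M → M →L[ℝ] ℝ) (x : M) : M →L[ℝ] ℝ := (A (retr x)).comp (fderiv ℝ retr x)

/-- The pullback of a `2`-form on `dS` by the retraction.  -/
def ext₂ (F : M → M [⋀^Fin 2]→L[ℝ] ℝ) : M → M [⋀^Fin 2]→L[ℝ] ℝ := pullback retr F

/-- `F` is an electromagnetic field on `W ⊆ dS`: a smooth closed `2`-form. -/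
def IsEMField (F : M → M [⋀^Fin 2]→L[ℝ] ℝ) (W : Set M) : Prop :=
  (∀ x ∈ W, ContDiffAt ℝ ∞ (ext₂ F) x) ∧ ∀ x ∈ W, extDeriv (ext₂ F) x = 0

/-- `L_X F = 0` on `W ⊆ dS`, for a linear vector field `X` on `M` that is tangent to `dS` (such a
field is related to itself by the retraction). -/
def LieInvariant (X : M → M) (F : M → M [⋀^Fin 2]→L[ℝ] ℝ) (W : Set M) : Prop :=
  ∀ x ∈ W, ∀ v w : M, lieDeriv X (ext₂ F) x v w = 0

/-! ### The Klein-Gordon operator and its first-order symmetry operators -/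

/-- `A` is a smooth potential of `F` on `V ⊆ dS`: `F_{ab} = ∂_a A_b - ∂_b A_a`. -/
def IsPotential (A : M → M →L[ℝ] ℝ) (F : M → M [⋀^Fin 2]→L[ℝ] ℝ) (V : Set M) : Prop :=
  (∀ x ∈ V, ContDiffAt ℝ ∞ (ext₁ A) x) ∧
  ∀ x ∈ V, ∀ v w : M,
    fderiv ℝ (ext₁ A) x v w - fderiv ℝ (ext₁ A) x w v = ext₂ F x ![v, w]

/-- The derivative `D_v φ = v φ - i e A(v) φ` at `x ∈ dS` along the projection of `v` to the tangent
space of `dS` at `x`. -/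
def covD (e : ℝ) (A : M → M →L[ℝ] ℝ) (φ : M → ℂ) (v x : M) : ℂ :=
  fderiv ℝ (fun y => φ (retr y)) x v - Complex.I * e * (ext₁ A x v : ℝ) * φ x

/-- The scalar curvature of `dS` (of radius `1`). -/
def scalarCurvature : ℝ := 6

/-- The Klein-Gordon operator `H = g^{ab} D_a D_b + ζ R + m²` on `dS`.  Since the Levi-Civita
connection of the hypersurface `dS` is the tangential part of the flat derivative, `g^{ab} D_a D_b φ`
(the divergence of the gradient) is `∑ η^{ii} D_i D_i φ`, where `D_i` is the derivative along the
tangential projection of the `i`-th basis vector of `M`. -/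
def kleinGordon (ζ m e : ℝ) (A : M → M →L[ℝ] ℝ) (φ : M → ℂ) (x : M) : ℂ :=
  (∑ i : Fin 4, (eta i : ℂ) *
    covD e A (fun y => covD e A φ (Pi.single i 1) y) (Pi.single i 1) x) +
  ((ζ * scalarCurvature + m ^ 2 : ℝ) : ℂ) * φ x

/-- The first-order operator `X^a D_a + i e χ`. -/
def firstOrderOp (e : ℝ) (A : M → M →L[ℝ] ℝ) (X : M → M) (χ : M → ℝ) (φ : M → ℂ) (x : M) : ℂ :=
  covD e A φ (X x) x + Complex.I * e * (χ x : ℂ) * φ x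

/-- `X^a D_a + i e χ`, with a real smooth vector field `X` and a real smooth function `χ` on the open
subset `V` of `dS`, is a symmetry operator: `[H, X^a D_a + i e χ] = q H` on all smooth functions on
`V`, for some function `q`. -/
def IsSymmetryOperator (ζ m e : ℝ) (A : M → M →L[ℝ] ℝ) (X : M → M) (χ : M → ℝ) (V : Set M) :
    Prop :=
  SmoothOn X V ∧ (∀ x ∈ V, mink x (X x) = 0) ∧ SmoothOn χ V ∧
  ∃ q : M → ℂ, ∀ φ : M → ℂ, SmoothOn φ V → ∀ x ∈ V,
    kleinGordon ζ m e A (firstOrderOp e A X χ φ) x -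
      firstOrderOp e A X χ (kleinGordon ζ m e A φ) x = q x * kleinGordon ζ m e A φ x

/-- The vector field `X` on `W ⊆ dS` extends, near each point of `W`, to a first-order symmetry
operator `X^a D_a + i e χ` of the Klein-Gordon equation in the electromagnetic field `F`. -/
def IsSymmetryField (ζ m e : ℝ) (F : M → M [⋀^Fin 2]→L[ℝ] ℝ) (W : Set M) (X : M → M) : Prop :=
  ∀ x ∈ W, ∃ V : Set M, IsOpenIn V ∧ x ∈ V ∧ V ⊆ W ∧
    ∃ (A : M → M →L[ℝ] ℝ) (χ : M → ℝ), IsPotential A F V ∧ IsSymmetryOperator ζ m e A X χ V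

/-- The Klein-Gordon equation in the field `F` on `W` has a nontrivial first-order symmetry algebra:
there is a first-order symmetry operator with nonzero vector field. -/
def AdmitsNontrivialSymmetry (ζ m e : ℝ) (F : M → M [⋀^Fin 2]→L[ℝ] ℝ) (W : Set M) : Prop :=
  ∃ X : M → M, IsSymmetryField ζ m e F W X ∧ ∃ x ∈ W, X x ≠ 0

/-! ### The Lie algebra `so(1,3)` of Killing vector fields, and isometries -/

/-- `J_{ij} = x_i ∂/∂x^j - x_j ∂/∂x^i`, where `x_i = η_{ii} x^i`. -/
def J (i j : Fin 4) : M → M :=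
  fun x => (eta i * x i) • Pi.single j 1 - (eta j * x j) • Pi.single i 1

/-- The Lie algebra `so(1,3)` of Killing vector fields of `dS`. -/
def so13 : Submodule ℝ (M → M) := Submodule.span ℝ {X | ∃ i j : Fin 4, X = J i j}

/-- Closedness under the commutator of vector fields. -/
def IsLieClosed (G : Submodule ℝ (M → M)) : Prop :=
  ∀ X ∈ G, ∀ Y ∈ G, VectorField.lieBracket ℝ X Y ∈ G

/-- `τ` belongs to `O(1,3)`, the isometry group of `dS`. -/
def IsLorentz (τ : M ≃L[ℝ] M) : Prop := ∀ x y, mink (τ x) (τ y) = mink x y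

/-- The action of `τ` on vector fields. -/
def pushField (τ : M ≃L[ℝ] M) (X : M → M) : M → M := fun x => τ (X (τ.symm x))

/-- The action of `τ` on `2`-forms (pullback by `τ⁻¹`). -/
def pushForm (τ : M ≃L[ℝ] M) (F : M → M [⋀^Fin 2]→L[ℝ] ℝ) : M → M [⋀^Fin 2]→L[ℝ] ℝ :=
  fun x => (F (τ.symm x)).compContinuousLinearMap (τ.symm : M →L[ℝ] M)

/-- The admissible algebra of `F` on `W`: the Killing fields `X` with `L_X F = 0`. -/
def admissible (F : M → M [⋀^Fin 2]→L[ℝ] ℝ) (W : Set M) : Set (M → M) :=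
  {X | X ∈ so13 ∧ LieInvariant X F W}

/-! ### The tables -/

/-- The labels of the subalgebras `G_{n,m}`, `G_{n,m}^a`. -/
inductive Row : Type
  | g11
  | g12
  | g13 (a : ℝ) (ha : 0 < a)
  | g14
  | g21
  | g22
  | g23
  | g31
  | g32
  | g33 (a : ℝ) (ha : 0 < a)
  | g34
  | g35
  | g41

namespace Row

/-- The dimension `n` of `G_{n,m}`. -/
def dim : Row → ℕ
  | g11 | g12 | g13 _ _ | g14 => 1
  | g21 | g22 | g23 => 2
  | g31 | g32 | g33 _ _ | g34 | g35 => 3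
  | g41 => 4

/-- The dimension `r` of the orbits in general position. -/
def rank : Row → ℕ
  | g11 | g12 | g13 _ _ | g14 => 1
  | g21 | g22 | g23 | g32 | g34 | g35 => 2
  | g31 | g33 _ _ | g41 => 3

/-- The basis fields `X_A` of `G_{n,m}`. -/
def gen : (R : Row) → Fin R.dim → M → M
  | g11 => ![-J 0 3]
  | g12 => ![-J 1 2]
  | g13 a _ => ![-(J 1 2 + a • J 0 3)]
  | g14 => ![J 1 3 - J 0 1]
  | g21 => ![J 1 3 - J 0 1, J 2 3 - J 0 2]
  | g22 => ![-J 1 2, -J 0 3]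
  | g23 => ![J 1 3 - J 0 1, -J 0 3]
  | g31 => ![J 1 3 - J 0 1, J 2 3 - J 0 2, -J 0 3]
  | g32 => ![J 1 3 - J 0 1, J 2 3 - J 0 2, -J 1 2]
  | g33 a _ => ![J 1 3 - J 0 1, J 2 3 - J 0 2, -(J 1 2 + a • J 0 3)]
  | g34 => ![-J 1 2, -J 2 3, -J 1 3]
  | g35 => ![-J 0 1, -J 1 2, -J 0 2]
  | g41 => ![J 1 3 - J 0 1, J 2 3 - J 0 2, -J 1 2, -J 0 3]

/-- The subspace `G_{n,m}` of `so(1,3)`. -/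
def alg (R : Row) : Submodule ℝ (M → M) := Submodule.span ℝ (range R.gen)

/-- The fields `X_A` in rectifying coordinates `p = (q, u)`, which are
`(q¹, u¹, u²)` for `r = 1`, `(q¹, q², u¹)` for `r = 2` and `(q¹, q², q³)` for `r = 3`. -/
def coordGen : (R : Row) → Fin R.dim → Q → Q
  | g11 => ![fun _ => ![1, 0, 0]]
  | g12 => ![fun _ => ![1, 0, 0]]
  | g13 _ _ => ![fun _ => ![1, 0, 0]]
  | g14 => ![fun _ => ![1, 0, 0]]
  | g21 => ![fun _ => ![1, 0, 0], fun _ => ![0, 1, 0]]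
  | g22 => ![fun _ => ![1, 0, 0], fun _ => ![0, 1, 0]]
  | g23 => ![fun _ => ![1, 0, 0], fun p => ![-p 0, 1, 0]]
  | g31 => ![fun _ => ![1, 0, 0], fun _ => ![0, 1, 0], fun p => ![-p 0, -p 1, 1]]
  | g32 => ![fun _ => ![1, 0, 0], fun _ => ![0, 1, 0], fun p => ![-p 1, p 0, 0]]
  | g33 a _ => ![fun _ => ![1, 0, 0], fun _ => ![0, 1, 0],
      fun p => ![-(a * p 0 + p 1), p 0 - a * p 1, 1]]
  | g34 => ![fun _ => ![1, 0, 0],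
      fun p => ![Real.sin (p 0) * Real.tan (p 1), Real.cos (p 0), 0],
      fun p => ![Real.cos (p 0) * Real.tan (p 1), -Real.sin (p 0), 0]]
  | g35 => ![fun _ => ![1, 0, 0],
      fun p => ![Real.sinh (p 0) * Real.tan (p 1), Real.cosh (p 0), 0],
      fun p => ![Real.cosh (p 0) * Real.tan (p 1), Real.sinh (p 0), 0]]
  | g41 => ![fun _ => ![1, 0, 0], fun _ => ![0, 1, 0], fun p => ![-p 1, p 0, 0],
      fun p => ![-p 0, -p 1, 1]]

/-- The set where the fields `coordGen` are defined. -/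
def coordDomain : Row → Set Q
  | g34 | g35 => {p | Real.cos (p 1) ≠ 0}
  | _ => univ

/-- The coordinate `1`-form `dp^i`. -/
def d (i : Fin 3) : Q →L[ℝ] ℝ := ContinuousLinearMap.proj i

/-- On `Ω`, the `2`-form `θ` is one of the forms listed for `G_{n,m}`. -/
def TableForm (R : Row) (Ω : Set Q) (θ : Q → Q [⋀^Fin 2]→L[ℝ] ℝ) : Prop :=
  match R with
  | g11 | g12 | g13 _ _ | g14 =>
    ∃ f₁ f₂ : ℝ × ℝ → ℝ,
      (∀ p ∈ Ω, ContDiffAt ℝ ∞ f₁ (p 1, p 2) ∧ ContDiffAt ℝ ∞ f₂ (p 1, p 2)) ∧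
      ∀ p ∈ Ω, θ p = wedge (d 0) (fderiv ℝ (fun p' : Q => f₁ (p' 1, p' 2)) p)
        + f₂ (p 1, p 2) • wedge (d 1) (d 2)
  | g21 | g22 =>
    ∃ (μ : ℝ) (f₁ f₂ : ℝ → ℝ),
      (∀ p ∈ Ω, ContDiffAt ℝ ∞ f₁ (p 2) ∧ ContDiffAt ℝ ∞ f₂ (p 2)) ∧
      ∀ p ∈ Ω, θ p = μ • wedge (d 0) (d 1) + f₁ (p 2) • wedge (d 0) (d 2)
        + f₂ (p 2) • wedge (d 1) (d 2)
  | g23 =>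
    ∃ f₁ f₂ : ℝ → ℝ,
      (∀ p ∈ Ω, ContDiffAt ℝ ∞ f₁ (p 2) ∧ ContDiffAt ℝ ∞ f₂ (p 2)) ∧
      ∀ p ∈ Ω, θ p =
        Real.exp (p 1) • wedge (d 0) (f₁ (p 2) • d 1 + fderiv ℝ (fun p' : Q => f₁ (p' 2)) p)
        + f₂ (p 2) • wedge (d 1) (d 2)
  | g31 =>
    ∃ μ₁ μ₂ : ℝ, ∀ p ∈ Ω, θ p = Real.exp (p 2) • wedge (μ₁ • d 0 + μ₂ • d 1) (d 2)
  | g32 => ∃ μ : ℝ, ∀ p ∈ Ω, θ p = μ • wedge (d 0) (d 1)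
  | g33 a _ =>
    ∃ μ₁ μ₂ : ℝ, ∀ p ∈ Ω, θ p =
      (Real.exp (a * p 2) * (μ₁ * Real.cos (p 2) + μ₂ * Real.sin (p 2))) • wedge (d 0) (d 2)
      + (Real.exp (a * p 2) * (μ₁ * Real.sin (p 2) - μ₂ * Real.cos (p 2))) • wedge (d 1) (d 2)
  | g34 | g35 => ∃ μ : ℝ, ∀ p ∈ Ω, θ p = (μ * Real.cos (p 1)) • wedge (d 0) (d 1)
  | g41 => ∀ p ∈ Ω, θ p = 0

/-- `ψ : Ω → dS` is the inverse of a local coordinate system on `dS` (a smooth injective immersion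
of an open set) in which the fields `X_A` of `G_{n,m}` have the coordinate expressions
`coordGen`. -/
structure IsRectifying (R : Row) (Ω : Set Q) (ψ : Q → M) : Prop where
  isOpen : IsOpen Ω
  subset : Ω ⊆ R.coordDomain
  mapsTo : MapsTo ψ Ω dS
  smooth : ContDiffOn ℝ ∞ ψ Ω
  injOn : InjOn ψ Ω
  immersion : ∀ p ∈ Ω, Function.Injective (fderiv ℝ ψ p)
  related : ∀ A : Fin R.dim, ∀ p ∈ Ω, fderiv ℝ ψ p (R.coordGen A p) = R.gen A (ψ p)

/-- The explicit rectifying coordinates for `G_{n,m}`; the components are `x⁰, x¹, x², x³`. -/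
def chart : Row → Q → M
  | g11 => fun p =>
      ![-(Real.sin (p 1) * Real.sin (p 2) * Real.sinh (p 0)),
        Real.cos (p 2),
        Real.cos (p 1) * Real.sin (p 2),
        Real.sin (p 1) * Real.sin (p 2) * Real.cosh (p 0)]
  | g12 => fun p =>
      ![Real.sinh (p 1),
        -(Real.cosh (p 1) * Real.cos (p 2) * Real.sin (p 0)),
        Real.cosh (p 1) * Real.cos (p 2) * Real.cos (p 0),
        Real.cosh (p 1) * Real.sin (p 2)]
  | g13 a _ => fun p =>
      ![-(Real.cosh (p 1) * Real.sin (p 2) * Real.sinh (a * p 0))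
          + Real.sinh (p 1) * Real.cosh (a * p 0),
        -(Real.cosh (p 1) * Real.cos (p 2) * Real.sin (p 0)),
        Real.cosh (p 1) * Real.cos (p 2) * Real.cos (p 0),
        Real.cosh (p 1) * Real.sin (p 2) * Real.cosh (a * p 0)
          - Real.sinh (p 1) * Real.sinh (a * p 0)]
  | g14 => fun p =>
      ![1 / 2 * p 0 ^ 2 * (Real.sinh (p 1) - Real.cosh (p 1) * Real.sin (p 2)) + Real.sinh (p 1),
        p 0 * (Real.cosh (p 1) * Real.sin (p 2) - Real.sinh (p 1)),
        Real.cosh (p 1) * Real.cos (p 2),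
        1 / 2 * p 0 ^ 2 * (Real.sinh (p 1) - Real.cosh (p 1) * Real.sin (p 2))
          + Real.cosh (p 1) * Real.sin (p 2)]
  | g21 | g32 => fun p =>
      ![Real.sinh (p 2) - 1 / 2 * Real.exp (-p 2) * (p 0 ^ 2 + p 1 ^ 2),
        p 0 * Real.exp (-p 2),
        p 1 * Real.exp (-p 2),
        Real.cosh (p 2) - 1 / 2 * Real.exp (-p 2) * (p 0 ^ 2 + p 1 ^ 2)]
  | g22 => fun p =>
      ![-(Real.sin (p 2) * Real.sinh (p 1)),
        Real.cos (p 2) * Real.cos (p 0),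
        Real.cos (p 2) * Real.sin (p 0),
        Real.sin (p 2) * Real.cosh (p 1)]
  | g23 => fun p =>
      ![-(Real.cos (p 2) * (Real.sinh (p 1) + 1 / 2 * p 0 ^ 2 * Real.exp (p 1))),
        p 0 * Real.exp (p 1) * Real.cos (p 2),
        Real.sin (p 2),
        Real.cos (p 2) * (Real.cosh (p 1) - 1 / 2 * p 0 ^ 2 * Real.exp (p 1))]
  | g31 | g41 => fun p =>
      ![-Real.sinh (p 2) - 1 / 2 * Real.exp (p 2) * (p 0 ^ 2 + p 1 ^ 2),
        p 0 * Real.exp (p 2),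
        p 1 * Real.exp (p 2),
        Real.cosh (p 2) - 1 / 2 * Real.exp (p 2) * (p 0 ^ 2 + p 1 ^ 2)]
  | g33 a _ => fun p =>
      ![-Real.sinh (a * p 2) - 1 / 2 * Real.exp (a * p 2) * (p 0 ^ 2 + p 1 ^ 2),
        p 0 * Real.exp (a * p 2),
        p 1 * Real.exp (a * p 2),
        Real.cosh (a * p 2) - 1 / 2 * Real.exp (a * p 2) * (p 0 ^ 2 + p 1 ^ 2)]
  | g34 => fun p =>
      ![Real.sinh (p 2),
        -(Real.cosh (p 2) * Real.sin (p 0) * Real.cos (p 1)),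
        Real.cosh (p 2) * Real.cos (p 0) * Real.cos (p 1),
        Real.cosh (p 2) * Real.sin (p 1)]
  | g35 => fun p =>
      ![-(Real.sin (p 2) * Real.sinh (p 0) * Real.cos (p 1)),
        Real.sin (p 2) * Real.cosh (p 0) * Real.cos (p 1),
        Real.sin (p 2) * Real.sin (p 1),
        Real.cos (p 2)]

/-- The domain of the explicit rectifying coordinates. -/
def chartDomain : Row → Set Q
  | g11 => {p | p 1 ∈ Ioo 0 Real.pi ∧ p 2 ∈ Ioo 0 Real.pi}
  | g12 | g13 _ _ =>
      {p | p 0 ∈ Ioo (-Real.pi) Real.pi ∧ p 2 ∈ Ioo (-(Real.pi / 2)) (Real.pi / 2)}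
  | g14 => {p | p 2 ∈ Ioo (-Real.pi) Real.pi ∧ Real.sinh (p 1) ≠ Real.cosh (p 1) * Real.sin (p 2)}
  | g22 => {p | p 0 ∈ Ioo (-Real.pi) Real.pi ∧ p 2 ∈ Ioo 0 (Real.pi / 2)}
  | g23 => {p | p 2 ∈ Ioo (-(Real.pi / 2)) (Real.pi / 2)}
  | g34 => {p | p 0 ∈ Ioo (-Real.pi) Real.pi ∧ p 1 ∈ Ioo (-(Real.pi / 2)) (Real.pi / 2)}
  | g35 => {p | p 1 ∈ Ioo (-(Real.pi / 2)) (Real.pi / 2) ∧ p 2 ∈ Ioo 0 Real.pi}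
  | g21 | g31 | g32 | g33 _ _ | g41 => univ

end Row

end DeSitter

end

open Set Topology
open scoped ContDiff

noncomputable section

namespace DeSitter

/-! Everything on de Sitter space is moved to the open cone of spacelike vectors in flat Minkowski
space. Pulled back along the radial retraction, functions become homogeneous of degree 0, while
vector fields are extended with degree 1. The extension of a Killing field is then just a
skew-adjoint linear map, the Klein-Gordon operator becomes, at points of the hyperboloid, the flat
gauge-covariant wave operator plus a constant (`kleinGordon_eq`), and its commutator with a
first-order operator is a flat commutator (`commutator_eq`, `box_Op`).

Symmetry operators. Testing `[H, X̂] = q H` at a point on products of two linear functions vanishing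
there gives the conformal Killing equation. Testing on one linear function gives, in its real part,
a wave equation for the field, and in its imaginary part `dχ = F(·, X)` (`symmetry_conditions`; here
`e ≠ 0` is used). The wave equation makes the conformal factor constant, and the curvature of the
hyperboloid then forces it to be zero (`symmetric_gradient_eq_zero`). So the field is locally
Killing, and the existence of `χ` with closed `F` gives `L_X F = 0`. Conversely, for an invariant
closed form the contraction with `X` is closed by Cartan's formula, hence locally exact; its
primitive is `χ`, and the commutator vanishes with `q = 0`, because skew coefficients meet
symmetrised second derivatives (`isSymmetryOperator_of_contraction`). Admissible Killing fields and
Killing symmetry fields are therefore the same.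

Subalgebras. Minkowski vectors are Hermitian `2 × 2` matrices, and `so(1,3)` is `sl(2, ℂ)` regarded
as a real Lie algebra. Unipotent, diagonal, Weyl and complex conjugation moves are implemented by
Lorentz transformations. A proper real subalgebra either contains a nilpotent element, and is then
conjugate to a triangular one or to `sl(2, ℝ)`, or contains none, and is then conjugate to a
triangular one, to `su(2)` or to `su(1,1)` (`classified_of_bracket_closed`). Triangular subalgebras
are sorted by their diagonal and nilpotent parts, each a real subspace of `ℂ` (`classified_borel`).

Tables. In a rectifying chart, invariance and closedness are linear first-order equations for three
component functions. On a convex set they integrate explicitly to the listed forms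
(`invariant_iff_tableForm`), and naturality of the Lie derivative (`lieDeriv_pullback`) carries this
to the hyperboloid.

Global statement. A Killing field is determined by its germ, so on a connected set a symmetry field
is one Killing field, and it preserves `F`. The admissible algebra is closed under brackets, hence
classified; if it is all of `so(1,3)`, isotropy forces `F = 0` (`ext₂_eq_zero_of_forall`). For the
dense set it suffices to rectify a single Killing field by its flow wherever it is nonzero
(`exists_flowBox`), which uses only a one-dimensional row. -/

theorem two_le_infty : (2 : ℕ∞ω) ≤ ∞ := by
  show ((2 : ℕ∞) : ℕ∞ω) ≤ ((⊤ : ℕ∞) : ℕ∞ω)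
  exact WithTop.coe_le_coe.2 le_top

/-! ### Algebra and calculus of 2-forms: pullback, exterior and Lie derivative. -/

section Forms

variable {E : Type*} [NormedAddCommGroup E] [NormedSpace ℝ E]
variable {E' : Type*} [NormedAddCommGroup E'] [NormedSpace ℝ E']

theorem update_pair_zero {E : Type*} (a b v : E) : Function.update ![a, v] 0 b = ![b, v] := by
  funext i; fin_cases i <;> rfl

theorem form_add_left (θ : E [⋀^Fin 2]→L[ℝ] ℝ) (a b v : E) :
    θ ![a + b, v] = θ ![a, v] + θ ![b, v] := by
  have h := θ.toMultilinearMap.map_update_add ![a, v] 0 a b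
  simp only [update_pair_zero] at h
  exact h

theorem form_smul_left (θ : E [⋀^Fin 2]→L[ℝ] ℝ) (c : ℝ) (a v : E) :
    θ ![c • a, v] = c * θ ![a, v] := by
  have h := θ.toMultilinearMap.map_update_smul ![a, v] 0 c a
  simp only [update_pair_zero] at h
  exact h

theorem form_swap (θ : E [⋀^Fin 2]→L[ℝ] ℝ) (a v : E) : θ ![a, v] = - θ ![v, a] := by
  have h := θ.toAlternatingMap.map_swap ![v, a] (show (0 : Fin 2) ≠ 1 by decide)
  have e : (![v, a] ∘ (Equiv.swap 0 1 : Equiv.Perm (Fin 2))) = ![a, v] := by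
    funext i; fin_cases i <;> simp
  rw [e] at h
  exact h

theorem form_self (θ : E [⋀^Fin 2]→L[ℝ] ℝ) (a : E) : θ ![a, a] = 0 := by
  have := form_swap θ a a
  linarith

theorem form_add_right (θ : E [⋀^Fin 2]→L[ℝ] ℝ) (v a b : E) :
    θ ![v, a + b] = θ ![v, a] + θ ![v, b] := by
  rw [form_swap, form_add_left, form_swap θ v a, form_swap θ v b]; ring

theorem form_smul_right (θ : E [⋀^Fin 2]→L[ℝ] ℝ) (c : ℝ) (v a : E) :
    θ ![v, c • a] = c * θ ![v, a] := by
  rw [form_swap, form_smul_left, form_swap θ v a]; ring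

theorem form_zero_left (θ : E [⋀^Fin 2]→L[ℝ] ℝ) (v : E) : θ ![0, v] = 0 := by
  simpa using form_smul_left θ 0 0 v

theorem form_zero_right (θ : E [⋀^Fin 2]→L[ℝ] ℝ) (v : E) : θ ![v, 0] = 0 := by
  simpa using form_smul_right θ 0 v 0

/-- A `2`-form as a bilinear map. -/
def formBilin (θ : E [⋀^Fin 2]→L[ℝ] ℝ) : E →ₗ[ℝ] E →ₗ[ℝ] ℝ :=
  LinearMap.mk₂ ℝ (fun v w => θ ![v, w]) (form_add_left θ) (form_smul_left θ) (form_add_right θ)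
    (form_smul_right θ)

theorem formBilin_apply (θ : E [⋀^Fin 2]→L[ℝ] ℝ) (v w : E) : formBilin θ v w = θ ![v, w] := rfl

theorem form_neg_right (θ : E [⋀^Fin 2]→L[ℝ] ℝ) (a v : E) : θ ![v, -a] = -θ ![v, a] := by
  simp [← formBilin_apply]

theorem form_sub_left (θ : E [⋀^Fin 2]→L[ℝ] ℝ) (a b v : E) :
    θ ![a - b, v] = θ ![a, v] - θ ![b, v] := by
  simp [← formBilin_apply]

theorem form_sub_right (θ : E [⋀^Fin 2]→L[ℝ] ℝ) (a b v : E) :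
    θ ![v, a - b] = θ ![v, a] - θ ![v, b] := by
  simp [← formBilin_apply]

theorem form_ext {θ θ' : E [⋀^Fin 2]→L[ℝ] ℝ} (h : ∀ v w, θ ![v, w] = θ' ![v, w]) : θ = θ' := by
  ext u
  have : u = ![u 0, u 1] := by funext i; fin_cases i <;> rfl
  rw [this]; exact h _ _

theorem comp_pair (θ : E' [⋀^Fin 2]→L[ℝ] ℝ) (f : E →L[ℝ] E') (v w : E) :
    θ.compContinuousLinearMap f ![v, w] = θ ![f v, f w] := by
  rw [ContinuousAlternatingMap.compContinuousLinearMap_apply]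
  congr 1; funext i; fin_cases i <;> rfl

theorem pullback_apply (f : E → E') (θ : E' → E' [⋀^Fin 2]→L[ℝ] ℝ) (x v w : E) :
    pullback f θ x ![v, w] = θ (f x) ![fderiv ℝ f x v, fderiv ℝ f x w] :=
  comp_pair _ _ _ _

theorem fderiv_form_apply {θ : E → E' [⋀^Fin 2]→L[ℝ] ℝ} {x : E} (h : DifferentiableAt ℝ θ x)
    (u : E) (v w : E') : fderiv ℝ θ x u ![v, w] = fderiv ℝ (fun y => θ y ![v, w]) x u := by
  rw [fderiv_continuousAlternatingMap_apply_const_apply h]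

theorem extDeriv_two_apply {θ : E → E [⋀^Fin 2]→L[ℝ] ℝ} (x u v w : E) :
    extDeriv θ x ![u, v, w] =
      fderiv ℝ θ x u ![v, w] - fderiv ℝ θ x v ![u, w] + fderiv ℝ θ x w ![u, v] := by
  rw [extDeriv, ContinuousAlternatingMap.alternatizeUncurryFin_apply]
  have e0 : Fin.removeNth 0 ![u, v, w] = ![v, w] := by
    funext i; fin_cases i <;> rfl
  have e1 : Fin.removeNth 1 ![u, v, w] = ![u, w] := by
    funext i; fin_cases i <;> rfl
  have e2 : Fin.removeNth 2 ![u, v, w] = ![u, v] := by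
    funext i; fin_cases i <;> rfl
  rw [Fin.sum_univ_three]
  simp only [e0, e1, e2]
  simp
  ring

theorem extDeriv_eq_zero_iff {θ : E → E [⋀^Fin 2]→L[ℝ] ℝ} (x : E) :
    extDeriv θ x = 0 ↔ ∀ u v w, fderiv ℝ θ x u ![v, w] - fderiv ℝ θ x v ![u, w]
      + fderiv ℝ θ x w ![u, v] = 0 := by
  constructor
  · intro h u v w
    rw [← extDeriv_two_apply, h]; rfl
  · intro h
    ext u
    have : u = ![u 0, u 1, u 2] := by funext i; fin_cases i <;> rfl
    rw [this, extDeriv_two_apply, h]; rfl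

/-- Product rule with three factors: the form along `f` and the two copies of `Df`. The second
derivatives of `f` enter once for each slot. -/
theorem fderiv_pullback_apply {f : E → E'} {θ : E' → E' [⋀^Fin 2]→L[ℝ] ℝ} {x : E}
    (hf : ContDiffAt ℝ ∞ f x) (hθ : DifferentiableAt ℝ θ (f x)) (u v w : E) :
    fderiv ℝ (pullback f θ) x u ![v, w] =
      fderiv ℝ θ (f x) (fderiv ℝ f x u) ![fderiv ℝ f x v, fderiv ℝ f x w]
      + θ (f x) ![fderiv ℝ (fderiv ℝ f) x u v, fderiv ℝ f x w]
      + θ (f x) ![fderiv ℝ f x v, fderiv ℝ (fderiv ℝ f) x u w] := by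
  have h1 : DifferentiableAt ℝ f x := hf.differentiableAt (by simp)
  have h2 : DifferentiableAt ℝ (fderiv ℝ f) x :=
    (hf.fderiv_right (m := ∞) (by simp)).differentiableAt (by simp)
  have := (DifferentiableAt.hasFDerivAt (hθ.comp x h1)).continuousAlternatingMapCompContinuousLinearMap
    h2.hasFDerivAt
  have e := this.fderiv
  simp only [Function.comp_apply] at e
  unfold pullback
  rw [e, fderiv_comp x hθ h1]
  simp only [add_apply, ContinuousLinearMap.comp_apply,
    ContinuousAlternatingMap.add_apply, ContinuousAlternatingMap.compContinuousLinearMapCLM_apply,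
    comp_pair]
  rw [ContinuousAlternatingMap.fderivCompContinuousLinearMap_apply, Fin.sum_univ_two, add_assoc]
  congr 2
  · congr 1; funext i; fin_cases i <;> simp
  · congr 1; funext i; fin_cases i <;> simp

theorem symm_snd {f : E → E'} {x : E} (hf : ContDiffAt ℝ ∞ f x) (u v : E) :
    fderiv ℝ (fderiv ℝ f) x u v = fderiv ℝ (fderiv ℝ f) x v u :=
  (hf.isSymmSndFDerivAt (by simpa using two_le_infty)).eq u v

/-- The Lie derivative is natural with respect to pullback. -/
theorem lieDeriv_pullback {f : E → E'} {X : E → E} {Y : E' → E'}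
    {θ : E' → E' [⋀^Fin 2]→L[ℝ] ℝ} {x : E}
    (hf : ContDiffAt ℝ ∞ f x) (hθ : DifferentiableAt ℝ θ (f x)) (hX : DifferentiableAt ℝ X x)
    (hY : DifferentiableAt ℝ Y (f x)) (hrel : ∀ᶠ y in 𝓝 x, fderiv ℝ f y (X y) = Y (f y))
    (v w : E) :
    lieDeriv X (pullback f θ) x v w = lieDeriv Y θ (f x) (fderiv ℝ f x v) (fderiv ℝ f x w) := by
  have h1 : DifferentiableAt ℝ f x := hf.differentiableAt (by simp)
  have h2 : DifferentiableAt ℝ (fderiv ℝ f) x :=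
    (hf.fderiv_right (m := ∞) (by simp)).differentiableAt (by simp)
  -- Differentiating the relation `Df · X = Y ∘ f` in the direction `u`; together with the symmetry
  -- of `D²f` this makes the second derivatives cancel.
  have key : ∀ u, fderiv ℝ (fderiv ℝ f) x u (X x) + fderiv ℝ f x (fderiv ℝ X x u)
      = fderiv ℝ Y (f x) (fderiv ℝ f x u) := by
    intro u
    have a := (h2.hasFDerivAt.clm_apply hX.hasFDerivAt).fderiv
    have b := Filter.EventuallyEq.fderiv_eq (𝕜 := ℝ) hrel
    rw [a, show (fun y => Y (f y)) = Y ∘ f from rfl, fderiv_comp x hY h1] at b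
    have := congrArg (fun l => l u) b
    simp at this
    rw [← this]; abel
  unfold lieDeriv
  rw [fderiv_pullback_apply hf hθ, pullback_apply, pullback_apply, ← key, ← key,
    hrel.self_of_nhds, form_add_left, form_add_right, symm_snd hf (X x) v, symm_snd hf (X x) w]
  ring

theorem pullback_congr {f g : E → E'} {x : E} (h : f =ᶠ[𝓝 x] g)
    (θ : E' → E' [⋀^Fin 2]→L[ℝ] ℝ) : pullback f θ x = pullback g θ x := by
  unfold pullback
  rw [h.fderiv_eq, h.self_of_nhds]

theorem lieDeriv_congr {X : E → E} {θ θ' : E → E [⋀^Fin 2]→L[ℝ] ℝ} {x : E}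
    (h : θ =ᶠ[𝓝 x] θ') (v w : E) : lieDeriv X θ x v w = lieDeriv X θ' x v w := by
  unfold lieDeriv
  rw [h.fderiv_eq, h.self_of_nhds]

theorem pullback_pullback {E'' : Type*} [NormedAddCommGroup E''] [NormedSpace ℝ E'']
    {f : E → E'} {g : E' → E''} {x : E} (hf : DifferentiableAt ℝ f x)
    (hg : DifferentiableAt ℝ g (f x)) (θ : E'' → E'' [⋀^Fin 2]→L[ℝ] ℝ) :
    pullback f (pullback g θ) x = pullback (g ∘ f) θ x := by
  apply form_ext
  intro v w
  rw [pullback_apply, pullback_apply, pullback_apply, fderiv_comp x hg hf]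
  rfl

end Forms

/-! ### Smoothness of form-valued maps through their components. -/

section Smooth

variable {E : Type*} [NormedAddCommGroup E] [NormedSpace ℝ E] {n : ℕ}

/-- The factor `1/2` is there because the sum runs over ordered pairs of indices. The expansion
reduces smoothness of a form-valued map to that of its scalar components. -/
theorem form_eq_sum (θ : (Fin n → ℝ) [⋀^Fin 2]→L[ℝ] ℝ) :
    θ = ∑ i, ∑ j, (1 / 2 * θ ![Pi.single i 1, Pi.single j 1]) •
      wedge (ContinuousLinearMap.proj (R := ℝ) (φ := fun _ : Fin n => ℝ) i)
        (ContinuousLinearMap.proj (R := ℝ) (φ := fun _ : Fin n => ℝ) j) := by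
  apply form_ext
  intro v w
  have hv : v = ∑ i, v i • Pi.single (M := fun _ => ℝ) i 1 := pi_eq_sum_univ' v
  have hw : w = ∑ i, w i • Pi.single (M := fun _ => ℝ) i 1 := pi_eq_sum_univ' w
  have l : θ ![v, w] = ∑ i, ∑ j, v i * w j * θ ![Pi.single i 1, Pi.single j 1] := by
    conv_lhs => rw [← formBilin_apply, hv, hw]
    simp only [map_sum, map_smul, LinearMap.sum_apply, LinearMap.smul_apply, smul_eq_mul,
      formBilin_apply, Finset.mul_sum]
    rw [Finset.sum_comm]
    refine Finset.sum_congr rfl fun i _ => Finset.sum_congr rfl fun j _ => ?_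
    ring
  have l' : θ ![v, w] = ∑ i, ∑ j, - (w i * v j) * θ ![Pi.single i 1, Pi.single j 1] := by
    rw [l, Finset.sum_comm]
    refine Finset.sum_congr rfl fun i _ => Finset.sum_congr rfl fun j _ => ?_
    rw [form_swap]; ring
  have : θ ![v, w] = 1 / 2 * (θ ![v, w] + θ ![v, w]) := by ring
  rw [this]
  nth_rewrite 1 [l]
  rw [l', ← Finset.sum_add_distrib, Finset.mul_sum]
  simp only [ContinuousAlternatingMap.sum_apply, ← Finset.sum_add_distrib, Finset.mul_sum,
    ContinuousAlternatingMap.smul_apply, wedge_apply, smul_eq_mul, ContinuousLinearMap.proj_apply]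
  refine Finset.sum_congr rfl fun i _ => Finset.sum_congr rfl fun j _ => ?_
  ring

theorem contDiffAt_form {k : ℕ∞ω} {θ : E → (Fin n → ℝ) [⋀^Fin 2]→L[ℝ] ℝ} {x : E}
    (h : ∀ v w, ContDiffAt ℝ k (fun y => θ y ![v, w]) x) : ContDiffAt ℝ k θ x := by
  rw [show θ = fun y => ∑ i, ∑ j, (1 / 2 * θ y ![Pi.single i 1, Pi.single j 1]) •
      wedge (ContinuousLinearMap.proj (R := ℝ) (φ := fun _ : Fin n => ℝ) i)
        (ContinuousLinearMap.proj (R := ℝ) (φ := fun _ : Fin n => ℝ) j) from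
    funext fun y => form_eq_sum (θ y)]
  refine ContDiffAt.sum fun i _ => ContDiffAt.sum fun j _ => ?_
  exact (contDiffAt_const.mul (h _ _)).smul contDiffAt_const

theorem contDiffAt_form_apply {E' : Type*} [NormedAddCommGroup E'] [NormedSpace ℝ E']
    {k : ℕ∞ω} {θ : E → E' [⋀^Fin 2]→L[ℝ] ℝ} {x : E}
    (h : ContDiffAt ℝ k θ x) (v w : E') : ContDiffAt ℝ k (fun y => θ y ![v, w]) x :=
  (ContinuousAlternatingMap.apply ℝ E' ℝ ![v, w]).contDiff.contDiffAt.comp x h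

theorem contDiffAt_form_apply_apply {k : ℕ∞ω} {θ : E → (Fin n → ℝ) [⋀^Fin 2]→L[ℝ] ℝ} {x : E}
    {v w : E → Fin n → ℝ} (h : ContDiffAt ℝ k θ x) (hv : ContDiffAt ℝ k v x)
    (hw : ContDiffAt ℝ k w x) : ContDiffAt ℝ k (fun y => θ y ![v y, w y]) x := by
  have : (fun y => θ y ![v y, w y]) = fun y => ∑ i, ∑ j,
      (1 / 2 * θ y ![Pi.single i 1, Pi.single j 1]) * (v y i * w y j - v y j * w y i) := by
    funext y
    conv_lhs => rw [form_eq_sum (θ y)]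
    simp [ContinuousAlternatingMap.sum_apply, wedge_apply]
    refine Finset.sum_congr rfl fun i _ => Finset.sum_congr rfl fun j _ => ?_
    ring
  rw [this]
  refine ContDiffAt.sum fun i _ => ContDiffAt.sum fun j _ => ?_
  have a := contDiffAt_pi.1 hv
  have b := contDiffAt_pi.1 hw
  exact (contDiffAt_const.mul (contDiffAt_form_apply h _ _)).mul
    (((a i).mul (b j)).sub ((a j).mul (b i)))

theorem contDiffAt_pullback {m : ℕ} {f : (Fin m → ℝ) → Fin n → ℝ}
    {θ : (Fin n → ℝ) → (Fin n → ℝ) [⋀^Fin 2]→L[ℝ] ℝ} {x : Fin m → ℝ}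
    (hf : ContDiffAt ℝ ∞ f x) (hθ : ContDiffAt ℝ ∞ θ (f x)) :
    ContDiffAt ℝ ∞ (pullback f θ) x := by
  apply contDiffAt_form
  intro v w
  simp_rw [pullback_apply]
  have h : ContDiffAt ℝ ∞ (fderiv ℝ f) x := hf.fderiv_right (by simp)
  exact contDiffAt_form_apply_apply (hθ.comp x hf) (h.clm_apply contDiffAt_const)
    (h.clm_apply contDiffAt_const)

end Smooth

/-! ### Minkowski geometry and the radial retraction onto the hyperboloid. -/

section Minkowski

theorem mink_eq (x y : M) : mink x y = x 0 * y 0 - x 1 * y 1 - x 2 * y 2 - x 3 * y 3 := by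
  simp [mink, eta, Fin.sum_univ_four]; ring

theorem mink_comm (x y : M) : mink x y = mink y x := by
  simp only [mink_eq]; ring

theorem mink_add_left (x y z : M) : mink (x + y) z = mink x z + mink y z := by
  simp only [mink_eq, Pi.add_apply]; ring

theorem mink_add_right (x y z : M) : mink x (y + z) = mink x y + mink x z := by
  simp only [mink_eq, Pi.add_apply]; ring

theorem mink_smul_left (c : ℝ) (x y : M) : mink (c • x) y = c * mink x y := by
  simp only [mink_eq, Pi.smul_apply, smul_eq_mul]; ring

theorem mink_smul_right (c : ℝ) (x y : M) : mink x (c • y) = c * mink x y := by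
  simp only [mink_eq, Pi.smul_apply, smul_eq_mul]; ring

/-- The Minkowski inner product as a bilinear map. -/
def minkB : M →ₗ[ℝ] M →ₗ[ℝ] ℝ :=
  LinearMap.mk₂ ℝ mink mink_add_left mink_smul_left mink_add_right mink_smul_right

/-- The covector `mink x`. -/
def minkL (x : M) : M →L[ℝ] ℝ := LinearMap.toContinuousLinearMap (minkB x)

@[simp] theorem minkL_apply (x y : M) : minkL x y = mink x y := rfl

theorem mink_single_right (x : M) (i : Fin 4) : mink x (Pi.single i 1) = eta i * x i := by
  fin_cases i <;> simp [mink_eq, eta]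

theorem eta_mul_self (i : Fin 4) : eta i * eta i = 1 := by
  fin_cases i <;> simp [eta]

theorem contDiff_mink_self : ContDiff ℝ ∞ (fun x : M => mink x x) := by
  simp only [mink_eq]
  fun_prop

theorem hasFDerivAt_mink_self (x : M) : HasFDerivAt (fun x : M => mink x x) (2 • minkL x) x := by
  have h : DifferentiableAt ℝ (fun x : M => mink x x) x :=
    contDiff_mink_self.contDiffAt.differentiableAt (by simp)
  convert h.hasFDerivAt using 1
  ext1 v
  -- The derivative is found on lines `x + t v`, where the quadratic form is a polynomial in `t`
  -- with linear coefficient `2⟨x, v⟩`.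
  have hl : HasDerivAt (fun t : ℝ => x + t • v) v 0 := by
    simpa using ((hasDerivAt_id (0 : ℝ)).smul_const v).const_add x
  have h1 := HasFDerivAt.comp_hasDerivAt (x := (0 : ℝ)) (f := fun t : ℝ => x + t • v)
    (l := fun x : M => mink x x) (l' := fderiv ℝ (fun x : M => mink x x) x)
    (by simpa using h.hasFDerivAt) hl
  have h2 : HasDerivAt (fun t : ℝ => mink x x + t * (2 * mink x v) + t * t * mink v v)
      (2 * mink x v) 0 := by
    have := (((hasDerivAt_id (0 : ℝ)).mul_const (2 * mink x v)).const_add (mink x x)).add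
      (((hasDerivAt_id (0 : ℝ)).mul (hasDerivAt_id (0 : ℝ))).mul_const (mink v v))
    exact this.congr_deriv (by simp)
  have e : ((fun x : M => mink x x) ∘ fun t : ℝ => x + t • v) =
      fun t : ℝ => mink x x + t * (2 * mink x v) + t * t * mink v v := by
    funext t
    simp only [Function.comp, mink_add_left, mink_add_right, mink_smul_left, mink_smul_right,
      mink_comm v x]
    ring
  rw [e] at h1
  have := h2.unique h1
  simp only [smul_apply, minkL_apply, ← this]
  simp

/-- The norm `√(-⟨x, x⟩)`. -/
def rad (x : M) : ℝ := Real.sqrt (-mink x x)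

theorem rad_pos {x : M} (h : mink x x < 0) : 0 < rad x := Real.sqrt_pos.2 (by linarith)

theorem rad_sq {x : M} (h : mink x x < 0) : rad x ^ 2 = -mink x x :=
  Real.sq_sqrt (by linarith)

theorem rad_of_mem {x : M} (h : x ∈ dS) : rad x = 1 := by
  have : mink x x = -1 := h
  simp [rad, this]

theorem rad_smul {t : ℝ} (ht : 0 < t) (x : M) : rad (t • x) = t * rad x := by
  unfold rad
  rw [mink_smul_left, mink_smul_right, show -(t * (t * mink x x)) = t ^ 2 * (-mink x x) by ring,
    Real.sqrt_mul (by positivity), Real.sqrt_sq ht.le]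

theorem retr_eq (x : M) : retr x = (rad x)⁻¹ • x := rfl

theorem mem_dS_iff {x : M} : x ∈ dS ↔ mink x x = -1 := Iff.rfl

theorem dS_neg {x : M} (h : x ∈ dS) : mink x x < 0 := by
  rw [mem_dS_iff] at h; linarith

theorem retr_mem {x : M} (h : mink x x < 0) : retr x ∈ dS := by
  rw [mem_dS_iff, retr_eq, mink_smul_left, mink_smul_right]
  have := rad_pos h
  have h2 := rad_sq h
  field_simp
  linarith

theorem retr_of_mem {x : M} (h : x ∈ dS) : retr x = x := by
  rw [retr_eq, rad_of_mem h]; simp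

theorem rad_smul_retr {x : M} (h : mink x x < 0) : rad x • retr x = x := by
  rw [retr_eq, smul_smul, mul_inv_cancel₀ (rad_pos h).ne', one_smul]

theorem retr_smul {t : ℝ} (ht : 0 < t) (x : M) : retr (t • x) = retr x := by
  rw [retr_eq, rad_smul ht, retr_eq, smul_smul]
  congr 1
  field_simp

theorem isOpen_neg : IsOpen {x : M | mink x x < 0} :=
  isOpen_lt contDiff_mink_self.continuous continuous_const

theorem contDiffAt_rad {x : M} (h : mink x x < 0) : ContDiffAt ℝ ∞ rad x :=
  contDiff_mink_self.neg.contDiffAt.sqrt (by linarith)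

theorem contDiffAt_retr {x : M} (h : mink x x < 0) : ContDiffAt ℝ ∞ retr x :=
  ((contDiffAt_rad h).inv (rad_pos h).ne').smul contDiffAt_id

theorem differentiableAt_retr {x : M} (h : mink x x < 0) : DifferentiableAt ℝ retr x :=
  (contDiffAt_retr h).differentiableAt (by simp)

theorem fderiv_rad {x : M} (h : mink x x < 0) (v : M) :
    fderiv ℝ rad x v = -(rad x)⁻¹ * mink x v := by
  have h0 : HasFDerivAt (fun x : M => -mink x x) (-(2 • minkL x)) x :=
    (hasFDerivAt_mink_self x).neg
  have := (h0.sqrt (by linarith)).fderiv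
  unfold rad
  rw [this]
  simp
  field_simp

/-- As `⟨x, x⟩ = -rad²`, this is `rad⁻¹` times the orthogonal projection along `x` onto the tangent
space. -/
theorem fderiv_retr {x : M} (h : mink x x < 0) (v : M) :
    fderiv ℝ retr x v = (rad x)⁻¹ • v + ((rad x)⁻¹ ^ 3 * mink x v) • x := by
  have hr := ((contDiffAt_rad h).differentiableAt (by simp)).hasFDerivAt
  have h1 := ((hasDerivAt_inv (rad_pos h).ne').comp_hasFDerivAt x hr).smul (hasFDerivAt_id x)
  have h2 : fderiv ℝ retr x = _ := h1.fderiv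
  rw [h2]
  simp only [add_apply, smul_apply, ContinuousLinearMap.smulRight_apply, fderiv_rad h, id,
    ContinuousLinearMap.coe_id', neg_smul, smul_eq_mul, neg_apply]
  have := (rad_pos h).ne'
  rw [← neg_smul]
  congr 2
  field_simp

theorem fderiv_retr_of_mem {x : M} (h : x ∈ dS) (v : M) :
    fderiv ℝ retr x v = v + mink x v • x := by
  rw [fderiv_retr (dS_neg h), rad_of_mem h]; simp

theorem fderiv_retr_self {x : M} (h : mink x x < 0) : fderiv ℝ retr x x = 0 := by
  rw [fderiv_retr h, ← add_smul]
  have := rad_sq h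
  rw [show mink x x = -(rad x) ^ 2 by linarith]
  have := (rad_pos h).ne'
  rw [show (rad x)⁻¹ + (rad x)⁻¹ ^ 3 * -(rad x) ^ 2 = 0 by field_simp; ring, zero_smul]

theorem mink_fderiv_retr {x : M} (h : mink x x < 0) (v : M) : mink x (fderiv ℝ retr x v) = 0 := by
  rw [fderiv_retr h, mink_add_right, mink_smul_right, mink_smul_right]
  have := rad_sq h
  rw [show mink x x = -(rad x) ^ 2 by linarith]
  have := (rad_pos h).ne'
  field_simp
  ring

theorem fderiv_retr_tangent {x v : M} (h : x ∈ dS) (hv : mink x v = 0) :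
    fderiv ℝ retr x v = v := by
  rw [fderiv_retr_of_mem h, hv]; simp

theorem retr_retr {x : M} (h : mink x x < 0) : retr (retr x) = retr x := retr_of_mem (retr_mem h)

theorem retr_retr_eventually {x : M} (h : mink x x < 0) : retr ∘ retr =ᶠ[𝓝 x] retr :=
  Filter.eventually_of_mem (isOpen_neg.mem_nhds h) fun _ hy => retr_retr hy

/-- The open cone over a subset of `dS`. -/
def cone (W : Set M) : Set M := {x | mink x x < 0 ∧ retr x ∈ W}

theorem IsOpenIn.subset {W : Set M} (h : IsOpenIn W) : W ⊆ dS := by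
  obtain ⟨O, -, rfl⟩ := h
  exact inter_subset_right

theorem isOpen_cone {W : Set M} (h : IsOpenIn W) : IsOpen (cone W) := by
  obtain ⟨O, hO, rfl⟩ := h
  have hc : ContinuousOn retr {x : M | mink x x < 0} := fun x hx =>
    (contDiffAt_retr hx).continuousAt.continuousWithinAt
  convert hc.isOpen_inter_preimage isOpen_neg hO using 1
  ext x
  constructor
  · rintro ⟨h1, h2, -⟩; exact ⟨h1, h2⟩
  · rintro ⟨h1, h2⟩; exact ⟨h1, h2, retr_mem h1⟩

theorem subset_cone {W : Set M} (h : W ⊆ dS) : W ⊆ cone W := fun x hx =>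
  ⟨dS_neg (h hx), by rwa [retr_of_mem (h hx)]⟩

theorem cone_inter_dS {W : Set M} (h : W ⊆ dS) : cone W ∩ dS = W := by
  ext x
  constructor
  · rintro ⟨⟨-, h1⟩, h2⟩; rwa [retr_of_mem h2] at h1
  · intro hx; exact ⟨subset_cone h hx, h hx⟩

theorem isOpenIn_inter {W O : Set M} (h : IsOpenIn W) (hO : IsOpen O) : IsOpenIn (O ∩ W) := by
  obtain ⟨O', hO', rfl⟩ := h
  exact ⟨O ∩ O', hO.inter hO', by rw [inter_assoc]⟩

/-! ### The Killing fields -/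

/-- Skew-adjointness with respect to the Minkowski product. -/
def IsSkew (L : M →L[ℝ] M) : Prop := ∀ x y, mink (L x) y + mink x (L y) = 0

theorem IsSkew.self {L : M →L[ℝ] M} (h : IsSkew L) (x : M) : mink x (L x) = 0 := by
  have := h x x
  rw [mink_comm] at this
  linarith

theorem isSkew_iff {L : M →L[ℝ] M} :
    IsSkew L ↔ ∀ i j, eta j * L (Pi.single i 1) j + eta i * L (Pi.single j 1) i = 0 := by
  constructor
  · intro h i j
    have := h (Pi.single i 1) (Pi.single j 1)
    rwa [mink_comm (Pi.single i 1), mink_single_right, mink_single_right] at this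
  · intro h x y
    have hx : x = ∑ i, x i • Pi.single (M := fun _ => ℝ) i 1 := pi_eq_sum_univ' x
    have hy : y = ∑ i, y i • Pi.single (M := fun _ => ℝ) i 1 := pi_eq_sum_univ' y
    have e1 : mink (L x) y = ∑ i, ∑ j, x i * y j * (eta j * L (Pi.single i 1) j) := by
      change minkB (L x) y = _
      conv_lhs => rw [hx, hy]
      simp only [map_sum, map_smul, LinearMap.sum_apply, LinearMap.smul_apply, smul_eq_mul,
        Finset.mul_sum]
      rw [Finset.sum_comm]
      refine Finset.sum_congr rfl fun i _ => Finset.sum_congr rfl fun j _ => ?_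
      change y j * (x i * mink _ _) = _
      rw [mink_single_right]; ring
    have e2 : mink x (L y) = ∑ i, ∑ j, x i * y j * (eta i * L (Pi.single j 1) i) := by
      rw [mink_comm]
      change minkB (L y) x = _
      conv_lhs => rw [hx, hy]
      simp only [map_sum, map_smul, LinearMap.sum_apply, LinearMap.smul_apply, smul_eq_mul,
        Finset.mul_sum]
      refine Finset.sum_congr rfl fun i _ => Finset.sum_congr rfl fun j _ => ?_
      change x i * (y j * mink _ _) = _
      rw [mink_single_right]; ring
    rw [e1, e2, ← Finset.sum_add_distrib]
    refine Finset.sum_eq_zero fun i _ => ?_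
    rw [← Finset.sum_add_distrib]
    refine Finset.sum_eq_zero fun j _ => ?_
    rw [← mul_add, h, mul_zero]

/-- The linear map underlying `J i j`. -/
def JL (i j : Fin 4) : M →L[ℝ] M :=
  (eta i • ContinuousLinearMap.proj (R := ℝ) (φ := fun _ : Fin 4 => ℝ) i).smulRight (Pi.single j 1)
  - (eta j • ContinuousLinearMap.proj (R := ℝ) (φ := fun _ : Fin 4 => ℝ) j).smulRight
    (Pi.single i 1)

theorem JL_coe (i j : Fin 4) : (JL i j : M → M) = J i j := by
  funext x
  simp [JL, J]

theorem isSkew_JL (i j : Fin 4) : IsSkew (JL i j) := by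
  intro x y
  rw [show JL i j x = J i j x from congrFun (JL_coe i j) x,
    show JL i j y = J i j y from congrFun (JL_coe i j) y]
  simp only [J, sub_eq_add_neg, ← neg_smul, mink_add_right, mink_smul_right, mink_single_right,
    mink_comm _ y]
  ring

/-- The skew-adjoint linear maps. -/
def skew : Submodule ℝ (M →L[ℝ] M) where
  carrier := {L | IsSkew L}
  zero_mem' := fun x y => by simp [mink_eq]
  add_mem' := fun {a b} ha hb x y => by
    have h1 := ha x y
    have h2 := hb x y
    simp only [add_apply, mink_add_left, mink_add_right]
    linarith
  smul_mem' := fun c a ha x y => by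
    have h1 := ha x y
    simp only [smul_apply, mink_smul_left, mink_smul_right]
    rw [← mul_add, h1, mul_zero]

/-- The coercion of linear maps to fields. -/
def toField : (M →L[ℝ] M) →ₗ[ℝ] (M → M) where
  toFun L := L
  map_add' _ _ := rfl
  map_smul' _ _ := rfl

/-- A skew map has six free matrix entries, and they are its coefficients in the `J i j` with `i <
j`. The linear form makes derivatives and brackets of Killing fields trivial to compute. -/
theorem mem_so13_iff {X : M → M} : X ∈ so13 ↔ ∃ L : M →L[ℝ] M, IsSkew L ∧ (L : M → M) = X := by
  constructor
  · intro h
    have : so13 ≤ skew.map toField := by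
      refine Submodule.span_le.2 ?_
      rintro _ ⟨i, j, rfl⟩
      exact ⟨JL i j, isSkew_JL i j, JL_coe i j⟩
    obtain ⟨L, hL, e⟩ := this h
    exact ⟨L, hL, e⟩
  · rintro ⟨L, hL, rfl⟩
    rw [isSkew_iff] at hL
    have : (L : M → M) = (eta 0 * L (Pi.single 0 1) 1) • J 0 1 + (eta 0 * L (Pi.single 0 1) 2) • J 0 2
        + (eta 0 * L (Pi.single 0 1) 3) • J 0 3 + (eta 1 * L (Pi.single 1 1) 2) • J 1 2
        + (eta 1 * L (Pi.single 1 1) 3) • J 1 3 + (eta 2 * L (Pi.single 2 1) 3) • J 2 3 := by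
      funext x k
      have hx : x = ∑ i, x i • Pi.single (M := fun _ => ℝ) i 1 := pi_eq_sum_univ' x
      have h00 := hL 0 0
      have h01 := hL 0 1
      have h02 := hL 0 2
      have h03 := hL 0 3
      have h11 := hL 1 1
      have h12 := hL 1 2
      have h13 := hL 1 3
      have h22 := hL 2 2
      have h23 := hL 2 3
      have h33 := hL 3 3
      have e : L x k = x 0 * L (Pi.single 0 1) k + x 1 * L (Pi.single 1 1) k
          + x 2 * L (Pi.single 2 1) k + x 3 * L (Pi.single 3 1) k := by
        conv_lhs => rw [hx]
        simp [Fin.sum_univ_four]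
      rw [e]
      simp [eta] at h00 h01 h02 h03 h11 h12 h13 h22 h23 h33
      fin_cases k <;> simp [J, eta]
      · linear_combination x 0 * h00 + x 1 * h01 + x 2 * h02 + x 3 * h03
      · linear_combination x 1 * h11 - x 2 * h12 - x 3 * h13
      · linear_combination x 2 * h22 - x 3 * h23
      · linear_combination x 3 * h33
    rw [this]
    have hJ : ∀ i j, J i j ∈ so13 := fun i j => Submodule.subset_span ⟨i, j, rfl⟩
    exact add_mem (add_mem (add_mem (add_mem (add_mem (Submodule.smul_mem _ _ (hJ _ _))
      (Submodule.smul_mem _ _ (hJ _ _))) (Submodule.smul_mem _ _ (hJ _ _)))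
      (Submodule.smul_mem _ _ (hJ _ _))) (Submodule.smul_mem _ _ (hJ _ _)))
      (Submodule.smul_mem _ _ (hJ _ _))

theorem mem_so13_of_isSkew {L : M →L[ℝ] M} (h : IsSkew L) : (L : M → M) ∈ so13 :=
  mem_so13_iff.2 ⟨L, h, rfl⟩

theorem J_mem (i j : Fin 4) : J i j ∈ so13 := Submodule.subset_span ⟨i, j, rfl⟩

theorem lieBracket_linear (K L : M →L[ℝ] M) :
    VectorField.lieBracket ℝ (K : M → M) L = ((L.comp K - K.comp L : M →L[ℝ] M) : M → M) := by
  funext x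
  simp [VectorField.lieBracket]

theorem IsSkew.bracket {K L : M →L[ℝ] M} (hK : IsSkew K) (hL : IsSkew L) :
    IsSkew (L.comp K - K.comp L) := by
  intro x y
  have h1 := hK (L x) y
  have h2 := hL x (K y)
  have h3 := hL (K x) y
  have h4 := hK x (L y)
  simp only [sub_apply, ContinuousLinearMap.comp_apply]
  change minkB _ _ + minkB _ _ = 0
  change minkB _ _ + minkB _ _ = 0 at h1 h2 h3 h4
  simp only [map_sub, LinearMap.sub_apply]
  linarith

/-- A Killing field is related to itself by the retraction. -/
theorem IsSkew.retr {L : M →L[ℝ] M} (hL : IsSkew L) {x : M} (h : mink x x < 0) :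
    fderiv ℝ retr x (L x) = L (retr x) := by
  rw [fderiv_retr h, hL.self, retr_eq]; simp

/-! ### Forms on `dS` and their extensions to the cone -/

/-- The retraction is idempotent, so an extended form is its own pullback. Through this, facts known
only at points of `dS` spread to the whole cone. -/
theorem ext₂_retr {F : M → M [⋀^Fin 2]→L[ℝ] ℝ} {x : M} (h : mink x x < 0) :
    pullback retr (ext₂ F) x = ext₂ F x := by
  unfold ext₂
  rw [pullback_pullback (differentiableAt_retr h)
    (differentiableAt_retr (dS_neg (retr_mem h)))]
  exact pullback_congr (retr_retr_eventually h) F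

theorem ext₂_retr_eventually {F : M → M [⋀^Fin 2]→L[ℝ] ℝ} {x : M} (h : mink x x < 0) :
    pullback retr (ext₂ F) =ᶠ[𝓝 x] ext₂ F :=
  Filter.eventually_of_mem (isOpen_neg.mem_nhds h) fun _ hy => ext₂_retr hy

theorem ext₂_retr_apply {F : M → M [⋀^Fin 2]→L[ℝ] ℝ} {x : M} (h : mink x x < 0) (v w : M) :
    ext₂ F (retr x) ![fderiv ℝ retr x v, fderiv ℝ retr x w] = ext₂ F x ![v, w] := by
  rw [← pullback_apply, ext₂_retr h]

theorem ext₂_self_left {F : M → M [⋀^Fin 2]→L[ℝ] ℝ} {x : M} (h : mink x x < 0) (w : M) :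
    ext₂ F x ![x, w] = 0 := by
  rw [← ext₂_retr_apply h, fderiv_retr_self h, form_zero_left]

/-- Near a point of the cone the extension is the pullback, by the smooth retraction, of its own
germ at the retracted point, where smoothness is assumed. -/
theorem IsEMField.contDiffAt_cone {F : M → M [⋀^Fin 2]→L[ℝ] ℝ} {W : Set M}
    (hF : IsEMField F W) {x : M} (hx : x ∈ cone W) : ContDiffAt ℝ ∞ (ext₂ F) x :=
  (contDiffAt_pullback (contDiffAt_retr hx.1) (hF.1 _ hx.2)).congr_of_eventuallyEq
    (ext₂_retr_eventually hx.1).symm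

theorem IsEMField.closed_cone {F : M → M [⋀^Fin 2]→L[ℝ] ℝ} {W : Set M}
    (hF : IsEMField F W) {x : M} (hx : x ∈ cone W) : extDeriv (ext₂ F) x = 0 := by
  rw [← (ext₂_retr_eventually hx.1).extDeriv_eq]
  have := extDeriv_pullback ((hF.1 _ hx.2).differentiableAt (by simp)) (contDiffAt_retr hx.1)
    (by simpa [minSmoothness] using two_le_infty)
  unfold pullback
  rw [this, hF.2 _ hx.2]
  rfl

/-- A skew linear field is related to itself by the retraction (`IsSkew.retr`), so naturality of the
Lie derivative applies to the self-pullback of the extension. -/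
theorem lieDeriv_retr {F : M → M [⋀^Fin 2]→L[ℝ] ℝ} {W : Set M}
    (hF : IsEMField F W) {L : M →L[ℝ] M} (hL : IsSkew L) {x : M} (hx : x ∈ cone W) (v w : M) :
    lieDeriv L (ext₂ F) x v w =
      lieDeriv L (ext₂ F) (retr x) (fderiv ℝ retr x v) (fderiv ℝ retr x w) := by
  rw [← lieDeriv_pullback (contDiffAt_retr hx.1) ((hF.1 _ hx.2).differentiableAt (by simp))
    L.differentiableAt L.differentiableAt, lieDeriv_congr (ext₂_retr_eventually hx.1)]
  exact Filter.eventually_of_mem (isOpen_neg.mem_nhds hx.1) fun _ hy => hL.retr hy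

theorem LieInvariant.cone {F : M → M [⋀^Fin 2]→L[ℝ] ℝ} {W : Set M}
    (hF : IsEMField F W) {L : M →L[ℝ] M} (hL : IsSkew L) (h : LieInvariant L F W) {x : M}
    (hx : x ∈ cone W) (v w : M) : lieDeriv L (ext₂ F) x v w = 0 := by
  rw [lieDeriv_retr hF hL hx, h _ hx.2]

end Minkowski

/-! ### Partial derivatives on coordinate space. -/

section Partial

variable {n : ℕ} {F : Type*} [NormedAddCommGroup F] [NormedSpace ℝ F]

/-- The partial derivative. -/
def pd (i : Fin n) (f : (Fin n → ℝ) → F) (p : Fin n → ℝ) : F := fderiv ℝ f p (Pi.single i 1)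

theorem fderiv_eq_sum_pd (f : (Fin n → ℝ) → F) (p v : Fin n → ℝ) :
    fderiv ℝ f p v = ∑ i, v i • pd i f p := by
  conv_lhs => rw [show v = ∑ i, v i • Pi.single (M := fun _ => ℝ) i 1 from pi_eq_sum_univ' v]
  simp [pd]

theorem fderiv_eq_zero_of_pd {f : (Fin n → ℝ) → F} {p : Fin n → ℝ} (h : ∀ i, pd i f p = 0) :
    fderiv ℝ f p = 0 := by
  ext1 v
  rw [fderiv_eq_sum_pd]; simp [h]

theorem pd_mul {f g : (Fin n → ℝ) → ℝ} {p : Fin n → ℝ} (hf : DifferentiableAt ℝ f p)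
    (hg : DifferentiableAt ℝ g p) (i : Fin n) :
    pd i (fun q => f q * g q) p = pd i f p * g p + f p * pd i g p := by
  have := (hf.hasFDerivAt.mul hg.hasFDerivAt).fderiv
  simp only [pd]
  rw [show (fun q => f q * g q) = f * g from rfl, this]
  simp
  ring

theorem pd_add {f g : (Fin n → ℝ) → F} {p : Fin n → ℝ} (hf : DifferentiableAt ℝ f p)
    (hg : DifferentiableAt ℝ g p) (i : Fin n) :
    pd i (fun q => f q + g q) p = pd i f p + pd i g p := by
  simp only [pd, fderiv_fun_add hf hg]; rfl

theorem pd_sub {f g : (Fin n → ℝ) → F} {p : Fin n → ℝ} (hf : DifferentiableAt ℝ f p)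
    (hg : DifferentiableAt ℝ g p) (i : Fin n) :
    pd i (fun q => f q - g q) p = pd i f p - pd i g p := by
  simp only [pd, fderiv_fun_sub hf hg]; rfl

theorem hasFDerivAt_coord {h : ℝ → F} {h' : F} {k : Fin n} {p : Fin n → ℝ}
    (hh : HasDerivAt h h' (p k)) :
    HasFDerivAt (fun q : Fin n → ℝ => h (q k))
      ((ContinuousLinearMap.proj (R := ℝ) (φ := fun _ : Fin n => ℝ) k).smulRight h') p := by
  have := HasFDerivAt.comp p hh.hasFDerivAt
    (hasFDerivAt_apply (𝕜 := ℝ) (F' := fun _ : Fin n => ℝ) k p)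
  exact this.congr_fderiv (by ext v; simp)

theorem pd_coord {h : ℝ → F} {h' : F} {k : Fin n} {p : Fin n → ℝ}
    (hh : HasDerivAt h h' (p k)) (i : Fin n) :
    pd i (fun q : Fin n → ℝ => h (q k)) p = if k = i then h' else 0 := by
  rw [pd, (hasFDerivAt_coord hh).fderiv]
  simp [Pi.single_apply]

theorem pd_congr {f g : (Fin n → ℝ) → F} {s : Set (Fin n → ℝ)} (hs : IsOpen s)
    (h : EqOn f g s) {p : Fin n → ℝ} (hp : p ∈ s) (i : Fin n) : pd i f p = pd i g p := by
  unfold pd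
  rw [Filter.EventuallyEq.fderiv_eq (Filter.eventually_of_mem (hs.mem_nhds hp) h)]

theorem contDiffAt_pd {f : (Fin n → ℝ) → F} {p : Fin n → ℝ} (h : ContDiffAt ℝ ∞ f p) (i : Fin n) :
    ContDiffAt ℝ ∞ (pd i f) p :=
  (h.fderiv_right (m := ∞) (by simp)).clm_apply contDiffAt_const

theorem pd_comm {f : (Fin n → ℝ) → F} {p : Fin n → ℝ} (h : ContDiffAt ℝ ∞ f p) (i j : Fin n) :
    pd i (pd j f) p = pd j (pd i f) p := by
  have h2 : DifferentiableAt ℝ (fderiv ℝ f) p :=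
    (h.fderiv_right (m := ∞) (by simp)).differentiableAt (by simp)
  have key : ∀ k l, pd k (pd l f) p = fderiv ℝ (fderiv ℝ f) p (Pi.single k 1) (Pi.single l 1) := by
    intro k l
    have := (h2.hasFDerivAt.clm_apply (hasFDerivAt_const (Pi.single l (1 : ℝ)) p)).fderiv
    rw [pd, show pd l f = fun y => fderiv ℝ f y (Pi.single l 1) from rfl, this]
    simp
  rw [key, key, symm_snd h]

end Partial

/-! ### Functions on convex sets that are constant along linear fibres. -/

section Descend

variable {E E' F : Type*} [NormedAddCommGroup E] [NormedSpace ℝ E]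
  [NormedAddCommGroup E'] [NormedSpace ℝ E'] [NormedAddCommGroup F] [NormedSpace ℝ F]

/-- A smooth function on a convex open set whose derivative vanishes along the fibers of a linear
projection descends to a smooth function on the base. -/
theorem exists_descend {Ω : Set E} (hΩ : IsOpen Ω) (hc : Convex ℝ Ω) (π : E →L[ℝ] E')
    (σ : E' →L[ℝ] E) (hσ : ∀ y, π (σ y) = y) {g : E → F} (hg : ∀ p ∈ Ω, ContDiffAt ℝ ∞ g p)
    (h0 : ∀ p ∈ Ω, ∀ v, π v = 0 → fderiv ℝ g p v = 0) :
    ∃ f : E' → F, ∀ p ∈ Ω, ContDiffAt ℝ ∞ f (π p) ∧ g p = f (π p) := by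
  classical
  -- Two points of one fibre are joined by a segment, which stays in `Ω` by convexity and has its
  -- direction in the kernel of `π`.
  have const : ∀ p ∈ Ω, ∀ q ∈ Ω, π p = π q → g p = g q := by
    intro p hp q hq e
    have hseg : ∀ t ∈ Icc (0 : ℝ) 1, p + t • (q - p) ∈ Ω := fun t ht =>
      hc.add_smul_sub_mem hp hq ht
    have hd : ∀ t ∈ Icc (0 : ℝ) 1, HasDerivAt (fun t : ℝ => g (p + t • (q - p))) 0 t := by
      intro t ht
      have hl : HasDerivAt (fun t : ℝ => p + t • (q - p)) (q - p) t := by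
        simpa using ((hasDerivAt_id t).smul_const (q - p)).const_add p
      have := ((hg _ (hseg t ht)).differentiableAt (by simp)).hasFDerivAt.comp_hasDerivAt t hl
      rwa [h0 _ (hseg t ht) _ (by rw [map_sub, e, sub_self])] at this
    have := constant_of_has_deriv_right_zero (f := fun t : ℝ => g (p + t • (q - p))) (a := 0)
      (b := 1) (fun t ht => (hd t ht).continuousAt.continuousWithinAt)
      (fun t ht => (hd t ⟨ht.1, ht.2.le⟩).hasDerivWithinAt) 1 (by simp)
    simpa using this.symm
  let f : E' → F := fun y => if h : ∃ p ∈ Ω, π p = y then g h.choose else 0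
  have hf : ∀ p ∈ Ω, g p = f (π p) := by
    intro p hp
    have h : ∃ q ∈ Ω, π q = π p := ⟨p, hp, rfl⟩
    simp only [f, dif_pos h]
    exact const p hp _ h.choose_spec.1 h.choose_spec.2.symm
  refine ⟨f, fun p hp => ⟨?_, hf p hp⟩⟩
  -- An affine local section through `p`: near `π p` the descended function is `g ∘ s`, hence smooth
  -- even though it was defined by choice.
  let s : E' → E := fun y => p + σ (y - π p)
  have hs : s (π p) = p := by simp [s]
  have hsm : ContDiff ℝ ∞ s :=
    contDiff_const.add (σ.contDiff.comp (contDiff_id.sub contDiff_const))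
  have hcomp : ContDiffAt ℝ ∞ (g ∘ s) (π p) :=
    ContDiffAt.comp _ (by rw [hs]; exact hg p hp) hsm.contDiffAt
  refine hcomp.congr_of_eventuallyEq ?_
  have : ∀ᶠ y in 𝓝 (π p), s y ∈ Ω :=
    hsm.continuous.continuousAt.eventually (by rw [hs]; exact hΩ.mem_nhds hp)
  filter_upwards [this] with y hy
  have := hf _ hy
  simp only [s, map_add, hσ, add_sub_cancel] at this
  exact this.symm

theorem exists_eq_const {Ω : Set E} (hΩ : IsOpen Ω) (hc : Convex ℝ Ω) {g : E → F}
    (hg : ∀ p ∈ Ω, ContDiffAt ℝ ∞ g p) (h0 : ∀ p ∈ Ω, fderiv ℝ g p = 0) :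
    ∃ c, ∀ p ∈ Ω, g p = c := by
  -- Constancy is descent to a one-point space.
  obtain ⟨f, hf⟩ := exists_descend hΩ hc (0 : E →L[ℝ] PUnit.{1}) 0 (fun _ => rfl) hg
    (fun p hp v _ => by rw [h0 p hp]; rfl)
  exact ⟨f PUnit.unit, fun p hp => (hf p hp).2⟩

/-- A primitive is one degree smoother than its derivative. This upgrades the potentials supplied by
the Poincaré lemma for 1-forms, which come only as differentiable functions. -/
theorem contDiffAt_of_hasFDerivAt {Ω : Set E} (hΩ : IsOpen Ω) {g : E → F} {α : E → E →L[ℝ] F}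
    (h : ∀ p ∈ Ω, HasFDerivAt g (α p) p) (hα : ∀ p ∈ Ω, ContDiffAt ℝ ∞ α p) {p : E} (hp : p ∈ Ω) :
    ContDiffAt ℝ ∞ g p := by
  have : ContDiffOn ℝ ∞ g Ω := by
    rw [contDiffOn_infty_iff_fderiv_of_isOpen hΩ]
    refine ⟨fun q hq => (h q hq).differentiableAt.differentiableWithinAt, ?_⟩
    refine ContDiffOn.congr (f := α) (fun q hq => (hα q hq).contDiffWithinAt) ?_
    intro q hq
    exact (h q hq).fderiv
  exact this.contDiffAt (hΩ.mem_nhds hp)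

end Descend

/-! ### Closedness and invariance of a 2-form on `ℝ³` in components. -/

section CoordForms

/-- The component `θ_{ij}` of a `2`-form. -/
def comp (θ : Q → Q [⋀^Fin 2]→L[ℝ] ℝ) (i j : Fin 3) (p : Q) : ℝ :=
  θ p ![Pi.single i 1, Pi.single j 1]

theorem form_comp (θ : Q → Q [⋀^Fin 2]→L[ℝ] ℝ) (p v w : Q) :
    θ p ![v, w] = comp θ 0 1 p * (v 0 * w 1 - v 1 * w 0) + comp θ 0 2 p * (v 0 * w 2 - v 2 * w 0)
      + comp θ 1 2 p * (v 1 * w 2 - v 2 * w 1) := by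
  have hv : v = ∑ i, v i • Pi.single (M := fun _ => ℝ) i 1 := pi_eq_sum_univ' v
  have hw : w = ∑ i, w i • Pi.single (M := fun _ => ℝ) i 1 := pi_eq_sum_univ' w
  conv_lhs => rw [← formBilin_apply, hv, hw]
  simp only [Fin.sum_univ_three, map_add, map_smul, LinearMap.add_apply, LinearMap.smul_apply,
    smul_eq_mul, formBilin_apply, form_self]
  rw [form_swap (θ p) (Pi.single 1 1) (Pi.single 0 1), form_swap (θ p) (Pi.single 2 1)
    (Pi.single 0 1), form_swap (θ p) (Pi.single 2 1) (Pi.single 1 1)]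
  simp only [comp]
  ring

theorem comp_of_eq {θ : Q → Q [⋀^Fin 2]→L[ℝ] ℝ} {p : Q} {a b c : ℝ} :
    θ p = a • wedge (Row.d 0) (Row.d 1) + b • wedge (Row.d 0) (Row.d 2)
      + c • wedge (Row.d 1) (Row.d 2) ↔
    comp θ 0 1 p = a ∧ comp θ 0 2 p = b ∧ comp θ 1 2 p = c := by
  constructor
  · intro h
    simp only [comp, h, ContinuousAlternatingMap.add_apply, ContinuousAlternatingMap.smul_apply,
      wedge_apply, Row.d, ContinuousLinearMap.proj_apply]
    simp
  · rintro ⟨rfl, rfl, rfl⟩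
    apply form_ext
    intro v w
    rw [form_comp]
    simp only [ContinuousAlternatingMap.add_apply, ContinuousAlternatingMap.smul_apply,
      wedge_apply, Row.d, ContinuousLinearMap.proj_apply, smul_eq_mul]
    ring

theorem contDiffAt_comp_iff {θ : Q → Q [⋀^Fin 2]→L[ℝ] ℝ} {p : Q} :
    ContDiffAt ℝ ∞ θ p ↔ ContDiffAt ℝ ∞ (comp θ 0 1) p ∧ ContDiffAt ℝ ∞ (comp θ 0 2) p ∧
      ContDiffAt ℝ ∞ (comp θ 1 2) p := by
  constructor
  · intro h
    exact ⟨contDiffAt_form_apply h _ _, contDiffAt_form_apply h _ _, contDiffAt_form_apply h _ _⟩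
  · rintro ⟨h1, h2, h3⟩
    apply contDiffAt_form
    intro v w
    simp_rw [form_comp]
    exact ((h1.mul contDiffAt_const).add (h2.mul contDiffAt_const)).add (h3.mul contDiffAt_const)

theorem fderiv_comp_form {θ : Q → Q [⋀^Fin 2]→L[ℝ] ℝ} {p : Q} (h : DifferentiableAt ℝ θ p)
    (u v w : Q) : fderiv ℝ θ p u ![v, w] =
      fderiv ℝ (comp θ 0 1) p u * (v 0 * w 1 - v 1 * w 0)
      + fderiv ℝ (comp θ 0 2) p u * (v 0 * w 2 - v 2 * w 0)
      + fderiv ℝ (comp θ 1 2) p u * (v 1 * w 2 - v 2 * w 1) := by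
  have e : ∀ i j, fderiv ℝ (comp θ i j) p u = fderiv ℝ θ p u ![Pi.single i 1, Pi.single j 1] :=
    fun i j => (fderiv_form_apply h u _ _).symm
  rw [e, e, e]
  exact form_comp (fun _ => fderiv ℝ θ p u) p v w

/-- The space of 3-covectors on `ℝ³` is one-dimensional, so closedness is a single scalar equation.
-/
theorem closed_iff_comp {θ : Q → Q [⋀^Fin 2]→L[ℝ] ℝ} {p : Q} (h : DifferentiableAt ℝ θ p) :
    extDeriv θ p = 0 ↔ pd 0 (comp θ 1 2) p - pd 1 (comp θ 0 2) p + pd 2 (comp θ 0 1) p = 0 := by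
  rw [extDeriv_eq_zero_iff]
  constructor
  · intro h'
    have := h' (Pi.single 0 1) (Pi.single 1 1) (Pi.single 2 1)
    simp only [fderiv_comp_form h] at this
    simpa [pd] using this
  · intro h' u v w
    simp only [fderiv_comp_form h]
    simp only [fderiv_eq_sum_pd, Fin.sum_univ_three, smul_eq_mul]
    linear_combination (u 0 * (v 1 * w 2 - v 2 * w 1) - v 0 * (u 1 * w 2 - u 2 * w 1)
      + w 0 * (u 1 * v 2 - u 2 * v 1)) * h'

/-- All listed coordinate fields are independent of the third coordinate and have a constant third
component, so only the upper left `2 × 2` block of the Jacobian matters. -/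
theorem lieDeriv_iff_comp {θ : Q → Q [⋀^Fin 2]→L[ℝ] ℝ} {p : Q} (h : DifferentiableAt ℝ θ p)
    {X : Q → Q} {j00 j01 j10 j11 : ℝ}
    (hX : ∀ v, fderiv ℝ X p v = ![j00 * v 0 + j01 * v 1, j10 * v 0 + j11 * v 1, 0]) :
    (∀ v w, lieDeriv X θ p v w = 0) ↔
      (X p 0 * pd 0 (comp θ 0 1) p + X p 1 * pd 1 (comp θ 0 1) p + X p 2 * pd 2 (comp θ 0 1) p
        + comp θ 0 1 p * (j00 + j11) = 0 ∧
      X p 0 * pd 0 (comp θ 0 2) p + X p 1 * pd 1 (comp θ 0 2) p + X p 2 * pd 2 (comp θ 0 2) p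
        + comp θ 0 2 p * j00 + comp θ 1 2 p * j10 = 0 ∧
      X p 0 * pd 0 (comp θ 1 2) p + X p 1 * pd 1 (comp θ 1 2) p + X p 2 * pd 2 (comp θ 1 2) p
        + comp θ 0 2 p * j01 + comp θ 1 2 p * j11 = 0) := by
  have key : ∀ v w, lieDeriv X θ p v w =
      (X p 0 * pd 0 (comp θ 0 1) p + X p 1 * pd 1 (comp θ 0 1) p + X p 2 * pd 2 (comp θ 0 1) p
        + comp θ 0 1 p * (j00 + j11)) * (v 0 * w 1 - v 1 * w 0)
      + (X p 0 * pd 0 (comp θ 0 2) p + X p 1 * pd 1 (comp θ 0 2) p + X p 2 * pd 2 (comp θ 0 2) p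
        + comp θ 0 2 p * j00 + comp θ 1 2 p * j10) * (v 0 * w 2 - v 2 * w 0)
      + (X p 0 * pd 0 (comp θ 1 2) p + X p 1 * pd 1 (comp θ 1 2) p + X p 2 * pd 2 (comp θ 1 2) p
        + comp θ 0 2 p * j01 + comp θ 1 2 p * j11) * (v 1 * w 2 - v 2 * w 1) := by
    intro v w
    unfold lieDeriv
    rw [fderiv_comp_form h, form_comp θ p (fderiv ℝ X p v), form_comp θ p v, hX, hX]
    simp only [fderiv_eq_sum_pd, Fin.sum_univ_three, smul_eq_mul]
    simp
    ring
  constructor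
  · intro h'
    refine ⟨?_, ?_, ?_⟩
    · have := h' (Pi.single 0 1) (Pi.single 1 1)
      rw [key] at this; simpa using this
    · have := h' (Pi.single 0 1) (Pi.single 2 1)
      rw [key] at this; simpa using this
    · have := h' (Pi.single 1 1) (Pi.single 2 1)
      rw [key] at this; simpa using this
  · rintro ⟨h1, h2, h3⟩ v w
    rw [key, h1, h2, h3]; ring

end CoordForms

/-! ### Invariance equations of the listed fields; rows spanned by translations. -/

section CoordRows

theorem fderiv_vec3 {f g : Q → ℝ} {f' g' : Q →L[ℝ] ℝ} {c : ℝ} {p : Q} (hf : HasFDerivAt f f' p)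
    (hg : HasFDerivAt g g' p) (v : Q) :
    fderiv ℝ (fun p => ![f p, g p, c]) p v = ![f' v, g' v, 0] := by
  have : HasFDerivAt (fun p : Q => (![f p, g p, c] : Q))
      (ContinuousLinearMap.pi ![f', g', 0]) p := by
    rw [hasFDerivAt_pi']
    intro i
    fin_cases i
    · exact hf.congr_fderiv (by ext v; simp)
    · exact hg.congr_fderiv (by ext v; simp)
    · exact (hasFDerivAt_const c p).congr_fderiv (by ext v; simp)
  rw [this.fderiv]
  funext i
  fin_cases i <;> simp

theorem hasFDerivAt_p (i : Fin 3) (p : Q) : HasFDerivAt (fun p : Q => p i) (Row.d i) p :=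
  hasFDerivAt_apply i p

variable {θ : Q → Q [⋀^Fin 2]→L[ℝ] ℝ} {Ω : Set Q}

/-- The component functions of `θ` are smooth at `p` and `θ` is closed at `p`. -/
def SmoothClosed (θ : Q → Q [⋀^Fin 2]→L[ℝ] ℝ) (p : Q) : Prop :=
  ContDiffAt ℝ ∞ (comp θ 0 1) p ∧ ContDiffAt ℝ ∞ (comp θ 0 2) p ∧ ContDiffAt ℝ ∞ (comp θ 1 2) p ∧
    pd 0 (comp θ 1 2) p - pd 1 (comp θ 0 2) p + pd 2 (comp θ 0 1) p = 0

/-- All components of `θ` have zero `i`-th partial derivative at `p`. -/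
def Transl (θ : Q → Q [⋀^Fin 2]→L[ℝ] ℝ) (i : Fin 3) (p : Q) : Prop :=
  pd i (comp θ 0 1) p = 0 ∧ pd i (comp θ 0 2) p = 0 ∧ pd i (comp θ 1 2) p = 0

/-- Smoothness and closedness are common to all rows. Splitting them off leaves, for each row, only
the pointwise equations `P` that express invariance. -/
theorem invariant_iff (R : Row) {P : Q → Prop}
    (hP : ∀ p ∈ Ω, DifferentiableAt ℝ θ p →
      ((∀ (A : Fin R.dim) (v w : Q), lieDeriv (R.coordGen A) θ p v w = 0) ↔ P p)) :
    ((∀ p ∈ Ω, ContDiffAt ℝ ∞ θ p) ∧ (∀ p ∈ Ω, extDeriv θ p = 0) ∧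
      ∀ (A : Fin R.dim), ∀ p ∈ Ω, ∀ v w : Q, lieDeriv (R.coordGen A) θ p v w = 0) ↔
    ∀ p ∈ Ω, SmoothClosed θ p ∧ P p := by
  constructor
  · rintro ⟨h1, h2, h3⟩ p hp
    have hd : DifferentiableAt ℝ θ p := (h1 p hp).differentiableAt (by simp)
    obtain ⟨a, b, c⟩ := contDiffAt_comp_iff.1 (h1 p hp)
    exact ⟨⟨a, b, c, (closed_iff_comp hd).1 (h2 p hp)⟩,
      (hP p hp hd).1 fun A v w => h3 A p hp v w⟩
  · intro h
    have h1 : ∀ p ∈ Ω, ContDiffAt ℝ ∞ θ p := fun p hp =>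
      contDiffAt_comp_iff.2 ⟨(h p hp).1.1, (h p hp).1.2.1, (h p hp).1.2.2.1⟩
    have hd : ∀ p ∈ Ω, DifferentiableAt ℝ θ p := fun p hp => (h1 p hp).differentiableAt (by simp)
    exact ⟨h1, fun p hp => (closed_iff_comp (hd p hp)).2 (h p hp).1.2.2.2,
      fun A p hp v w => (hP p hp (hd p hp)).2 (h p hp).2 A v w⟩

/-- The field has zero Jacobian, so the Lie derivative is the directional derivative of each
component. -/
theorem lie_const (h : DifferentiableAt ℝ θ p) (x y z : ℝ) :
    (∀ v w, lieDeriv (fun _ => ![x, y, z]) θ p v w = 0) ↔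
      (x * pd 0 (comp θ 0 1) p + y * pd 1 (comp θ 0 1) p + z * pd 2 (comp θ 0 1) p = 0 ∧
      x * pd 0 (comp θ 0 2) p + y * pd 1 (comp θ 0 2) p + z * pd 2 (comp θ 0 2) p = 0 ∧
      x * pd 0 (comp θ 1 2) p + y * pd 1 (comp θ 1 2) p + z * pd 2 (comp θ 1 2) p = 0) := by
  rw [lieDeriv_iff_comp h (j00 := 0) (j01 := 0) (j10 := 0) (j11 := 0)
    (by intro v; funext i; fin_cases i <;> simp)]
  simp

theorem lie_d0 (h : DifferentiableAt ℝ θ p) :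
    (∀ v w, lieDeriv (fun _ => ![1, 0, 0]) θ p v w = 0) ↔ Transl θ 0 p := by
  rw [lie_const h]; simp [Transl]

theorem lie_d1 (h : DifferentiableAt ℝ θ p) :
    (∀ v w, lieDeriv (fun _ => ![0, 1, 0]) θ p v w = 0) ↔ Transl θ 1 p := by
  rw [lie_const h]; simp [Transl]

theorem lie_affine (h : DifferentiableAt ℝ θ p) (a b c d : ℝ) (f f' g : ℝ) {X : Q → Q}
    (hX : ∀ p, X p = ![a * p 0 + b * p 1 + f, c * p 0 + d * p 1 + f', g]) :
    (∀ v w, lieDeriv X θ p v w = 0) ↔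
      ((a * p 0 + b * p 1 + f) * pd 0 (comp θ 0 1) p + (c * p 0 + d * p 1 + f') *
        pd 1 (comp θ 0 1) p + g * pd 2 (comp θ 0 1) p + comp θ 0 1 p * (a + d) = 0 ∧
      (a * p 0 + b * p 1 + f) * pd 0 (comp θ 0 2) p + (c * p 0 + d * p 1 + f') *
        pd 1 (comp θ 0 2) p + g * pd 2 (comp θ 0 2) p + comp θ 0 2 p * a + comp θ 1 2 p * c = 0 ∧
      (a * p 0 + b * p 1 + f) * pd 0 (comp θ 1 2) p + (c * p 0 + d * p 1 + f') *
        pd 1 (comp θ 1 2) p + g * pd 2 (comp θ 1 2) p + comp θ 0 2 p * b + comp θ 1 2 p * d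
        = 0) := by
  have h1 : HasFDerivAt (fun p : Q => a * p 0 + b * p 1 + f) (a • Row.d 0 + b • Row.d 1) p :=
    (((hasFDerivAt_p 0 p).const_mul a).add ((hasFDerivAt_p 1 p).const_mul b)).add_const f
  have h2 : HasFDerivAt (fun p : Q => c * p 0 + d * p 1 + f') (c • Row.d 0 + d • Row.d 1) p :=
    (((hasFDerivAt_p 0 p).const_mul c).add ((hasFDerivAt_p 1 p).const_mul d)).add_const f'
  have hX' : X = fun p => ![a * p 0 + b * p 1 + f, c * p 0 + d * p 1 + f', g] := funext hX
  refine (lieDeriv_iff_comp h (j00 := a) (j01 := b) (j10 := c) (j11 := d) fun v => ?_).trans ?_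
  · rw [hX', fderiv_vec3 h1 h2]
    simp [Row.d]
  · rw [hX']
    simp

theorem lie_prod (h : DifferentiableAt ℝ θ p) {f g k : ℝ → ℝ} {f' g' k' : ℝ} {X : Q → Q}
    (hX : ∀ p, X p = ![f (p 0) * k (p 1), g (p 0), 0]) (hf : HasDerivAt f f' (p 0))
    (hg : HasDerivAt g g' (p 0)) (hk : HasDerivAt k k' (p 1)) :
    (∀ v w, lieDeriv X θ p v w = 0) ↔
      (f (p 0) * k (p 1) * pd 0 (comp θ 0 1) p + g (p 0) * pd 1 (comp θ 0 1) p
        + comp θ 0 1 p * (f' * k (p 1)) = 0 ∧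
      f (p 0) * k (p 1) * pd 0 (comp θ 0 2) p + g (p 0) * pd 1 (comp θ 0 2) p
        + comp θ 0 2 p * (f' * k (p 1)) + comp θ 1 2 p * g' = 0 ∧
      f (p 0) * k (p 1) * pd 0 (comp θ 1 2) p + g (p 0) * pd 1 (comp θ 1 2) p
        + comp θ 0 2 p * (f (p 0) * k') = 0) := by
  have h1 : HasFDerivAt (fun p : Q => f (p 0) * k (p 1)) _ p :=
    (hasFDerivAt_coord hf).mul (hasFDerivAt_coord hk)
  have hX' : X = fun p => ![f (p 0) * k (p 1), g (p 0), 0] := funext hX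
  refine (lieDeriv_iff_comp h (j00 := f' * k (p 1)) (j01 := f (p 0) * k') (j10 := g')
    (j11 := 0) fun v => ?_).trans ?_
  · rw [hX', fderiv_vec3 h1 (hasFDerivAt_coord hg)]
    funext i
    fin_cases i <;> simp <;> ring
  · rw [hX']
    simp

theorem contDiffAt_congr_on (hΩ : IsOpen Ω) {f g : Q → ℝ} (h : EqOn f g Ω) {p : Q} (hp : p ∈ Ω)
    (hg : ContDiffAt ℝ ∞ g p) : ContDiffAt ℝ ∞ f p :=
  hg.congr_of_eventuallyEq (Filter.eventually_of_mem (hΩ.mem_nhds hp) h)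

theorem exists_const_of_pd (hΩ : IsOpen Ω) (hc : Convex ℝ Ω) {g : Q → ℝ}
    (hg : ∀ p ∈ Ω, ContDiffAt ℝ ∞ g p) (h : ∀ p ∈ Ω, pd 0 g p = 0 ∧ pd 1 g p = 0 ∧ pd 2 g p = 0) :
    ∃ c, ∀ p ∈ Ω, g p = c := by
  refine exists_eq_const hΩ hc hg fun p hp => fderiv_eq_zero_of_pd fun i => ?_
  obtain ⟨h0, h1, h2⟩ := h p hp
  fin_cases i
  exacts [h0, h1, h2]

theorem exists_descend_one (hΩ : IsOpen Ω) (hc : Convex ℝ Ω) {g : Q → ℝ}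
    (hg : ∀ p ∈ Ω, ContDiffAt ℝ ∞ g p) (h : ∀ p ∈ Ω, pd 0 g p = 0 ∧ pd 1 g p = 0) :
    ∃ f : ℝ → ℝ, ∀ p ∈ Ω, ContDiffAt ℝ ∞ f (p 2) ∧ g p = f (p 2) := by
  refine exists_descend hΩ hc (Row.d 2) (ContinuousLinearMap.single ℝ (fun _ : Fin 3 => ℝ) 2)
    (fun y => by simp [Row.d]) hg fun p hp v hv => ?_
  have hv : v 2 = 0 := hv
  rw [fderiv_eq_sum_pd, Fin.sum_univ_three, (h p hp).1, (h p hp).2, hv]; simp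

theorem exists_descend_two (hΩ : IsOpen Ω) (hc : Convex ℝ Ω) {g : Q → ℝ}
    (hg : ∀ p ∈ Ω, ContDiffAt ℝ ∞ g p) (h : ∀ p ∈ Ω, pd 0 g p = 0) :
    ∃ f : ℝ × ℝ → ℝ, ∀ p ∈ Ω, ContDiffAt ℝ ∞ f (p 1, p 2) ∧ g p = f (p 1, p 2) := by
  refine exists_descend hΩ hc ((Row.d 1).prod (Row.d 2))
    ((ContinuousLinearMap.single ℝ (fun _ : Fin 3 => ℝ) 1).coprod
      (ContinuousLinearMap.single ℝ (fun _ : Fin 3 => ℝ) 2))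
    (fun y => by simp [Row.d]) hg fun p hp v hv => ?_
  have h1 : v 1 = 0 := congrArg Prod.fst hv
  have h2 : v 2 = 0 := congrArg Prod.snd hv
  rw [fderiv_eq_sum_pd, Fin.sum_univ_three, h p hp, h1, h2]; simp

theorem contDiffAt_p (i : Fin 3) (p : Q) : ContDiffAt ℝ ∞ (fun q : Q => q i) p :=
  (contDiff_apply ℝ ℝ i).contDiffAt

theorem pd_fun_const_mul {g : Q → ℝ} {p : Q} (hg : DifferentiableAt ℝ g p) (c : ℝ) (i : Fin 3) :
    pd i (fun q => c * g q) p = c * pd i g p := by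
  rw [pd_mul (differentiableAt_const c) hg]; simp [pd]

theorem pd_const (c : ℝ) (i : Fin 3) (p : Q) : pd i (fun _ : Q => c) p = 0 := by simp [pd]

theorem contDiffAt_comp_p {h : ℝ → ℝ} {k : Fin 3} {p : Q} (hh : ContDiffAt ℝ ∞ h (p k)) :
    ContDiffAt ℝ ∞ (fun q : Q => h (q k)) p :=
  ContDiffAt.comp p hh (contDiffAt_p k p)

theorem pd_comp_p {h : ℝ → ℝ} {k : Fin 3} {p : Q} (hh : ContDiffAt ℝ ∞ h (p k)) (i : Fin 3) :
    pd i (fun q : Q => h (q k)) p = if k = i then deriv h (p k) else 0 :=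
  pd_coord (hh.differentiableAt (by simp)).hasDerivAt i

/-! #### One-dimensional orbits -/

/-- Contracting with `∂₀` gives `θ₀₁ dp¹ + θ₀₂ dp²`, which is closed because `dθ = 0` and `∂₀θ₁₂ =
0`. Its potential, descended to the last two coordinates, is `f₁`; the remaining component is
unconstrained and descends to `f₂`. -/
theorem tableForm_one (hΩ : IsOpen Ω) (hc : Convex ℝ Ω) :
    (∀ p ∈ Ω, SmoothClosed θ p ∧ Transl θ 0 p) ↔ Row.TableForm .g11 Ω θ := by
  have wd : ∀ (f : Q → ℝ) (p : Q) (c : ℝ), pd 0 f p = 0 →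
      wedge (Row.d 0) (fderiv ℝ f p) + c • wedge (Row.d 1) (Row.d 2) =
      pd 1 f p • wedge (Row.d 0) (Row.d 1) + pd 2 f p • wedge (Row.d 0) (Row.d 2)
        + c • wedge (Row.d 1) (Row.d 2) := by
    intro f p c h
    apply form_ext
    intro v w
    simp only [ContinuousAlternatingMap.add_apply, ContinuousAlternatingMap.smul_apply,
      wedge_apply, Row.d, ContinuousLinearMap.proj_apply, smul_eq_mul, fderiv_eq_sum_pd,
      Fin.sum_univ_three, h]
    ring
  have pd0 : ∀ (f : ℝ × ℝ → ℝ) (p : Q), ContDiffAt ℝ ∞ f (p 1, p 2) →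
      pd 0 (fun q : Q => f (q 1, q 2)) p = 0 := by
    intro f p hf
    have h1 : HasFDerivAt (fun q : Q => (q 1, q 2)) ((Row.d 1).prod (Row.d 2)) p :=
      (hasFDerivAt_p 1 p).prodMk (hasFDerivAt_p 2 p)
    have := (HasFDerivAt.comp p (hf.differentiableAt (by simp)).hasFDerivAt h1).fderiv
    rw [pd, show (fun q : Q => f (q 1, q 2)) = f ∘ fun q : Q => (q 1, q 2) from rfl, this]
    simp [Row.d, show ((0 : ℝ), (0 : ℝ)) = 0 from rfl]
  constructor
  · intro h
    have hsm : ∀ p ∈ Ω, ContDiffAt ℝ ∞ (fun q => comp θ 0 1 q • Row.d 1 + comp θ 0 2 q • Row.d 2)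
        p := fun p hp => ((h p hp).1.1.smul contDiffAt_const).add
          ((h p hp).1.2.1.smul contDiffAt_const)
    obtain ⟨G, hG⟩ := hc.exists_forall_hasFDerivAt_of_fderiv_symmetric hΩ
      (fun p hp => ((hsm p hp).differentiableAt (by simp)).differentiableWithinAt) (by
        intro p hp x y
        obtain ⟨⟨sa, sb, -, hcl⟩, h1, h2, h3⟩ := h p hp
        have e := (((sa.differentiableAt (by simp)).hasFDerivAt.smul_const (Row.d 1)).add
          ((sb.differentiableAt (by simp)).hasFDerivAt.smul_const (Row.d 2))).fderiv
        change fderiv ℝ ((fun q => comp θ 0 1 q • Row.d 1) + fun q => comp θ 0 2 q • Row.d 2) p x y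
          = fderiv ℝ ((fun q => comp θ 0 1 q • Row.d 1) + fun q => comp θ 0 2 q • Row.d 2) p y x
        rw [e]
        simp only [add_apply, ContinuousLinearMap.smulRight_apply, smul_apply, smul_eq_mul,
          fderiv_eq_sum_pd, Fin.sum_univ_three, Row.d, ContinuousLinearMap.proj_apply, h1, h2]
        rw [h3] at hcl
        linear_combination (x 2 * y 1 - y 2 * x 1) * hcl)
    have hGs : ∀ p ∈ Ω, ContDiffAt ℝ ∞ G p := fun p hp => contDiffAt_of_hasFDerivAt hΩ hG hsm hp
    have hGd : ∀ p ∈ Ω, pd 0 G p = 0 ∧ pd 1 G p = comp θ 0 1 p ∧ pd 2 G p = comp θ 0 2 p := by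
      intro p hp
      simp only [pd, (hG p hp).fderiv]
      simp [Row.d]
    obtain ⟨f₁, hf₁⟩ := exists_descend_two hΩ hc hGs fun p hp => (hGd p hp).1
    obtain ⟨f₂, hf₂⟩ := exists_descend_two hΩ hc (fun p hp => (h p hp).1.2.2.1)
      fun p hp => (h p hp).2.2.2
    refine ⟨f₁, f₂, fun p hp => ⟨(hf₁ p hp).1, (hf₂ p hp).1⟩, fun p hp => ?_⟩
    have e : ∀ i, pd i G p = pd i (fun q : Q => f₁ (q 1, q 2)) p := fun i =>
      pd_congr hΩ (fun q hq => (hf₁ q hq).2) hp i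
    rw [wd _ _ _ (pd0 _ _ (hf₁ p hp).1), comp_of_eq, ← e, ← e, (hGd p hp).2.1, (hGd p hp).2.2]
    exact ⟨rfl, rfl, (hf₂ p hp).2⟩
  · rintro ⟨f₁, f₂, hs, he⟩
    set G : Q → ℝ := fun q => f₁ (q 1, q 2) with hG
    have hπ : ∀ p : Q, ContDiffAt ℝ ∞ (fun q : Q => (q 1, q 2)) p := fun p =>
      (contDiffAt_p 1 p).prodMk (contDiffAt_p 2 p)
    have hGs : ∀ p ∈ Ω, ContDiffAt ℝ ∞ G p := fun p hp => ContDiffAt.comp p (hs p hp).1 (hπ p)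
    have hG0 : ∀ p ∈ Ω, pd 0 G p = 0 := fun p hp => pd0 _ _ (hs p hp).1
    have hcs : ∀ p ∈ Ω, ContDiffAt ℝ ∞ (fun q : Q => f₂ (q 1, q 2)) p := fun p hp =>
      ContDiffAt.comp p (hs p hp).2 (hπ p)
    have ha : EqOn (comp θ 0 1) (pd 1 G) Ω := fun p hp =>
      (comp_of_eq.1 ((he p hp).trans (wd _ _ _ (hG0 p hp)))).1
    have hb : EqOn (comp θ 0 2) (pd 2 G) Ω := fun p hp =>
      (comp_of_eq.1 ((he p hp).trans (wd _ _ _ (hG0 p hp)))).2.1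
    have hcc : EqOn (comp θ 1 2) (fun q : Q => f₂ (q 1, q 2)) Ω := fun p hp =>
      (comp_of_eq.1 ((he p hp).trans (wd _ _ _ (hG0 p hp)))).2.2
    intro p hp
    -- Partial derivatives of a function independent of `p 0` are again independent of it, as mixed
    -- derivatives commute.
    have z : ∀ i, pd 0 (pd i G) p = 0 := by
      intro i
      rw [pd_comm (hGs p hp), pd_congr hΩ (g := fun _ => (0 : ℝ)) hG0 hp, pd_const]
    have h1 := z 1
    have h2 := z 2
    have h3 := pd0 f₂ p (hs p hp).2
    refine ⟨⟨contDiffAt_congr_on hΩ ha hp (contDiffAt_pd (hGs p hp) 1),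
      contDiffAt_congr_on hΩ hb hp (contDiffAt_pd (hGs p hp) 2),
      contDiffAt_congr_on hΩ hcc hp (hcs p hp), ?_⟩, ?_, ?_, ?_⟩
    · rw [pd_congr hΩ ha hp, pd_congr hΩ hb hp, pd_congr hΩ hcc hp, h3, pd_comm (hGs p hp) 1 2]
      ring
    · rw [pd_congr hΩ ha hp, h1]
    · rw [pd_congr hΩ hb hp, h2]
    · rw [pd_congr hΩ hcc hp, h3]

/-! #### Two translations -/

/-- With both translations, closedness reduces to `∂₂θ₀₁ = 0`, which makes that component the
constant `μ`; the other two depend on the transverse coordinate alone. -/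
theorem tableForm_two (hΩ : IsOpen Ω) (hc : Convex ℝ Ω) :
    (∀ p ∈ Ω, SmoothClosed θ p ∧ Transl θ 0 p ∧ Transl θ 1 p) ↔ Row.TableForm .g21 Ω θ := by
  constructor
  · intro h
    obtain ⟨μ, hμ⟩ := exists_const_of_pd hΩ hc (fun p hp => (h p hp).1.1) (fun p hp => by
      obtain ⟨⟨-, -, -, hcl⟩, ⟨h1, h2, h3⟩, h4, h5, h6⟩ := h p hp
      refine ⟨h1, h4, ?_⟩
      linarith)
    obtain ⟨f₁, hf₁⟩ := exists_descend_one hΩ hc (fun p hp => (h p hp).1.2.1)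
      fun p hp => ⟨(h p hp).2.1.2.1, (h p hp).2.2.2.1⟩
    obtain ⟨f₂, hf₂⟩ := exists_descend_one hΩ hc (fun p hp => (h p hp).1.2.2.1)
      fun p hp => ⟨(h p hp).2.1.2.2, (h p hp).2.2.2.2⟩
    exact ⟨μ, f₁, f₂, fun p hp => ⟨(hf₁ p hp).1, (hf₂ p hp).1⟩, fun p hp =>
      comp_of_eq.2 ⟨hμ p hp, (hf₁ p hp).2, (hf₂ p hp).2⟩⟩
  · rintro ⟨μ, f₁, f₂, hs, he⟩
    have ha : EqOn (comp θ 0 1) (fun _ => μ) Ω := fun p hp => (comp_of_eq.1 (he p hp)).1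
    have hb : EqOn (comp θ 0 2) (fun q => f₁ (q 2)) Ω := fun p hp => (comp_of_eq.1 (he p hp)).2.1
    have hcc : EqOn (comp θ 1 2) (fun q => f₂ (q 2)) Ω := fun p hp =>
      (comp_of_eq.1 (he p hp)).2.2
    intro p hp
    refine ⟨⟨contDiffAt_congr_on hΩ ha hp contDiffAt_const,
      contDiffAt_congr_on hΩ hb hp (contDiffAt_comp_p (hs p hp).1),
      contDiffAt_congr_on hΩ hcc hp (contDiffAt_comp_p (hs p hp).2), ?_⟩, ⟨?_, ?_, ?_⟩, ?_, ?_, ?_⟩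
    all_goals simp [pd_congr hΩ ha hp, pd_congr hΩ hb hp, pd_congr hΩ hcc hp, pd_const,
      pd_comp_p (hs p hp).1, pd_comp_p (hs p hp).2]

end CoordRows

/-! ### The rows with non-translational generators. -/

section CoordRows

variable {θ : Q → Q [⋀^Fin 2]→L[ℝ] ℝ} {Ω : Set Q}

theorem pd_exp (s : ℝ) (k i : Fin 3) (p : Q) :
    pd i (fun q : Q => Real.exp (s * q k)) p = if k = i then s * Real.exp (s * p k) else 0 := by
  refine pd_coord (h := fun t => Real.exp (s * t)) ?_ i
  simpa [mul_comm] using ((hasDerivAt_id (p k)).const_mul s).exp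

theorem contDiffAt_exp (s : ℝ) (k : Fin 3) (p : Q) :
    ContDiffAt ℝ ∞ (fun q : Q => Real.exp (s * q k)) p :=
  (contDiffAt_const.mul (contDiffAt_p k p)).exp

theorem pd_exp_mul {g : Q → ℝ} {p : Q} (hg : ContDiffAt ℝ ∞ g p) (s : ℝ) (k i : Fin 3) :
    pd i (fun q => Real.exp (s * q k) * g q) p =
      Real.exp (s * p k) * ((if k = i then s * g p else 0) + pd i g p) := by
  rw [pd_mul ((contDiffAt_exp s k p).differentiableAt (by simp)) (hg.differentiableAt (by simp)),
    pd_exp]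
  split_ifs <;> ring

/-- Invariance makes `θ₀₁` and `θ₀₂` scale like `exp (p 1)`, so `exp (-p 1) θ₀₁` descends to `f₁`.
Closedness then reads `θ₀₂ = ∂₂θ₀₁`, which produces the `df₁` term. -/
theorem tableForm_g23 (hΩ : IsOpen Ω) (hc : Convex ℝ Ω) :
    (∀ p ∈ Ω, SmoothClosed θ p ∧ Transl θ 0 p ∧ pd 1 (comp θ 0 1) p = comp θ 0 1 p ∧
      pd 1 (comp θ 0 2) p = comp θ 0 2 p ∧ pd 1 (comp θ 1 2) p = 0) ↔
      Row.TableForm .g23 Ω θ := by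
  have wd : ∀ (f₁ : ℝ → ℝ) (p : Q) (c : ℝ), ContDiffAt ℝ ∞ f₁ (p 2) →
      Real.exp (p 1) • wedge (Row.d 0) (f₁ (p 2) • Row.d 1 + fderiv ℝ (fun p' : Q => f₁ (p' 2)) p)
        + c • wedge (Row.d 1) (Row.d 2) =
      (Real.exp (1 * p 1) * f₁ (p 2)) • wedge (Row.d 0) (Row.d 1)
        + (Real.exp (1 * p 1) * deriv f₁ (p 2)) • wedge (Row.d 0) (Row.d 2)
        + c • wedge (Row.d 1) (Row.d 2) := by
    intro f p c h
    have e : ∀ v, fderiv ℝ (fun p' : Q => f (p' 2)) p v = v 2 * deriv f (p 2) := by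
      intro v
      rw [fderiv_eq_sum_pd, Fin.sum_univ_three, pd_comp_p h, pd_comp_p h, pd_comp_p h]; simp
    apply form_ext
    intro v w
    simp only [ContinuousAlternatingMap.add_apply, ContinuousAlternatingMap.smul_apply,
      wedge_apply, Row.d, ContinuousLinearMap.proj_apply, smul_eq_mul, add_apply, smul_apply, e,
      one_mul]
    ring
  constructor
  · intro h
    obtain ⟨f₁, hf₁⟩ := exists_descend_one hΩ hc (g := fun q => Real.exp (-1 * q 1) * comp θ 0 1 q)
      (fun p hp => (contDiffAt_exp _ _ _).mul (h p hp).1.1) (fun p hp => by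
        rw [pd_exp_mul (h p hp).1.1, pd_exp_mul (h p hp).1.1, (h p hp).2.1.1, (h p hp).2.2.1]
        simp)
    obtain ⟨f₂, hf₂⟩ := exists_descend_one hΩ hc (fun p hp => (h p hp).1.2.2.1)
      fun p hp => ⟨(h p hp).2.1.2.2, (h p hp).2.2.2.2⟩
    have ha : EqOn (comp θ 0 1) (fun q => Real.exp (1 * q 1) * f₁ (q 2)) Ω := by
      intro p hp
      simp only [← (hf₁ p hp).2, ← mul_assoc, ← Real.exp_add]
      simp
    refine ⟨f₁, f₂, fun p hp => ⟨(hf₁ p hp).1, (hf₂ p hp).1⟩, fun p hp => ?_⟩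
    rw [wd _ _ _ (hf₁ p hp).1]
    refine comp_of_eq.2 ⟨ha hp, ?_, (hf₂ p hp).2⟩
    obtain ⟨⟨-, -, -, hcl⟩, ⟨-, -, h0⟩, h1, h2, h3⟩ := h p hp
    have e : pd 2 (comp θ 0 1) p = Real.exp (1 * p 1) * deriv f₁ (p 2) := by
      rw [pd_congr hΩ ha hp, pd_exp_mul (contDiffAt_comp_p (hf₁ p hp).1),
        pd_comp_p (hf₁ p hp).1]
      simp
    linarith
  · rintro ⟨f₁, f₂, hs, he⟩
    have he' := fun p hp => comp_of_eq.1 ((he p hp).trans (wd _ _ _ (hs p hp).1))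
    have ha : EqOn (comp θ 0 1) (fun q => Real.exp (1 * q 1) * f₁ (q 2)) Ω := fun p hp =>
      (he' p hp).1
    have hb : EqOn (comp θ 0 2) (fun q => Real.exp (1 * q 1) * deriv f₁ (q 2)) Ω := fun p hp =>
      (he' p hp).2.1
    have hcc : EqOn (comp θ 1 2) (fun q => f₂ (q 2)) Ω := fun p hp => (he' p hp).2.2
    intro p hp
    have hd : ContDiffAt ℝ ∞ (deriv f₁) (p 2) := by
      have := ((hs p hp).1.fderiv_right (m := ∞) (by simp)).clm_apply
        (contDiffAt_const (c := (1 : ℝ)))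
      exact this
    have hcd : ∀ {g : ℝ → ℝ}, ContDiffAt ℝ ∞ g (p 2) →
        ContDiffAt ℝ ∞ (fun q : Q => g (q 2)) p := fun h => contDiffAt_comp_p h
    refine ⟨⟨contDiffAt_congr_on hΩ ha hp ((contDiffAt_exp _ _ _).mul (hcd (hs p hp).1)),
      contDiffAt_congr_on hΩ hb hp ((contDiffAt_exp _ _ _).mul (hcd hd)),
      contDiffAt_congr_on hΩ hcc hp (hcd (hs p hp).2), ?_⟩, ⟨?_, ?_, ?_⟩, ?_, ?_, ?_⟩
    all_goals simp [pd_congr hΩ ha hp, pd_congr hΩ hb hp, pd_congr hΩ hcc hp,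
      pd_exp_mul (hcd (hs p hp).1), pd_exp_mul (hcd hd), -one_mul,
      pd_comp_p (hs p hp).1, pd_comp_p (hs p hp).2, pd_comp_p hd, ha hp, hb hp] <;> ring

/-- Closedness gives `∂₂θ₀₁ = 0` and the dilation gives `∂₂θ₀₁ = 2θ₀₁`, so this component vanishes.
The other two, multiplied by `exp (-p 2)`, are constant. -/
theorem tableForm_g31 (hΩ : IsOpen Ω) (hc : Convex ℝ Ω) :
    (∀ p ∈ Ω, SmoothClosed θ p ∧ Transl θ 0 p ∧ Transl θ 1 p ∧
      pd 2 (comp θ 0 1) p = 2 * comp θ 0 1 p ∧ pd 2 (comp θ 0 2) p = comp θ 0 2 p ∧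
      pd 2 (comp θ 1 2) p = comp θ 1 2 p) ↔ Row.TableForm .g31 Ω θ := by
  have wd : ∀ (μ₁ μ₂ : ℝ) (p : Q),
      Real.exp (p 2) • wedge (μ₁ • Row.d 0 + μ₂ • Row.d 1) (Row.d 2) =
      (0 : ℝ) • wedge (Row.d 0) (Row.d 1)
        + (Real.exp (1 * p 2) * μ₁) • wedge (Row.d 0) (Row.d 2)
        + (Real.exp (1 * p 2) * μ₂) • wedge (Row.d 1) (Row.d 2) := by
    intro μ₁ μ₂ p
    apply form_ext
    intro v w
    simp only [ContinuousAlternatingMap.add_apply, ContinuousAlternatingMap.smul_apply,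
      wedge_apply, Row.d, ContinuousLinearMap.proj_apply, smul_eq_mul, add_apply, smul_apply,
      one_mul]
    ring
  constructor
  · intro h
    obtain ⟨μ₁, h₁⟩ := exists_const_of_pd hΩ hc (g := fun q => Real.exp (-1 * q 2) * comp θ 0 2 q)
      (fun p hp => (contDiffAt_exp _ _ _).mul (h p hp).1.2.1) (fun p hp => by
        obtain ⟨⟨-, hs, -, -⟩, ⟨-, h1, -⟩, ⟨-, h2, -⟩, -, h3, -⟩ := h p hp
        rw [pd_exp_mul hs, pd_exp_mul hs, pd_exp_mul hs, h1, h2, h3]; simp)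
    obtain ⟨μ₂, h₂⟩ := exists_const_of_pd hΩ hc (g := fun q => Real.exp (-1 * q 2) * comp θ 1 2 q)
      (fun p hp => (contDiffAt_exp _ _ _).mul (h p hp).1.2.2.1) (fun p hp => by
        obtain ⟨⟨-, -, hs, -⟩, ⟨-, -, h1⟩, ⟨-, -, h2⟩, -, -, h3⟩ := h p hp
        rw [pd_exp_mul hs, pd_exp_mul hs, pd_exp_mul hs, h1, h2, h3]; simp)
    refine ⟨μ₁, μ₂, fun p hp => ?_⟩
    rw [wd]
    obtain ⟨⟨-, -, -, hcl⟩, ⟨-, -, h0⟩, ⟨-, h1, -⟩, h2, -, -⟩ := h p hp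
    refine comp_of_eq.2 ⟨by linarith, ?_, ?_⟩
    · simp only [← h₁ p hp, ← mul_assoc, ← Real.exp_add]; simp
    · simp only [← h₂ p hp, ← mul_assoc, ← Real.exp_add]; simp
  · rintro ⟨μ₁, μ₂, he⟩
    have he' := fun p hp => comp_of_eq.1 ((he p hp).trans (wd _ _ _))
    have ha : EqOn (comp θ 0 1) (fun q => 0) Ω := fun p hp => (he' p hp).1
    have hb : EqOn (comp θ 0 2) (fun q => Real.exp (1 * q 2) * μ₁) Ω := fun p hp =>
      (he' p hp).2.1
    have hcc : EqOn (comp θ 1 2) (fun q => Real.exp (1 * q 2) * μ₂) Ω := fun p hp =>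
      (he' p hp).2.2
    intro p hp
    refine ⟨⟨contDiffAt_congr_on hΩ ha hp contDiffAt_const,
      contDiffAt_congr_on hΩ hb hp ((contDiffAt_exp _ _ _).mul contDiffAt_const),
      contDiffAt_congr_on hΩ hcc hp ((contDiffAt_exp _ _ _).mul contDiffAt_const), ?_⟩,
      ⟨?_, ?_, ?_⟩, ⟨?_, ?_, ?_⟩, ?_, ?_, ?_⟩
    all_goals simp [pd_congr hΩ ha hp, pd_congr hΩ hb hp, pd_congr hΩ hcc hp,
      pd_exp_mul (contDiffAt_const (c := μ₁)), pd_exp_mul (contDiffAt_const (c := μ₂)), -one_mul,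
      pd_const, ha hp, hb hp, hcc hp] <;> ring

/-- No rotation-invariant covector exists in the plane, which removes the two mixed components;
closedness makes the area coefficient constant. -/
theorem tableForm_g32 (hΩ : IsOpen Ω) (hc : Convex ℝ Ω) :
    (∀ p ∈ Ω, SmoothClosed θ p ∧ Transl θ 0 p ∧ Transl θ 1 p ∧
      comp θ 0 2 p = 0 ∧ comp θ 1 2 p = 0) ↔ Row.TableForm .g32 Ω θ := by
  have wd : ∀ (μ : ℝ), μ • wedge (Row.d 0) (Row.d 1) = μ • wedge (Row.d 0) (Row.d 1)
      + (0 : ℝ) • wedge (Row.d 0) (Row.d 2) + (0 : ℝ) • wedge (Row.d 1) (Row.d 2) := by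
    intro μ; simp
  constructor
  · intro h
    obtain ⟨μ, hμ⟩ := exists_const_of_pd hΩ hc (fun p hp => (h p hp).1.1) (fun p hp => by
      obtain ⟨⟨-, -, -, hcl⟩, ⟨h1, h2, h3⟩, ⟨h4, h5, h6⟩, -⟩ := h p hp
      refine ⟨h1, h4, ?_⟩
      linarith)
    refine ⟨μ, fun p hp => ?_⟩
    rw [wd]
    exact comp_of_eq.2 ⟨hμ p hp, (h p hp).2.2.2.1, (h p hp).2.2.2.2⟩
  · rintro ⟨μ, he⟩
    have he' := fun p hp => comp_of_eq.1 ((he p hp).trans (wd _))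
    have ha : EqOn (comp θ 0 1) (fun q => μ) Ω := fun p hp => (he' p hp).1
    have hb : EqOn (comp θ 0 2) (fun q => 0) Ω := fun p hp => (he' p hp).2.1
    have hcc : EqOn (comp θ 1 2) (fun q => 0) Ω := fun p hp => (he' p hp).2.2
    intro p hp
    refine ⟨⟨contDiffAt_congr_on hΩ ha hp contDiffAt_const,
      contDiffAt_congr_on hΩ hb hp contDiffAt_const,
      contDiffAt_congr_on hΩ hcc hp contDiffAt_const, ?_⟩,
      ⟨?_, ?_, ?_⟩, ⟨?_, ?_, ?_⟩, hb hp, hcc hp⟩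
    all_goals simp [pd_congr hΩ ha hp, pd_congr hΩ hb hp, pd_congr hΩ hcc hp, pd_const]

theorem pd_rot {f g : Q → ℝ} {p : Q} (hf : ContDiffAt ℝ ∞ f p) (hg : ContDiffAt ℝ ∞ g p)
    (i : Fin 3) : pd i (fun q => f q * Real.cos (q 2) + g q * Real.sin (q 2)) p =
      (pd i f p + if (2 : Fin 3) = i then g p else 0) * Real.cos (p 2)
        + (pd i g p - if (2 : Fin 3) = i then f p else 0) * Real.sin (p 2) := by
  have hcs : DifferentiableAt ℝ (fun q : Q => Real.cos (q 2)) p := by fun_prop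
  have hsn : DifferentiableAt ℝ (fun q : Q => Real.sin (q 2)) p := by fun_prop
  have hf' := hf.differentiableAt (n := ∞) (by simp)
  have hg' := hg.differentiableAt (n := ∞) (by simp)
  have h1 : DifferentiableAt ℝ (fun q => f q * Real.cos (q 2)) p := hf'.mul hcs
  have h2 : DifferentiableAt ℝ (fun q => g q * Real.sin (q 2)) p := hg'.mul hsn
  rw [pd_add h1 h2, pd_mul hf' hcs, pd_mul hg' hsn,
    pd_coord (Real.hasDerivAt_cos (p 2)), pd_coord (Real.hasDerivAt_sin (p 2))]
  split_ifs <;> ring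

theorem contDiffAt_rot {f g : Q → ℝ} {p : Q} (hf : ContDiffAt ℝ ∞ f p) (hg : ContDiffAt ℝ ∞ g p) :
    ContDiffAt ℝ ∞ (fun q => f q * Real.cos (q 2) + g q * Real.sin (q 2)) p :=
  (hf.mul (contDiffAt_p 2 p).cos).add (hg.mul (contDiffAt_p 2 p).sin)

/-- As for pure dilations, `θ₀₁` dies, now because `2α ≠ 0`. The pair `(θ₀₂, θ₁₂)` solves a linear
system that scales by `α` and rotates with unit speed in `p 2`; undoing both motions gives the
constants `μ₁, μ₂`. -/
theorem tableForm_g33 (α : ℝ) (hα : 0 < α) (hΩ : IsOpen Ω) (hc : Convex ℝ Ω) :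
    (∀ p ∈ Ω, SmoothClosed θ p ∧ Transl θ 0 p ∧ Transl θ 1 p ∧
      pd 2 (comp θ 0 1) p = 2 * α * comp θ 0 1 p ∧
      pd 2 (comp θ 0 2) p = α * comp θ 0 2 p - comp θ 1 2 p ∧
      pd 2 (comp θ 1 2) p = comp θ 0 2 p + α * comp θ 1 2 p) ↔
      Row.TableForm (.g33 α hα) Ω θ := by
  have wd : ∀ (b c : ℝ), b • wedge (Row.d 0) (Row.d 2) + c • wedge (Row.d 1) (Row.d 2) =
      (0 : ℝ) • wedge (Row.d 0) (Row.d 1)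
      + b • wedge (Row.d 0) (Row.d 2) + c • wedge (Row.d 1) (Row.d 2) := by
    intro b c; simp
  constructor
  · intro h
    obtain ⟨μ₁, h₁⟩ := exists_const_of_pd hΩ hc (g := fun q => Real.exp (-α * q 2) *
        (comp θ 0 2 q * Real.cos (q 2) + comp θ 1 2 q * Real.sin (q 2)))
      (fun p hp => (contDiffAt_exp _ _ _).mul
        (contDiffAt_rot (h p hp).1.2.1 (h p hp).1.2.2.1)) (fun p hp => by
        obtain ⟨⟨-, hs, hs', -⟩, ⟨-, h1, h1'⟩, ⟨-, h2, h2'⟩, -, h3, h3'⟩ := h p hp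
        rw [pd_exp_mul (contDiffAt_rot hs hs'), pd_exp_mul (contDiffAt_rot hs hs'),
          pd_exp_mul (contDiffAt_rot hs hs'), pd_rot hs hs', pd_rot hs hs', pd_rot hs hs',
          h1, h1', h2, h2', h3, h3']
        refine ⟨by simp, by simp, ?_⟩
        rw [if_pos rfl, if_pos rfl, if_pos rfl]
        ring)
    -- The second conserved combination is the first one for the pair `(-θ₁₂, θ₀₂)`, which solves
    -- the same system.
    obtain ⟨μ₂, h₂⟩ := exists_const_of_pd hΩ hc (g := fun q => Real.exp (-α * q 2) *
        ((-1 * comp θ 1 2 q) * Real.cos (q 2) + comp θ 0 2 q * Real.sin (q 2)))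
      (fun p hp => (contDiffAt_exp _ _ _).mul
        (contDiffAt_rot (contDiffAt_const.mul (h p hp).1.2.2.1) (h p hp).1.2.1)) (fun p hp => by
        obtain ⟨⟨-, hs', hs'', -⟩, ⟨-, h1', h1⟩, ⟨-, h2', h2⟩, -, h3', h3⟩ := h p hp
        have hs : ContDiffAt ℝ ∞ (fun q => -1 * comp θ 1 2 q) p := contDiffAt_const.mul hs''
        have hd := hs''.differentiableAt (n := ∞) (by simp)
        rw [pd_exp_mul (contDiffAt_rot hs hs'), pd_exp_mul (contDiffAt_rot hs hs'),
          pd_exp_mul (contDiffAt_rot hs hs'), pd_rot hs hs', pd_rot hs hs', pd_rot hs hs',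
          pd_fun_const_mul hd, pd_fun_const_mul hd, pd_fun_const_mul hd,
          h1, h1', h2, h2', h3, h3']
        refine ⟨by simp, by simp, ?_⟩
        rw [if_pos rfl, if_pos rfl, if_pos rfl]
        ring)
    refine ⟨μ₁, μ₂, fun p hp => ?_⟩
    rw [wd]
    obtain ⟨⟨-, -, -, hcl⟩, ⟨-, -, h0⟩, ⟨-, h1, -⟩, h2, -, -⟩ := h p hp
    have ha : comp θ 0 1 p = 0 := by
      have : 2 * α * comp θ 0 1 p = 0 := by linarith
      rcases mul_eq_zero.1 this with h | h
      · linarith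
      · exact h
    have hex : Real.exp (α * p 2) * Real.exp (-α * p 2) = 1 := by rw [← Real.exp_add]; simp
    have hsc := Real.sin_sq_add_cos_sq (p 2)
    refine comp_of_eq.2 ⟨ha, ?_, ?_⟩
    · simp only [← h₁ p hp, ← h₂ p hp]
      linear_combination (-comp θ 0 2 p * (Real.sin (p 2) ^ 2 + Real.cos (p 2) ^ 2)) * hex
        - comp θ 0 2 p * hsc
    · simp only [← h₁ p hp, ← h₂ p hp]
      linear_combination (-comp θ 1 2 p * (Real.sin (p 2) ^ 2 + Real.cos (p 2) ^ 2)) * hex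
        - comp θ 1 2 p * hsc
  · rintro ⟨μ₁, μ₂, he⟩
    have he' := fun p hp => comp_of_eq.1 ((he p hp).trans (wd _ _))
    have ha : EqOn (comp θ 0 1) (fun q => 0) Ω := fun p hp => (he' p hp).1
    have hb : EqOn (comp θ 0 2) (fun q => Real.exp (α * q 2) *
        (μ₁ * Real.cos (q 2) + μ₂ * Real.sin (q 2))) Ω := fun p hp => (he' p hp).2.1
    have hcc : EqOn (comp θ 1 2) (fun q => Real.exp (α * q 2) *
        (-μ₂ * Real.cos (q 2) + μ₁ * Real.sin (q 2))) Ω := fun p hp => by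
      rw [(he' p hp).2.2]; ring
    intro p hp
    have hk := fun μ : ℝ => contDiffAt_const (𝕜 := ℝ) (n := ∞) (x := p) (c := μ)
    refine ⟨⟨contDiffAt_congr_on hΩ ha hp contDiffAt_const,
      contDiffAt_congr_on hΩ hb hp ((contDiffAt_exp _ _ _).mul (contDiffAt_rot (hk _) (hk _))),
      contDiffAt_congr_on hΩ hcc hp ((contDiffAt_exp _ _ _).mul (contDiffAt_rot (hk _) (hk _))),
        ?_⟩, ⟨?_, ?_, ?_⟩, ⟨?_, ?_, ?_⟩, ?_, ?_, ?_⟩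
    all_goals
      simp only [pd_congr hΩ ha hp, pd_congr hΩ hb hp, pd_congr hΩ hcc hp,
        pd_exp_mul (contDiffAt_rot (hk μ₁) (hk μ₂)), pd_exp_mul (contDiffAt_rot (hk (-μ₂)) (hk μ₁)),
        pd_rot (hk μ₁) (hk μ₂), pd_rot (hk (-μ₂)) (hk μ₁),
        pd_const, ha hp, hb hp, hcc hp]
    all_goals simp
    all_goals ring

/-- The surviving equation is the one satisfied by `cos (p 1)`, the area density of both orbit
geometries, so the quotient is constant. It serves both rows with two-dimensional orbits of constant
curvature. -/
theorem tableForm_cos (hΩ : IsOpen Ω) (hc : Convex ℝ Ω) (hcos : ∀ p ∈ Ω, Real.cos (p 1) ≠ 0) :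
    (∀ p ∈ Ω, SmoothClosed θ p ∧ Transl θ 0 p ∧
      pd 1 (comp θ 0 1) p = -(comp θ 0 1 p * Real.tan (p 1)) ∧ comp θ 0 2 p = 0 ∧
      comp θ 1 2 p = 0 ∧ pd 1 (comp θ 0 2) p = 0 ∧ pd 1 (comp θ 1 2) p = 0) ↔
      Row.TableForm .g34 Ω θ := by
  have wd : ∀ (μ : ℝ), μ • wedge (Row.d 0) (Row.d 1) = μ • wedge (Row.d 0) (Row.d 1)
      + (0 : ℝ) • wedge (Row.d 0) (Row.d 2) + (0 : ℝ) • wedge (Row.d 1) (Row.d 2) := by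
    intro μ; simp
  constructor
  · intro h
    obtain ⟨μ, hμ⟩ := exists_const_of_pd hΩ hc (g := fun q => (Real.cos (q 1))⁻¹ * comp θ 0 1 q)
      (fun p hp => ((contDiffAt_p 1 p).cos.inv (hcos p hp)).mul (h p hp).1.1) (fun p hp => by
      obtain ⟨⟨hs, -, -, hcl⟩, ⟨h1, h2, h3⟩, h4, -, -, h5, h6⟩ := h p hp
      have hi : HasDerivAt (fun t => (Real.cos t)⁻¹) (-(-Real.sin (p 1)) / Real.cos (p 1) ^ 2)
        (p 1) := (Real.hasDerivAt_cos (p 1)).inv (hcos p hp)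
      have hci : ContDiffAt ℝ ∞ (fun q : Q => (Real.cos (q 1))⁻¹) p :=
        (contDiffAt_p 1 p).cos.inv (hcos p hp)
      have hm := fun i => pd_mul (hci.differentiableAt (by simp))
        (hs.differentiableAt (n := ∞) (by simp)) i
      have h2' : pd 2 (comp θ 0 1) p = 0 := by linarith
      refine ⟨?_, ?_, ?_⟩
      · rw [hm, pd_coord hi, h1]; simp
      · rw [hm, pd_coord hi, h4, Real.tan_eq_sin_div_cos]
        have := hcos p hp
        simp
        field_simp
        ring
      · rw [hm, pd_coord hi, h2']; simp)
    refine ⟨μ, fun p hp => ?_⟩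
    rw [wd]
    refine comp_of_eq.2 ⟨?_, (h p hp).2.2.2.1, (h p hp).2.2.2.2.1⟩
    rw [← hμ p hp]
    have := hcos p hp
    field_simp
  · rintro ⟨μ, he⟩
    have he' := fun p hp => comp_of_eq.1 ((he p hp).trans (wd _))
    have ha : EqOn (comp θ 0 1) (fun q => μ * Real.cos (q 1)) Ω := fun p hp => (he' p hp).1
    have hb : EqOn (comp θ 0 2) (fun q => 0) Ω := fun p hp => (he' p hp).2.1
    have hcc : EqOn (comp θ 1 2) (fun q => 0) Ω := fun p hp => (he' p hp).2.2
    intro p hp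
    refine ⟨⟨contDiffAt_congr_on hΩ ha hp (contDiffAt_const.mul (contDiffAt_p 1 p).cos),
      contDiffAt_congr_on hΩ hb hp contDiffAt_const,
      contDiffAt_congr_on hΩ hcc hp contDiffAt_const, ?_⟩,
      ⟨?_, ?_, ?_⟩, ?_, hb hp, hcc hp, ?_, ?_⟩
    all_goals simp [pd_congr hΩ ha hp, pd_congr hΩ hb hp, pd_congr hΩ hcc hp, pd_const,
      pd_coord ((Real.hasDerivAt_cos (p 1)).const_mul μ), ha hp]
    have := hcos p hp
    rw [Real.tan_eq_sin_div_cos]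
    field_simp

/-- The rotation leaves only `θ₀₁`, and the dilation together with closedness kills it. -/
theorem tableForm_g41 (hΩ : IsOpen Ω) :
    (∀ p ∈ Ω, SmoothClosed θ p ∧ Transl θ 0 p ∧ Transl θ 1 p ∧
      comp θ 0 2 p = 0 ∧ comp θ 1 2 p = 0 ∧ pd 2 (comp θ 0 1) p = 2 * comp θ 0 1 p ∧
      pd 2 (comp θ 0 2) p = 0 ∧ pd 2 (comp θ 1 2) p = 0) ↔ Row.TableForm .g41 Ω θ := by
  have wd : 0 = (0 : ℝ) • wedge (Row.d 0) (Row.d 1)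
      + (0 : ℝ) • wedge (Row.d 0) (Row.d 2) + (0 : ℝ) • wedge (Row.d 1) (Row.d 2) := by
    simp
  constructor
  · intro h p hp
    rw [wd]
    obtain ⟨⟨-, -, -, hcl⟩, ⟨-, -, h0⟩, ⟨-, h1, -⟩, h2, h3, h4, -, -⟩ := h p hp
    exact comp_of_eq.2 ⟨by linarith, h2, h3⟩
  · intro he
    have he' := fun p hp => comp_of_eq.1 ((he p hp).trans wd)
    have ha : EqOn (comp θ 0 1) (fun q => 0) Ω := fun p hp => (he' p hp).1
    have hb : EqOn (comp θ 0 2) (fun q => 0) Ω := fun p hp => (he' p hp).2.1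
    have hcc : EqOn (comp θ 1 2) (fun q => 0) Ω := fun p hp => (he' p hp).2.2
    intro p hp
    refine ⟨⟨contDiffAt_congr_on hΩ ha hp contDiffAt_const,
      contDiffAt_congr_on hΩ hb hp contDiffAt_const,
      contDiffAt_congr_on hΩ hcc hp contDiffAt_const, ?_⟩,
      ⟨?_, ?_, ?_⟩, ⟨?_, ?_, ?_⟩, hb hp, hcc hp, ?_, ?_, ?_⟩
    all_goals simp [pd_congr hΩ ha hp, pd_congr hΩ hb hp, pd_congr hΩ hcc hp, pd_const, ha hp]

/-! #### The Lie derivative conditions -/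

theorem forall_fin_three {P : Fin 3 → Prop} : (∀ A, P A) ↔ P 0 ∧ P 1 ∧ P 2 := by
  simp [Fin.forall_fin_succ]

theorem forall_fin_four {P : Fin 4 → Prop} : (∀ A, P A) ↔ P 0 ∧ P 1 ∧ P 2 ∧ P 3 := by
  simp [Fin.forall_fin_succ]

/-- The closed invariant `2`-forms in rectifying coordinates. -/
theorem invariant_iff_tableForm (R : Row) (hΩ : IsOpen Ω) (hc : Convex ℝ Ω)
    (hdom : Ω ⊆ R.coordDomain) :
    ((∀ p ∈ Ω, ContDiffAt ℝ ∞ θ p) ∧ (∀ p ∈ Ω, extDeriv θ p = 0) ∧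
      ∀ (A : Fin R.dim), ∀ p ∈ Ω, ∀ v w : Q, lieDeriv (R.coordGen A) θ p v w = 0) ↔
    R.TableForm Ω θ := by
  cases R with
  | g11 =>
    refine (invariant_iff .g11 fun p hp hd => ?_).trans (tableForm_one hΩ hc)
    exact Fin.forall_fin_one.trans (lie_d0 hd)
  | g12 =>
    refine (invariant_iff .g12 fun p hp hd => ?_).trans (tableForm_one hΩ hc)
    exact Fin.forall_fin_one.trans (lie_d0 hd)
  | g13 a ha =>
    refine (invariant_iff (.g13 a ha) fun p hp hd => ?_).trans (tableForm_one hΩ hc)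
    exact Fin.forall_fin_one.trans (lie_d0 hd)
  | g14 =>
    refine (invariant_iff .g14 fun p hp hd => ?_).trans (tableForm_one hΩ hc)
    exact Fin.forall_fin_one.trans (lie_d0 hd)
  | g21 =>
    refine (invariant_iff .g21 fun p hp hd => ?_).trans (tableForm_two hΩ hc)
    exact Fin.forall_fin_two.trans (and_congr (lie_d0 hd) (lie_d1 hd))
  | g22 =>
    refine (invariant_iff .g22 fun p hp hd => ?_).trans (tableForm_two hΩ hc)
    exact Fin.forall_fin_two.trans (and_congr (lie_d0 hd) (lie_d1 hd))
  | g23 =>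
    refine (invariant_iff .g23 fun p hp hd => ?_).trans (tableForm_g23 hΩ hc)
    refine Fin.forall_fin_two.trans ((and_congr (lie_d0 hd)
      (lie_affine hd (-1) 0 0 0 0 1 0 fun p => by simp [Row.coordGen])).trans ?_)
    constructor
    · rintro ⟨⟨h1, h2, h3⟩, e1, e2, e3⟩
      rw [h1] at e1; rw [h2] at e2; rw [h3] at e3
      exact ⟨⟨h1, h2, h3⟩, by linarith, by linarith, by linarith⟩
    · rintro ⟨⟨h1, h2, h3⟩, e1, e2, e3⟩
      rw [h1, h2, h3]
      exact ⟨⟨h1, h2, h3⟩, by linarith, by linarith, by linarith⟩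
  | g31 =>
    refine (invariant_iff .g31 fun p hp hd => ?_).trans (tableForm_g31 hΩ hc)
    refine forall_fin_three.trans ((and_congr (lie_d0 hd) (and_congr (lie_d1 hd)
      (lie_affine hd (-1) 0 0 (-1) 0 0 1 fun p => by simp [Row.coordGen]))).trans ?_)
    constructor
    · rintro ⟨⟨h1, h2, h3⟩, ⟨h4, h5, h6⟩, e1, e2, e3⟩
      rw [h1, h4] at e1; rw [h2, h5] at e2; rw [h3, h6] at e3
      exact ⟨⟨h1, h2, h3⟩, ⟨h4, h5, h6⟩, by linarith, by linarith, by linarith⟩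
    · rintro ⟨⟨h1, h2, h3⟩, ⟨h4, h5, h6⟩, e1, e2, e3⟩
      rw [h1, h2, h3, h4, h5, h6]
      exact ⟨⟨h1, h2, h3⟩, ⟨h4, h5, h6⟩, by linarith, by linarith, by linarith⟩
  | g32 =>
    refine (invariant_iff .g32 fun p hp hd => ?_).trans (tableForm_g32 hΩ hc)
    refine forall_fin_three.trans ((and_congr (lie_d0 hd) (and_congr (lie_d1 hd)
      (lie_affine hd 0 (-1) 1 0 0 0 0 fun p => by simp [Row.coordGen]))).trans ?_)
    constructor
    · rintro ⟨⟨h1, h2, h3⟩, ⟨h4, h5, h6⟩, e1, e2, e3⟩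
      rw [h1, h4] at e1; rw [h2, h5] at e2; rw [h3, h6] at e3
      exact ⟨⟨h1, h2, h3⟩, ⟨h4, h5, h6⟩, by linarith, by linarith⟩
    · rintro ⟨⟨h1, h2, h3⟩, ⟨h4, h5, h6⟩, e1, e2⟩
      rw [h1, h2, h3, h4, h5, h6, e1, e2]
      exact ⟨⟨h1, h2, h3⟩, ⟨h4, h5, h6⟩, by ring, by ring, by ring⟩
  | g33 a ha =>
    refine (invariant_iff (.g33 a ha) fun p hp hd => ?_).trans (tableForm_g33 a ha hΩ hc)
    refine forall_fin_three.trans ((and_congr (lie_d0 hd) (and_congr (lie_d1 hd)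
      (lie_affine hd (-a) (-1) 1 (-a) 0 0 1 fun p => by
        funext i; fin_cases i <;> simp [Row.coordGen] <;> ring))).trans ?_)
    constructor
    · rintro ⟨⟨h1, h2, h3⟩, ⟨h4, h5, h6⟩, e1, e2, e3⟩
      rw [h1, h4] at e1; rw [h2, h5] at e2; rw [h3, h6] at e3
      exact ⟨⟨h1, h2, h3⟩, ⟨h4, h5, h6⟩, by linarith, by linarith, by linarith⟩
    · rintro ⟨⟨h1, h2, h3⟩, ⟨h4, h5, h6⟩, e1, e2, e3⟩
      rw [h1, h2, h3, h4, h5, h6]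
      exact ⟨⟨h1, h2, h3⟩, ⟨h4, h5, h6⟩, by linarith, by linarith, by linarith⟩
  | g34 =>
    refine (invariant_iff .g34 fun p hp hd => ?_).trans (tableForm_cos hΩ hc hdom)
    have hcos : Real.cos (p 1) ≠ 0 := hdom hp
    refine forall_fin_three.trans ((and_congr (lie_d0 hd) (and_congr
      (lie_prod hd (X := Row.g34.coordGen (1 : Fin 3)) (fun p => rfl) (Real.hasDerivAt_sin _)
        (Real.hasDerivAt_cos _) (Real.hasDerivAt_tan hcos))
      (lie_prod hd (X := Row.g34.coordGen (2 : Fin 3)) (fun p => rfl) (Real.hasDerivAt_cos _)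
        (Real.hasDerivAt_sin _).neg (Real.hasDerivAt_tan hcos)))).trans ?_)
    have hsc := Real.sin_sq_add_cos_sq (p 0)
    have hi : Real.cos (p 1) ^ 2 * (1 / Real.cos (p 1) ^ 2) = 1 := by field_simp
    simp only [Pi.neg_apply]
    constructor
    · rintro ⟨⟨h1, h2, h3⟩, ⟨e1, e2, e3⟩, e4, e5, e6⟩
      rw [h1] at e1 e4; rw [h2] at e2 e5; rw [h3] at e3 e6
      -- In this combination the derivative and the `tan` terms of the two fields cancel, and the
      -- coefficient of the component is `sin² + cos² = 1`. The next component is isolated likewise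
      -- from the third equations, whose factor `1 / cos²` comes from `tan'`.
      have hcz : comp θ 1 2 p = 0 := by
        linear_combination (-comp θ 1 2 p) * hsc - Real.sin (p 0) * e2 - Real.cos (p 0) * e5
      have hbz : comp θ 0 2 p = 0 := by
        linear_combination (-comp θ 0 2 p) * hsc
          + Real.cos (p 1) ^ 2 * (Real.sin (p 0) * e3 + Real.cos (p 0) * e6)
          - comp θ 0 2 p * (Real.sin (p 0) ^ 2 + Real.cos (p 0) ^ 2) * hi
      rw [hbz, hcz] at e2 e5
      rw [hbz] at e3 e6
      refine ⟨⟨h1, h2, h3⟩, ?_, hbz, hcz, ?_, ?_⟩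
      · linear_combination (-pd 1 (comp θ 0 1) p - comp θ 0 1 p * Real.tan (p 1)) * hsc
          + Real.cos (p 0) * e1 - Real.sin (p 0) * e4
      · linear_combination (-pd 1 (comp θ 0 2) p) * hsc
          + Real.cos (p 0) * e2 - Real.sin (p 0) * e5
      · linear_combination (-pd 1 (comp θ 1 2) p) * hsc
          + Real.cos (p 0) * e3 - Real.sin (p 0) * e6
    · rintro ⟨⟨h1, h2, h3⟩, e1, e2, e3, e4, e5⟩
      rw [h1, h2, h3, e1, e2, e3, e4, e5]
      exact ⟨⟨h1, h2, h3⟩, ⟨by ring, by ring, by ring⟩, by ring, by ring, by ring⟩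
  | g35 =>
    refine (invariant_iff .g35 fun p hp hd => ?_).trans (tableForm_cos hΩ hc hdom)
    have hcos : Real.cos (p 1) ≠ 0 := hdom hp
    refine forall_fin_three.trans ((and_congr (lie_d0 hd) (and_congr
      (lie_prod hd (X := Row.g35.coordGen (1 : Fin 3)) (fun p => rfl) (Real.hasDerivAt_sinh _)
        (Real.hasDerivAt_cosh _) (Real.hasDerivAt_tan hcos))
      (lie_prod hd (X := Row.g35.coordGen (2 : Fin 3)) (fun p => rfl) (Real.hasDerivAt_cosh _)
        (Real.hasDerivAt_sinh _) (Real.hasDerivAt_tan hcos)))).trans ?_)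
    have hsc := Real.cosh_sq_sub_sinh_sq (p 0)
    have hi : Real.cos (p 1) ^ 2 * (1 / Real.cos (p 1) ^ 2) = 1 := by field_simp
    constructor
    · rintro ⟨⟨h1, h2, h3⟩, ⟨e1, e2, e3⟩, e4, e5, e6⟩
      rw [h1] at e1 e4; rw [h2] at e2 e5; rw [h3] at e3 e6
      -- The same elimination as for rotations, with `cosh² - sinh² = 1` in place of `sin² + cos² =
      -- 1`.
      have hcz : comp θ 1 2 p = 0 := by
        linear_combination (-comp θ 1 2 p) * hsc - Real.sinh (p 0) * e2 + Real.cosh (p 0) * e5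
      have hbz : comp θ 0 2 p = 0 := by
        linear_combination (-comp θ 0 2 p) * hsc
          + Real.cos (p 1) ^ 2 * (Real.cosh (p 0) * e6 - Real.sinh (p 0) * e3)
          - comp θ 0 2 p * (Real.cosh (p 0) ^ 2 - Real.sinh (p 0) ^ 2) * hi
      rw [hbz, hcz] at e2 e5
      rw [hbz] at e3 e6
      refine ⟨⟨h1, h2, h3⟩, ?_, hbz, hcz, ?_, ?_⟩
      · linear_combination (-pd 1 (comp θ 0 1) p - comp θ 0 1 p * Real.tan (p 1)) * hsc
          + Real.cosh (p 0) * e1 - Real.sinh (p 0) * e4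
      · linear_combination (-pd 1 (comp θ 0 2) p) * hsc
          + Real.cosh (p 0) * e2 - Real.sinh (p 0) * e5
      · linear_combination (-pd 1 (comp θ 1 2) p) * hsc
          + Real.cosh (p 0) * e3 - Real.sinh (p 0) * e6
    · rintro ⟨⟨h1, h2, h3⟩, e1, e2, e3, e4, e5⟩
      rw [h1, h2, h3, e1, e2, e3, e4, e5]
      exact ⟨⟨h1, h2, h3⟩, ⟨by ring, by ring, by ring⟩, by ring, by ring, by ring⟩
  | g41 =>
    refine (invariant_iff .g41 fun p hp hd => ?_).trans (tableForm_g41 hΩ)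
    refine forall_fin_four.trans ((and_congr (lie_d0 hd) (and_congr (lie_d1 hd) (and_congr
      (lie_affine hd 0 (-1) 1 0 0 0 0 fun p => by simp [Row.coordGen])
      (lie_affine hd (-1) 0 0 (-1) 0 0 1 fun p => by simp [Row.coordGen])))).trans ?_)
    constructor
    · rintro ⟨⟨h1, h2, h3⟩, ⟨h4, h5, h6⟩, ⟨e1, e2, e3⟩, e4, e5, e6⟩
      rw [h1, h4] at e1 e4; rw [h2, h5] at e2 e5; rw [h3, h6] at e3 e6
      exact ⟨⟨h1, h2, h3⟩, ⟨h4, h5, h6⟩, by linarith, by linarith, by linarith, by linarith,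
        by linarith⟩
    · rintro ⟨⟨h1, h2, h3⟩, ⟨h4, h5, h6⟩, e1, e2, e3, e4, e5⟩
      rw [h1, h2, h3, h4, h5, h6, e1, e2, e3, e4, e5]
      exact ⟨⟨h1, h2, h3⟩, ⟨h4, h5, h6⟩, ⟨by ring, by ring, by ring⟩, by ring, by ring, by ring⟩

end CoordRows

/-! ### The listed generators as skew linear maps. -/

namespace Row

/-- The basis of `G_{n,m}` as linear maps. -/
def genL : (R : Row) → Fin R.dim → M →L[ℝ] M
  | g11 => ![-JL 0 3]
  | g12 => ![-JL 1 2]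
  | g13 a _ => ![-(JL 1 2 + a • JL 0 3)]
  | g14 => ![JL 1 3 - JL 0 1]
  | g21 => ![JL 1 3 - JL 0 1, JL 2 3 - JL 0 2]
  | g22 => ![-JL 1 2, -JL 0 3]
  | g23 => ![JL 1 3 - JL 0 1, -JL 0 3]
  | g31 => ![JL 1 3 - JL 0 1, JL 2 3 - JL 0 2, -JL 0 3]
  | g32 => ![JL 1 3 - JL 0 1, JL 2 3 - JL 0 2, -JL 1 2]
  | g33 a _ => ![JL 1 3 - JL 0 1, JL 2 3 - JL 0 2, -(JL 1 2 + a • JL 0 3)]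
  | g34 => ![-JL 1 2, -JL 2 3, -JL 1 3]
  | g35 => ![-JL 0 1, -JL 1 2, -JL 0 2]
  | g41 => ![JL 1 3 - JL 0 1, JL 2 3 - JL 0 2, -JL 1 2, -JL 0 3]

/-- The index type `Fin R.dim` depends on the row. This case distinction exposes concrete indices
once, so that a property of all generators can be given as a table of small facts. -/
theorem forall_gen {P : ∀ R : Row, Fin R.dim → Prop} (h11 : P g11 (0 : Fin 1))
    (h12 : P g12 (0 : Fin 1)) (h13 : ∀ a ha, P (g13 a ha) (0 : Fin 1)) (h14 : P g14 (0 : Fin 1))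
    (h21 : P g21 (0 : Fin 2) ∧ P g21 (1 : Fin 2)) (h22 : P g22 (0 : Fin 2) ∧ P g22 (1 : Fin 2))
    (h23 : P g23 (0 : Fin 2) ∧ P g23 (1 : Fin 2))
    (h31 : P g31 (0 : Fin 3) ∧ P g31 (1 : Fin 3) ∧ P g31 (2 : Fin 3))
    (h32 : P g32 (0 : Fin 3) ∧ P g32 (1 : Fin 3) ∧ P g32 (2 : Fin 3))
    (h33 : ∀ a ha, P (g33 a ha) (0 : Fin 3) ∧ P (g33 a ha) (1 : Fin 3) ∧ P (g33 a ha) (2 : Fin 3))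
    (h34 : P g34 (0 : Fin 3) ∧ P g34 (1 : Fin 3) ∧ P g34 (2 : Fin 3))
    (h35 : P g35 (0 : Fin 3) ∧ P g35 (1 : Fin 3) ∧ P g35 (2 : Fin 3))
    (h41 : P g41 (0 : Fin 4) ∧ P g41 (1 : Fin 4) ∧ P g41 (2 : Fin 4) ∧ P g41 (3 : Fin 4))
    (R : Row) : ∀ A, P R A := by
  cases R with
  | g11 => exact Fin.forall_fin_one.2 h11
  | g12 => exact Fin.forall_fin_one.2 h12
  | g13 a ha => exact Fin.forall_fin_one.2 (h13 a ha)
  | g14 => exact Fin.forall_fin_one.2 h14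
  | g21 => exact Fin.forall_fin_two.2 h21
  | g22 => exact Fin.forall_fin_two.2 h22
  | g23 => exact Fin.forall_fin_two.2 h23
  | g31 => exact forall_fin_three.2 h31
  | g32 => exact forall_fin_three.2 h32
  | g33 a ha => exact forall_fin_three.2 (h33 a ha)
  | g34 => exact forall_fin_three.2 h34
  | g35 => exact forall_fin_three.2 h35
  | g41 => exact forall_fin_four.2 h41

theorem JL_sub_coe (i j k l : Fin 4) : ((JL i j - JL k l : M →L[ℝ] M) : M → M) = J i j - J k l :=
  congrArg₂ (· - ·) (JL_coe i j) (JL_coe k l)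

theorem JL_neg_coe (i j : Fin 4) : ((-JL i j : M →L[ℝ] M) : M → M) = -J i j :=
  congrArg Neg.neg (JL_coe i j)

theorem JL_lox_coe (a : ℝ) :
    ((-(JL 1 2 + a • JL 0 3) : M →L[ℝ] M) : M → M) = -(J 1 2 + a • J 0 3) := by
  rw [← JL_coe, ← JL_coe]; rfl

theorem genL_coe (R : Row) (A : Fin R.dim) : (R.genL A : M → M) = R.gen A :=
  forall_gen (P := fun R A => (R.genL A : M → M) = R.gen A)
    (JL_neg_coe _ _) (JL_neg_coe _ _) (fun a _ => JL_lox_coe a) (JL_sub_coe _ _ _ _)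
    ⟨JL_sub_coe _ _ _ _, JL_sub_coe _ _ _ _⟩ ⟨JL_neg_coe _ _, JL_neg_coe _ _⟩
    ⟨JL_sub_coe _ _ _ _, JL_neg_coe _ _⟩
    ⟨JL_sub_coe _ _ _ _, JL_sub_coe _ _ _ _, JL_neg_coe _ _⟩
    ⟨JL_sub_coe _ _ _ _, JL_sub_coe _ _ _ _, JL_neg_coe _ _⟩
    (fun a _ => ⟨JL_sub_coe _ _ _ _, JL_sub_coe _ _ _ _, JL_lox_coe a⟩)
    ⟨JL_neg_coe _ _, JL_neg_coe _ _, JL_neg_coe _ _⟩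
    ⟨JL_neg_coe _ _, JL_neg_coe _ _, JL_neg_coe _ _⟩
    ⟨JL_sub_coe _ _ _ _, JL_sub_coe _ _ _ _, JL_neg_coe _ _, JL_neg_coe _ _⟩ R A

theorem isSkew_genL (R : Row) (A : Fin R.dim) : IsSkew (R.genL A) := by
  have hJ : ∀ i j, JL i j ∈ skew := isSkew_JL
  have hs : ∀ i j k l, JL i j - JL k l ∈ skew := fun i j k l => sub_mem (hJ i j) (hJ k l)
  have hn : ∀ i j, -JL i j ∈ skew := fun i j => neg_mem (hJ i j)
  have hx : ∀ a : ℝ, -(JL 1 2 + a • JL 0 3) ∈ skew := fun a =>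
    neg_mem (add_mem (hJ 1 2) (Submodule.smul_mem _ a (hJ 0 3)))
  exact forall_gen (P := fun R A => IsSkew (R.genL A))
    (hn _ _) (hn _ _) (fun a _ => hx a) (hs _ _ _ _)
    ⟨hs _ _ _ _, hs _ _ _ _⟩ ⟨hn _ _, hn _ _⟩ ⟨hs _ _ _ _, hn _ _⟩
    ⟨hs _ _ _ _, hs _ _ _ _, hn _ _⟩ ⟨hs _ _ _ _, hs _ _ _ _, hn _ _⟩
    (fun a _ => ⟨hs _ _ _ _, hs _ _ _ _, hx a⟩) ⟨hn _ _, hn _ _, hn _ _⟩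
    ⟨hn _ _, hn _ _, hn _ _⟩ ⟨hs _ _ _ _, hs _ _ _ _, hn _ _, hn _ _⟩ R A

theorem gen_mem_so13 (R : Row) (A : Fin R.dim) : R.gen A ∈ so13 := by
  rw [← genL_coe]
  exact mem_so13_of_isSkew (R.isSkew_genL A)

theorem alg_le (R : Row) : R.alg ≤ so13 :=
  Submodule.span_le.2 (by rintro _ ⟨A, rfl⟩; exact R.gen_mem_so13 A)

theorem differentiable_gen (R : Row) (A : Fin R.dim) (x : M) : DifferentiableAt ℝ (R.gen A) x := by
  rw [← genL_coe]
  exact (R.genL A).differentiableAt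

end Row

/-! ### Closure of the listed spans under the bracket. -/

theorem differentiableAt_of_mem_so13 {X : M → M} (h : X ∈ so13) (x : M) :
    DifferentiableAt ℝ X x := by
  obtain ⟨L, -, rfl⟩ := mem_so13_iff.1 h
  exact L.differentiableAt

theorem lieBracket_add_right' {X Y Z : M → M} (hY : Y ∈ so13) (hZ : Z ∈ so13) :
    VectorField.lieBracket ℝ X (Y + Z) =
      VectorField.lieBracket ℝ X Y + VectorField.lieBracket ℝ X Z := by
  funext x
  exact VectorField.lieBracket_add_right (differentiableAt_of_mem_so13 hY x)
    (differentiableAt_of_mem_so13 hZ x)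

theorem lieBracket_smul_right' {X Y : M → M} (c : ℝ) (hY : Y ∈ so13) :
    VectorField.lieBracket ℝ X (c • Y) = c • VectorField.lieBracket ℝ X Y := by
  funext x
  exact VectorField.lieBracket_const_smul_right (differentiableAt_of_mem_so13 hY x)

theorem lieBracket_swap' (X Y : M → M) :
    VectorField.lieBracket ℝ X Y = -VectorField.lieBracket ℝ Y X :=
  funext fun _ => VectorField.lieBracket_swap

theorem isLieClosed_span {ι : Type*} {g : ι → M → M} (hg : ∀ i, g i ∈ so13)
    (h : ∀ i j, VectorField.lieBracket ℝ (g i) (g j) ∈ Submodule.span ℝ (range g)) :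
    IsLieClosed (Submodule.span ℝ (range g)) := by
  have hle : Submodule.span ℝ (range g) ≤ so13 :=
    Submodule.span_le.2 (by rintro _ ⟨A, rfl⟩; exact hg A)
  have zero : ∀ X : M → M, VectorField.lieBracket ℝ X (0 : M → M) = 0 := by
    intro X; funext x; simp [VectorField.lieBracket]
  have step : ∀ X : M → M, (∀ j, VectorField.lieBracket ℝ X (g j) ∈ Submodule.span ℝ (range g)) →
      ∀ Y ∈ Submodule.span ℝ (range g),
        VectorField.lieBracket ℝ X Y ∈ Submodule.span ℝ (range g) := by
    intro X hX Y hY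
    induction hY using Submodule.span_induction with
    | mem y hy => obtain ⟨j, rfl⟩ := hy; exact hX j
    | zero => rw [zero]; exact Submodule.zero_mem _
    | add y z hy hz h1 h2 =>
      rw [lieBracket_add_right' (hle hy) (hle hz)]; exact Submodule.add_mem _ h1 h2
    | smul c y hy h1 => rw [lieBracket_smul_right' c (hle hy)]; exact Submodule.smul_mem _ _ h1
  intro X hX Y hY
  refine step X (fun j => ?_) Y hY
  rw [lieBracket_swap']
  exact Submodule.neg_mem _ (step (g j) (fun i => h j i) X hX)

/-- The bracket of linear fields is the reversed commutator of matrices, and antisymmetry leaves the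
pairs `A < B`; `c` holds the structure constants. -/
theorem isLieClosed_linear {n : ℕ} (g : Fin n → M →L[ℝ] M) (hg : ∀ A, IsSkew (g A))
    (c : Fin n → Fin n → Fin n → ℝ)
    (h : ∀ A B, A < B → ∀ x, g B (g A x) - g A (g B x) = ∑ C, c A B C • g C x) :
    IsLieClosed (Submodule.span ℝ (range fun A => (g A : M → M))) := by
  have key : ∀ A B, A < B → VectorField.lieBracket ℝ (g A : M → M) (g B) ∈
      Submodule.span ℝ (range fun A => (g A : M → M)) := by
    intro A B hAB
    have : VectorField.lieBracket ℝ (g A : M → M) (g B) = ∑ C, c A B C • (g C : M → M) := by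
      funext x
      rw [lieBracket_linear]
      simpa using h A B hAB x
    rw [this]
    exact Submodule.sum_mem _ fun C _ => Submodule.smul_mem _ _ (Submodule.subset_span ⟨C, rfl⟩)
  refine isLieClosed_span (fun A => mem_so13_of_isSkew (hg A)) fun A B => ?_
  rcases lt_trichotomy A B with h1 | rfl | h1
  · exact key A B h1
  · rw [VectorField.lieBracket_self]; exact Submodule.zero_mem _
  · rw [lieBracket_swap']; exact Submodule.neg_mem _ (key B A h1)

theorem isLieClosed_one (g : Fin 1 → M →L[ℝ] M) (hg : ∀ A, IsSkew (g A)) :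
    IsLieClosed (Submodule.span ℝ (range fun A => (g A : M → M))) :=
  isLieClosed_linear g hg 0 fun A B h => absurd h (by simp [Subsingleton.elim A B])

theorem isLieClosed_two {X Y : M →L[ℝ] M} (hg : ∀ A, IsSkew (![X, Y] A)) (c : Fin 2 → ℝ)
    (h : ∀ x, Y (X x) - X (Y x) = c 0 • X x + c 1 • Y x) :
    IsLieClosed (Submodule.span ℝ (range fun A => (![X, Y] A : M → M))) := by
  refine isLieClosed_linear ![X, Y] hg (fun _ _ => c) fun A B hAB x => ?_
  fin_cases A <;> fin_cases B <;> (first | exact absurd hAB (by decide) | skip)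
  simpa using h x

theorem isLieClosed_three {X Y Z : M →L[ℝ] M} (hg : ∀ A, IsSkew (![X, Y, Z] A)) (c d e : Fin 3 → ℝ)
    (h1 : ∀ x, Y (X x) - X (Y x) = c 0 • X x + c 1 • Y x + c 2 • Z x)
    (h2 : ∀ x, Z (X x) - X (Z x) = d 0 • X x + d 1 • Y x + d 2 • Z x)
    (h3 : ∀ x, Z (Y x) - Y (Z x) = e 0 • X x + e 1 • Y x + e 2 • Z x) :
    IsLieClosed (Submodule.span ℝ (range fun A => (![X, Y, Z] A : M → M))) := by
  refine isLieClosed_linear ![X, Y, Z] hg ![![0, c, d], ![0, 0, e], 0] fun A B hAB x => ?_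
  fin_cases A <;> fin_cases B <;> (first | exact absurd hAB (by decide) | skip)
  · simpa [Fin.sum_univ_three] using h1 x
  · simpa [Fin.sum_univ_three] using h2 x
  · simpa [Fin.sum_univ_three] using h3 x

theorem isLieClosed_four {X Y Z T : M →L[ℝ] M} (hg : ∀ A, IsSkew (![X, Y, Z, T] A))
    (c₁₂ c₁₃ c₂₃ c₁₄ c₂₄ c₃₄ : Fin 4 → ℝ)
    (h₁₂ : ∀ x, Y (X x) - X (Y x) = c₁₂ 0 • X x + c₁₂ 1 • Y x + c₁₂ 2 • Z x + c₁₂ 3 • T x)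
    (h₁₃ : ∀ x, Z (X x) - X (Z x) = c₁₃ 0 • X x + c₁₃ 1 • Y x + c₁₃ 2 • Z x + c₁₃ 3 • T x)
    (h₂₃ : ∀ x, Z (Y x) - Y (Z x) = c₂₃ 0 • X x + c₂₃ 1 • Y x + c₂₃ 2 • Z x + c₂₃ 3 • T x)
    (h₁₄ : ∀ x, T (X x) - X (T x) = c₁₄ 0 • X x + c₁₄ 1 • Y x + c₁₄ 2 • Z x + c₁₄ 3 • T x)
    (h₂₄ : ∀ x, T (Y x) - Y (T x) = c₂₄ 0 • X x + c₂₄ 1 • Y x + c₂₄ 2 • Z x + c₂₄ 3 • T x)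
    (h₃₄ : ∀ x, T (Z x) - Z (T x) = c₃₄ 0 • X x + c₃₄ 1 • Y x + c₃₄ 2 • Z x + c₃₄ 3 • T x) :
    IsLieClosed (Submodule.span ℝ (range fun A => (![X, Y, Z, T] A : M → M))) := by
  refine isLieClosed_linear ![X, Y, Z, T] hg
    ![![0, c₁₂, c₁₃, c₁₄], ![0, 0, c₂₃, c₂₄], ![0, 0, 0, c₃₄], 0] fun A B hAB x => ?_
  rw [Fin.sum_univ_four]
  fin_cases A <;> fin_cases B <;> (first | exact absurd hAB (by decide) | skip)
  exacts [h₁₂ x, h₁₃ x, h₁₄ x, h₂₃ x, h₂₄ x, h₃₄ x]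

theorem JL_apply (i j : Fin 4) (x : M) :
    JL i j x = (eta i * x i) • Pi.single j 1 - (eta j * x j) • Pi.single i 1 :=
  congrFun (JL_coe i j) x

theorem vec4_ext {x y : M} (h0 : x 0 = y 0) (h1 : x 1 = y 1) (h2 : x 2 = y 2) (h3 : x 3 = y 3) :
    x = y := by
  funext k
  fin_cases k
  exacts [h0, h1, h2, h3]

namespace Row

theorem alg_eq (R : Row) : R.alg = Submodule.span ℝ (range fun A => (R.genL A : M → M)) := by
  unfold alg
  congr 2
  funext A
  exact (R.genL_coe A).symm

set_option maxHeartbeats 1000000 in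
theorem isLieClosed_alg (R : Row) : IsLieClosed R.alg := by
  rw [alg_eq]
  have hg := R.isSkew_genL
  cases R with
  | g11 => exact isLieClosed_one _ hg
  | g12 => exact isLieClosed_one _ hg
  | g13 a ha => exact isLieClosed_one _ hg
  | g14 => exact isLieClosed_one _ hg
  | g21 =>
    refine isLieClosed_two hg 0 fun x => ?_
    apply vec4_ext <;> simp [JL_apply, eta]
  | g22 =>
    refine isLieClosed_two hg 0 fun x => ?_
    apply vec4_ext <;> simp [JL_apply, eta]
  | g23 =>
    refine isLieClosed_two hg ![-1, 0] fun x => ?_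
    apply vec4_ext <;> simp [JL_apply, eta] <;> ring
  | g31 =>
    refine isLieClosed_three hg 0 ![-1, 0, 0] ![0, -1, 0] (fun x => ?_) (fun x => ?_) fun x => ?_
    all_goals apply vec4_ext <;> simp [JL_apply, eta] <;> ring
  | g32 =>
    refine isLieClosed_three hg 0 ![0, 1, 0] ![-1, 0, 0] (fun x => ?_) (fun x => ?_) fun x => ?_
    all_goals apply vec4_ext <;> simp [JL_apply, eta]
  | g33 a ha =>
    refine isLieClosed_three hg 0 ![-a, 1, 0] ![-1, -a, 0] (fun x => ?_) (fun x => ?_) fun x => ?_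
    all_goals apply vec4_ext <;> simp [JL_apply, eta] <;> ring
  | g34 =>
    refine isLieClosed_three hg ![0, 0, 1] ![0, -1, 0] ![1, 0, 0] (fun x => ?_) (fun x => ?_)
      fun x => ?_
    all_goals apply vec4_ext <;> simp [JL_apply, eta]
  | g35 =>
    refine isLieClosed_three hg ![0, 0, 1] ![0, 1, 0] ![1, 0, 0] (fun x => ?_) (fun x => ?_)
      fun x => ?_
    all_goals apply vec4_ext <;> simp [JL_apply, eta]
  | g41 =>
    refine isLieClosed_four hg 0 ![0, 1, 0, 0] ![-1, 0, 0, 0] ![-1, 0, 0, 0] ![0, -1, 0, 0] 0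
      (fun x => ?_) (fun x => ?_) (fun x => ?_) (fun x => ?_) (fun x => ?_) fun x => ?_
    all_goals apply vec4_ext <;> simp [JL_apply, eta] <;> ring

end Row

/-- The components of a linear field that determine an element of `so(1,3)`. -/
theorem linearIndependent_fields {n : ℕ} (g : Fin n → M → M)
    (h : ∀ c : Fin n → ℝ, (∀ i j : Fin 4, i < j → ∑ A, c A * g A (Pi.single i 1) j = 0) → c = 0) :
    LinearIndependent ℝ g := by
  rw [Fintype.linearIndependent_iff]
  intro c hc A
  refine congrFun (h c fun i j _ => ?_) A
  simpa using congrFun (congrFun hc (Pi.single i 1)) j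

/-! ### Linear independence of the listed bases. -/

namespace Row

theorem linearIndependent_gen (R : Row) : LinearIndependent ℝ R.gen := by
  cases R with
  | g11 =>
    refine linearIndependent_fields (n := 1) ![-J 0 3] fun c h => ?_
    have h1 := h 0 3 (by decide)
    simp [J, eta] at h1
    funext A; fin_cases A; simpa using h1
  | g12 =>
    refine linearIndependent_fields (n := 1) ![-J 1 2] fun c h => ?_
    have h1 := h 1 2 (by decide)
    simp [J, eta] at h1
    funext A; fin_cases A; simpa using h1
  | g13 a ha =>
    refine linearIndependent_fields (n := 1) ![-(J 1 2 + a • J 0 3)] fun c h => ?_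
    have h1 := h 1 2 (by decide)
    simp [J, eta] at h1
    funext A; fin_cases A; simpa using h1
  | g14 =>
    refine linearIndependent_fields (n := 1) ![J 1 3 - J 0 1] fun c h => ?_
    have h1 := h 0 1 (by decide)
    simp [J, eta] at h1
    funext A; fin_cases A; simpa using h1
  | g21 =>
    refine linearIndependent_fields (n := 2) ![J 1 3 - J 0 1, J 2 3 - J 0 2] fun c h => ?_
    have h1 := h 0 1 (by decide)
    have h2 := h 0 2 (by decide)
    simp [J, eta] at h1 h2
    funext A; fin_cases A; exacts [h1, h2]
  | g22 =>
    refine linearIndependent_fields (n := 2) ![-J 1 2, -J 0 3] fun c h => ?_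
    have h1 := h 1 2 (by decide)
    have h2 := h 0 3 (by decide)
    simp [J, eta] at h1 h2
    funext A; fin_cases A; exacts [h1, h2]
  | g23 =>
    refine linearIndependent_fields (n := 2) ![J 1 3 - J 0 1, -J 0 3] fun c h => ?_
    have h1 := h 0 1 (by decide)
    have h2 := h 0 3 (by decide)
    simp [J, eta] at h1 h2
    funext A; fin_cases A; exacts [h1, h2]
  | g31 =>
    refine linearIndependent_fields (n := 3) ![J 1 3 - J 0 1, J 2 3 - J 0 2, -J 0 3] fun c h => ?_
    have h1 := h 0 1 (by decide)
    have h2 := h 0 2 (by decide)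
    have h3 := h 0 3 (by decide)
    simp [J, eta, Fin.sum_univ_three] at h1 h2 h3
    funext A; fin_cases A; exacts [h1, h2, h3]
  | g32 =>
    refine linearIndependent_fields (n := 3) ![J 1 3 - J 0 1, J 2 3 - J 0 2, -J 1 2] fun c h => ?_
    have h1 := h 0 1 (by decide)
    have h2 := h 0 2 (by decide)
    have h3 := h 1 2 (by decide)
    simp [J, eta, Fin.sum_univ_three] at h1 h2 h3
    funext A; fin_cases A; exacts [h1, h2, h3]
  | g33 a ha =>
    refine linearIndependent_fields (n := 3) ![J 1 3 - J 0 1, J 2 3 - J 0 2,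
      -(J 1 2 + a • J 0 3)] fun c h => ?_
    have h1 := h 0 1 (by decide)
    have h2 := h 0 2 (by decide)
    have h3 := h 1 2 (by decide)
    simp [J, eta, Fin.sum_univ_three] at h1 h2 h3
    funext A; fin_cases A; exacts [h1, h2, h3]
  | g34 =>
    refine linearIndependent_fields (n := 3) ![-J 1 2, -J 2 3, -J 1 3] fun c h => ?_
    have h1 := h 1 2 (by decide)
    have h2 := h 2 3 (by decide)
    have h3 := h 1 3 (by decide)
    simp [J, eta, Fin.sum_univ_three] at h1 h2 h3
    funext A; fin_cases A; exacts [h1, h2, h3]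
  | g35 =>
    refine linearIndependent_fields (n := 3) ![-J 0 1, -J 1 2, -J 0 2] fun c h => ?_
    have h1 := h 0 1 (by decide)
    have h2 := h 1 2 (by decide)
    have h3 := h 0 2 (by decide)
    simp [J, eta, Fin.sum_univ_three] at h1 h2 h3
    funext A; fin_cases A; exacts [h1, h2, h3]
  | g41 =>
    refine linearIndependent_fields (n := 4) ![J 1 3 - J 0 1, J 2 3 - J 0 2, -J 1 2, -J 0 3]
      fun c h => ?_
    have h1 := h 0 1 (by decide)
    have h2 := h 0 2 (by decide)
    have h3 := h 1 2 (by decide)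
    have h4 := h 0 3 (by decide)
    simp [J, eta, Fin.sum_univ_four] at h1 h2 h3 h4
    funext A; fin_cases A; exacts [h1, h2, h3, h4]

end Row

/-! ### Dimension of the orbits in general position. -/

theorem isGreatest_rank {n r : ℕ} {g : Fin n → M → M}
    (hup : ∀ x ∈ dS, Module.finrank ℝ (Submodule.span ℝ (range fun A => g A x)) ≤ r)
    {x : M} (hx : x ∈ dS) (v : Fin r → Fin n) (hv : LinearIndependent ℝ fun i => g (v i) x) :
    IsGreatest {k : ℕ | ∃ x ∈ dS,
      k = Module.finrank ℝ (Submodule.span ℝ (range fun A => g A x))} r := by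
  refine ⟨⟨x, hx, le_antisymm ?_ (hup x hx)⟩, ?_⟩
  · calc r = Module.finrank ℝ (Submodule.span ℝ (range fun i => g (v i) x)) := by
          rw [finrank_span_eq_card hv, Fintype.card_fin]
      _ ≤ _ := Submodule.finrank_mono (Submodule.span_mono (by
          rintro _ ⟨i, rfl⟩; exact ⟨v i, rfl⟩))
  · rintro _ ⟨y, hy, rfl⟩
    exact hup y hy

theorem finrank_le_of_relation {n : ℕ} {v : Fin (n + 1) → M} (c : Fin (n + 1) → ℝ)
    (h : ∑ A, c A • v A = 0) (hc : ∃ A, c A ≠ 0) :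
    Module.finrank ℝ (Submodule.span ℝ (range v)) ≤ n := by
  have : ¬ LinearIndependent ℝ v := by
    rw [Fintype.linearIndependent_iff]
    intro h'
    obtain ⟨A, hA⟩ := hc
    exact hA (h' c h A)
  rw [linearIndependent_iff_card_le_finrank_span, Fintype.card_fin] at this
  exact Nat.lt_succ_iff.1 (not_le.1 this)

theorem linearIndependent_one {v : Fin 1 → M} (k : Fin 4) (h : v 0 k ≠ 0) :
    LinearIndependent ℝ v := by
  rw [Fintype.linearIndependent_iff]
  intro c hc A
  have := congrFun hc k
  rw [Subsingleton.elim A 0]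
  simpa [h] using this

theorem linearIndependent_of_comp {n : ℕ} {v : Fin n → M}
    (h : ∀ c : Fin n → ℝ, (∀ k : Fin 4, ∑ A, c A * v A k = 0) → ∀ A, c A = 0) :
    LinearIndependent ℝ v := by
  rw [Fintype.linearIndependent_iff]
  intro c hc
  exact h c fun k => by simpa using congrFun hc k

theorem ex_mem_dS : (![0, 1, 0, 0] : M) ∈ dS ∧ (![0, 0, 1, 0] : M) ∈ dS ∧ (![0, 0, 0, 1] : M) ∈ dS := by
  simp [mem_dS_iff, mink_eq]

namespace Row

theorem isGreatest_rank (R : Row) :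
    IsGreatest {k : ℕ | ∃ x ∈ dS,
      k = Module.finrank ℝ (Submodule.span ℝ (range fun A => R.gen A x))} R.rank := by
  have hcard : ∀ x ∈ dS, Module.finrank ℝ (Submodule.span ℝ (range fun A => R.gen A x)) ≤ R.dim :=
    fun x _ => (finrank_range_le_card _).trans_eq (Fintype.card_fin _)
  obtain ⟨h1, h2, h3⟩ := ex_mem_dS
  cases R with
  | g11 =>
    refine DeSitter.isGreatest_rank (r := 1) hcard h3 id (linearIndependent_one 0 ?_)
    simp [gen, J, eta]
  | g12 =>
    refine DeSitter.isGreatest_rank (r := 1) hcard h1 id (linearIndependent_one 2 ?_)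
    simp [gen, J, eta]
  | g13 a ha =>
    refine DeSitter.isGreatest_rank (r := 1) hcard h1 id (linearIndependent_one 2 ?_)
    simp [gen, J, eta]
  | g14 =>
    refine DeSitter.isGreatest_rank (r := 1) hcard h1 id (linearIndependent_one 3 ?_)
    simp [gen, J, eta]
  | g21 =>
    refine DeSitter.isGreatest_rank (r := 2) hcard h3 id (linearIndependent_of_comp fun c h => ?_)
    have e1 := h 1
    have e2 := h 2
    simp [gen, J, eta, Fin.sum_univ_two] at e1 e2
    exact Fin.forall_fin_two.2 ⟨e1, e2⟩
  | g22 =>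
    -- Each of the three coordinate vectors in `dS` is annihilated by one of the two fields, so
    -- another point is needed: `(1, 1, 0, 1)`.
    have h4 : (![0, 1, 0, 1] : M) ∈ dS ∨ (![1, 1, 0, 1] : M) ∈ dS := by
      right; simp [mem_dS_iff, mink_eq]
    replace h4 := h4.resolve_left (by simp [mem_dS_iff, mink_eq])
    refine DeSitter.isGreatest_rank (r := 2) hcard h4 id (linearIndependent_of_comp fun c h => ?_)
    have e1 := h 2
    have e2 := h 3
    simp [gen, J, eta, Fin.sum_univ_two] at e1 e2
    exact Fin.forall_fin_two.2 ⟨e1, e2⟩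
  | g23 =>
    refine DeSitter.isGreatest_rank (r := 2) hcard h3 id (linearIndependent_of_comp fun c h => ?_)
    have e1 := h 1
    have e2 := h 0
    simp [gen, J, eta, Fin.sum_univ_two] at e1 e2
    exact Fin.forall_fin_two.2 ⟨e1, e2⟩
  | g31 =>
    refine DeSitter.isGreatest_rank (r := 3) hcard h3 id (linearIndependent_of_comp fun c h => ?_)
    have e1 := h 1
    have e2 := h 2
    have e3 := h 0
    simp [gen, J, eta, Fin.sum_univ_three] at e1 e2 e3
    exact forall_fin_three.2 ⟨e1, e2, e3⟩
  | g33 a ha =>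
    refine DeSitter.isGreatest_rank (r := 3) hcard h3 id (linearIndependent_of_comp fun c h => ?_)
    have e1 := h 1
    have e2 := h 2
    have e3 := h 0
    simp [gen, J, eta, Fin.sum_univ_three, ha.ne'] at e1 e2 e3
    exact forall_fin_three.2 ⟨e1, e2, e3⟩
  | g32 =>
    refine DeSitter.isGreatest_rank (r := 2) (fun x hx => ?_) h3 (![0, 1] : Fin 2 → Fin 3)
      (linearIndependent_of_comp fun c h => ?_)
    -- The orbits are the two-dimensional level sets of `x³ - x⁰`, which gives this pointwise
    -- relation between the three fields. Its coefficients cannot all vanish on `dS`, since then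
    -- `⟨x, x⟩ = 0`.
    · refine finrank_le_of_relation (n := 2) ![x 2, -x 1, x 3 - x 0] ?_ ?_
      · rw [Fin.sum_univ_three]
        apply vec4_ext <;> simp [gen, J, eta] <;> ring
      · by_contra hne
        push Not at hne
        have e0 : x 2 = 0 := hne 0
        have e1 : -x 1 = 0 := hne 1
        have e2 : x 3 - x 0 = 0 := hne 2
        have := mem_dS_iff.1 hx
        rw [mink_eq, e0, neg_eq_zero.1 e1, sub_eq_zero.1 e2] at this
        linarith
    · have e1 := h 1
      have e2 := h 2
      simp [gen, J, eta, Fin.sum_univ_two] at e1 e2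
      exact Fin.forall_fin_two.2 ⟨e1, e2⟩
  | g34 =>
    refine DeSitter.isGreatest_rank (r := 2) (fun x hx => ?_) h1 (![0, 2] : Fin 2 → Fin 3)
      (linearIndependent_of_comp fun c h => ?_)
    · refine finrank_le_of_relation (n := 2) ![x 3, x 1, -x 2] ?_ ?_
      · rw [Fin.sum_univ_three]
        apply vec4_ext <;> simp [gen, J, eta] <;> ring
      · by_contra hne
        push Not at hne
        have e0 : x 3 = 0 := hne 0
        have e1 : x 1 = 0 := hne 1
        have e2 : -x 2 = 0 := hne 2
        have := mem_dS_iff.1 hx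
        rw [mink_eq] at this
        nlinarith [sq_nonneg (x 0)]
    · have e1 := h 2
      have e2 := h 3
      simp [gen, J, eta, Fin.sum_univ_two] at e1 e2
      exact Fin.forall_fin_two.2 ⟨e1, e2⟩
  | g35 =>
    refine DeSitter.isGreatest_rank (r := 2) (fun x hx => ?_) h1 (![0, 1] : Fin 2 → Fin 3)
      (linearIndependent_of_comp fun c h => ?_)
    -- The coefficients of the generic relation vanish at the two points of `dS` fixed by this
    -- group; there all three fields vanish, so a trivial relation suffices.
    · by_cases hz : x 0 = 0 ∧ x 1 = 0 ∧ x 2 = 0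
      · obtain ⟨a0, a1, a2⟩ := hz
        refine finrank_le_of_relation (n := 2) ![1, 0, 0] ?_ ⟨0, one_ne_zero⟩
        rw [Fin.sum_univ_three]
        apply vec4_ext <;> simp [gen, J, eta, a0, a1]
      · refine finrank_le_of_relation (n := 2) ![x 2, -x 0, -x 1] ?_ ?_
        · rw [Fin.sum_univ_three]
          apply vec4_ext <;> simp [gen, J, eta] <;> ring
        · by_contra hne
          push Not at hne
          have e0 : x 2 = 0 := hne 0
          have e1 : -x 0 = 0 := hne 1
          have e2 : -x 1 = 0 := hne 2
          exact hz ⟨neg_eq_zero.1 e1, neg_eq_zero.1 e2, e0⟩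
    · have e1 := h 0
      have e2 := h 2
      simp [gen, J, eta, Fin.sum_univ_two] at e1 e2
      exact Fin.forall_fin_two.2 ⟨e1, e2⟩
  | g41 =>
    refine DeSitter.isGreatest_rank (r := 3) (fun x hx => ?_) h3 (![0, 1, 3] : Fin 3 → Fin 4)
      (linearIndependent_of_comp fun c h => ?_)
    · refine finrank_le_of_relation (n := 3) ![x 2, -x 1, x 3 - x 0, 0] ?_ ?_
      · rw [Fin.sum_univ_four]
        apply vec4_ext <;> simp [gen, J, eta] <;> ring
      · by_contra hne
        push Not at hne
        have e0 : x 2 = 0 := hne 0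
        have e1 : -x 1 = 0 := hne 1
        have e2 : x 3 - x 0 = 0 := hne 2
        have := mem_dS_iff.1 hx
        rw [mink_eq, e0, neg_eq_zero.1 e1, sub_eq_zero.1 e2] at this
        linarith
    · have e1 := h 1
      have e2 := h 2
      have e3 := h 0
      simp [gen, J, eta, Fin.sum_univ_three] at e1 e2 e3
      exact forall_fin_three.2 ⟨e1, e2, e3⟩

end Row

/-! ### The explicit parametrisations: smoothness, injectivity, immersion. -/

theorem hasFDerivAt_vec4 {f₀ f₁ f₂ f₃ : Q → ℝ} {D₀ D₁ D₂ D₃ : Q →L[ℝ] ℝ} {p : Q}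
    (h₀ : HasFDerivAt f₀ D₀ p) (h₁ : HasFDerivAt f₁ D₁ p) (h₂ : HasFDerivAt f₂ D₂ p)
    (h₃ : HasFDerivAt f₃ D₃ p) (v : Q) :
    fderiv ℝ (fun p : Q => (![f₀ p, f₁ p, f₂ p, f₃ p] : M)) p v = ![D₀ v, D₁ v, D₂ v, D₃ v] := by
  have : HasFDerivAt (fun p : Q => (![f₀ p, f₁ p, f₂ p, f₃ p] : M))
      (ContinuousLinearMap.pi ![D₀, D₁, D₂, D₃]) p := by
    rw [hasFDerivAt_pi']
    intro i
    fin_cases i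
    · exact h₀.congr_fderiv (by ext v; simp)
    · exact h₁.congr_fderiv (by ext v; simp)
    · exact h₂.congr_fderiv (by ext v; simp)
    · exact h₃.congr_fderiv (by ext v; simp)
  rw [this.fderiv]
  funext i
  fin_cases i <;> simp

theorem contDiff_vec4 {f₀ f₁ f₂ f₃ : Q → ℝ} (h₀ : ContDiff ℝ ∞ f₀) (h₁ : ContDiff ℝ ∞ f₁)
    (h₂ : ContDiff ℝ ∞ f₂) (h₃ : ContDiff ℝ ∞ f₃) :
    ContDiff ℝ ∞ (fun p : Q => (![f₀ p, f₁ p, f₂ p, f₃ p] : M)) := by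
  rw [contDiff_pi]
  intro i
  fin_cases i
  exacts [h₀, h₁, h₂, h₃]

/-- `ψ` parametrizes a part of `dS` on `Ω` and has the derivative `D`. -/
structure IsParam (ψ : Q → M) (D : Q → Q → M) (Ω : Set Q) : Prop where
  smooth : ContDiff ℝ ∞ ψ
  deriv : ∀ p v, fderiv ℝ ψ p v = D p v
  mem : ∀ p, ψ p ∈ dS
  inj : InjOn ψ Ω
  imm : ∀ p ∈ Ω, ∀ v, D p v = 0 → v = 0

theorem IsParam.isRectifying {R : Row} {ψ : Q → M} {D : Q → Q → M} {Ω : Set Q}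
    (h : IsParam ψ D Ω) (hΩ : IsOpen Ω) (hs : Ω ⊆ R.coordDomain)
    (hrel : ∀ A : Fin R.dim, ∀ p ∈ Ω, D p (R.coordGen A p) = R.gen A (ψ p)) :
    R.IsRectifying Ω ψ where
  isOpen := hΩ
  subset := hs
  mapsTo p _ := h.mem p
  smooth := h.smooth.contDiffOn
  injOn := h.inj
  immersion p hp := (injective_iff_map_eq_zero _).2 fun v hv => h.imm p hp v (by rw [← h.deriv, hv])
  related A p hp := by rw [h.deriv, hrel A p hp]

theorem angle_ext {a b : ℝ} (ha : a ∈ Ioo (-Real.pi) Real.pi) (hb : b ∈ Ioo (-Real.pi) Real.pi)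
    (hc : Real.cos a = Real.cos b) (hs : Real.sin a = Real.sin b) : a = b := by
  have h : Real.cos (a - b) = 1 := by
    rw [Real.cos_sub, hc, hs, ← sq, ← sq, Real.cos_sq_add_sin_sq]
  have := (Real.cos_eq_one_iff_of_lt_of_lt (by linarith [ha.1, hb.2]) (by linarith [ha.2, hb.1])).1 h
  linarith

theorem sin_ext {a b : ℝ} (ha : a ∈ Ioo (-(Real.pi / 2)) (Real.pi / 2))
    (hb : b ∈ Ioo (-(Real.pi / 2)) (Real.pi / 2)) (h : Real.sin a = Real.sin b) : a = b :=
  Real.injOn_sin (Ioo_subset_Icc_self ha) (Ioo_subset_Icc_self hb) h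

theorem cos_ext {a b : ℝ} (ha : a ∈ Ioo 0 Real.pi) (hb : b ∈ Ioo 0 Real.pi)
    (h : Real.cos a = Real.cos b) : a = b :=
  Real.injOn_cos (Ioo_subset_Icc_self ha) (Ioo_subset_Icc_self hb) h

theorem vec3_ext {x y : Q} (h0 : x 0 = y 0) (h1 : x 1 = y 1) (h2 : x 2 = y 2) : x = y := by
  funext k
  fin_cases k
  exacts [h0, h1, h2]

theorem sq_left_cancel {a b : ℝ} (ha : 0 < a) (hb : 0 < b) (h : a ^ 2 = b ^ 2) : a = b :=
  (sq_eq_sq₀ ha.le hb.le).1 h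

section Charts

open Real

theorem isParam_g11 : IsParam Row.g11.chart
    (fun p v => ![-(cos (p 1) * sin (p 2) * sinh (p 0) * v 1 + sin (p 1) * cos (p 2) * sinh (p 0) * v 2
        + sin (p 1) * sin (p 2) * cosh (p 0) * v 0),
      -sin (p 2) * v 2, -sin (p 1) * sin (p 2) * v 1 + cos (p 1) * cos (p 2) * v 2,
      cos (p 1) * sin (p 2) * cosh (p 0) * v 1 + sin (p 1) * cos (p 2) * cosh (p 0) * v 2
        + sin (p 1) * sin (p 2) * sinh (p 0) * v 0])
    Row.g11.chartDomain where
  smooth := contDiff_vec4 (by fun_prop) (by fun_prop) (by fun_prop) (by fun_prop)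
  deriv p v := by
    have h0 := hasFDerivAt_p 0 p
    have h1 := hasFDerivAt_p 1 p
    have h2 := hasFDerivAt_p 2 p
    refine (hasFDerivAt_vec4 ((h1.sin.mul h2.sin).mul h0.sinh).neg h2.cos (h1.cos.mul h2.sin)
      ((h1.sin.mul h2.sin).mul h0.cosh) v).trans ?_
    apply vec4_ext <;> simp [Row.d] <;> ring
  mem p := by
    rw [mem_dS_iff, mink_eq]
    simp only [Row.chart, Matrix.cons_val]
    linear_combination (-(sin (p 1)^2 * sin (p 2)^2)) * cosh_sq (p 0)
      - sin (p 2)^2 * sin_sq_add_cos_sq (p 1) - sin_sq_add_cos_sq (p 2)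
  inj p hp q hq h := by
    have e0 : -(sin (p 1) * sin (p 2) * sinh (p 0)) = -(sin (q 1) * sin (q 2) * sinh (q 0)) :=
      congrFun h 0
    have e1 : cos (p 2) = cos (q 2) := congrFun h 1
    have e2 : cos (p 1) * sin (p 2) = cos (q 1) * sin (q 2) := congrFun h 2
    have i2 := cos_ext hp.2 hq.2 e1
    have s1 := sin_pos_of_pos_of_lt_pi hp.1.1 hp.1.2
    have s2 := sin_pos_of_pos_of_lt_pi hp.2.1 hp.2.2
    rw [← i2] at e0 e2
    have i1 := cos_ext hp.1 hq.1 (mul_right_cancel₀ s2.ne' e2)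
    rw [← i1] at e0
    exact vec3_ext (sinh_injective (mul_left_cancel₀ (mul_pos s1 s2).ne' (neg_injective e0))) i1 i2
  imm p hp v h := by
    have e0 : -(cos (p 1) * sin (p 2) * sinh (p 0) * v 1 + sin (p 1) * cos (p 2) * sinh (p 0) * v 2
        + sin (p 1) * sin (p 2) * cosh (p 0) * v 0) = 0 := congrFun h 0
    have e1 : -sin (p 2) * v 2 = 0 := congrFun h 1
    have e2 : -sin (p 1) * sin (p 2) * v 1 + cos (p 1) * cos (p 2) * v 2 = 0 := congrFun h 2
    have s1 := (sin_pos_of_pos_of_lt_pi hp.1.1 hp.1.2).ne'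
    have s2 := (sin_pos_of_pos_of_lt_pi hp.2.1 hp.2.2).ne'
    have c0 := (cosh_pos (p 0)).ne'
    have i2 : v 2 = 0 := by simpa [s2] using e1
    have i1 : v 1 = 0 := by simpa [s1, s2, i2] using e2
    have i0 : v 0 = 0 := by simpa [s1, s2, i2, i1, c0] using e0
    exact vec3_ext i0 i1 i2

/-- The common form of the coordinates for `G_{1,2}` and `G_{1,3}^a`. -/
def loxChart (a : ℝ) (p : Q) : M :=
  ![-(cosh (p 1) * sin (p 2) * sinh (a * p 0)) + sinh (p 1) * cosh (a * p 0),
    -(cosh (p 1) * cos (p 2) * sin (p 0)), cosh (p 1) * cos (p 2) * cos (p 0),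
    cosh (p 1) * sin (p 2) * cosh (a * p 0) - sinh (p 1) * sinh (a * p 0)]

/-- `(x¹)² + (x²)²` determines `cosh u¹ cos u²`, positive on the domain; then `(x¹, x²)` gives the
angle `q¹`. Undoing the boost by `a q¹` in the `(x⁰, x³)` plane recovers `sinh u¹` and `sin u²`. The
same elimination, linearised, shows the immersion property. -/
theorem isParam_lox (a : ℝ) : IsParam (loxChart a)
    (fun p v => ![-(sinh (p 1) * sin (p 2) * sinh (a * p 0) * v 1
          + cosh (p 1) * cos (p 2) * sinh (a * p 0) * v 2
          + cosh (p 1) * sin (p 2) * cosh (a * p 0) * (a * v 0))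
        + cosh (p 1) * cosh (a * p 0) * v 1 + sinh (p 1) * sinh (a * p 0) * (a * v 0),
      -(sinh (p 1) * cos (p 2) * sin (p 0) * v 1 - cosh (p 1) * sin (p 2) * sin (p 0) * v 2
          + cosh (p 1) * cos (p 2) * cos (p 0) * v 0),
      sinh (p 1) * cos (p 2) * cos (p 0) * v 1 - cosh (p 1) * sin (p 2) * cos (p 0) * v 2
          - cosh (p 1) * cos (p 2) * sin (p 0) * v 0,
      sinh (p 1) * sin (p 2) * cosh (a * p 0) * v 1 + cosh (p 1) * cos (p 2) * cosh (a * p 0) * v 2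
        + cosh (p 1) * sin (p 2) * sinh (a * p 0) * (a * v 0)
        - cosh (p 1) * sinh (a * p 0) * v 1 - sinh (p 1) * cosh (a * p 0) * (a * v 0)])
    {p | p 0 ∈ Ioo (-π) π ∧ p 2 ∈ Ioo (-(π / 2)) (π / 2)} where
  smooth := contDiff_vec4 (by fun_prop) (by fun_prop) (by fun_prop) (by fun_prop)
  deriv p v := by
    have h0 := hasFDerivAt_p 0 p
    have ha := h0.const_mul a
    have h1 := hasFDerivAt_p 1 p
    have h2 := hasFDerivAt_p 2 p
    refine (hasFDerivAt_vec4
      (((h1.cosh.mul h2.sin).mul ha.sinh).neg.add (h1.sinh.mul ha.cosh))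
      ((h1.cosh.mul h2.cos).mul h0.sin).neg ((h1.cosh.mul h2.cos).mul h0.cos)
      (((h1.cosh.mul h2.sin).mul ha.cosh).sub (h1.sinh.mul ha.sinh)) v).trans ?_
    apply vec4_ext <;> simp [Row.d] <;> ring
  mem p := by
    rw [mem_dS_iff, mink_eq]
    simp only [loxChart, Matrix.cons_val]
    linear_combination (sinh (p 1)^2 - cosh (p 1)^2 * sin (p 2)^2) * cosh_sq (a * p 0)
      - cosh (p 1)^2 * cos (p 2)^2 * sin_sq_add_cos_sq (p 0)
      - cosh (p 1)^2 * sin_sq_add_cos_sq (p 2) - cosh_sq (p 1)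
  inj p hp q hq h := by
    have e0 : -(cosh (p 1) * sin (p 2) * sinh (a * p 0)) + sinh (p 1) * cosh (a * p 0) =
      -(cosh (q 1) * sin (q 2) * sinh (a * q 0)) + sinh (q 1) * cosh (a * q 0) := congrFun h 0
    have e1 : -(cosh (p 1) * cos (p 2) * sin (p 0)) = -(cosh (q 1) * cos (q 2) * sin (q 0)) :=
      congrFun h 1
    have e2 : cosh (p 1) * cos (p 2) * cos (p 0) = cosh (q 1) * cos (q 2) * cos (q 0) :=
      congrFun h 2
    have e3 : cosh (p 1) * sin (p 2) * cosh (a * p 0) - sinh (p 1) * sinh (a * p 0) =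
      cosh (q 1) * sin (q 2) * cosh (a * q 0) - sinh (q 1) * sinh (a * q 0) := congrFun h 3
    have hpos : ∀ r : Q, r 2 ∈ Ioo (-(π / 2)) (π / 2) → 0 < cosh (r 1) * cos (r 2) := fun r hr =>
      mul_pos (cosh_pos _) (cos_pos_of_mem_Ioo hr)
    have eA : cosh (p 1) * cos (p 2) = cosh (q 1) * cos (q 2) := by
      refine sq_left_cancel (hpos p hp.2) (hpos q hq.2) ?_
      linear_combination (-(cosh (p 1) * cos (p 2) * sin (p 0)) - cosh (q 1) * cos (q 2) * sin (q 0))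
        * e1 + (cosh (p 1) * cos (p 2) * cos (p 0) + cosh (q 1) * cos (q 2) * cos (q 0)) * e2
        - (cosh (p 1) * cos (p 2))^2 * sin_sq_add_cos_sq (p 0)
        + (cosh (q 1) * cos (q 2))^2 * sin_sq_add_cos_sq (q 0)
    rw [← eA] at e1 e2
    have i0 := angle_ext hp.1 hq.1 (mul_left_cancel₀ (hpos p hp.2).ne' e2)
      (mul_left_cancel₀ (hpos p hp.2).ne' (neg_injective e1))
    rw [← i0] at e0 e3
    have i1 : p 1 = q 1 := by
      apply sinh_injective
      linear_combination cosh (a * p 0) * e0 + sinh (a * p 0) * e3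
        - (sinh (p 1) - sinh (q 1)) * cosh_sq (a * p 0)
    rw [← i1] at e0 e3
    have i2 : p 2 = q 2 := by
      apply sin_ext hp.2 hq.2
      refine mul_left_cancel₀ (cosh_pos (p 1)).ne' ?_
      linear_combination sinh (a * p 0) * e0 + cosh (a * p 0) * e3
        - cosh (p 1) * (sin (p 2) - sin (q 2)) * cosh_sq (a * p 0)
    exact vec3_ext i0 i1 i2
  imm p hp v h := by
    have e0 : -(sinh (p 1) * sin (p 2) * sinh (a * p 0) * v 1
          + cosh (p 1) * cos (p 2) * sinh (a * p 0) * v 2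
          + cosh (p 1) * sin (p 2) * cosh (a * p 0) * (a * v 0))
        + cosh (p 1) * cosh (a * p 0) * v 1 + sinh (p 1) * sinh (a * p 0) * (a * v 0) = 0 :=
      congrFun h 0
    have e1 : -(sinh (p 1) * cos (p 2) * sin (p 0) * v 1 - cosh (p 1) * sin (p 2) * sin (p 0) * v 2
          + cosh (p 1) * cos (p 2) * cos (p 0) * v 0) = 0 := congrFun h 1
    have e2 : sinh (p 1) * cos (p 2) * cos (p 0) * v 1 - cosh (p 1) * sin (p 2) * cos (p 0) * v 2
          - cosh (p 1) * cos (p 2) * sin (p 0) * v 0 = 0 := congrFun h 2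
    have e3 : sinh (p 1) * sin (p 2) * cosh (a * p 0) * v 1
        + cosh (p 1) * cos (p 2) * cosh (a * p 0) * v 2
        + cosh (p 1) * sin (p 2) * sinh (a * p 0) * (a * v 0)
        - cosh (p 1) * sinh (a * p 0) * v 1 - sinh (p 1) * cosh (a * p 0) * (a * v 0) = 0 :=
      congrFun h 3
    have c1 := (cosh_pos (p 1)).ne'
    have c2 := (cos_pos_of_mem_Ioo hp.2).ne'
    have i0 : v 0 = 0 := by
      refine mul_left_cancel₀ (mul_ne_zero c1 c2) ?_
      linear_combination -cos (p 0) * e1 - sin (p 0) * e2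
        - cosh (p 1) * cos (p 2) * v 0 * sin_sq_add_cos_sq (p 0)
    rw [i0] at e0 e3
    have i1 : v 1 = 0 := by
      refine mul_left_cancel₀ c1 ?_
      linear_combination cosh (a * p 0) * e0 + sinh (a * p 0) * e3
        - cosh (p 1) * v 1 * cosh_sq (a * p 0)
    rw [i1] at e0 e3
    have i2 : v 2 = 0 := by
      refine mul_left_cancel₀ (mul_ne_zero c1 c2) ?_
      linear_combination sinh (a * p 0) * e0 + cosh (a * p 0) * e3
        - cosh (p 1) * cos (p 2) * v 2 * cosh_sq (a * p 0)
    exact vec3_ext i0 i1 i2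

/-- The null coordinate `x³ - x⁰` equals `k`, which is nonzero on the domain; dividing `x¹` by it
gives `q¹`, and then `u¹` and `u²` follow. -/
theorem isParam_g14 : IsParam Row.g14.chart
    (fun p v => ![p 0 * v 0 * (sinh (p 1) - cosh (p 1) * sin (p 2))
        + 1 / 2 * p 0 ^ 2 * (cosh (p 1) * v 1 - sinh (p 1) * sin (p 2) * v 1
          - cosh (p 1) * cos (p 2) * v 2) + cosh (p 1) * v 1,
      v 0 * (cosh (p 1) * sin (p 2) - sinh (p 1)) + p 0 * (sinh (p 1) * sin (p 2) * v 1
          + cosh (p 1) * cos (p 2) * v 2 - cosh (p 1) * v 1),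
      sinh (p 1) * cos (p 2) * v 1 - cosh (p 1) * sin (p 2) * v 2,
      p 0 * v 0 * (sinh (p 1) - cosh (p 1) * sin (p 2))
        + 1 / 2 * p 0 ^ 2 * (cosh (p 1) * v 1 - sinh (p 1) * sin (p 2) * v 1
          - cosh (p 1) * cos (p 2) * v 2)
        + sinh (p 1) * sin (p 2) * v 1 + cosh (p 1) * cos (p 2) * v 2])
    Row.g14.chartDomain where
  smooth := contDiff_vec4 (by fun_prop) (by fun_prop) (by fun_prop) (by fun_prop)
  deriv p v := by
    have h0 := hasFDerivAt_p 0 p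
    have h1 := hasFDerivAt_p 1 p
    have h2 := hasFDerivAt_p 2 p
    refine (hasFDerivAt_vec4
      ((((h0.pow 2).const_mul (1 / 2)).mul (h1.sinh.sub (h1.cosh.mul h2.sin))).add h1.sinh)
      (h0.mul ((h1.cosh.mul h2.sin).sub h1.sinh)) (h1.cosh.mul h2.cos)
      ((((h0.pow 2).const_mul (1 / 2)).mul (h1.sinh.sub (h1.cosh.mul h2.sin))).add
        (h1.cosh.mul h2.sin)) v).trans ?_
    apply vec4_ext <;> simp [Row.d] <;> ring
  mem p := by
    rw [mem_dS_iff, mink_eq]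
    simp only [Row.chart, Matrix.cons_val]
    linear_combination - cosh (p 1)^2 * sin_sq_add_cos_sq (p 2) - cosh_sq (p 1)
  inj p hp q hq h := by
    have e0 : 1 / 2 * p 0 ^ 2 * (sinh (p 1) - cosh (p 1) * sin (p 2)) + sinh (p 1) =
      1 / 2 * q 0 ^ 2 * (sinh (q 1) - cosh (q 1) * sin (q 2)) + sinh (q 1) := congrFun h 0
    have e1 : p 0 * (cosh (p 1) * sin (p 2) - sinh (p 1)) =
      q 0 * (cosh (q 1) * sin (q 2) - sinh (q 1)) := congrFun h 1
    have e2 : cosh (p 1) * cos (p 2) = cosh (q 1) * cos (q 2) := congrFun h 2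
    have e3 : 1 / 2 * p 0 ^ 2 * (sinh (p 1) - cosh (p 1) * sin (p 2)) + cosh (p 1) * sin (p 2) =
      1 / 2 * q 0 ^ 2 * (sinh (q 1) - cosh (q 1) * sin (q 2)) + cosh (q 1) * sin (q 2) :=
      congrFun h 3
    have ek : cosh (p 1) * sin (p 2) - sinh (p 1) = cosh (q 1) * sin (q 2) - sinh (q 1) := by
      linear_combination e3 - e0
    have i0 : p 0 = q 0 := by
      rw [← ek] at e1
      exact mul_right_cancel₀ (fun hk => hp.2 (by linarith)) e1
    rw [← i0] at e0 e3
    have i1 : p 1 = q 1 := by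
      apply sinh_injective
      linear_combination e0 + 1 / 2 * p 0 ^ 2 * ek
    rw [← i1] at e2 ek
    exact vec3_ext i0 i1 (angle_ext hp.1 hq.1 (mul_left_cancel₀ (cosh_pos _).ne' e2)
      (mul_left_cancel₀ (cosh_pos _).ne' (sub_left_injective ek)))
  imm p hp v h := by
    have e0 : p 0 * v 0 * (sinh (p 1) - cosh (p 1) * sin (p 2))
        + 1 / 2 * p 0 ^ 2 * (cosh (p 1) * v 1 - sinh (p 1) * sin (p 2) * v 1
          - cosh (p 1) * cos (p 2) * v 2) + cosh (p 1) * v 1 = 0 := congrFun h 0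
    have e1 : v 0 * (cosh (p 1) * sin (p 2) - sinh (p 1)) + p 0 * (sinh (p 1) * sin (p 2) * v 1
          + cosh (p 1) * cos (p 2) * v 2 - cosh (p 1) * v 1) = 0 := congrFun h 1
    have e2 : sinh (p 1) * cos (p 2) * v 1 - cosh (p 1) * sin (p 2) * v 2 = 0 := congrFun h 2
    have e3 : p 0 * v 0 * (sinh (p 1) - cosh (p 1) * sin (p 2))
        + 1 / 2 * p 0 ^ 2 * (cosh (p 1) * v 1 - sinh (p 1) * sin (p 2) * v 1
          - cosh (p 1) * cos (p 2) * v 2)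
        + sinh (p 1) * sin (p 2) * v 1 + cosh (p 1) * cos (p 2) * v 2 = 0 := congrFun h 3
    have hk : cosh (p 1) * sin (p 2) - sinh (p 1) ≠ 0 := fun hk => hp.2 (by linarith)
    have c1 := (cosh_pos (p 1)).ne'
    have ek : sinh (p 1) * sin (p 2) * v 1 + cosh (p 1) * cos (p 2) * v 2 - cosh (p 1) * v 1 = 0 := by
      linear_combination e3 - e0
    have i0 : v 0 = 0 := by
      refine mul_right_cancel₀ hk ?_
      linear_combination e1 - p 0 * ek
    have i1 : v 1 = 0 := by
      refine mul_left_cancel₀ c1 ?_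
      linear_combination e0 + 1 / 2 * p 0 ^ 2 * ek
        - p 0 * (sinh (p 1) - cosh (p 1) * sin (p 2)) * i0
    have i2 : v 2 = 0 := by
      refine mul_left_cancel₀ c1 ?_
      linear_combination cos (p 2) * ek - sin (p 2) * e2 + cosh (p 1) * cos (p 2) * i1
        - cosh (p 1) * v 2 * sin_sq_add_cos_sq (p 2)
    exact vec3_ext i0 i1 i2

/-- The common form of the horospherical coordinates. -/
def horoChart (a : ℝ) (p : Q) : M :=
  ![-sinh (a * p 2) - 1 / 2 * exp (a * p 2) * (p 0 ^ 2 + p 1 ^ 2),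
    p 0 * exp (a * p 2), p 1 * exp (a * p 2),
    cosh (a * p 2) - 1 / 2 * exp (a * p 2) * (p 0 ^ 2 + p 1 ^ 2)]

/-- The null coordinate `x³ - x⁰` equals `exp (a p₂)`, so it determines the third coordinate when `a
≠ 0`, and the first two follow by division. The value `a = -1` gives the rows with coordinate `u¹`,
and `a > 0` those with `q³`. -/
theorem isParam_horo {a : ℝ} (ha : a ≠ 0) : IsParam (horoChart a)
    (fun p v => ![-cosh (a * p 2) * (a * v 2)
        - 1 / 2 * exp (a * p 2) * (a * v 2) * (p 0 ^ 2 + p 1 ^ 2)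
        - exp (a * p 2) * (p 0 * v 0 + p 1 * v 1),
      exp (a * p 2) * v 0 + p 0 * exp (a * p 2) * (a * v 2),
      exp (a * p 2) * v 1 + p 1 * exp (a * p 2) * (a * v 2),
      sinh (a * p 2) * (a * v 2)
        - 1 / 2 * exp (a * p 2) * (a * v 2) * (p 0 ^ 2 + p 1 ^ 2)
        - exp (a * p 2) * (p 0 * v 0 + p 1 * v 1)])
    univ where
  smooth := contDiff_vec4 (by fun_prop) (by fun_prop) (by fun_prop) (by fun_prop)
  deriv p v := by
    have h0 := hasFDerivAt_p 0 p
    have h1 := hasFDerivAt_p 1 p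
    have h2 := (hasFDerivAt_p 2 p).const_mul a
    have hr := (h2.exp.const_mul (1 / 2)).mul ((h0.pow 2).add (h1.pow 2))
    refine (hasFDerivAt_vec4 (h2.sinh.neg.sub hr) (h0.mul h2.exp) (h1.mul h2.exp)
      (h2.cosh.sub hr) v).trans ?_
    apply vec4_ext <;> simp [Row.d] <;> ring
  mem p := by
    rw [mem_dS_iff, mink_eq]
    simp only [horoChart, Matrix.cons_val]
    linear_combination exp (a * p 2) * (p 0 ^ 2 + p 1 ^ 2) * cosh_add_sinh (a * p 2)
      - cosh_sq (a * p 2)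
  inj p _ q _ h := by
    have e0 : -sinh (a * p 2) - 1 / 2 * exp (a * p 2) * (p 0 ^ 2 + p 1 ^ 2) =
      -sinh (a * q 2) - 1 / 2 * exp (a * q 2) * (q 0 ^ 2 + q 1 ^ 2) := congrFun h 0
    have e1 : p 0 * exp (a * p 2) = q 0 * exp (a * q 2) := congrFun h 1
    have e2 : p 1 * exp (a * p 2) = q 1 * exp (a * q 2) := congrFun h 2
    have e3 : cosh (a * p 2) - 1 / 2 * exp (a * p 2) * (p 0 ^ 2 + p 1 ^ 2) =
      cosh (a * q 2) - 1 / 2 * exp (a * q 2) * (q 0 ^ 2 + q 1 ^ 2) := congrFun h 3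
    have i2 : p 2 = q 2 := by
      refine mul_left_cancel₀ ha (exp_injective ?_)
      linear_combination e3 - e0 - cosh_add_sinh (a * p 2) + cosh_add_sinh (a * q 2)
    rw [← i2] at e1 e2
    exact vec3_ext (mul_right_cancel₀ (exp_pos _).ne' e1) (mul_right_cancel₀ (exp_pos _).ne' e2) i2
  imm p _ v h := by
    have e0 : -cosh (a * p 2) * (a * v 2)
        - 1 / 2 * exp (a * p 2) * (a * v 2) * (p 0 ^ 2 + p 1 ^ 2)
        - exp (a * p 2) * (p 0 * v 0 + p 1 * v 1) = 0 := congrFun h 0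
    have e1 : exp (a * p 2) * v 0 + p 0 * exp (a * p 2) * (a * v 2) = 0 := congrFun h 1
    have e2 : exp (a * p 2) * v 1 + p 1 * exp (a * p 2) * (a * v 2) = 0 := congrFun h 2
    have e3 : sinh (a * p 2) * (a * v 2)
        - 1 / 2 * exp (a * p 2) * (a * v 2) * (p 0 ^ 2 + p 1 ^ 2)
        - exp (a * p 2) * (p 0 * v 0 + p 1 * v 1) = 0 := congrFun h 3
    have hE := (exp_pos (a * p 2)).ne'
    have i2 : v 2 = 0 := by
      refine mul_left_cancel₀ (mul_ne_zero hE ha) ?_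
      linear_combination e3 - e0 - a * v 2 * cosh_add_sinh (a * p 2)
    rw [i2] at e1 e2
    exact vec3_ext (mul_left_cancel₀ hE (by rw [Pi.zero_apply]; linear_combination e1))
      (mul_left_cancel₀ hE (by rw [Pi.zero_apply]; linear_combination e2)) i2

theorem isParam_g22 : IsParam Row.g22.chart
    (fun p v => ![-(cos (p 2) * sinh (p 1) * v 2 + sin (p 2) * cosh (p 1) * v 1),
      -sin (p 2) * cos (p 0) * v 2 - cos (p 2) * sin (p 0) * v 0,
      -sin (p 2) * sin (p 0) * v 2 + cos (p 2) * cos (p 0) * v 0,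
      cos (p 2) * cosh (p 1) * v 2 + sin (p 2) * sinh (p 1) * v 1])
    Row.g22.chartDomain where
  smooth := contDiff_vec4 (by fun_prop) (by fun_prop) (by fun_prop) (by fun_prop)
  deriv p v := by
    have h0 := hasFDerivAt_p 0 p
    have h1 := hasFDerivAt_p 1 p
    have h2 := hasFDerivAt_p 2 p
    refine (hasFDerivAt_vec4 (h2.sin.mul h1.sinh).neg (h2.cos.mul h0.cos) (h2.cos.mul h0.sin)
      (h2.sin.mul h1.cosh) v).trans ?_
    apply vec4_ext <;> simp [Row.d] <;> ring
  mem p := by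
    rw [mem_dS_iff, mink_eq]
    simp only [Row.chart, Matrix.cons_val]
    linear_combination (-sin (p 2)^2) * cosh_sq (p 1)
      - cos (p 2)^2 * sin_sq_add_cos_sq (p 0) - sin_sq_add_cos_sq (p 2)
  inj p hp q hq h := by
    have e0 : -(sin (p 2) * sinh (p 1)) = -(sin (q 2) * sinh (q 1)) := congrFun h 0
    have e1 : cos (p 2) * cos (p 0) = cos (q 2) * cos (q 0) := congrFun h 1
    have e2 : cos (p 2) * sin (p 0) = cos (q 2) * sin (q 0) := congrFun h 2
    have hc : ∀ r : Q, r 2 ∈ Ioo 0 (π / 2) → 0 < cos (r 2) := fun r hr =>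
      cos_pos_of_mem_Ioo ⟨by linarith [hr.1, pi_pos], hr.2⟩
    have hl : Ioo 0 (π / 2) ⊆ Ioo 0 π := Ioo_subset_Ioo_right (by linarith [pi_pos])
    -- The sum `(x¹)² + (x²)²` is `cos² u¹`, and the cosine is positive on this domain.
    have i2 : p 2 = q 2 := by
      refine cos_ext (hl hp.2) (hl hq.2) (sq_left_cancel (hc p hp.2) (hc q hq.2) ?_)
      linear_combination (cos (p 2) * cos (p 0) + cos (q 2) * cos (q 0)) * e1
        + (cos (p 2) * sin (p 0) + cos (q 2) * sin (q 0)) * e2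
        - cos (p 2) ^ 2 * sin_sq_add_cos_sq (p 0) + cos (q 2) ^ 2 * sin_sq_add_cos_sq (q 0)
    rw [← i2] at e0 e1 e2
    have s2 := sin_pos_of_pos_of_lt_pi (hl hp.2).1 (hl hp.2).2
    exact vec3_ext (angle_ext hp.1 hq.1 (mul_left_cancel₀ (hc p hp.2).ne' e1)
      (mul_left_cancel₀ (hc p hp.2).ne' e2))
      (sinh_injective (mul_left_cancel₀ s2.ne' (neg_injective e0))) i2
  imm p hp v h := by
    have e0 : -(cos (p 2) * sinh (p 1) * v 2 + sin (p 2) * cosh (p 1) * v 1) = 0 := congrFun h 0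
    have e1 : -sin (p 2) * cos (p 0) * v 2 - cos (p 2) * sin (p 0) * v 0 = 0 := congrFun h 1
    have e2 : -sin (p 2) * sin (p 0) * v 2 + cos (p 2) * cos (p 0) * v 0 = 0 := congrFun h 2
    have s2 := (sin_pos_of_pos_of_lt_pi hp.2.1 (by linarith [hp.2.2, pi_pos])).ne'
    have c2 := (cos_pos_of_mem_Ioo ⟨by linarith [hp.2.1, pi_pos], hp.2.2⟩).ne'
    have i2 : v 2 = 0 := by
      refine mul_left_cancel₀ s2 ?_
      linear_combination -cos (p 0) * e1 - sin (p 0) * e2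
        - sin (p 2) * v 2 * sin_sq_add_cos_sq (p 0)
    have i0 : v 0 = 0 := by
      refine mul_left_cancel₀ c2 ?_
      linear_combination -sin (p 0) * e1 + cos (p 0) * e2
        - cos (p 2) * v 0 * sin_sq_add_cos_sq (p 0)
    have i1 : v 1 = 0 := by
      refine mul_left_cancel₀ (mul_ne_zero s2 (cosh_pos (p 1)).ne') ?_
      linear_combination -e0 - cos (p 2) * sinh (p 1) * i2
    exact vec3_ext i0 i1 i2

theorem isParam_g23 : IsParam Row.g23.chart
    (fun p v => ![sin (p 2) * v 2 * (sinh (p 1) + 1 / 2 * p 0 ^ 2 * exp (p 1))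
        - cos (p 2) * (cosh (p 1) * v 1 + p 0 * v 0 * exp (p 1) + 1 / 2 * p 0 ^ 2 * exp (p 1) * v 1),
      v 0 * exp (p 1) * cos (p 2) + p 0 * exp (p 1) * v 1 * cos (p 2)
        - p 0 * exp (p 1) * sin (p 2) * v 2,
      cos (p 2) * v 2,
      -sin (p 2) * v 2 * (cosh (p 1) - 1 / 2 * p 0 ^ 2 * exp (p 1))
        + cos (p 2) * (sinh (p 1) * v 1 - p 0 * v 0 * exp (p 1)
          - 1 / 2 * p 0 ^ 2 * exp (p 1) * v 1)])
    Row.g23.chartDomain where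
  smooth := contDiff_vec4 (by fun_prop) (by fun_prop) (by fun_prop) (by fun_prop)
  deriv p v := by
    have h0 := hasFDerivAt_p 0 p
    have h1 := hasFDerivAt_p 1 p
    have h2 := hasFDerivAt_p 2 p
    have hr := ((h0.pow 2).const_mul (1 / 2)).mul h1.exp
    refine (hasFDerivAt_vec4 (h2.cos.mul (h1.sinh.add hr)).neg ((h0.mul h1.exp).mul h2.cos) h2.sin
      (h2.cos.mul (h1.cosh.sub hr)) v).trans ?_
    apply vec4_ext <;> simp [Row.d] <;> ring
  mem p := by
    rw [mem_dS_iff, mink_eq]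
    simp only [Row.chart, Matrix.cons_val]
    linear_combination (-cos (p 2)^2) * cosh_sq (p 1) - sin_sq_add_cos_sq (p 2)
      + cos (p 2) ^ 2 * p 0 ^ 2 * exp (p 1) * cosh_add_sinh (p 1)
  inj p hp q hq h := by
    have e0 : -(cos (p 2) * (sinh (p 1) + 1 / 2 * p 0 ^ 2 * exp (p 1))) =
      -(cos (q 2) * (sinh (q 1) + 1 / 2 * q 0 ^ 2 * exp (q 1))) := congrFun h 0
    have e1 : p 0 * exp (p 1) * cos (p 2) = q 0 * exp (q 1) * cos (q 2) := congrFun h 1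
    have e2 : sin (p 2) = sin (q 2) := congrFun h 2
    have e3 : cos (p 2) * (cosh (p 1) - 1 / 2 * p 0 ^ 2 * exp (p 1)) =
      cos (q 2) * (cosh (q 1) - 1 / 2 * q 0 ^ 2 * exp (q 1)) := congrFun h 3
    have i2 := sin_ext hp hq e2
    rw [← i2] at e0 e1 e3
    have c2 := (cos_pos_of_mem_Ioo hp).ne'
    have i1 : p 1 = q 1 := by
      refine exp_injective (mul_left_cancel₀ c2 ?_)
      linear_combination e3 - e0 - cos (p 2) * cosh_add_sinh (p 1)
        + cos (p 2) * cosh_add_sinh (q 1)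
    rw [← i1] at e1
    exact vec3_ext (mul_right_cancel₀ (exp_pos _).ne' (mul_right_cancel₀ c2 e1)) i1 i2
  imm p hp v h := by
    have e0 : sin (p 2) * v 2 * (sinh (p 1) + 1 / 2 * p 0 ^ 2 * exp (p 1))
        - cos (p 2) * (cosh (p 1) * v 1 + p 0 * v 0 * exp (p 1) + 1 / 2 * p 0 ^ 2 * exp (p 1) * v 1)
        = 0 := congrFun h 0
    have e1 : v 0 * exp (p 1) * cos (p 2) + p 0 * exp (p 1) * v 1 * cos (p 2)
        - p 0 * exp (p 1) * sin (p 2) * v 2 = 0 := congrFun h 1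
    have e2 : cos (p 2) * v 2 = 0 := congrFun h 2
    have e3 : -sin (p 2) * v 2 * (cosh (p 1) - 1 / 2 * p 0 ^ 2 * exp (p 1))
        + cos (p 2) * (sinh (p 1) * v 1 - p 0 * v 0 * exp (p 1)
          - 1 / 2 * p 0 ^ 2 * exp (p 1) * v 1) = 0 := congrFun h 3
    have c2 := (cos_pos_of_mem_Ioo hp).ne'
    have hE := (exp_pos (p 1)).ne'
    have i2 : v 2 = 0 := by simpa [c2] using e2
    rw [i2] at e0 e1 e3
    have i1 : v 1 = 0 := by
      refine mul_left_cancel₀ (mul_ne_zero c2 hE) ?_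
      linear_combination e3 - e0 - cos (p 2) * v 1 * cosh_add_sinh (p 1)
    rw [i1] at e1
    exact vec3_ext (mul_left_cancel₀ (mul_ne_zero c2 hE)
      (by rw [Pi.zero_apply]; linear_combination e1)) i1 i2

theorem isParam_g34 : IsParam Row.g34.chart
    (fun p v => ![cosh (p 2) * v 2,
      -(sinh (p 2) * sin (p 0) * cos (p 1) * v 2 + cosh (p 2) * cos (p 0) * cos (p 1) * v 0
        - cosh (p 2) * sin (p 0) * sin (p 1) * v 1),
      sinh (p 2) * cos (p 0) * cos (p 1) * v 2 - cosh (p 2) * sin (p 0) * cos (p 1) * v 0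
        - cosh (p 2) * cos (p 0) * sin (p 1) * v 1,
      sinh (p 2) * sin (p 1) * v 2 + cosh (p 2) * cos (p 1) * v 1])
    Row.g34.chartDomain where
  smooth := contDiff_vec4 (by fun_prop) (by fun_prop) (by fun_prop) (by fun_prop)
  deriv p v := by
    have h0 := hasFDerivAt_p 0 p
    have h1 := hasFDerivAt_p 1 p
    have h2 := hasFDerivAt_p 2 p
    refine (hasFDerivAt_vec4 h2.sinh ((h2.cosh.mul h0.sin).mul h1.cos).neg
      ((h2.cosh.mul h0.cos).mul h1.cos) (h2.cosh.mul h1.sin) v).trans ?_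
    apply vec4_ext <;> simp [Row.d] <;> ring
  mem p := by
    rw [mem_dS_iff, mink_eq]
    simp only [Row.chart, Matrix.cons_val]
    linear_combination (-cosh (p 2)^2) * sin_sq_add_cos_sq (p 1) - cosh_sq (p 2)
      - cosh (p 2)^2 * cos (p 1)^2 * sin_sq_add_cos_sq (p 0)
  inj p hp q hq h := by
    have e0 : sinh (p 2) = sinh (q 2) := congrFun h 0
    have e1 : -(cosh (p 2) * sin (p 0) * cos (p 1)) = -(cosh (q 2) * sin (q 0) * cos (q 1)) :=
      congrFun h 1
    have e2 : cosh (p 2) * cos (p 0) * cos (p 1) = cosh (q 2) * cos (q 0) * cos (q 1) := congrFun h 2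
    have e3 : cosh (p 2) * sin (p 1) = cosh (q 2) * sin (q 1) := congrFun h 3
    have i2 := sinh_injective e0
    rw [← i2] at e1 e2 e3
    have C2 := (cosh_pos (p 2)).ne'
    have i1 := sin_ext hp.2 hq.2 (mul_left_cancel₀ C2 e3)
    rw [← i1] at e1 e2
    have c1 := (cos_pos_of_mem_Ioo hp.2).ne'
    exact vec3_ext (angle_ext hp.1 hq.1 (mul_left_cancel₀ C2 (mul_right_cancel₀ c1 e2))
      (mul_left_cancel₀ C2 (mul_right_cancel₀ c1 (neg_injective e1)))) i1 i2
  imm p hp v h := by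
    have e0 : cosh (p 2) * v 2 = 0 := congrFun h 0
    have e1 : -(sinh (p 2) * sin (p 0) * cos (p 1) * v 2 + cosh (p 2) * cos (p 0) * cos (p 1) * v 0
        - cosh (p 2) * sin (p 0) * sin (p 1) * v 1) = 0 := congrFun h 1
    have e2 : sinh (p 2) * cos (p 0) * cos (p 1) * v 2 - cosh (p 2) * sin (p 0) * cos (p 1) * v 0
        - cosh (p 2) * cos (p 0) * sin (p 1) * v 1 = 0 := congrFun h 2
    have e3 : sinh (p 2) * sin (p 1) * v 2 + cosh (p 2) * cos (p 1) * v 1 = 0 := congrFun h 3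
    have C2 := (cosh_pos (p 2)).ne'
    have c1 := (cos_pos_of_mem_Ioo hp.2).ne'
    have i2 : v 2 = 0 := by simpa [C2] using e0
    have i1 : v 1 = 0 := by simpa [C2, c1, i2] using e3
    rw [i1, i2] at e1 e2
    have i0 : v 0 = 0 := by
      refine mul_left_cancel₀ (mul_ne_zero C2 c1) ?_
      linear_combination -cos (p 0) * e1 - sin (p 0) * e2
        - cosh (p 2) * cos (p 1) * v 0 * sin_sq_add_cos_sq (p 0)
    exact vec3_ext i0 i1 i2

theorem isParam_g35 : IsParam Row.g35.chart
    (fun p v => ![-(cos (p 2) * sinh (p 0) * cos (p 1) * v 2 + sin (p 2) * cosh (p 0) * cos (p 1) * v 0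
        - sin (p 2) * sinh (p 0) * sin (p 1) * v 1),
      cos (p 2) * cosh (p 0) * cos (p 1) * v 2 + sin (p 2) * sinh (p 0) * cos (p 1) * v 0
        - sin (p 2) * cosh (p 0) * sin (p 1) * v 1,
      cos (p 2) * sin (p 1) * v 2 + sin (p 2) * cos (p 1) * v 1,
      -sin (p 2) * v 2])
    Row.g35.chartDomain where
  smooth := contDiff_vec4 (by fun_prop) (by fun_prop) (by fun_prop) (by fun_prop)
  deriv p v := by
    have h0 := hasFDerivAt_p 0 p
    have h1 := hasFDerivAt_p 1 p
    have h2 := hasFDerivAt_p 2 p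
    refine (hasFDerivAt_vec4 ((h2.sin.mul h0.sinh).mul h1.cos).neg ((h2.sin.mul h0.cosh).mul h1.cos)
      (h2.sin.mul h1.sin) h2.cos v).trans ?_
    apply vec4_ext <;> simp [Row.d] <;> ring
  mem p := by
    rw [mem_dS_iff, mink_eq]
    simp only [Row.chart, Matrix.cons_val]
    linear_combination (-sin (p 2)^2) * sin_sq_add_cos_sq (p 1) - sin_sq_add_cos_sq (p 2)
      - sin (p 2)^2 * cos (p 1)^2 * cosh_sq (p 0)
  inj p hp q hq h := by
    have e0 : -(sin (p 2) * sinh (p 0) * cos (p 1)) = -(sin (q 2) * sinh (q 0) * cos (q 1)) :=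
      congrFun h 0
    have e2 : sin (p 2) * sin (p 1) = sin (q 2) * sin (q 1) := congrFun h 2
    have i2 := cos_ext hp.2 hq.2 (congrFun h 3)
    rw [← i2] at e0 e2
    have s2 := (sin_pos_of_pos_of_lt_pi hp.2.1 hp.2.2).ne'
    have i1 := sin_ext hp.1 hq.1 (mul_left_cancel₀ s2 e2)
    rw [← i1] at e0
    have c1 := (cos_pos_of_mem_Ioo hp.1).ne'
    exact vec3_ext (sinh_injective
      (mul_left_cancel₀ s2 (mul_right_cancel₀ c1 (neg_injective e0)))) i1 i2
  imm p hp v h := by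
    have e0 : -(cos (p 2) * sinh (p 0) * cos (p 1) * v 2 + sin (p 2) * cosh (p 0) * cos (p 1) * v 0
        - sin (p 2) * sinh (p 0) * sin (p 1) * v 1) = 0 := congrFun h 0
    have e2 : cos (p 2) * sin (p 1) * v 2 + sin (p 2) * cos (p 1) * v 1 = 0 := congrFun h 2
    have e3 : -sin (p 2) * v 2 = 0 := congrFun h 3
    have s2 := (sin_pos_of_pos_of_lt_pi hp.2.1 hp.2.2).ne'
    have c1 := (cos_pos_of_mem_Ioo hp.1).ne'
    have C0 := (cosh_pos (p 0)).ne'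
    have i2 : v 2 = 0 := by simpa [s2] using e3
    have i1 : v 1 = 0 := by simpa [s2, c1, i2] using e2
    have i0 : v 0 = 0 := by simpa [s2, c1, i2, i1, C0] using e0
    exact vec3_ext i0 i1 i2

end Charts

open Real

theorem chart_eq_horo_neg : Row.g21.chart = horoChart (-1) ∧ Row.g32.chart = horoChart (-1) := by
  constructor <;>
  · funext p
    simp [Row.chart, horoChart]

theorem chart_eq_horo_one : Row.g31.chart = horoChart 1 ∧ Row.g41.chart = horoChart 1 := by
  constructor <;>
  · funext p
    simp [Row.chart, horoChart]

theorem chart_eq_lox : Row.g12.chart = loxChart 0 := by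
  funext p
  simp [Row.chart, loxChart]

theorem isOpen_box {k : Fin 3} {a b : ℝ} : IsOpen {p : Q | p k ∈ Ioo a b} :=
  isOpen_Ioo.preimage (continuous_apply k)

/-! ### The explicit charts rectify the listed fields. -/

namespace Row

theorem isOpen_chartDomain (R : Row) : IsOpen R.chartDomain := by
  cases R with
  | g11 => exact isOpen_box.inter isOpen_box
  | g12 => exact isOpen_box.inter isOpen_box
  | g13 => exact isOpen_box.inter isOpen_box
  | g22 => exact isOpen_box.inter isOpen_box
  | g34 => exact isOpen_box.inter isOpen_box
  | g35 => exact isOpen_box.inter isOpen_box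
  | g23 => exact isOpen_box
  | g14 =>
    refine isOpen_box.inter (isOpen_ne_fun ?_ ?_) <;> fun_prop
  | g21 => exact isOpen_univ
  | g31 => exact isOpen_univ
  | g32 => exact isOpen_univ
  | g33 => exact isOpen_univ
  | g41 => exact isOpen_univ

theorem chartDomain_subset (R : Row) : R.chartDomain ⊆ R.coordDomain := by
  cases R with
  | g34 => exact fun p hp => (cos_pos_of_mem_Ioo hp.2).ne'
  | g35 => exact fun p hp => (cos_pos_of_mem_Ioo hp.1).ne'
  | _ => exact subset_univ _

theorem isRectifying_chart (R : Row) : R.IsRectifying R.chartDomain R.chart := by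
  have ho := R.isOpen_chartDomain
  have hs := R.chartDomain_subset
  cases R with
  | g11 =>
    refine isParam_g11.isRectifying ho hs (Fin.forall_fin_one.2 fun p hp => ?_)
    apply vec4_ext <;> simp [gen, coordGen, J, eta, chart]
  | g12 =>
    rw [chart_eq_lox]
    refine (isParam_lox 0).isRectifying ho hs (Fin.forall_fin_one.2 fun p hp => ?_)
    apply vec4_ext <;> simp [gen, coordGen, J, eta, loxChart]
  | g13 a ha =>
    refine (isParam_lox a).isRectifying ho hs (Fin.forall_fin_one.2 fun p hp => ?_)
    apply vec4_ext <;> simp [gen, coordGen, J, eta, loxChart] <;> ring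
  | g14 =>
    refine isParam_g14.isRectifying ho hs (Fin.forall_fin_one.2 fun p hp => ?_)
    apply vec4_ext <;> simp [gen, coordGen, J, eta, chart] <;> ring
  | g21 =>
    rw [chart_eq_horo_neg.1]
    refine (isParam_horo (by norm_num)).isRectifying ho hs
      (Fin.forall_fin_two.2 ⟨fun p hp => ?_, fun p hp => ?_⟩)
    all_goals
      have hE := cosh_add_sinh (-1 * p 2)
      apply vec4_ext <;> simp [gen, coordGen, J, eta, horoChart] at hE ⊢ <;> linarith
  | g22 =>
    refine isParam_g22.isRectifying ho hs (Fin.forall_fin_two.2 ⟨fun p hp => ?_, fun p hp => ?_⟩)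
    all_goals apply vec4_ext <;> simp [gen, coordGen, J, eta, chart]
  | g23 =>
    refine isParam_g23.isRectifying ho hs (Fin.forall_fin_two.2 ⟨fun p hp => ?_, fun p hp => ?_⟩)
    all_goals
      have hE := cosh_add_sinh (p 1)
      apply vec4_ext <;> simp [gen, coordGen, J, eta, chart, ← hE, -cosh_add_sinh, -mul_eq_mul_left_iff, -mul_eq_zero] <;> ring
  | g31 =>
    rw [chart_eq_horo_one.1]
    refine (isParam_horo one_ne_zero).isRectifying ho hs
      (forall_fin_three.2 ⟨fun p hp => ?_, fun p hp => ?_, fun p hp => ?_⟩)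
    all_goals
      have hE := cosh_add_sinh (p 2)
      apply vec4_ext <;> simp [gen, coordGen, J, eta, horoChart, ← hE, -cosh_add_sinh, -mul_eq_mul_left_iff, -mul_eq_zero] <;> ring
  | g32 =>
    rw [chart_eq_horo_neg.2]
    refine (isParam_horo (by norm_num)).isRectifying ho hs
      (forall_fin_three.2 ⟨fun p hp => ?_, fun p hp => ?_, fun p hp => ?_⟩)
    all_goals
      have hE := cosh_add_sinh (-1 * p 2)
      apply vec4_ext <;> simp [gen, coordGen, J, eta, horoChart] at hE ⊢ <;> linarith
  | g33 a ha =>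
    refine (isParam_horo ha.ne').isRectifying ho hs
      (forall_fin_three.2 ⟨fun p hp => ?_, fun p hp => ?_, fun p hp => ?_⟩)
    all_goals
      have hE := cosh_add_sinh (a * p 2)
      apply vec4_ext <;> simp [gen, coordGen, J, eta, horoChart, ← hE, -cosh_add_sinh, -mul_eq_mul_left_iff, -mul_eq_zero] <;> ring
  | g34 =>
    refine isParam_g34.isRectifying ho hs
      (forall_fin_three.2 ⟨fun p hp => ?_, fun p hp => ?_, fun p hp => ?_⟩)
    all_goals
      -- Writing the sine through the tangent avoids division by the cosine in the comparison of
      -- components.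
      have ht : sin (p 1) = tan (p 1) * cos (p 1) := (tan_mul_cos (hs hp)).symm
      have h0 := sin_sq_add_cos_sq (p 0)
      apply vec4_ext <;> simp [gen, coordGen, J, eta, chart, ht] <;>
        first | ring1 | linear_combination (-(cosh (p 2) * cos (p 1) * tan (p 1))) * h0
  | g35 =>
    refine isParam_g35.isRectifying ho hs
      (forall_fin_three.2 ⟨fun p hp => ?_, fun p hp => ?_, fun p hp => ?_⟩)
    all_goals
      have ht : sin (p 1) = tan (p 1) * cos (p 1) := (tan_mul_cos (hs hp)).symm
      have h0 := cosh_sq (p 0)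
      apply vec4_ext <;> simp [gen, coordGen, J, eta, chart, ht] <;>
        first | ring1 | linear_combination (-(sin (p 2) * cos (p 1) * tan (p 1))) * h0
  | g41 =>
    rw [chart_eq_horo_one.2]
    refine (isParam_horo one_ne_zero).isRectifying ho hs
      (forall_fin_four.2 ⟨fun p hp => ?_, fun p hp => ?_, fun p hp => ?_, fun p hp => ?_⟩)
    all_goals
      have hE := cosh_add_sinh (p 2)
      apply vec4_ext <;> simp [gen, coordGen, J, eta, horoChart, ← hE, -cosh_add_sinh, -mul_eq_mul_left_iff, -mul_eq_zero] <;> ring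

end Row

/-! ### Commutators of gauge-covariant operators in flat space. -/

section Operators

variable {C : Set M} {e : ℝ} {a : M → M →L[ℝ] ℝ}

theorem pd_congr' {F : Type*} [NormedAddCommGroup F] [NormedSpace ℝ F] {n : ℕ}
    {f g : (Fin n → ℝ) → F} {p : Fin n → ℝ} (h : f =ᶠ[𝓝 p] g) (i : Fin n) : pd i f p = pd i g p := by
  rw [pd, pd, h.fderiv_eq]

theorem pd_mulC {n : ℕ} {f g : (Fin n → ℝ) → ℂ} {p : Fin n → ℝ} (hf : DifferentiableAt ℝ f p)
    (hg : DifferentiableAt ℝ g p) (i : Fin n) :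
    pd i (fun y => f y * g y) p = pd i f p * g p + f p * pd i g p := by
  rw [pd, fderiv_fun_mul hf hg]
  simp [pd]
  ring

theorem pd_sum {F : Type*} [NormedAddCommGroup F] [NormedSpace ℝ F] {n : ℕ} {ι : Type*}
    {s : Finset ι} {f : ι → (Fin n → ℝ) → F} {p : Fin n → ℝ}
    (hf : ∀ j ∈ s, DifferentiableAt ℝ (f j) p) (i : Fin n) :
    pd i (fun y => ∑ j ∈ s, f j y) p = ∑ j ∈ s, pd i (f j) p := by
  rw [pd, fderiv_fun_sum hf]
  simp [pd]

theorem pd_ofReal {n : ℕ} {f : (Fin n → ℝ) → ℝ} {p : Fin n → ℝ} (hf : DifferentiableAt ℝ f p)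
    (i : Fin n) : pd i (fun y => (f y : ℂ)) p = ((pd i f p : ℝ) : ℂ) := by
  have := (Complex.ofRealCLM.hasFDerivAt.comp p hf.hasFDerivAt).fderiv
  have h2 : (fun y => (f y : ℂ)) = Complex.ofRealCLM ∘ f := rfl
  rw [pd, h2, this]
  rfl

/-- `ie a_i`. -/
def pot (e : ℝ) (a : M → M →L[ℝ] ℝ) (i : Fin 4) (y : M) : ℂ :=
  Complex.I * e * (a y (Pi.single i 1) : ℝ)

/-- The covariant derivative `D_i = ∂_i - ie a_i` in Minkowski space. -/
def Dc (e : ℝ) (a : M → M →L[ℝ] ℝ) (i : Fin 4) (f : M → ℂ) (y : M) : ℂ := pd i f y - pot e a i y * f y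

/-- The first-order operator `∑ c_j D_j + b`. -/
def Op (e : ℝ) (a : M → M →L[ℝ] ℝ) (c : Fin 4 → M → ℂ) (b : M → ℂ) (f : M → ℂ) (y : M) : ℂ :=
  ∑ j, c j y * Dc e a j f y + b y * f y

/-- The curvature `∂_i (ie a_j) - ∂_j (ie a_i)` of the connection. -/
def curv (e : ℝ) (a : M → M →L[ℝ] ℝ) (i j : Fin 4) (y : M) : ℂ :=
  pd i (pot e a j) y - pd j (pot e a i) y

theorem contDiffAt_pot {y : M} (ha : ContDiffAt ℝ ∞ a y) (i : Fin 4) :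
    ContDiffAt ℝ ∞ (pot e a i) y := by
  unfold pot
  have h : ContDiffAt ℝ ∞ (fun y => ((a y (Pi.single i 1) : ℝ) : ℂ)) y :=
    Complex.ofRealCLM.contDiff.contDiffAt.comp y (ha.clm_apply contDiffAt_const)
  exact contDiffAt_const.mul h

theorem contDiffAt_Dc {y : M} {f : M → ℂ} (ha : ContDiffAt ℝ ∞ a y) (hf : ContDiffAt ℝ ∞ f y)
    (i : Fin 4) : ContDiffAt ℝ ∞ (Dc e a i f) y :=
  (contDiffAt_pd hf i).sub ((contDiffAt_pot ha i).mul hf)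

theorem contDiffAt_Op {y : M} {c : Fin 4 → M → ℂ} {b f : M → ℂ} (ha : ContDiffAt ℝ ∞ a y)
    (hc : ∀ j, ContDiffAt ℝ ∞ (c j) y) (hb : ContDiffAt ℝ ∞ b y) (hf : ContDiffAt ℝ ∞ f y) :
    ContDiffAt ℝ ∞ (Op e a c b f) y :=
  (ContDiffAt.sum fun j _ => (hc j).mul (contDiffAt_Dc ha hf j)).add (hb.mul hf)

theorem _root_.ContDiffAt.da {E F : Type*} [NormedAddCommGroup E] [NormedSpace ℝ E]
    [NormedAddCommGroup F] [NormedSpace ℝ F] {f : E → F} {y : E}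
    (h : ContDiffAt ℝ ∞ f y) : DifferentiableAt ℝ f y := h.differentiableAt (by simp)

theorem Dc_congr {f g : M → ℂ} {y : M} (h : f =ᶠ[𝓝 y] g) (i : Fin 4) :
    Dc e a i f y = Dc e a i g y := by
  rw [Dc, Dc, pd_congr' h, h.eq_of_nhds]

theorem Op_congr {c : Fin 4 → M → ℂ} {b f g : M → ℂ} {y : M} (h : f =ᶠ[𝓝 y] g) :
    Op e a c b f y = Op e a c b g y := by
  simp only [Op, Dc_congr h, h.eq_of_nhds]

theorem Dc_add {f g : M → ℂ} {y : M} (hf : ContDiffAt ℝ ∞ f y) (hg : ContDiffAt ℝ ∞ g y)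
    (i : Fin 4) : Dc e a i (fun z => f z + g z) y = Dc e a i f y + Dc e a i g y := by
  have : pd i (fun z => f z + g z) y = pd i f y + pd i g y := pd_add hf.da hg.da i
  rw [Dc, Dc, Dc, this]
  ring

theorem Dc_mul {c f : M → ℂ} {y : M} (hc : ContDiffAt ℝ ∞ c y) (hf : ContDiffAt ℝ ∞ f y)
    (i : Fin 4) : Dc e a i (fun z => c z * f z) y = pd i c y * f y + c y * Dc e a i f y := by
  rw [Dc, Dc, pd_mulC hc.da hf.da]
  ring

theorem Dc_sum {ι : Type*} {s : Finset ι} {f : ι → M → ℂ} {y : M}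
    (hf : ∀ j ∈ s, ContDiffAt ℝ ∞ (f j) y) (i : Fin 4) :
    Dc e a i (fun z => ∑ j ∈ s, f j z) y = ∑ j ∈ s, Dc e a i (f j) y := by
  simp only [Dc]
  rw [pd_sum (fun j hj => (hf j hj).da), Finset.sum_sub_distrib, Finset.mul_sum]

/-- Mixed partial derivatives commute, so only the derivatives of the connection coefficients
survive in the commutator. -/
theorem Dc_comm {f : M → ℂ} {y : M} (ha : ContDiffAt ℝ ∞ a y) (hf : ContDiffAt ℝ ∞ f y)
    (i j : Fin 4) :
    Dc e a i (Dc e a j f) y = Dc e a j (Dc e a i f) y - curv e a i j y * f y := by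
  have h : ∀ i j : Fin 4, Dc e a i (Dc e a j f) y = pd i (pd j f) y - pd i (pot e a j) y * f y
      - pot e a j y * pd i f y - pot e a i y * (pd j f y - pot e a j y * f y) := by
    intro i j
    have h1 : pd i (Dc e a j f) y = pd i (pd j f) y - pd i (fun z => pot e a j z * f z) y :=
      pd_sub (contDiffAt_pd hf j).da ((contDiffAt_pot ha j).mul hf).da i
    rw [Dc, h1, pd_mulC (contDiffAt_pot ha j).da hf.da, Dc]
    ring
  rw [h, h, pd_comm hf i j, curv]
  ring

/-- The coefficient `∂_i b - ∑ c_j (curvature)_{ij}` of the commutator `[D_i, ∑ c_j D_j + b]`. -/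
def opY (e : ℝ) (a : M → M →L[ℝ] ℝ) (c : Fin 4 → M → ℂ) (b : M → ℂ) (i : Fin 4) (y : M) : ℂ :=
  pd i b y - ∑ j, c j y * curv e a i j y

theorem contDiffAt_opY {y : M} {c : Fin 4 → M → ℂ} {b : M → ℂ} (ha : ContDiffAt ℝ ∞ a y)
    (hc : ∀ j, ContDiffAt ℝ ∞ (c j) y) (hb : ContDiffAt ℝ ∞ b y) (i : Fin 4) :
    ContDiffAt ℝ ∞ (opY e a c b i) y :=
  (contDiffAt_pd hb i).sub (ContDiffAt.sum fun j _ => (hc j).mul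
    ((contDiffAt_pd (contDiffAt_pot ha j) i).sub (contDiffAt_pd (contDiffAt_pot ha i) j)))

/-- The commutator of `D_i` with a first-order operator is again first-order: the leading
coefficients are differentiated, and the curvature enters the zeroth-order one. Since the form is
preserved, the lemma can be iterated. -/
theorem Dc_Op {y : M} {c : Fin 4 → M → ℂ} {b f : M → ℂ} (ha : ContDiffAt ℝ ∞ a y)
    (hc : ∀ j, ContDiffAt ℝ ∞ (c j) y) (hb : ContDiffAt ℝ ∞ b y) (hf : ContDiffAt ℝ ∞ f y)
    (i : Fin 4) :
    Dc e a i (Op e a c b f) y =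
      Op e a c b (Dc e a i f) y + Op e a (fun j => pd i (c j)) (opY e a c b i) f y := by
  have h1 : Dc e a i (Op e a c b f) y =
      Dc e a i (fun z => ∑ j, c j z * Dc e a j f z) y + Dc e a i (fun z => b z * f z) y :=
    Dc_add (ContDiffAt.sum fun j _ => (hc j).mul (contDiffAt_Dc ha hf j)) (hb.mul hf) i
  rw [h1, Dc_sum (fun j _ => (hc j).mul (contDiffAt_Dc ha hf j)), Dc_mul hb hf]
  have h2 : ∀ j, Dc e a i (fun z => c j z * Dc e a j f z) y = pd i (c j) y * Dc e a j f y
      + c j y * Dc e a j (Dc e a i f) y - c j y * curv e a i j y * f y := by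
    intro j
    rw [Dc_mul (hc j) (contDiffAt_Dc ha hf j), Dc_comm ha hf]
    ring
  simp only [h2, Op, opY, Finset.sum_add_distrib, Finset.sum_sub_distrib, Finset.sum_mul, sub_mul]
  ring

/-- The flat gauge-covariant wave operator. -/
def box (e : ℝ) (a : M → M →L[ℝ] ℝ) (f : M → ℂ) (y : M) : ℂ :=
  ∑ i, (eta i : ℂ) * Dc e a i (Dc e a i f) y

theorem contDiffAt_box {y : M} {f : M → ℂ} (ha : ∀ᶠ z in 𝓝 y, ContDiffAt ℝ ∞ a z)
    (hf : ∀ᶠ z in 𝓝 y, ContDiffAt ℝ ∞ f z) : ContDiffAt ℝ ∞ (box e a f) y :=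
  ContDiffAt.sum fun i _ => contDiffAt_const.mul
    (contDiffAt_Dc ha.self_of_nhds (contDiffAt_Dc ha.self_of_nhds hf.self_of_nhds i) i)

/-- From `D T = T D + T'` with `T' = [D, T]` follows `D² T = T D² + 2 T' D + T''`; this is summed
with the signature over the four directions. -/
theorem box_Op (hC : IsOpen C) {c : Fin 4 → M → ℂ} {b f : M → ℂ}
    (ha : ∀ y ∈ C, ContDiffAt ℝ ∞ a y)
    (hc : ∀ j, ∀ y ∈ C, ContDiffAt ℝ ∞ (c j) y) (hb : ∀ y ∈ C, ContDiffAt ℝ ∞ b y)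
    (hf : ∀ y ∈ C, ContDiffAt ℝ ∞ f y) {y : M} (hy : y ∈ C) :
    box e a (Op e a c b f) y - Op e a c b (box e a f) y =
      ∑ i, (eta i : ℂ) * (2 * Op e a (fun j => pd i (c j)) (opY e a c b i) (Dc e a i f) y
        + Op e a (fun j => pd i (pd i (c j))) (opY e a (fun j => pd i (c j)) (opY e a c b i) i) f y) := by
  have hs : ∀ i, Dc e a i (Dc e a i (Op e a c b f)) y =
      Op e a c b (Dc e a i (Dc e a i f)) y +
      (2 * Op e a (fun j => pd i (c j)) (opY e a c b i) (Dc e a i f) y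
        + Op e a (fun j => pd i (pd i (c j))) (opY e a (fun j => pd i (c j)) (opY e a c b i) i) f y) := by
    intro i
    have h1 : Dc e a i (Op e a c b f) =ᶠ[𝓝 y] fun z => Op e a c b (Dc e a i f) z +
        Op e a (fun j => pd i (c j)) (opY e a c b i) f z := by
      filter_upwards [hC.mem_nhds hy] with z hz
      exact Dc_Op (ha z hz) (fun j => hc j z hz) (hb z hz) (hf z hz) i
    have hD := contDiffAt_Dc (e := e) (ha y hy) (hf y hy) i
    have hc' := fun j => contDiffAt_pd (hc j y hy) i
    have hY := contDiffAt_opY (e := e) (ha y hy) (fun j => hc j y hy) (hb y hy) i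
    rw [Dc_congr h1, Dc_add (contDiffAt_Op (ha y hy) (fun j => hc j y hy) (hb y hy) hD)
      (contDiffAt_Op (ha y hy) hc' hY (hf y hy)),
      Dc_Op (ha y hy) (fun j => hc j y hy) (hb y hy) hD, Dc_Op (ha y hy) hc' hY (hf y hy)]
    ring
  have hDD : ∀ i, ContDiffAt ℝ ∞ (Dc e a i (Dc e a i f)) y := fun i =>
    contDiffAt_Dc (ha y hy) (contDiffAt_Dc (ha y hy) (hf y hy) i) i
  have ht : Op e a c b (box e a f) y = ∑ i, (eta i : ℂ) * Op e a c b (Dc e a i (Dc e a i f)) y := by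
    have h2 : ∀ j, Dc e a j (box e a f) y = ∑ i, (eta i : ℂ) * Dc e a j (Dc e a i (Dc e a i f)) y := by
      intro j
      have : Dc e a j (box e a f) y =
          ∑ i, Dc e a j (fun z => (eta i : ℂ) * Dc e a i (Dc e a i f) z) y :=
        Dc_sum (fun i _ => contDiffAt_const.mul (hDD i)) j
      rw [this]
      refine Finset.sum_congr rfl fun i _ => ?_
      rw [Dc_mul contDiffAt_const (hDD i)]
      simp [pd]
    simp only [Op, h2, box, Finset.mul_sum, mul_add, Finset.sum_add_distrib]
    rw [Finset.sum_comm]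
    congr 1
    · exact Finset.sum_congr rfl fun i _ => Finset.sum_congr rfl fun j _ => by ring
    · exact Finset.sum_congr rfl fun i _ => by ring
  rw [ht, box, ← Finset.sum_sub_distrib]
  refine Finset.sum_congr rfl fun i _ => ?_
  rw [hs]
  ring

end Operators

/-! ### Homogeneity of the extensions to the cone. -/

section Homogeneous

variable {F : Type*} [NormedAddCommGroup F] [NormedSpace ℝ F]

theorem fderiv_of_homogeneous {f : M → F} {s t : ℝ} (h : ∀ y, f y = s • f (t • y)) (y : M) :
    fderiv ℝ f y = (s * t) • fderiv ℝ f (t • y) := by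
  have h1 : f = fun y => s • f (t • y) := funext h
  conv_lhs => rw [h1]
  have h2 : fderiv ℝ (fun y => s • f (t • y)) y = s • fderiv ℝ (fun y => f (t • y)) y :=
    congrFun (fderiv_const_smul_field (f := fun y => f (t • y)) s) y
  rw [h2, fderiv_comp_smul, smul_smul]

theorem pd_of_homogeneous {f : M → F} {s t : ℝ} (h : ∀ y, f y = s • f (t • y)) (i : Fin 4) (y : M) :
    pd i f y = (s * t) • pd i f (t • y) := by
  rw [pd, fderiv_of_homogeneous h]
  rfl

theorem contDiffAt_of_homogeneous {f : M → F} {s t : ℝ} (h : ∀ y, f y = s • f (t • y)) {y : M}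
    (hf : ContDiffAt ℝ ∞ f (t • y)) : ContDiffAt ℝ ∞ f y := by
  rw [show f = fun y => s • f (t • y) from funext h]
  exact contDiffAt_const.smul (ContDiffAt.comp (f := fun y : M => t • y) y hf (by fun_prop))

/-- The retraction has degree 0, so its derivative, and with it an extended 1-form, has degree -1.
-/
theorem ext₁_smul (A : M → M →L[ℝ] ℝ) {t : ℝ} (ht : 0 < t) (y : M) :
    ext₁ A y = t • ext₁ A (t • y) := by
  have h := fderiv_of_homogeneous (f := retr) (s := 1) (t := t)
    (fun y => by rw [one_smul, retr_smul ht]) y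
  rw [ext₁, ext₁, retr_smul ht, h, one_mul, ContinuousLinearMap.comp_smul]

/-- Scaling by `(rad y)⁻¹` moves a point of the cone to `dS`, where smoothness is known. -/
theorem contDiffAt_cone_of_homogeneous {f : M → F} {V : Set M} {k : ℝ → ℝ}
    (h : ∀ t : ℝ, 0 < t → ∀ y, f y = k t • f (t • y)) (hf : ∀ x ∈ V, ContDiffAt ℝ ∞ f x) {y : M}
    (hy : y ∈ cone V) : ContDiffAt ℝ ∞ f y :=
  contDiffAt_of_homogeneous (h _ (inv_pos.2 (rad_pos hy.1))) (hf _ hy.2)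

/-- Euler's relation in degree 0. It needs differentiability only at the retracted point. -/
theorem fderiv_comp_retr_self {f : M → F} {y : M} (hy : mink y y < 0)
    (hf : DifferentiableAt ℝ (fun z => f (retr z)) (retr y)) :
    fderiv ℝ (fun z => f (retr z)) y y = 0 := by
  have h1 : (fun z => f (retr z)) =ᶠ[𝓝 y] (fun z => f (retr z)) ∘ retr := by
    filter_upwards [isOpen_neg.mem_nhds hy] with z hz
    simp [retr_retr hz]
  rw [h1.fderiv_eq, fderiv_comp y hf (differentiableAt_retr hy), ContinuousLinearMap.comp_apply,
    fderiv_retr_self hy, map_zero]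

theorem ext₁_self (A : M → M →L[ℝ] ℝ) {y : M} (hy : mink y y < 0) : ext₁ A y y = 0 := by
  rw [ext₁, ContinuousLinearMap.comp_apply, fderiv_retr_self hy, map_zero]

end Homogeneous

/-! ### The Klein-Gordon commutator as a flat commutator. -/

section Reduction

variable {e : ℝ} {V : Set M} {A : M → M →L[ℝ] ℝ} {φ : M → ℂ}

theorem smoothOn_cone {F : Type*} [NormedAddCommGroup F] [NormedSpace ℝ F] {f : M → F}
    (h : SmoothOn f V) {y : M} (hy : y ∈ cone V) : ContDiffAt ℝ ∞ (fun z => f (retr z)) y :=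
  contDiffAt_cone_of_homogeneous (k := fun _ => 1) (fun t ht y => by rw [one_smul, retr_smul ht]) h hy

theorem ext₁_cone (h : ∀ x ∈ V, ContDiffAt ℝ ∞ (ext₁ A) x) {y : M} (hy : y ∈ cone V) :
    ContDiffAt ℝ ∞ (ext₁ A) y :=
  contDiffAt_cone_of_homogeneous (k := id) (fun _ ht y => ext₁_smul A ht y) h hy

theorem pot_smul {t : ℝ} (ht : 0 < t) (i : Fin 4) (y : M) :
    pot e (ext₁ A) i y = t • pot e (ext₁ A) i (t • y) := by
  rw [pot, pot, ext₁_smul A ht y]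
  simp
  ring

theorem Dc_of_homogeneous {f : M → ℂ} {s t : ℝ} (ht : 0 < t) (h : ∀ y, f y = s • f (t • y)) (i : Fin 4)
    (y : M) : Dc e (ext₁ A) i f y = (s * t) • Dc e (ext₁ A) i f (t • y) := by
  rw [Dc, Dc, pd_of_homogeneous h, pot_smul ht, h y]
  simp
  ring

theorem Dc_retr {y : M} (hy : mink y y < 0) (i : Fin 4) :
    Dc e (ext₁ A) i (fun z => φ (retr z)) (retr y) =
      rad y * Dc e (ext₁ A) i (fun z => φ (retr z)) y := by
  have hr := rad_pos hy
  rw [Dc_of_homogeneous (s := 1) (inv_pos.2 hr) (fun z => by rw [retr_smul (inv_pos.2 hr), one_smul])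
    i y, ← retr_eq]
  have : (rad y : ℂ) ≠ 0 := by exact_mod_cast hr.ne'
  simp [this]

theorem box_retr {y : M} (hy : mink y y < 0) :
    box e (ext₁ A) (fun z => φ (retr z)) (retr y) =
      rad y ^ 2 * box e (ext₁ A) (fun z => φ (retr z)) y := by
  have hr := rad_pos hy
  have hi := inv_pos.2 hr
  have h1 : ∀ i z, Dc e (ext₁ A) i (fun z => φ (retr z)) z =
      (1 * (rad y)⁻¹) • Dc e (ext₁ A) i (fun z => φ (retr z)) ((rad y)⁻¹ • z) := fun i z =>
    Dc_of_homogeneous (s := 1) hi (fun z => by rw [retr_smul hi, one_smul]) i z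
  have : (rad y : ℂ) ≠ 0 := by exact_mod_cast hr.ne'
  simp only [box, Finset.mul_sum]
  refine Finset.sum_congr rfl fun i _ => ?_
  rw [Dc_of_homogeneous hi (h1 i) i y, ← retr_eq]
  simp
  field_simp

theorem pd_rad {x : M} (hx : x ∈ dS) (i : Fin 4) :
    pd i (fun y => (rad y : ℂ)) x = ((-(eta i * x i) : ℝ) : ℂ) := by
  rw [pd_ofReal (contDiffAt_rad (dS_neg hx)).da, pd, fderiv_rad (dS_neg hx), rad_of_mem hx,
    mink_single_right]
  simp

/-- Both the derivative of a degree 0 function and the extended potential annihilate the radial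
direction. -/
theorem sum_Dc_self {y : M} (hy : y ∈ cone V) (hφ : SmoothOn φ V) :
    ∑ i, (y i : ℂ) * Dc e (ext₁ A) i (fun z => φ (retr z)) y = 0 := by
  have h1 := fderiv_comp_retr_self hy.1 ((hφ _ hy.2).da)
  rw [fderiv_eq_sum_pd] at h1
  have h2 := ext₁_self A hy.1
  have h3 : (y : M) = ∑ i, y i • Pi.single (M := fun _ => ℝ) i 1 := pi_eq_sum_univ' y
  have h4 : ∑ i, y i * ext₁ A y (Pi.single i 1) = 0 := by
    rw [← h2]
    conv_rhs => rw [h3]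
    simp only [map_sum, map_smul, smul_eq_mul]
    rw [← h3]
  have h5 : ∑ i, (y i : ℂ) * pot e (ext₁ A) i y = 0 := by
    have : ∀ i, (y i : ℂ) * pot e (ext₁ A) i y =
        Complex.I * e * ((y i * ext₁ A y (Pi.single i 1) : ℝ) : ℂ) := by
      intro i; rw [pot]; push_cast; ring
    simp only [this]
    rw [← Finset.mul_sum, ← Complex.ofReal_sum, h4]
    simp
  simp only [Dc, mul_sub, Finset.sum_sub_distrib]
  simp only [Complex.real_smul] at h1
  rw [h1, zero_sub, neg_eq_zero]
  calc _ = (∑ i, (y i : ℂ) * pot e (ext₁ A) i y) * φ (retr y) := by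
        rw [Finset.sum_mul]; exact Finset.sum_congr rfl fun i _ => by ring
    _ = 0 := by rw [h5, zero_mul]

theorem covD_retr {y v : M} (hy : mink y y < 0) :
    covD e A φ v (retr y) = ∑ i, (v i : ℂ) * (rad y * Dc e (ext₁ A) i (fun z => φ (retr z)) y) := by
  have h3 : v = ∑ i, v i • Pi.single (M := fun _ => ℝ) i 1 := pi_eq_sum_univ' v
  have h4 : ext₁ A (retr y) v = ∑ i, v i * ext₁ A (retr y) (Pi.single i 1) := by
    conv_lhs => rw [h3]
    simp only [map_sum, map_smul, smul_eq_mul]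
  simp only [← Dc_retr hy]
  rw [covD, fderiv_eq_sum_pd, h4]
  simp only [Dc, pot, retr_retr hy, mul_sub, Finset.sum_sub_distrib, Complex.real_smul]
  congr 1
  push_cast
  rw [Finset.mul_sum, Finset.sum_mul]
  exact Finset.sum_congr rfl fun i _ => by ring

/-- At the retracted point the derivative along a projected basis vector is `rad · D_i` of the
extension. Differentiating once more, the factor `rad` contributes `-η_i x_i D_i`, and the sum of
these terms is the radial derivative, which is zero. -/
theorem kleinGordon_eq {ζ m : ℝ} (hV : IsOpenIn V) (hA : ∀ x ∈ V, ContDiffAt ℝ ∞ (ext₁ A) x)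
    (hφ : SmoothOn φ V) {x : M} (hx : x ∈ V) :
    kleinGordon ζ m e A φ x = box e (ext₁ A) (fun z => φ (retr z)) x +
      ((ζ * scalarCurvature + m ^ 2 : ℝ) : ℂ) * φ x := by
  have hxd := hV.subset hx
  have hxc := subset_cone hV.subset hx
  rw [kleinGordon]
  congr 1
  have key : ∀ i, covD e A (fun y => covD e A φ (Pi.single i 1) y) (Pi.single i 1) x =
      Dc e (ext₁ A) i (Dc e (ext₁ A) i (fun z => φ (retr z))) x
        - eta i * x i * Dc e (ext₁ A) i (fun z => φ (retr z)) x := by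
    intro i
    have h1 : (fun y => covD e A φ (Pi.single i 1) (retr y)) =ᶠ[𝓝 x]
        fun y => (rad y : ℂ) * Dc e (ext₁ A) i (fun z => φ (retr z)) y := by
      filter_upwards [isOpen_neg.mem_nhds hxc.1] with y hy
      rw [covD_retr hy, Finset.sum_eq_single i]
      · simp
      · intro j _ hj; simp [hj]
      · simp
    have h2 : covD e A (fun y => covD e A φ (Pi.single i 1) y) (Pi.single i 1) x =
        Dc e (ext₁ A) i (fun y => covD e A φ (Pi.single i 1) (retr y)) x := by
      simp only [covD, Dc, pot, pd, retr_of_mem hxd]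
    have hr : ContDiffAt ℝ ∞ (fun y => (rad y : ℂ)) x :=
      Complex.ofRealCLM.contDiff.contDiffAt.comp x (contDiffAt_rad hxc.1)
    rw [h2, Dc_congr h1, Dc_mul hr (contDiffAt_Dc (hA x hx) (hφ x hx) i), pd_rad hxd,
      rad_of_mem hxd]
    push_cast
    ring
  have h0 := sum_Dc_self (e := e) (A := A) hxc hφ
  simp only [key, box, mul_sub, Finset.sum_sub_distrib]
  rw [sub_eq_self, ← h0]
  refine Finset.sum_congr rfl fun i _ => ?_
  have : (eta i : ℂ) * eta i = 1 := by exact_mod_cast eta_mul_self i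
  linear_combination (x i * Dc e (ext₁ A) i (fun z => φ (retr z)) x) * this

/-- The vector field on the cone that corresponds to `X`. -/
def coneField (X : M → M) (y : M) : M := rad y • X (retr y)

/-- The zeroth order coefficient of the symmetry operator. -/
def zeroth (e : ℝ) (χ : M → ℝ) (y : M) : ℂ := Complex.I * e * (χ (retr y) : ℂ)

theorem firstOrderOp_retr {X : M → M} {χ : M → ℝ} {y : M} (hy : mink y y < 0) :
    firstOrderOp e A X χ φ (retr y) =
      Op e (ext₁ A) (fun j y => (coneField X y j : ℂ)) (zeroth e χ) (fun z => φ (retr z)) y := by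
  rw [firstOrderOp, covD_retr hy, Op, zeroth]
  congr 1
  refine Finset.sum_congr rfl fun i _ => ?_
  simp [coneField]
  ring

theorem contDiffAt_coneField {X : M → M} (hX : SmoothOn X V) {y : M} (hy : y ∈ cone V) :
    ContDiffAt ℝ ∞ (coneField X) y :=
  (contDiffAt_rad hy.1).smul (smoothOn_cone hX hy)

theorem contDiffAt_coneField_coe {X : M → M} (hX : SmoothOn X V) {y : M} (hy : y ∈ cone V)
    (j : Fin 4) : ContDiffAt ℝ ∞ (fun y => (coneField X y j : ℂ)) y :=
  Complex.ofRealCLM.contDiff.contDiffAt.comp y (contDiffAt_pi.1 (contDiffAt_coneField hX hy) j)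

theorem contDiffAt_zeroth {χ : M → ℝ} (hχ : SmoothOn χ V) {y : M} (hy : y ∈ cone V) :
    ContDiffAt ℝ ∞ (zeroth e χ) y :=
  contDiffAt_const.mul (Complex.ofRealCLM.contDiff.contDiffAt.comp y (smoothOn_cone hχ hy))

/-- Off the hyperboloid the extension of `Hφ` is `rad²` times the flat wave operator plus a multiple
of `φ`. The constant commutes, and the derivative of `rad²` along `X` vanishes because `X` is
tangent. -/
theorem commutator_eq {ζ m : ℝ} (hV : IsOpenIn V) (hA : ∀ x ∈ V, ContDiffAt ℝ ∞ (ext₁ A) x)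
    {X : M → M} {χ : M → ℝ} (hX : SmoothOn X V) (ht : ∀ x ∈ V, mink x (X x) = 0)
    (hχ : SmoothOn χ V) (hφ : SmoothOn φ V) {x : M} (hx : x ∈ V) :
    kleinGordon ζ m e A (firstOrderOp e A X χ φ) x -
        firstOrderOp e A X χ (kleinGordon ζ m e A φ) x =
      box e (ext₁ A) (Op e (ext₁ A) (fun j y => (coneField X y j : ℂ)) (zeroth e χ)
          (fun z => φ (retr z))) x -
        Op e (ext₁ A) (fun j y => (coneField X y j : ℂ)) (zeroth e χ)
          (box e (ext₁ A) (fun z => φ (retr z))) x := by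
  have hxd := hV.subset hx
  have hxc := subset_cone hV.subset hx
  set f : M → ℂ := fun z => φ (retr z) with hf
  set c : Fin 4 → M → ℂ := fun j y => (coneField X y j : ℂ) with hc
  set κ : ℂ := ((ζ * scalarCurvature + m ^ 2 : ℝ) : ℂ) with hκ
  have hcs : ∀ j, ∀ y ∈ cone V, ContDiffAt ℝ ∞ (c j) y := fun j y hy =>
    contDiffAt_coneField_coe hX hy j
  have hfs : ∀ y ∈ cone V, ContDiffAt ℝ ∞ f y := fun y hy => smoothOn_cone hφ hy
  have hC := isOpen_cone hV
  have e1 : ∀ {y : M}, mink y y < 0 →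
      (fun z => firstOrderOp e A X χ φ (retr z)) =ᶠ[𝓝 y] Op e (ext₁ A) c (zeroth e χ) f := by
    intro y hy
    filter_upwards [isOpen_neg.mem_nhds hy] with z hz using firstOrderOp_retr hz
  have hTs : SmoothOn (firstOrderOp e A X χ φ) V := by
    intro y hy
    have hyc := subset_cone hV.subset hy
    exact (contDiffAt_Op (hA y hy) (fun j => hcs j y hyc) (contDiffAt_zeroth hχ hyc)
      (hfs y hyc)).congr_of_eventuallyEq (e1 hyc.1)
  have hbox : ∀ {g h : M → ℂ} {y : M}, g =ᶠ[𝓝 y] h → box e (ext₁ A) g y = box e (ext₁ A) h y := by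
    intro g h y hgh
    refine Finset.sum_congr rfl fun i _ => ?_
    rw [Dc_congr (hgh.eventuallyEq_nhds.mono fun z hz => Dc_congr hz i)]
  have e2 : (fun z => kleinGordon ζ m e A φ (retr z)) =ᶠ[𝓝 x]
      fun z => (rad z : ℂ) ^ 2 * box e (ext₁ A) f z + κ * f z := by
    filter_upwards [hC.mem_nhds hxc] with z hz
    rw [kleinGordon_eq hV hA hφ hz.2, box_retr hz.1]
  have hbs : ContDiffAt ℝ ∞ (box e (ext₁ A) f) x :=
    contDiffAt_box (Filter.eventually_of_mem (hC.mem_nhds hxc) fun z hz => ext₁_cone hA hz)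
      (Filter.eventually_of_mem (hC.mem_nhds hxc) hfs)
  have hr : ContDiffAt ℝ ∞ (fun y => (rad y : ℂ)) x :=
    Complex.ofRealCLM.contDiff.contDiffAt.comp x (contDiffAt_rad hxc.1)
  have e3 : ∀ j, Dc e (ext₁ A) j (fun z => (rad z : ℂ) ^ 2 * box e (ext₁ A) f z + κ * f z) x =
      -2 * (eta j * x j : ℝ) * box e (ext₁ A) f x + Dc e (ext₁ A) j (box e (ext₁ A) f) x
        + κ * Dc e (ext₁ A) j f x := by
    intro j
    have hp : pd j (fun z => (rad z : ℂ) ^ 2) x = -2 * (eta j * x j : ℝ) := by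
      have : (fun z => (rad z : ℂ) ^ 2) = fun z => (rad z : ℂ) * (rad z : ℂ) := by
        funext z; ring
      rw [this, pd_mulC hr.da hr.da, pd_rad hxd, rad_of_mem hxd]
      push_cast; ring
    rw [Dc_add ((hr.pow 2).mul hbs) (contDiffAt_const.mul (hfs x hxc)), Dc_mul (hr.pow 2) hbs,
      Dc_mul contDiffAt_const (hfs x hxc), hp, rad_of_mem hxd]
    simp [pd]
  have hrx : retr x = x := retr_of_mem hxd
  have e4 : firstOrderOp e A X χ (kleinGordon ζ m e A φ) x =
      Op e (ext₁ A) c (zeroth e χ) (box e (ext₁ A) f) x + κ * Op e (ext₁ A) c (zeroth e χ) f x := by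
    have : firstOrderOp e A X χ (kleinGordon ζ m e A φ) (retr x) = Op e (ext₁ A) c (zeroth e χ)
        (fun z => kleinGordon ζ m e A φ (retr z)) x := firstOrderOp_retr hxc.1
    rw [hrx] at this
    rw [this, Op_congr e2]
    -- Tangency of `X`: this is the factor through which the derivative of `rad²` would enter.
    have h0 : ∑ j, c j x * ((eta j * x j : ℝ) : ℂ) = 0 := by
      have := ht x hx
      rw [mink_comm] at this
      have h2 : ∑ j, X x j * (eta j * x j) = 0 := by
        rw [← this, mink]
        exact Finset.sum_congr rfl fun j _ => by ring
      have h3 : ∀ j, c j x * ((eta j * x j : ℝ) : ℂ) = ((X x j * (eta j * x j) : ℝ) : ℂ) := by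
        intro j
        simp [hc, coneField, rad_of_mem hxd, hrx]
      simp only [h3, ← Complex.ofReal_sum, h2, Complex.ofReal_zero]
    have h5 : ∑ j, c j x * (-2 * ((eta j * x j : ℝ) : ℂ) * box e (ext₁ A) f x) = 0 := by
      calc _ = -2 * box e (ext₁ A) f x * ∑ j, c j x * ((eta j * x j : ℝ) : ℂ) := by
            rw [Finset.mul_sum]; exact Finset.sum_congr rfl fun j _ => by ring
        _ = 0 := by rw [h0, mul_zero]
    simp only [Op, e3, rad_of_mem hxd, mul_add, Finset.sum_add_distrib, h5]
    rw [Finset.mul_sum]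
    have h6 : ∑ j, c j x * (κ * Dc e (ext₁ A) j f x) = ∑ j, κ * (c j x * Dc e (ext₁ A) j f x) :=
      Finset.sum_congr rfl fun j _ => by ring
    rw [h6]
    push_cast
    ring
  have e5 : firstOrderOp e A X χ φ x = Op e (ext₁ A) c (zeroth e χ) f x := by
    have := firstOrderOp_retr (e := e) (A := A) (X := X) (χ := χ) (φ := φ) hxc.1
    rwa [hrx] at this
  rw [kleinGordon_eq hV hA hTs hx, e4, hbox (e1 hxc.1), e5]
  ring

end Reduction

/-! ### Pointwise test of the symmetry condition; geometry of the extended field. -/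

section Necessary

variable {e ζ m : ℝ} {V : Set M} {A : M → M →L[ℝ] ℝ} {F : M → M [⋀^Fin 2]→L[ℝ] ℝ} {X : M → M}
  {χ : M → ℝ}

theorem Dc_Dc_of_zero {a : M → M →L[ℝ] ℝ} {f : M → ℂ} {x : M} (ha : ContDiffAt ℝ ∞ a x)
    (hf : ContDiffAt ℝ ∞ f x) (h0 : f x = 0) (i j : Fin 4) :
    Dc e a j (Dc e a i f) x =
      pd j (pd i f) x - pot e a i x * pd j f x - pot e a j x * pd i f x := by
  have h1 : pd j (Dc e a i f) x = pd j (pd i f) x - pd j (fun z => pot e a i z * f z) x :=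
    pd_sub (contDiffAt_pd hf i).da ((contDiffAt_pot ha i).mul hf).da j
  rw [Dc, h1, pd_mulC (contDiffAt_pot ha i).da hf.da, Dc, h0]
  ring

theorem pd_pd_ofReal {n : ℕ} {f : (Fin n → ℝ) → ℝ} {p : Fin n → ℝ} (hf : ContDiffAt ℝ ∞ f p)
    (i j : Fin n) : pd j (pd i (fun y => (f y : ℂ))) p = ((pd j (pd i f) p : ℝ) : ℂ) := by
  refine (pd_congr' (g := fun y => ((pd i f y : ℝ) : ℂ)) ?_ j).trans
    (pd_ofReal (contDiffAt_pd hf i).da j)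
  filter_upwards [(hf.of_le (m := 1) (by simp)).eventually (by simp)] with z hz
  exact pd_ofReal (hz.differentiableAt (by simp)) i

/-- The equation `[H, X̂] = q H` on a real function that vanishes at `x`. -/
theorem symmetry_identity (hV : IsOpenIn V) (hA : ∀ x ∈ V, ContDiffAt ℝ ∞ (ext₁ A) x)
    (hX : SmoothOn X V) (ht : ∀ x ∈ V, mink x (X x) = 0) (hχ : SmoothOn χ V) {q : M → ℂ}
    (hq : ∀ φ : M → ℂ, SmoothOn φ V → ∀ x ∈ V,
      kleinGordon ζ m e A (firstOrderOp e A X χ φ) x -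
        firstOrderOp e A X χ (kleinGordon ζ m e A φ) x = q x * kleinGordon ζ m e A φ x)
    {x : M} (hx : x ∈ V) {φ : M → ℝ} (hφ : SmoothOn φ V) (h0 : φ x = 0) :
    ∑ i, (eta i : ℂ) * (2 * (∑ j, (pd i (fun y => coneField X y j) x : ℝ) *
        ((pd j (pd i (fun z => φ (retr z))) x : ℝ)
          - pot e (ext₁ A) i x * (pd j (fun z => φ (retr z)) x : ℝ)
          - pot e (ext₁ A) j x * (pd i (fun z => φ (retr z)) x : ℝ)) +
        opY e (ext₁ A) (fun j y => (coneField X y j : ℂ)) (zeroth e χ) i x *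
          (pd i (fun z => φ (retr z)) x : ℝ)) +
        ∑ j, ((pd i (pd i (fun y => coneField X y j)) x : ℝ) : ℂ) *
          ((pd j (fun z => φ (retr z)) x : ℝ) : ℂ)) =
    q x * ∑ i, (eta i : ℂ) * ((pd i (pd i (fun z => φ (retr z))) x : ℝ)
          - 2 * pot e (ext₁ A) i x * (pd i (fun z => φ (retr z)) x : ℝ)) := by
  have hxd := hV.subset hx
  have hxc := subset_cone hV.subset hx
  have hφ' : SmoothOn (fun y => (φ y : ℂ)) V := fun y hy =>
    Complex.ofRealCLM.contDiff.contDiffAt.comp y (hφ y hy)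
  have hf := hφ x hx
  have hfc := hφ' x hx
  have hfx : φ (retr x) = 0 := by rw [retr_of_mem hxd, h0]
  have hfx' : (fun z => (φ (retr z) : ℂ)) x = 0 := by simp [hfx]
  have hc : ∀ j, ContDiffAt ℝ ∞ (fun y => coneField X y j) x := fun j =>
    contDiffAt_pi.1 (contDiffAt_coneField hX hxc) j
  have key := hq _ hφ' x hx
  rw [commutator_eq hV hA hX ht hχ hφ' hx, box_Op (isOpen_cone hV) (fun y hy => ext₁_cone hA hy)
    (fun j y hy => contDiffAt_coneField_coe hX hy j) (fun y hy => contDiffAt_zeroth hχ hy)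
    (fun y hy => smoothOn_cone hφ' hy) hxc, kleinGordon_eq hV hA hφ' hx, h0] at key
  have hD : ∀ i, Dc e (ext₁ A) i (fun z => (φ (retr z) : ℂ)) x =
      (pd i (fun z => φ (retr z)) x : ℝ) := by
    intro i
    rw [Dc, pd_ofReal hf.da, hfx]
    simp
  have hDD : ∀ i j, Dc e (ext₁ A) j (Dc e (ext₁ A) i (fun z => (φ (retr z) : ℂ))) x =
      (pd j (pd i (fun z => φ (retr z))) x : ℝ)
          - pot e (ext₁ A) i x * (pd j (fun z => φ (retr z)) x : ℝ)
          - pot e (ext₁ A) j x * (pd i (fun z => φ (retr z)) x : ℝ) := by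
    intro i j
    rw [Dc_Dc_of_zero (hA x hx) hfc hfx', pd_pd_ofReal hf, pd_ofReal hf.da, pd_ofReal hf.da]
  simp only [Op, box, hDD, hD, hfx, pd_pd_ofReal (hc _), pd_ofReal (hc _).da, Complex.ofReal_zero,
    mul_zero, add_zero] at key
  rw [key]
  congr 1
  exact Finset.sum_congr rfl fun i _ => by ring

theorem smoothOn_mink (hV : IsOpenIn V) (v : M) : SmoothOn (fun y => mink v y) V := fun x hx =>
  (minkL v).contDiff.contDiffAt.comp x (contDiffAt_retr (dS_neg (hV.subset hx)))

theorem pd_mink_retr {x v : M} (hx : mink x x < 0) (i : Fin 4) :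
    pd i (fun z => mink v (retr z)) x =
      (rad x)⁻¹ * (eta i * v i) + (rad x)⁻¹ ^ 3 * (eta i * x i) * mink v x := by
  have h := ((minkL v).hasFDerivAt.comp x (differentiableAt_retr hx).hasFDerivAt).fderiv
  have h2 : (fun z => mink v (retr z)) = minkL v ∘ retr := rfl
  rw [pd, h2, h, ContinuousLinearMap.comp_apply, fderiv_retr hx, mink_single_right]
  change mink v _ = _
  rw [mink_add_right, mink_smul_right, mink_smul_right, mink_single_right]

/-- Linear functions orthogonal to `x` are the test functions of first order. Their extension has a
mixed radial-tangential Hessian at `x`, coming from the curvature of the hyperboloid. -/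
theorem pd_pd_mink_retr {x v : M} (hx : x ∈ dS) (hv : mink v x = 0) (i j : Fin 4) :
    pd j (pd i (fun z => mink v (retr z))) x =
      eta i * eta j * (v i * x j + v j * x i) := by
  have hn := dS_neg hx
  have h1 : pd i (fun z => mink v (retr z)) =ᶠ[𝓝 x] fun z =>
      (rad z)⁻¹ * (eta i * v i) + ((rad z)⁻¹ ^ 3 * (eta i * z i)) * mink v z := by
    filter_upwards [isOpen_neg.mem_nhds hn] with z hz using pd_mink_retr hz i
  have hr := (contDiffAt_rad hn).da.hasFDerivAt
  have hri := (hasDerivAt_inv (rad_pos hn).ne').comp_hasFDerivAt x hr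
  have hk : DifferentiableAt ℝ (fun z : M => (rad z)⁻¹ ^ 3 * (eta i * z i)) x :=
    (hri.differentiableAt.pow 3).mul (by fun_prop)
  have hm : HasFDerivAt (fun z => mink v z) (minkL v) x := (minkL v).hasFDerivAt
  have h2 := ((hri.mul_const (eta i * v i)).add (hk.hasFDerivAt.mul hm)).fderiv
  have h3 : fderiv ℝ (fun z => (rad z)⁻¹ * (eta i * v i) +
      ((rad z)⁻¹ ^ 3 * (eta i * z i)) * mink v z) x = _ := h2
  rw [pd_congr' h1, pd, h3]
  simp only [add_apply, smul_apply, hv, rad_of_mem hx, fderiv_rad hn, smul_eq_mul, zero_mul]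
  rw [show (minkL v) (Pi.single j 1) = mink v (Pi.single j 1) from rfl, mink_single_right,
    mink_single_right]
  ring

/-- The tensor `∂_i ξ_j + ∂_j ξ_i`. -/
def sym (ξ : M → M) (x v w : M) : ℝ := mink (fderiv ℝ ξ x v) w + mink (fderiv ℝ ξ x w) v

theorem mink_fderiv_eq {ξ : M → M} {x : M} (h : DifferentiableAt ℝ ξ x) (v w : M) :
    mink (fderiv ℝ ξ x v) w = ∑ i, ∑ j, v i * pd i (fun y => ξ y j) x * (eta j * w j) := by
  have h1 : ∀ j, fderiv ℝ ξ x v j = ∑ i, v i * pd i (fun y => ξ y j) x := by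
    intro j
    have h2 := (hasFDerivAt_pi'.1 h.hasFDerivAt j).fderiv
    rw [show fderiv ℝ ξ x v j = fderiv ℝ (fun y => ξ y j) x v by rw [h2]; rfl, fderiv_eq_sum_pd]
    rfl
  rw [mink, Finset.sum_comm]
  refine Finset.sum_congr rfl fun j _ => ?_
  rw [h1, Finset.mul_sum, Finset.sum_mul]
  exact Finset.sum_congr rfl fun i _ => by ring

theorem coneField_smul (X : M → M) {t : ℝ} (ht : 0 < t) (y : M) :
    coneField X y = t⁻¹ • coneField X (t • y) := by
  rw [coneField, coneField, retr_smul ht, rad_smul ht, smul_smul, ← mul_assoc,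
    inv_mul_cancel₀ ht.ne', one_mul]

/-- Euler's relation in degree 1. -/
theorem fderiv_coneField_self (hX : SmoothOn X V) {y : M} (hy : y ∈ cone V) :
    fderiv ℝ (coneField X) y y = coneField X y := by
  have h1 := fderiv_comp_retr_self hy.1 (hX _ hy.2).da
  have h2 := ((contDiffAt_rad hy.1).da.hasFDerivAt.smul
    (smoothOn_cone hX hy).da.hasFDerivAt).fderiv
  have h3 : fderiv ℝ (coneField X) y = _ := h2
  have h4 := rad_sq hy.1
  have h5 := (rad_pos hy.1).ne'
  rw [h3]
  simp only [add_apply, smul_apply, h1, smul_zero, zero_add, ContinuousLinearMap.smulRight_apply,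
    fderiv_rad hy.1]
  rw [coneField, show -(rad y)⁻¹ * mink y y = rad y by field_simp; linarith]

theorem mink_coneField (ht : ∀ x ∈ V, mink x (X x) = 0) {y : M} (hy : y ∈ cone V) :
    mink y (coneField X y) = 0 := by
  have := ht _ hy.2
  rw [retr_eq, mink_smul_left, ← retr_eq] at this
  rw [coneField, mink_smul_right, (mul_eq_zero.1 this).resolve_left (inv_pos.2 (rad_pos hy.1)).ne',
    mul_zero]

theorem mink_fderiv_coneField (hV : IsOpenIn V) (hX : SmoothOn X V)
    (ht : ∀ x ∈ V, mink x (X x) = 0) {y : M} (hy : y ∈ cone V) (v : M) :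
    mink (fderiv ℝ (coneField X) y v) y + mink (coneField X y) v = 0 := by
  have hd := (contDiffAt_coneField hX hy).da
  have h1 : (fun z => mink z (coneField X z)) =ᶠ[𝓝 y] fun _ => 0 := by
    filter_upwards [(isOpen_cone hV).mem_nhds hy] with z hz using mink_coneField ht hz
  have h2 : HasFDerivAt (fun z => mink z (coneField X z)) (∑ i, (eta i * y i) •
      ((ContinuousLinearMap.proj i).comp (fderiv ℝ (coneField X) y)) + minkL (coneField X y)) y := by
    have h3 : ∀ i ∈ (Finset.univ : Finset (Fin 4)), HasFDerivAt
        (fun z : M => eta i * z i * coneField X z i)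
        ((eta i * y i) • ((ContinuousLinearMap.proj i).comp (fderiv ℝ (coneField X) y)) +
          (coneField X y i) • (eta i • ContinuousLinearMap.proj (R := ℝ) (φ := fun _ : Fin 4 => ℝ) i)) y :=
      fun i _ => ((hasFDerivAt_apply i y).const_mul (eta i)).mul (hasFDerivAt_pi'.1 hd.hasFDerivAt i)
    refine (HasFDerivAt.fun_sum h3).congr_fderiv ?_
    rw [Finset.sum_add_distrib]
    congr 1
    ext v
    change _ = mink _ _
    simp [mink]
    exact Finset.sum_congr rfl fun i _ => by ring
  have h4 := congrArg (fun L => L v) (h2.fderiv.symm.trans h1.fderiv_eq)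
  simp only [fderiv_fun_const, Pi.zero_apply, add_apply, zero_apply] at h4
  rw [← h4]
  congr 1
  simp [mink]
  exact Finset.sum_congr rfl fun i _ => by ring

/-- The derivative of `⟨y, ξ⟩ = 0` and Euler's relation show that the symmetrised gradient has no
radial part. -/
theorem sym_coneField_self (hV : IsOpenIn V) (hX : SmoothOn X V)
    (ht : ∀ x ∈ V, mink x (X x) = 0) {y : M} (hy : y ∈ cone V) (v : M) :
    sym (coneField X) y v y = 0 := by
  rw [sym, fderiv_coneField_self hX hy]
  exact mink_fderiv_coneField hV hX ht hy v

end Necessary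

/-! ### The determining equations of a symmetry operator. -/

section Necessary

variable {e ζ m : ℝ} {V : Set M} {A : M → M →L[ℝ] ℝ} {F : M → M [⋀^Fin 2]→L[ℝ] ℝ} {X : M → M}
  {χ : M → ℝ}

theorem mink_proj_ne_zero {x : M} (hx : x ∈ dS) :
    ∃ v : M, mink v x = 0 ∧ mink v v ≠ 0 := by
  refine ⟨fderiv ℝ retr x (Pi.single 0 1), by rw [mink_comm, mink_fderiv_retr (dS_neg hx)], ?_⟩
  rw [fderiv_retr_of_mem hx]
  simp only [mink_add_left, mink_add_right, mink_smul_left, mink_smul_right, mink_single_right,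
    mink_comm (Pi.single 0 1) x, mem_dS_iff.1 hx]
  simp [eta]
  nlinarith [sq_nonneg (x 0)]

theorem curv_eq {x : M} (hA : IsPotential A F V) (hx : x ∈ V) (i j : Fin 4) :
    curv e (ext₁ A) i j x =
      Complex.I * e * (ext₂ F x ![Pi.single i 1, Pi.single j 1] : ℝ) := by
  have h : ∀ i j, pd i (pot e (ext₁ A) j) x =
      Complex.I * e * (fderiv ℝ (ext₁ A) x (Pi.single i 1) (Pi.single j 1) : ℝ) := by
    intro i j
    have h1 := ((hA.1 x hx).da.hasFDerivAt.clm_apply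
      (hasFDerivAt_const (Pi.single j (1 : ℝ) : M) x))
    have h2 : pd i (fun y => ext₁ A y (Pi.single j 1)) x =
        fderiv ℝ (ext₁ A) x (Pi.single i 1) (Pi.single j 1) := by
      rw [pd, h1.fderiv]; simp
    have h3 : DifferentiableAt ℝ (fun y => ((ext₁ A y (Pi.single j 1) : ℝ) : ℂ)) x :=
      (Complex.ofRealCLM.hasFDerivAt.comp x h1).differentiableAt
    have h4 : pot e (ext₁ A) j = fun y => (Complex.I * e) * ((ext₁ A y (Pi.single j 1) : ℝ) : ℂ) := rfl
    rw [h4, pd_mulC (by fun_prop) h3, pd_ofReal h1.differentiableAt, h2]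
    simp [pd]
  rw [curv, h, h, ← hA.2 x hx]
  push_cast
  ring

/-- The real form of the coefficient `opY` of the symmetry operator. -/
def defect (F : M → M [⋀^Fin 2]→L[ℝ] ℝ) (X : M → M) (χ : M → ℝ) (x w : M) : ℝ :=
  fderiv ℝ (fun y => χ (retr y)) x w - ext₂ F x ![w, X x]

theorem form_sum_right (θ : M [⋀^Fin 2]→L[ℝ] ℝ) (v w : M) :
    θ ![v, w] = ∑ j, w j * θ ![v, Pi.single j 1] := by
  have h : w = ∑ j, w j • Pi.single (M := fun _ => ℝ) j 1 := pi_eq_sum_univ' w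
  have := congrArg (formBilin θ v) h
  simpa [formBilin_apply] using this

/-- The curvature of the connection is `ie F`, so the zeroth-order coefficient of the commutator is
`ie (dχ - F(·, X))`. -/
theorem opY_eq (hV : IsOpenIn V) (hA : IsPotential A F V) (hχ : SmoothOn χ V) {x : M} (hx : x ∈ V)
    (i : Fin 4) :
    opY e (ext₁ A) (fun j y => (coneField X y j : ℂ)) (zeroth e χ) i x =
      Complex.I * e * (defect F X χ x (Pi.single i 1) : ℝ) := by
  have hxd := hV.subset hx
  have h1 : pd i (zeroth e χ) x = Complex.I * e * (pd i (fun y => χ (retr y)) x : ℝ) := by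
    have h3 : DifferentiableAt ℝ (fun y => ((χ (retr y) : ℝ) : ℂ)) x :=
      (Complex.ofRealCLM.hasFDerivAt.comp x (hχ x hx).da.hasFDerivAt).differentiableAt
    have h4 : zeroth e χ = fun y => (Complex.I * e) * (χ (retr y) : ℂ) := rfl
    rw [h4, pd_mulC (by fun_prop) h3, pd_ofReal (hχ x hx).da]
    simp [pd]
  rw [opY, h1, defect, form_sum_right _ _ (X x)]
  simp only [curv_eq hA hx, coneField, rad_of_mem hxd, retr_of_mem hxd, one_smul]
  push_cast
  rw [mul_sub, Finset.mul_sum]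
  congr 1
  exact Finset.sum_congr rfl fun j _ => by ring

/-- The flat wave operator on vector fields, paired with `v`. -/
def waveField (ξ : M → M) (x v : M) : ℝ :=
  ∑ i, eta i * ∑ j, pd i (pd i (fun y => ξ y j)) x * (eta j * v j)

theorem sym_eq {ξ : M → M} {x : M} (h : DifferentiableAt ℝ ξ x) (v w : M) :
    sym ξ x v w = ∑ i, eta i * ∑ j, pd i (fun y => ξ y j) x *
      (eta i * v i * (eta j * w j) + eta j * v j * (eta i * w i)) := by
  rw [sym, mink_fderiv_eq h, mink_fderiv_eq h, ← Finset.sum_add_distrib]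
  refine Finset.sum_congr rfl fun i _ => ?_
  rw [← Finset.sum_add_distrib, Finset.mul_sum]
  refine Finset.sum_congr rfl fun j _ => ?_
  linear_combination (-(pd i (fun y => ξ y j) x * eta j * (v i * w j + v j * w i))) * eta_mul_self i

/-- The identity is tested on functions vanishing at `x`, where zeroth-order terms drop out.
Products of linear functions isolate the second-order symbol; linear functions isolate the
first-order one, whose real part is independent of the gauge potential and whose imaginary part
carries `χ` and `F`. -/
theorem symmetry_conditions (he : e ≠ 0) (hV : IsOpenIn V) (hA : IsPotential A F V)
    (hs : IsSymmetryOperator ζ m e A X χ V) {x : M} (hx : x ∈ V) :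
    (∃ ρ : ℝ, ∀ v w, mink v x = 0 → mink w x = 0 → sym (coneField X) x v w = ρ * mink v w) ∧
    (∀ v, mink v x = 0 → waveField (coneField X) x v = 0) ∧
    ∀ w, fderiv ℝ (fun y => χ (retr y)) x w = ext₂ F x ![w, X x] := by
  obtain ⟨hX, ht, hχ, q, hq⟩ := hs
  have hxd := hV.subset hx
  have hxc := subset_cone hV.subset hx
  have hξ := (contDiffAt_coneField hX hxc).da
  have hr1 : ∀ v : M, mink v x = 0 → ∀ i, pd i (fun z => mink v (retr z)) x = eta i * v i := by
    intro v hv i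
    rw [pd_mink_retr hxc.1, hv, rad_of_mem hxd]
    simp
  -- The product of two linear functions vanishing at `x` has zero gradient there and Hessian the
  -- symmetric product of `v` and `w`.
  have hprod : ∀ v w, mink v x = 0 → mink w x = 0 →
      (sym (coneField X) x v w : ℂ) = q x * (mink v w : ℝ) := by
    intro v w hv hw
    have sv := smoothOn_mink hV v
    have sw := smoothOn_mink hV w
    have h1 : ∀ i, pd i (fun z => mink v (retr z) * mink w (retr z)) =ᶠ[𝓝 x] fun z =>
        pd i (fun z => mink v (retr z)) z * mink w (retr z) +
          mink v (retr z) * pd i (fun z => mink w (retr z)) z := by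
      intro i
      filter_upwards [(isOpen_cone hV).mem_nhds hxc] with z hz
      exact pd_mul (smoothOn_cone sv hz).da (smoothOn_cone sw hz).da i
    have h2 : ∀ i, pd i (fun z => mink v (retr z) * mink w (retr z)) x = 0 := by
      intro i
      rw [(h1 i).eq_of_nhds, retr_of_mem hxd, hv, hw]
      simp
    have h3 : ∀ i j, pd j (pd i (fun z => mink v (retr z) * mink w (retr z))) x =
        eta i * v i * (eta j * w j) + eta j * v j * (eta i * w i) := by
      intro i j
      have a1 : ContDiffAt ℝ ∞ (fun z => mink v (retr z)) x := sv x hx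
      have a2 : ContDiffAt ℝ ∞ (fun z => mink w (retr z)) x := sw x hx
      have b : pd j (fun z => pd i (fun z => mink v (retr z)) z * mink w (retr z) +
          mink v (retr z) * pd i (fun z => mink w (retr z)) z) x =
          pd j (fun z => pd i (fun z => mink v (retr z)) z * mink w (retr z)) x +
          pd j (fun z => mink v (retr z) * pd i (fun z => mink w (retr z)) z) x :=
        pd_add ((contDiffAt_pd a1 i).mul a2).da (a1.mul (contDiffAt_pd a2 i)).da j
      rw [pd_congr' (h1 i), b, pd_mul (contDiffAt_pd a1 i).da a2.da, pd_mul a1.da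
        (contDiffAt_pd a2 i).da, retr_of_mem hxd, hv, hw, hr1 v hv, hr1 v hv, hr1 w hw, hr1 w hw]
      ring
    have key := symmetry_identity hV hA.1 hX ht hχ hq hx
      (φ := fun z => mink v z * mink w z) (fun y hy => (sv y hy).mul (sw y hy)) (by simp [hv])
    simp only [h2, h3, Complex.ofReal_zero, mul_zero, sub_zero, add_zero,
      Finset.sum_const_zero] at key
    have e1 := sym_eq hξ v w
    have e2 : ∑ i, eta i * (eta i * v i * (eta i * w i) + eta i * v i * (eta i * w i)) =
        2 * mink v w := by
      rw [mink, Finset.mul_sum]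
      refine Finset.sum_congr rfl fun i _ => ?_
      linear_combination 2 * eta i * v i * w i * eta_mul_self i
    have e3 : (∑ i, (eta i : ℂ) * (2 * ∑ j, ((pd i (fun y => coneField X y j) x : ℝ) : ℂ) *
        ((eta i * v i * (eta j * w j) + eta j * v j * (eta i * w i) : ℝ) : ℂ))) =
        ((2 * sym (coneField X) x v w : ℝ) : ℂ) := by
      rw [e1]
      push_cast
      rw [Finset.mul_sum]
      exact Finset.sum_congr rfl fun i _ => by ring
    have e4 : ∑ i, (eta i : ℂ) *
        ((eta i * v i * (eta i * w i) + eta i * v i * (eta i * w i) : ℝ) : ℂ) =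
        ((2 * mink v w : ℝ) : ℂ) := by
      rw [← e2]
      push_cast
      rfl
    rw [e3, e4] at key
    push_cast at key
    linear_combination key / 2
  -- The a priori complex factor is real: it is a quotient of real numbers once a tangent vector
  -- with nonzero square is chosen.
  obtain ⟨ρ, hρ⟩ : ∃ ρ : ℝ, q x = ρ := by
    obtain ⟨v, hv, hvv⟩ := mink_proj_ne_zero hxd
    refine ⟨sym (coneField X) x v v / mink v v, ?_⟩
    have : ((mink v v : ℝ) : ℂ) ≠ 0 := by exact_mod_cast hvv
    rw [Complex.ofReal_div, hprod v v hv hv, mul_div_cancel_right₀ _ this]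
  have hprod' : ∀ v w, mink v x = 0 → mink w x = 0 → sym (coneField X) x v w = ρ * mink v w := by
    intro v w hv hw
    have := hprod v w hv hw
    rw [hρ] at this
    exact_mod_cast this
  have hlin : ∀ v, mink v x = 0 → waveField (coneField X) x v = 0 ∧
      ∑ i, defect F X χ x (Pi.single i 1) * v i = 0 := by
    intro v hv
    set a : M := fun i => ext₁ A x (Pi.single i 1) with ha
    set y : M := fun i => defect F X χ x (Pi.single i 1) with hy
    set Z : Fin 4 → Fin 4 → ℝ := fun i j => pd i (fun y => coneField X y j) x with hZ
    have key := symmetry_identity hV hA.1 hX ht hχ hq hx (smoothOn_mink hV v) hv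
    have hpd : ∀ i, pd i (fun z => (fun y => mink v y) (retr z)) x = eta i * v i := hr1 v hv
    have hpp : ∀ i j, pd j (pd i (fun z => (fun y => mink v y) (retr z))) x =
      eta i * eta j * (v i * x j + v j * x i) := pd_pd_mink_retr hxd hv
    have hpot : ∀ i, pot e (ext₁ A) i x = Complex.I * e * (a i : ℝ) := fun i => rfl
    have hoy : ∀ i, opY e (ext₁ A) (fun j y => (coneField X y j : ℂ)) (zeroth e χ) i x =
      Complex.I * e * (y i : ℝ) := opY_eq hV hA hχ hx
    simp only [hpd, hpp, hpot, hoy, hρ] at key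
    have r1 : sym (coneField X) x v x = 0 := sym_coneField_self hV hX ht hxc v
    -- The potential with raised index. It is tangent, so the conformal equation applied to `α` and
    -- `v` cancels the gauge-dependent terms of the imaginary part.
    set α : M := fun i => eta i * a i with hα
    have hax : mink α x = 0 := by
      have h3 : x = ∑ i, x i • Pi.single (M := fun _ => ℝ) i 1 := pi_eq_sum_univ' x
      have h4 := congrArg (ext₁ A x) h3
      rw [ext₁_self A hxc.1, map_sum] at h4
      rw [mink, h4]
      refine Finset.sum_congr rfl fun i _ => ?_
      rw [map_smul, smul_eq_mul]
      change eta i * (eta i * a i) * x i = x i * a i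
      linear_combination (a i * x i) * eta_mul_self i
    have r2 := hprod' α v hax hv
    rw [sym_eq hξ] at r1 r2
    have hvx := hv
    rw [mink_eq] at hv r2 
    have re := congrArg Complex.re key
    have im := congrArg Complex.im key
    simp only [Fin.sum_univ_four] at r1 r2 re im
    rw [waveField]
    simp only [Fin.sum_univ_four]
    have hη : eta 0 = 1 ∧ eta 1 = -1 ∧ eta 2 = -1 ∧ eta 3 = -1 := by simp [eta]
    obtain ⟨n0, n1, n2, n3⟩ := hη
    change _ = _ * (_ * a 0 * _ - _ * a 1 * _ - _ * a 2 * _ - _ * a 3 * _) at r2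
    simp only [hα, n0, n1, n2, n3] at r1 r2 re im ⊢
    simp at re im
    constructor
    · linear_combination re - 2 * r1 + 2 * ρ * hv
    · refine mul_left_cancel₀ he ?_
      linear_combination im / 2 + e * r2
  refine ⟨⟨ρ, hprod'⟩, fun v hv => (hlin v hv).1, fun w => ?_⟩
  have hd : ∀ w, defect F X χ x w = ∑ i, defect F X χ x (Pi.single i 1) * w i := by
    intro w
    simp only [defect, sub_mul, Finset.sum_sub_distrib]
    rw [fderiv_eq_sum_pd, form_swap, form_sum_right]
    congr 1
    · exact Finset.sum_congr rfl fun i _ => by rw [smul_eq_mul, mul_comm]; rfl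
    · rw [← Finset.sum_neg_distrib]
      refine Finset.sum_congr rfl fun i _ => ?_
      rw [form_swap]; ring
  -- The previous step covers tangent directions; radially, both terms of the defect vanish.
  have hself : defect F X χ x x = 0 := by
    rw [defect, fderiv_comp_retr_self hxc.1 (by rw [retr_of_mem hxd]; exact (hχ x hx).da),
      ext₂_self_left hxc.1, sub_zero]
  have hall : defect F X χ x w = 0 := by
    have h1 := (hlin (fderiv ℝ retr x w) (by rw [mink_comm, mink_fderiv_retr hxc.1])).2
    rw [← hd, fderiv_retr_of_mem hxd] at h1
    have h2 : defect F X χ x (w + mink x w • x) = defect F X χ x w + mink x w * defect F X χ x x := by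
      simp only [defect, map_add, map_smul, form_add_left, form_smul_left, smul_eq_mul]
      ring
    rwa [h2, hself, mul_zero, add_zero] at h1
  rwa [defect, sub_eq_zero] at hall

end Necessary

/-! ### The conformal Killing equation with the additional wave equation. -/

section Conformal

variable {C : Set M} {u : Fin 4 → M → ℝ}

theorem pd_const_mul' {f : M → ℝ} {y : M} (hf : DifferentiableAt ℝ f y) (c : ℝ) (i : Fin 4) :
    pd i (fun z => c * f z) y = c * pd i f y := by
  rw [pd, fderiv_const_mul hf]; rfl

theorem pd_coord' (i k : Fin 4) (y : M) : pd i (fun z : M => z k) y = if i = k then 1 else 0 := by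
  have := pd_coord (h := fun t : ℝ => t) (k := k) (p := y) (hasDerivAt_id _) i
  simpa [eq_comm] using this

theorem pd_mink_self (i : Fin 4) (y : M) : pd i (fun z => mink z z) y = 2 * (eta i * y i) := by
  rw [pd, (hasFDerivAt_mink_self y).fderiv]
  have : minkL y (Pi.single i 1) = eta i * y i := mink_single_right y i
  simp [this]

theorem pd_zero_of_eqOn (hC : IsOpen C) {f : M → ℝ} {c : ℝ} (h : ∀ y ∈ C, f y = c) {y : M}
    (hy : y ∈ C) (i : Fin 4) : pd i f y = 0 := by
  rw [pd_congr hC (g := fun _ => c) h hy]; simp [pd]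

/-- A homothety with the additional constraints of a symmetry operator is an isometry. -/
theorem symmetric_gradient_eq_zero (hC : IsOpen C) (hneg : ∀ y ∈ C, mink y y < 0)
    (hu : ∀ j, ∀ y ∈ C, ContDiffAt ℝ ∞ (u j) y)
    (hS : ∀ y ∈ C, ∀ i j, mink y y * (eta j * pd i (u j) y + eta i * pd j (u i) y) =
      2 / 3 * (∑ k, pd k (u k) y) *
        (mink y y * (if i = j then eta i else 0) - eta i * eta j * (y i * y j)))
    (hE : ∀ y ∈ C, ∑ i, y i * pd i (fun z => ∑ k, pd k (u k) z) y = 0)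
    (hw : ∀ y ∈ C, ∀ v, mink v y = 0 →
      ∑ i, eta i * ∑ j, pd i (pd i (u j)) y * (eta j * v j) = 0)
    {y : M} (hy : y ∈ C) (i j : Fin 4) : eta j * pd i (u j) y + eta i * pd j (u i) y = 0 := by
  set σ : M → ℝ := fun z => ∑ k, pd k (u k) z with hσ
  have hη : eta 0 = 1 ∧ eta 1 = -1 ∧ eta 2 = -1 ∧ eta 3 = -1 := by simp [eta]
  obtain ⟨n0, n1, n2, n3⟩ := hη
  have hp : ∀ i j, ∀ y ∈ C, ContDiffAt ℝ ∞ (pd i (u j)) y := fun i j y hy =>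
    contDiffAt_pd (hu j y hy) i
  have hpp : ∀ i k j, ∀ y ∈ C, ContDiffAt ℝ ∞ (pd i (pd k (u j))) y := fun i k j y hy =>
    contDiffAt_pd (hp k j y hy) i
  have hσs : ∀ y ∈ C, ContDiffAt ℝ ∞ σ y := fun y hy => ContDiffAt.sum fun k _ => hp k k y hy
  have hN : ∀ y : M, DifferentiableAt ℝ (fun z : M => mink z z) y := fun y =>
    (hasFDerivAt_mink_self y).differentiableAt
  have hpσ : ∀ j, ∀ y ∈ C, pd j σ y = ∑ k, pd k (pd j (u k)) y := by
    intro j y hy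
    rw [hσ, pd_sum (fun k _ => (hp k k y hy).da)]
    exact Finset.sum_congr rfl fun k _ => pd_comm (hu k y hy) j k
  -- the contracted derivative of the conformal Killing equation
  have hdiv : ∀ y ∈ C, ∀ v : M, mink y y * ((∑ i, eta i * ∑ j, pd i (pd i (u j)) y * (eta j * v j)) +
      ∑ j, v j * pd j σ y) = 2 / 3 * (mink y y * ∑ j, v j * pd j σ y) - 2 * σ y * mink v y := by
    intro y hy v
    have hD : ∀ i j, 2 * (eta i * y i) * (eta j * pd i (u j) y + eta i * pd j (u i) y) +
        mink y y * (eta j * pd i (pd i (u j)) y + eta i * pd i (pd j (u i)) y) =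
        2 / 3 * pd i σ y * (mink y y * (if i = j then eta i else 0) - eta i * eta j * (y i * y j)) +
        2 / 3 * σ y * (2 * (eta i * y i) * (if i = j then eta i else 0) -
          eta i * eta j * (y j + y i * (if i = j then 1 else 0))) := by
      intro i j
      have h1 := pd_congr hC (f := fun y => mink y y * (eta j * pd i (u j) y + eta i * pd j (u i) y))
        (g := fun y => (2 / 3 * σ y) *
        (mink y y * (if i = j then eta i else 0) - eta i * eta j * (y i * y j)))
        (fun y hy => hS y hy i j) hy i
      have a1 := (hp i j y hy).da
      have a2 := (hp j i y hy).da
      have b1 : pd i (fun y => eta j * pd i (u j) y + eta i * pd j (u i) y) y =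
          eta j * pd i (pd i (u j)) y + eta i * pd i (pd j (u i)) y := by
        have : pd i (fun y => eta j * pd i (u j) y + eta i * pd j (u i) y) y =
          pd i (fun y => eta j * pd i (u j) y) y + pd i (fun y => eta i * pd j (u i) y) y :=
          pd_add (a1.const_mul _) (a2.const_mul _) i
        rw [this, pd_const_mul' a1, pd_const_mul' a2]
      have b2 : pd i (fun y : M => mink y y * (if i = j then eta i else 0)
          - eta i * eta j * (y i * y j)) y = 2 * (eta i * y i) * (if i = j then eta i else 0) -
          eta i * eta j * (y j + y i * (if i = j then 1 else 0)) := by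
        have : pd i (fun y : M => mink y y * (if i = j then eta i else 0)
          - eta i * eta j * (y i * y j)) y = pd i (fun y : M => mink y y * (if i = j then eta i else 0)) y
          - pd i (fun y => eta i * eta j * (y i * y j)) y :=
          pd_sub ((hN y).mul_const _) (by fun_prop) i
        rw [this, pd_mul (hN y) (by fun_prop), pd_const_mul' (by fun_prop),
          pd_mul (f := fun y : M => y i) (by fun_prop) (by fun_prop), pd_mink_self, pd_coord',
          pd_coord']
        simp [pd]
      have a3 : DifferentiableAt ℝ (fun y => eta j * pd i (u j) y + eta i * pd j (u i) y) y :=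
        (a1.const_mul _).add (a2.const_mul _)
      have a4 : DifferentiableAt ℝ (fun y : M => mink y y * (if i = j then eta i else 0)
          - eta i * eta j * (y i * y j)) y := ((hN y).mul_const _).sub (by fun_prop)
      rw [pd_mul (hN y) a3, b1, pd_mink_self,
        pd_mul ((hσs y hy).da.const_mul _) a4, b2, pd_const_mul' (hσs y hy).da] at h1
      exact h1
    -- The right-hand side of the conformal equation is a multiple of the projection to the tangent
    -- space, which annihilates `y`.
    have hY : ∀ j, ∑ i, y i * (eta j * pd i (u j) y + eta i * pd j (u i) y) = 0 := by
      intro j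
      refine mul_left_cancel₀ (hneg y hy).ne ?_
      rw [mul_zero, Finset.mul_sum]
      have : ∀ i, mink y y * (y i * (eta j * pd i (u j) y + eta i * pd j (u i) y)) =
          2 / 3 * σ y * (mink y y * (y i * if i = j then eta i else 0)
            - eta j * y j * (eta i * y i * y i)) := by
        intro i
        linear_combination y i * hS y hy i j
      simp only [this]
      rw [← Finset.mul_sum, Finset.sum_sub_distrib, ← Finset.mul_sum, ← Finset.mul_sum, ← mink]
      simp
      right; ring
    have hT : ∑ i, ∑ j, eta i * v j * (2 * (eta i * y i) * (eta j * pd i (u j) y + eta i * pd j (u i) y) +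
        mink y y * (eta j * pd i (pd i (u j)) y + eta i * pd i (pd j (u i)) y)) =
        ∑ i, ∑ j, eta i * v j * (2 / 3 * pd i σ y * (mink y y * (if i = j then eta i else 0)
          - eta i * eta j * (y i * y j)) + 2 / 3 * σ y * (2 * (eta i * y i) *
          (if i = j then eta i else 0) - eta i * eta j * (y j + y i * (if i = j then 1 else 0)))) :=
      Finset.sum_congr rfl fun i _ => Finset.sum_congr rfl fun j _ => by rw [hD]
    have hP0 := hpσ 0 y hy
    have hP1 := hpσ 1 y hy
    have hP2 := hpσ 2 y hy
    have hP3 := hpσ 3 y hy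
    have hY0 := hY 0
    have hY1 := hY 1
    have hY2 := hY 2
    have hY3 := hY 3
    have hEy := hE y hy
    rw [mink_eq v y]
    generalize hn : mink y y = N at *
    simp only [Fin.sum_univ_four, n0, n1, n2, n3] at hT hP0 hP1 hP2 hP3 hY0 hY1 hY2 hY3 hEy ⊢
    simp only [Fin.isValue, Fin.reduceEq, if_true, if_false] at hT
    linear_combination hT - 2 * (v 0 * hY0 + v 1 * hY1 + v 2 * hY2 + v 3 * hY3)
      + N * (v 0 * hP0 + v 1 * hP1 + v 2 * hP2 + v 3 * hP3)
      - 2 / 3 * (v 0 * y 0 - v 1 * y 1 - v 2 * y 2 - v 3 * y 3) * hEy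
  -- For tangent `v` the wave term vanishes and `hdiv` says that `dσ(v)` equals two thirds of
  -- itself, hence zero. The radial derivative is zero by `hE`, so `dσ = 0`.
  have hdσ : ∀ y ∈ C, ∀ v : M, ∑ j, v j * pd j σ y = 0 := by
    intro y hy v
    have hn := (hneg y hy).ne
    set w : M := v - (mink v y / mink y y) • y with hw'
    have hwy : mink w y = 0 := by
      rw [hw', sub_eq_add_neg, ← neg_smul, mink_add_left, mink_smul_left]
      field_simp
      ring
    have h1 := hdiv y hy w
    rw [hw y hy w hwy, hwy] at h1
    have h2 : ∑ j, w j * pd j σ y = 0 := by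
      refine mul_left_cancel₀ hn ?_
      linear_combination 3 * h1
    have h3 : ∑ j, w j * pd j σ y = ∑ j, v j * pd j σ y -
        (mink v y / mink y y) * ∑ j, y j * pd j σ y := by
      rw [Finset.mul_sum, ← Finset.sum_sub_distrib]
      refine Finset.sum_congr rfl fun j _ => ?_
      simp [hw']; ring
    rw [h2, hE y hy] at h3
    linarith
  have hσ0 : ∀ j, ∀ y ∈ C, pd j σ y = 0 := fun j y hy => by
    simpa [Pi.single_apply] using hdσ y hy (Pi.single j 1)
  have hB : ∀ j, ∀ y ∈ C, mink y y * (∑ i, eta i * pd i (pd i (u j)) y) = -2 * (σ y * y j) := by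
    intro j y hy
    have h1 := hdiv y hy (Pi.single j 1)
    rw [hdσ y hy, mink_comm (Pi.single j 1), mink_single_right] at h1
    have h2 : ∑ i, eta i * ∑ k, pd i (pd i (u k)) y * (eta k * (Pi.single j (1:ℝ) : M) k) =
        eta j * ∑ i, eta i * pd i (pd i (u j)) y := by
      simp [Pi.single_apply, Finset.mul_sum]
      exact Finset.sum_congr rfl fun i _ => by ring
    rw [h2] at h1
    linear_combination eta j * h1 - (mink y y * (∑ i, eta i * pd i (pd i (u j)) y) + 2 * σ y * y j) *
      eta_mul_self j
  -- With `σ` locally constant, `hB` reads `⟨y, y⟩ □ξ = -2σ y`. Taking its divergence, where `div □ξ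
  -- = □σ = 0`, gives `2⟨y, □ξ⟩ = -8σ`, while pairing with `y` gives `-4σ` for the same quantity.
  -- Hence no proper homothety exists.
  have hσz : ∀ y ∈ C, σ y = 0 := by
    intro y hy
    have hBs : ∀ j, DifferentiableAt ℝ (fun y => ∑ i, eta i * pd i (pd i (u j)) y) y := fun j =>
      DifferentiableAt.fun_sum fun i _ => (hpp i i j y hy).da.const_mul _
    have h1 : ∀ j, 2 * (eta j * y j) * (∑ i, eta i * pd i (pd i (u j)) y) +
        mink y y * (∑ i, eta i * pd i (pd i (pd j (u j))) y) = -2 * σ y := by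
      intro j
      have a := pd_congr hC (fun y hy => hB j y hy) hy j
      have b : pd j (fun y => ∑ i, eta i * pd i (pd i (u j)) y) y =
          ∑ i, eta i * pd i (pd i (pd j (u j))) y := by
        rw [pd_sum (fun i _ => (hpp i i j y hy).da.const_mul _)]
        refine Finset.sum_congr rfl fun i _ => ?_
        rw [pd_const_mul' (hpp i i j y hy).da, pd_comm (hp i j y hy),
          pd_congr hC (fun z hz => pd_comm (hu j z hz) j i) hy]
      have c : DifferentiableAt ℝ (fun y => σ y * y j) y := (hσs y hy).da.mul (by fun_prop)
      rw [pd_mul (hN y) (hBs j), pd_mink_self, b, pd_const_mul' c, pd_mul (hσs y hy).da (by fun_prop),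
        hσ0 j y hy, pd_coord'] at a
      simpa using a
    have h2 : ∑ j, ∑ i, eta i * pd i (pd i (pd j (u j))) y = 0 := by
      rw [Finset.sum_comm]
      refine Finset.sum_eq_zero fun i _ => ?_
      rw [← Finset.mul_sum]
      have : ∑ j, pd i (pd i (pd j (u j))) y = pd i (pd i σ) y := by
        rw [pd_congr hC (f := pd i σ) (g := fun y => ∑ j, pd i (pd j (u j)) y)
          (fun z hz => pd_sum (fun k _ => (hp k k z hz).da) i) hy,
          pd_sum (fun k _ => (hpp i k k y hy).da)]
      rw [this, pd_zero_of_eqOn hC (hσ0 i) hy, mul_zero]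
    have h3 : ∑ j, (2 * (eta j * y j) * (∑ i, eta i * pd i (pd i (u j)) y) +
        mink y y * (∑ i, eta i * pd i (pd i (pd j (u j))) y)) = -8 * σ y := by
      simp only [h1]
      simp
      ring
    rw [Finset.sum_add_distrib, ← Finset.mul_sum, h2, mul_zero, add_zero] at h3
    have h4 : mink y y * ∑ j, 2 * (eta j * y j) * (∑ i, eta i * pd i (pd i (u j)) y) =
        -4 * σ y * mink y y := by
      rw [Finset.mul_sum]
      conv_rhs => rw [mink, Finset.mul_sum]
      refine Finset.sum_congr rfl fun j _ => ?_
      linear_combination 2 * (eta j * y j) * hB j y hy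
    rw [h3] at h4
    refine mul_left_cancel₀ (hneg y hy).ne ?_
    linear_combination -h4 / 4
  refine mul_left_cancel₀ (hneg y hy).ne ?_
  have h0 : ∑ k, pd k (u k) y = 0 := hσz y hy
  rw [hS y hy i j, h0]
  ring

/-- The array `∂_k ∂_i ξ_j` is symmetric in `k, i` and, after lowering, skew in `i, j`; cyclic
permutation of the indices shows that it vanishes. -/
theorem pd_pd_eq_zero_of_skew (hC : IsOpen C) (hu : ∀ j, ∀ y ∈ C, ContDiffAt ℝ ∞ (u j) y)
    (hS : ∀ y ∈ C, ∀ i j, eta j * pd i (u j) y + eta i * pd j (u i) y = 0) {y : M} (hy : y ∈ C)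
    (k i j : Fin 4) : pd k (pd i (u j)) y = 0 := by
  have h : ∀ k i j, eta j * pd k (pd i (u j)) y + eta i * pd k (pd j (u i)) y = 0 := by
    intro k i j
    have a1 := (contDiffAt_pd (hu j y hy) i).da
    have a2 := (contDiffAt_pd (hu i y hy) j).da
    have h1 := pd_zero_of_eqOn hC (fun y hy => hS y hy i j) hy k
    have : pd k (fun y => eta j * pd i (u j) y + eta i * pd j (u i) y) y =
      pd k (fun y => eta j * pd i (u j) y) y + pd k (fun y => eta i * pd j (u i) y) y :=
      pd_add (a1.const_mul _) (a2.const_mul _) k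
    rwa [this, pd_const_mul' a1, pd_const_mul' a2] at h1
  have hc : ∀ k i j, pd k (pd i (u j)) y = pd i (pd k (u j)) y := fun k i j => pd_comm (hu j y hy) k i
  have e1 := h k i j
  have e2 := h i j k
  have e3 := h j k i
  rw [hc i j k] at e2
  rw [hc j k i] at e3
  rw [hc i k j] at e2
  have : eta j * pd k (pd i (u j)) y = 0 := by linarith
  refine mul_left_cancel₀ (a := eta j) ?_ (by rw [this, mul_zero])
  intro h0
  have := eta_mul_self j
  rw [h0] at this
  norm_num at this

end Conformal

/-! ### Symmetry fields are Killing fields that preserve `F`. -/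

section Killing

variable {e ζ m : ℝ} {V W : Set M} {A : M → M →L[ℝ] ℝ} {F : M → M [⋀^Fin 2]→L[ℝ] ℝ} {X : M → M}
  {χ : M → ℝ}

theorem sym_add_left (ξ : M → M) (x v v' w : M) :
    sym ξ x (v + v') w = sym ξ x v w + sym ξ x v' w := by
  simp only [sym, map_add, mink_add_left, mink_add_right]; ring

theorem sym_smul_left (ξ : M → M) (x v w : M) (c : ℝ) : sym ξ x (c • v) w = c * sym ξ x v w := by
  simp only [sym, map_smul, mink_smul_left, mink_smul_right]; ring

theorem sym_comm (ξ : M → M) (x v w : M) : sym ξ x v w = sym ξ x w v := by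
  simp only [sym]; ring

theorem fderiv_comp_coord {ξ : M → M} {y : M} (h : DifferentiableAt ℝ ξ y) (v : M) (j : Fin 4) :
    fderiv ℝ (fun z => ξ z j) y v = fderiv ℝ ξ y v j := by
  rw [(hasFDerivAt_pi'.1 h.hasFDerivAt j).fderiv]; rfl

theorem sym_single {ξ : M → M} {y : M} (h : DifferentiableAt ℝ ξ y) (i j : Fin 4) :
    sym ξ y (Pi.single i 1) (Pi.single j 1) =
      eta j * pd i (fun z => ξ z j) y + eta i * pd j (fun z => ξ z i) y := by
  rw [sym, mink_single_right, mink_single_right, pd, pd, fderiv_comp_coord h, fderiv_comp_coord h]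

/-- The vectors `⟨y, y⟩ e_i - ⟨y, e_i⟩ y` are tangent, which turns the tangential equation into
components. The trace of the projection is 3 and that of the symmetrised gradient is twice the
divergence, whence `ρ = 2/3 div ξ`. -/
theorem conformal_eq {ξ : M → M} {y : M} (h : DifferentiableAt ℝ ξ y) (hy : mink y y < 0) {ρ : ℝ}
    (hρ : ∀ v w, mink v y = 0 → mink w y = 0 → sym ξ y v w = ρ * mink v w)
    (h0 : ∀ v, sym ξ y v y = 0) (i j : Fin 4) :
    mink y y * (eta j * pd i (fun z => ξ z j) y + eta i * pd j (fun z => ξ z i) y) =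
      2 / 3 * (∑ k, pd k (fun z => ξ z k) y) *
        (mink y y * (if i = j then eta i else 0) - eta i * eta j * (y i * y j)) := by
  have hN := hy.ne
  have key : ∀ i j, mink y y * sym ξ y (Pi.single i 1) (Pi.single j 1) =
      ρ * (mink y y * (if i = j then eta i else 0) - eta i * eta j * (y i * y j)) := by
    intro i j
    have hperp : ∀ i, mink (mink y y • Pi.single i 1 + (-(eta i * y i)) • y) y = 0 := by
      intro i
      rw [mink_add_left, mink_smul_left, mink_smul_left, mink_comm (Pi.single i 1),
        mink_single_right]
      ring
    have h1 := hρ _ _ (hperp i) (hperp j)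
    have h2 : ∀ w, sym ξ y y w = 0 := fun w => by rw [sym_comm, h0]
    rw [sym_add_left, sym_smul_left, sym_smul_left, h2, sym_comm, sym_add_left, sym_smul_left,
      sym_smul_left, h2, sym_comm] at h1
    simp only [mink_add_left, mink_add_right, mink_smul_left, mink_smul_right, mink_single_right,
      mink_comm (Pi.single i 1) y, Pi.add_apply, Pi.smul_apply, smul_eq_mul] at h1
    have h3 : eta j * (Pi.single i (1 : ℝ) : M) j = if i = j then eta i else 0 := by
      rw [Pi.single_apply]
      rcases eq_or_ne i j with rfl | hne
      · simp
      · simp [hne, hne.symm]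
    refine mul_left_cancel₀ hN ?_
    linear_combination h1 + ρ * mink y y ^ 2 * h3
  have htr : ρ = 2 / 3 * ∑ k, pd k (fun z => ξ z k) y := by
    have h1 : ∀ i, mink y y * (2 * pd i (fun z => ξ z i) y) =
        ρ * (mink y y - eta i * y i * y i) := by
      intro i
      have h2 := key i i
      rw [sym_single h, if_pos rfl] at h2
      linear_combination eta i * h2 - (mink y y * (2 * pd i (fun z => ξ z i) y)
        - ρ * (mink y y - eta i * y i * y i)) * eta_mul_self i
    have h2 : ∑ i, mink y y * (2 * pd i (fun z => ξ z i) y) =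
        ∑ i, ρ * (mink y y - eta i * y i * y i) := Finset.sum_congr rfl fun i _ => h1 i
    rw [← Finset.mul_sum, ← Finset.mul_sum, ← Finset.mul_sum, Finset.sum_sub_distrib, ← mink] at h2
    simp at h2
    refine mul_left_cancel₀ hN ?_
    linear_combination -h2 / 3
  rw [← sym_single h, key i j, htr]

theorem pd_coneField (X : M → M) {t : ℝ} (ht : 0 < t) (i j : Fin 4) (y : M) :
    pd i (fun z => coneField X z j) y = pd i (fun z => coneField X z j) (t • y) := by
  have := pd_of_homogeneous (f := fun z => coneField X z j) (s := t⁻¹) (t := t)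
    (fun z => by rw [coneField_smul X ht z]; rfl) i y
  rwa [inv_mul_cancel₀ ht.ne', one_smul] at this

theorem fderiv_coneField (X : M → M) {t : ℝ} (ht : 0 < t) (y : M) :
    fderiv ℝ (coneField X) y = fderiv ℝ (coneField X) (t • y) := by
  have := fderiv_of_homogeneous (coneField_smul X ht) y
  rwa [inv_mul_cancel₀ ht.ne', one_smul] at this

/-- The field of a first-order symmetry operator is locally a Killing field. -/
theorem exists_killing_coneField (he : e ≠ 0) (hV : IsOpenIn V) (hA : IsPotential A F V)
    (hs : IsSymmetryOperator ζ m e A X χ V) {x : M} (hx : x ∈ V) :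
    ∃ L : M →L[ℝ] M, IsSkew L ∧ ∀ᶠ y in 𝓝 x, coneField X y = L y := by
  have hcond := fun x hx => symmetry_conditions he hV hA hs (x := x) hx
  obtain ⟨hX, ht, -, -⟩ := hs
  have hC := isOpen_cone hV
  have hu : ∀ j, ∀ y ∈ cone V, ContDiffAt ℝ ∞ (fun z => coneField X z j) y := fun j y hy =>
    contDiffAt_pi.1 (contDiffAt_coneField hX hy) j
  have hd : ∀ y ∈ cone V, DifferentiableAt ℝ (coneField X) y := fun y hy =>
    (contDiffAt_coneField hX hy).da
  have hperp : ∀ y ∈ cone V, ∀ v, mink v y = 0 → mink v (retr y) = 0 := by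
    intro y hy v hv
    rw [retr_eq, mink_smul_right, hv, mul_zero]
  have hS : ∀ y ∈ cone V, ∀ i j, mink y y * (eta j * pd i (fun z => coneField X z j) y +
      eta i * pd j (fun z => coneField X z i) y) =
      2 / 3 * (∑ k, pd k (fun z => coneField X z k) y) *
        (mink y y * (if i = j then eta i else 0) - eta i * eta j * (y i * y j)) := by
    intro y hy i j
    obtain ⟨ρ, hρ⟩ := (hcond _ hy.2).1
    refine conformal_eq (ρ := ρ) (hd y hy) hy.1 (fun v w hv hw => ?_)
      (fun v => sym_coneField_self hV hX ht hy v) i j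
    rw [← hρ v w (hperp y hy v hv) (hperp y hy w hw), sym, sym,
      fderiv_coneField X (inv_pos.2 (rad_pos hy.1)), ← retr_eq]
  -- The divergence of a field of degree 1 has degree 0, so it is constant along rays.
  have hE : ∀ y ∈ cone V,
      ∑ i, y i * pd i (fun z => ∑ k, pd k (fun z => coneField X z k) z) y = 0 := by
    intro y hy
    set σ : M → ℝ := fun z => ∑ k, pd k (fun z => coneField X z k) z with hσ
    have h1 : ∀ z ∈ cone V, (fun z => σ (retr z)) =ᶠ[𝓝 z] σ := by
      intro z hz
      filter_upwards [hC.mem_nhds hz] with w hw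
      refine Finset.sum_congr rfl fun k _ => ?_
      rw [retr_eq, ← pd_coneField X (inv_pos.2 (rad_pos hw.1))]
    have hσd : ∀ z ∈ cone V, DifferentiableAt ℝ σ z := fun z hz =>
      DifferentiableAt.fun_sum fun k _ => (contDiffAt_pd (hu k z hz) k).da
    have hry : retr y ∈ cone V := subset_cone hV.subset hy.2
    have h2 := fderiv_comp_retr_self (f := σ) hy.1
      ((hσd _ hry).congr_of_eventuallyEq (h1 _ hry))
    rw [(h1 y hy).fderiv_eq, fderiv_eq_sum_pd] at h2
    exact h2
  have hw : ∀ y ∈ cone V, ∀ v, mink v y = 0 → ∑ i, eta i * ∑ j,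
      pd i (pd i (fun z => coneField X z j)) y * (eta j * v j) = 0 := by
    intro y hy v hv
    have h1 := (hcond _ hy.2).2.1 v (hperp y hy v hv)
    have hi := inv_pos.2 (rad_pos hy.1)
    have h2 : ∀ i j, pd i (pd i (fun z => coneField X z j)) y =
        (rad y)⁻¹ * pd i (pd i (fun z => coneField X z j)) (retr y) := by
      intro i j
      have := pd_of_homogeneous (f := pd i (fun z => coneField X z j)) (s := 1) (t := (rad y)⁻¹)
        (fun z => by rw [one_smul]; exact pd_coneField X hi i j z) i y
      rwa [one_mul, ← retr_eq] at this
    rw [waveField] at h1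
    simp only [h2]
    rw [← mul_zero (rad y)⁻¹, ← h1, Finset.mul_sum]
    refine Finset.sum_congr rfl fun i _ => ?_
    rw [Finset.mul_sum, Finset.mul_sum, Finset.mul_sum]
    exact Finset.sum_congr rfl fun j _ => by ring
  have hskew := fun y (hy : y ∈ cone V) => symmetric_gradient_eq_zero hC (fun y hy => hy.1) hu hS hE
    hw hy
  have hpp := fun y (hy : y ∈ cone V) => pd_pd_eq_zero_of_skew hC hu hskew hy
  have hxc := subset_cone hV.subset hx
  obtain ⟨r, hr, hball⟩ := Metric.isOpen_iff.1 hC x hxc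
  have hconst : ∀ y ∈ Metric.ball x r, ∀ i j,
      pd i (fun z => coneField X z j) y = pd i (fun z => coneField X z j) x := by
    intro y hy i j
    refine Metric.isOpen_ball.is_const_of_fderiv_eq_zero (𝕜 := ℝ) (convex_ball x r).isPreconnected
      (fun z hz => (contDiffAt_pd (hu j z (hball hz)) i).da.differentiableWithinAt)
      (fun z hz => fderiv_eq_zero_of_pd fun k => hpp z (hball hz) k i j) hy (Metric.mem_ball_self hr)
  refine ⟨fderiv ℝ (coneField X) x, ?_, ?_⟩
  · intro v w
    have h1 := hd x hxc
    rw [mink_comm v, mink_fderiv_eq h1, mink_fderiv_eq h1, Finset.sum_comm, ← Finset.sum_add_distrib]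
    refine Finset.sum_eq_zero fun i _ => ?_
    rw [← Finset.sum_add_distrib]
    refine Finset.sum_eq_zero fun j _ => ?_
    linear_combination v j * w i * hskew x hxc i j
  -- By Euler's relation `ξ(y) = Dξ(y) y`, and `Dξ` is constant on the ball.
  · filter_upwards [Metric.ball_mem_nhds x hr] with y hy
    rw [← fderiv_coneField_self hX (hball hy)]
    funext j
    rw [← fderiv_comp_coord (hd y (hball hy)), ← fderiv_comp_coord (hd x hxc), fderiv_eq_sum_pd,
      fderiv_eq_sum_pd]
    simp only [hconst y hy]

theorem fderiv_form_linear {θ : M → M [⋀^Fin 2]→L[ℝ] ℝ} {y : M} (hθ : DifferentiableAt ℝ θ y)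
    (L : M →L[ℝ] M) (w u : M) :
    fderiv ℝ (fun z => θ z ![w, L z]) y u = fderiv ℝ θ y u ![w, L y] + θ y ![w, L u] := by
  have h1 : (fun z => θ z ![w, L z]) = fun z => ∑ j, L z j * θ z ![w, Pi.single j 1] := by
    funext z
    exact form_sum_right _ _ _
  have hL : ∀ j, HasFDerivAt (fun z => L z j) ((ContinuousLinearMap.proj j).comp L) y := fun j =>
    hasFDerivAt_pi'.1 L.hasFDerivAt j
  have hθj : ∀ j : Fin 4, DifferentiableAt ℝ (fun z => θ z ![w, Pi.single j 1]) y := fun j =>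
    ((ContinuousAlternatingMap.apply ℝ M ℝ ![w, Pi.single j 1]).differentiableAt).comp y hθ
  have hs : ∀ j ∈ Finset.univ, DifferentiableAt ℝ (fun z => L z j * θ z ![w, Pi.single j 1]) y :=
    fun j _ => (hL j).differentiableAt.mul (hθj j)
  rw [h1, fderiv_fun_sum hs,
    form_sum_right (fderiv ℝ θ y u) w (L y), form_sum_right (θ y) w (L u), ← Finset.sum_add_distrib,
    _root_.sum_apply]
  refine Finset.sum_congr rfl fun j _ => ?_
  rw [fderiv_fun_mul (hL j).differentiableAt (hθj j), (hL j).fderiv, fderiv_form_apply hθ]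
  simp
  ring

/-- If the contraction of a closed form with a linear field has a potential, then the form is
invariant. -/
theorem lieDeriv_eq_zero_of_potential {θ : M → M [⋀^Fin 2]→L[ℝ] ℝ} {y : M} {L : M →L[ℝ] M}
    {f : M → ℝ} (hθ : DifferentiableAt ℝ θ y) (hcl : extDeriv θ y = 0) (hf : ContDiffAt ℝ ∞ f y)
    (h : ∀ᶠ z in 𝓝 y, ∀ w, fderiv ℝ f z w = θ z ![w, L z]) (v w : M) : lieDeriv L θ y v w = 0 := by
  have h2 : DifferentiableAt ℝ (fderiv ℝ f) y :=
    (hf.fderiv_right (m := ∞) (by simp)).differentiableAt (by simp)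
  have key : ∀ u w, fderiv ℝ (fderiv ℝ f) y u w = fderiv ℝ θ y u ![w, L y] + θ y ![w, L u] := by
    intro u w
    rw [← fderiv_form_linear hθ, ← Filter.EventuallyEq.fderiv_eq (h.mono fun z hz => hz w),
      (h2.hasFDerivAt.clm_apply (hasFDerivAt_const w y)).fderiv]
    simp
  -- Symmetry of the Hessian of `f` says that the contraction of `θ` with `L` is closed; with `dθ =
  -- 0`, Cartan's formula gives the claim.
  have hs := symm_snd hf v w
  rw [key, key] at hs
  have hc := (extDeriv_eq_zero_iff y).1 hcl (L y) v w
  rw [lieDeriv, L.fderiv]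
  rw [form_swap _ w (L y), form_swap (θ y) w (L v)] at hs
  rw [form_swap _ (L y) v] at hc
  linarith [form_swap (fderiv ℝ θ y v) w (L y), form_swap (fderiv ℝ θ y v) (L y) w]

/-- A first-order symmetry operator has a Killing field that preserves `F`. -/
theorem IsSymmetryField.exists_killing (he : e ≠ 0) (hF : IsEMField F W)
    (h : IsSymmetryField ζ m e F W X) {x : M} (hx : x ∈ W) :
    ∃ L : M →L[ℝ] M, IsSkew L ∧ ∀ᶠ y in 𝓝 x, (y ∈ dS → X y = L y) ∧
      ∀ v w, lieDeriv L (ext₂ F) y v w = 0 := by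
  obtain ⟨V, hV, hxV, hVW, A, χ, hA, hs⟩ := h x hx
  obtain ⟨L, hL, hLe⟩ := exists_killing_coneField he hV hA hs hxV
  refine ⟨L, hL, ?_⟩
  have hcond := fun x hx => (symmetry_conditions he hV hA hs (x := x) hx).2.2
  obtain ⟨hX, ht, hχ, -⟩ := hs
  have hC := isOpen_cone hV
  -- The relation holds on `V` and extends to the cone, as `D retr` maps the extended field to `X`
  -- at the retracted point.
  have hpot : ∀ y ∈ cone V, ∀ w, fderiv ℝ (fun z => χ (retr z)) y w =
      ext₂ F y ![w, coneField X y] := by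
    intro y hy w
    have hry : retr y ∈ V := hy.2
    have h1 : (fun z => χ (retr z)) =ᶠ[𝓝 y] (fun z => χ (retr z)) ∘ retr := by
      filter_upwards [isOpen_neg.mem_nhds hy.1] with z hz
      simp [retr_retr hz]
    have h2 : fderiv ℝ retr y (coneField X y) = X (retr y) := by
      rw [fderiv_retr hy.1, mink_coneField ht hy, coneField, smul_smul,
        inv_mul_cancel₀ (rad_pos hy.1).ne']
      simp
    rw [h1.fderiv_eq, fderiv_comp y (hχ _ hry).da (differentiableAt_retr hy.1),
      ContinuousLinearMap.comp_apply, hcond _ hry, ← h2, ext₂_retr_apply hy.1]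
  filter_upwards [hC.mem_nhds (subset_cone hV.subset hxV), hLe.eventually_nhds] with y hy hyL
  have hyW : y ∈ cone W := ⟨hy.1, hVW hy.2⟩
  refine ⟨fun hyd => ?_, lieDeriv_eq_zero_of_potential (hF.contDiffAt_cone hyW).da
    (hF.closed_cone hyW) (smoothOn_cone hχ hy) ?_⟩
  · rw [← hyL.self_of_nhds, coneField, rad_of_mem hyd, retr_of_mem hyd, one_smul]
  · filter_upwards [hC.mem_nhds hy, hyL] with z hz hzL w
    rw [hpot z hz, hzL]

end Killing

/-! ### Potentials of closed forms -/

section Poincare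

section Parametric

variable {E : Type} [NormedAddCommGroup E] [NormedSpace ℝ E] [ProperSpace E] {U : Set E}

/-- Differentiation under the integral sign. The dominating constant comes from compactness of a
closed ball times the unit interval. -/
theorem hasFDerivAt_integral {F : Type} [NormedAddCommGroup F] [NormedSpace ℝ F] (hU : IsOpen U)
    {G : E → ℝ → F}
    (hG : ∀ x ∈ U, ∀ t ∈ Icc (0 : ℝ) 1, ContDiffAt ℝ ∞ (fun p : E × ℝ => G p.1 p.2) (x, t)) {x : E}
    (hx : x ∈ U) :
    HasFDerivAt (fun x => ∫ t in (0 : ℝ)..1, G x t)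
      (∫ t in (0 : ℝ)..1, (fderiv ℝ (fun p : E × ℝ => G p.1 p.2) (x, t)).comp
        (ContinuousLinearMap.inl ℝ E ℝ)) x := by
  set G' : E × ℝ → E →L[ℝ] F := fun p => (fderiv ℝ (fun p : E × ℝ => G p.1 p.2) p).comp
    (ContinuousLinearMap.inl ℝ E ℝ) with hG'
  have hc' : ∀ x ∈ U, ∀ t ∈ Icc (0 : ℝ) 1, ContinuousAt G' (x, t) := fun x hx t ht =>
    (((hG x hx t ht).fderiv_right (m := ∞) (by simp)).continuousAt).clm_comp continuousAt_const
  have hcont : ∀ x ∈ U, ContinuousOn (G x) (Icc 0 1) := fun x hx t ht =>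
    (ContinuousAt.comp (f := fun t : ℝ => (x, t)) (hG x hx t ht).continuousAt
      (by fun_prop)).continuousWithinAt
  have hcont' : ContinuousOn (fun t => G' (x, t)) (Icc 0 1) := fun t ht =>
    (ContinuousAt.comp (f := fun t : ℝ => (x, t)) (hc' x hx t ht) (by fun_prop)).continuousWithinAt
  obtain ⟨r, hr, hball⟩ := Metric.nhds_basis_closedBall.mem_iff.1 (hU.mem_nhds hx)
  have hK : IsCompact (Metric.closedBall x r ×ˢ Icc (0 : ℝ) 1) :=
    (isCompact_closedBall x r).prod isCompact_Icc
  obtain ⟨B, hB⟩ := hK.exists_bound_of_continuousOn (f := G') fun p hp =>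
    (hc' p.1 (hball hp.1) p.2 hp.2).continuousWithinAt
  have hsub : ∀ {t : ℝ}, t ∈ uIoc (0 : ℝ) 1 → t ∈ Icc (0 : ℝ) 1 := fun {t} ht => by
    rw [uIoc_of_le zero_le_one] at ht
    exact Ioc_subset_Icc_self ht
  have hms : ∀ {F' : Type} [NormedAddCommGroup F'] {g : ℝ → F'}, ContinuousOn g (Icc 0 1) →
      MeasureTheory.AEStronglyMeasurable g (MeasureTheory.volume.restrict (uIoc (0 : ℝ) 1)) := by
    intro F' _ g hg
    rw [uIoc_of_le zero_le_one]
    exact (hg.mono Ioc_subset_Icc_self).aestronglyMeasurable measurableSet_Ioc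
  refine intervalIntegral.hasFDerivAt_integral_of_dominated_of_fderiv_le (F := G)
    (F' := fun x t => G' (x, t)) (bound := fun _ => B) (Metric.closedBall_mem_nhds x hr) ?_ ?_ ?_ ?_ ?_ ?_
  · filter_upwards [hU.mem_nhds hx] with y hy using hms (hcont y hy)
  · exact ContinuousOn.intervalIntegrable (by rw [uIcc_of_le zero_le_one]; exact hcont x hx)
  · exact hms hcont'
  · exact .of_forall fun t ht y hy => hB (y, t) ⟨hy, hsub ht⟩
  · exact intervalIntegrable_const
  · refine .of_forall fun t ht y hy => ?_
    exact HasFDerivAt.comp (f := fun z : E => (z, t)) y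
      (hG y (hball hy) t (hsub ht)).da.hasFDerivAt (hasFDerivAt_prodMk_left y t)

theorem fderiv_integral_apply {F : Type} [NormedAddCommGroup F] [NormedSpace ℝ F]
    [CompleteSpace F] (hU : IsOpen U) {G : E → ℝ → F}
    (hG : ∀ x ∈ U, ∀ t ∈ Icc (0 : ℝ) 1, ContDiffAt ℝ ∞ (fun p : E × ℝ => G p.1 p.2) (x, t)) {x : E}
    (hx : x ∈ U) (u : E) :
    IntervalIntegrable (fun t => (fderiv ℝ (fun p : E × ℝ => G p.1 p.2) (x, t)).comp
        (ContinuousLinearMap.inl ℝ E ℝ) u) MeasureTheory.volume 0 1 ∧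
    fderiv ℝ (fun x => ∫ t in (0 : ℝ)..1, G x t) x u =
      ∫ t in (0 : ℝ)..1, (fderiv ℝ (fun p : E × ℝ => G p.1 p.2) (x, t)).comp
        (ContinuousLinearMap.inl ℝ E ℝ) u := by
  have hI : IntervalIntegrable (fun t => (fderiv ℝ (fun p : E × ℝ => G p.1 p.2) (x, t)).comp
      (ContinuousLinearMap.inl ℝ E ℝ)) MeasureTheory.volume 0 1 := by
    refine ContinuousOn.intervalIntegrable fun t ht => ContinuousAt.continuousWithinAt ?_
    rw [uIcc_of_le zero_le_one] at ht
    exact ContinuousAt.clm_comp (ContinuousAt.comp (f := fun t : ℝ => (x, t))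
      ((hG x hx t ht).fderiv_right (m := ∞) (by simp)).continuousAt (by fun_prop)) continuousAt_const
  refine ⟨⟨hI.1.apply_continuousLinearMap u, hI.2.apply_continuousLinearMap u⟩, ?_⟩
  rw [(hasFDerivAt_integral hU hG hx).fderiv, ContinuousLinearMap.intervalIntegral_apply hI u]

/-- Induction on the order, for all target spaces simultaneously: the derivative is an integral of
the same kind with values in linear maps. -/
theorem contDiffAt_integral (n : ℕ) : ∀ {F : Type} [NormedAddCommGroup F] [NormedSpace ℝ F]
    (_ : IsOpen U) {G : E → ℝ → F}
    (_ : ∀ x ∈ U, ∀ t ∈ Icc (0 : ℝ) 1, ContDiffAt ℝ ∞ (fun p : E × ℝ => G p.1 p.2) (x, t)) {x : E}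
    (_ : x ∈ U), ContDiffAt ℝ n (fun x => ∫ t in (0 : ℝ)..1, G x t) x := by
  induction n with
  | zero =>
    intro F _ _ hU G hG x hx
    refine contDiffAt_zero.2 ⟨U, hU.mem_nhds hx, fun y hy => ?_⟩
    exact (hasFDerivAt_integral hU hG hy).continuousAt.continuousWithinAt
  | succ n ih =>
    intro F _ _ hU G hG x hx
    refine contDiffAt_succ_iff_hasFDerivAt.2 ⟨_, ⟨U, hU.mem_nhds hx, fun y hy =>
      hasFDerivAt_integral hU hG hy⟩, ?_⟩
    exact ih hU (G := fun x t => (fderiv ℝ (fun p : E × ℝ => G p.1 p.2) (x, t)).comp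
      (ContinuousLinearMap.inl ℝ E ℝ)) (fun y hy t ht =>
      ((hG y hy t ht).fderiv_right (m := ∞) (by simp)).clm_comp contDiffAt_const) hx

end Parametric

/-- The Poincaré lemma for `2`-forms on a ball. -/
theorem exists_primitive_form {θ : M → M [⋀^Fin 2]→L[ℝ] ℝ} {a : M} {r : ℝ}
    (hθ : ∀ y ∈ Metric.ball a r, ContDiffAt ℝ ∞ θ y)
    (hcl : ∀ y ∈ Metric.ball a r, extDeriv θ y = 0) :
    ∃ A : M → M →L[ℝ] ℝ, ∀ y ∈ Metric.ball a r, ContDiffAt ℝ ∞ A y ∧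
      ∀ v w, fderiv ℝ A y v w - fderiv ℝ A y w v = θ y ![v, w] := by
  set c : ℝ → M → M := fun t y => a + t • (y - a) with hcdef
  have hmem : ∀ y ∈ Metric.ball a r, ∀ t ∈ Icc (0 : ℝ) 1, c t y ∈ Metric.ball a r := by
    intro y hy t ht
    rw [mem_ball_iff_norm] at hy ⊢
    rw [hcdef, add_sub_cancel_left, norm_smul, Real.norm_of_nonneg ht.1]
    exact (mul_le_of_le_one_left (norm_nonneg _) ht.2).trans_lt hy
  -- The radial homotopy operator: the primitive is the integral over `t` of `t θ(a + t(y - a))(y -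
  -- a, ·)`.
  set G : M → ℝ → M →L[ℝ] ℝ := fun y t =>
    ∑ j, (t * θ (c t y) ![y - a, Pi.single j 1]) • ContinuousLinearMap.proj j with hGdef
  have hGapp : ∀ y t v, G y t v = t * θ (c t y) ![y - a, v] := by
    intro y t v
    rw [form_sum_right, hGdef, Finset.mul_sum]
    simp only [_root_.sum_apply, _root_.smul_apply,
      ContinuousLinearMap.proj_apply, smul_eq_mul]
    exact Finset.sum_congr rfl fun j _ => by ring
  have hG : ∀ y ∈ Metric.ball a r, ∀ t ∈ Icc (0 : ℝ) 1,
      ContDiffAt ℝ ∞ (fun p : M × ℝ => G p.1 p.2) (y, t) := by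
    intro y hy t ht
    refine ContDiffAt.sum fun j _ => ContDiffAt.smul (contDiffAt_snd.mul ?_) contDiffAt_const
    have h1 : ContDiffAt ℝ ∞ (fun p : M × ℝ => θ (c p.2 p.1)) (y, t) :=
      ContDiffAt.comp (f := fun p : M × ℝ => c p.2 p.1) (y, t) (hθ _ (hmem y hy t ht))
        (by simp only [hcdef]; fun_prop)
    exact contDiffAt_form_apply_apply h1 (by fun_prop) contDiffAt_const
  set G' : M → ℝ → M →L[ℝ] M →L[ℝ] ℝ := fun y t =>
    (fderiv ℝ (fun p : M × ℝ => G p.1 p.2) (y, t)).comp (ContinuousLinearMap.inl ℝ M ℝ) with hG'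
  have hGd : ∀ y ∈ Metric.ball a r, ∀ t ∈ Icc (0 : ℝ) 1,
      HasFDerivAt (fun z => G z t) (G' y t) y := fun y hy t ht =>
    HasFDerivAt.comp (f := fun z : M => (z, t)) y (hG y hy t ht).da.hasFDerivAt
      (hasFDerivAt_prodMk_left y t)
  have hval : ∀ y ∈ Metric.ball a r, ∀ t ∈ Icc (0 : ℝ) 1, ∀ u v, G' y t u v =
      t ^ 2 * fderiv ℝ θ (c t y) u ![y - a, v] + t * θ (c t y) ![u, v] := by
    intro y hy t ht u v
    have hθt : HasFDerivAt (fun z => θ (c t z))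
        ((fderiv ℝ θ (c t y)).comp (t • ContinuousLinearMap.id ℝ M)) y := by
      refine HasFDerivAt.comp (f := c t) y (hθ _ (hmem y hy t ht)).da.hasFDerivAt ?_
      exact (((hasFDerivAt_id y).sub_const a).const_smul t).const_add a
    have h1 : HasFDerivAt (fun z => G z t v) ((G' y t).flip v) y := by
      refine ((hGd y hy t ht).clm_apply (hasFDerivAt_const v y)).congr_fderiv ?_
      ext; simp
    have h2 := fderiv_form_linear hθt.differentiableAt (ContinuousLinearMap.id ℝ M) v u
    have h3 := fderiv_form_apply hθt.differentiableAt u v a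
    rw [hθt.fderiv] at h2 h3
    have d2 : DifferentiableAt ℝ (fun z => θ (c t z) ![v, z]) y :=
      (contDiffAt_form_apply_apply (θ := fun z => θ (c t z)) (k := 1)
        (ContDiffAt.comp (f := c t) y ((hθ _ (hmem y hy t ht)).of_le (by simp))
          (by simp only [hcdef]; fun_prop)) contDiffAt_const contDiffAt_id).differentiableAt (by simp)
    have d3 : DifferentiableAt ℝ (fun z => θ (c t z) ![v, a]) y :=
      ((ContinuousAlternatingMap.apply ℝ M ℝ ![v, a]).differentiableAt).comp y hθt.differentiableAt
    have h4 : (fun z => G z t v) = fun z => t * (θ (c t z) ![v, a] - θ (c t z) ![v, z]) := by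
      funext z
      rw [hGapp, ← form_sub_right, form_swap, ← form_neg_right, neg_sub]
    have h5 : G' y t u v = fderiv ℝ (fun z => G z t v) y u := by rw [h1.fderiv]; rfl
    rw [h5, h4, fderiv_const_mul (d3.fun_sub d2), fderiv_fun_sub d3 d2]
    simp only [_root_.smul_apply, _root_.sub_apply, smul_eq_mul]
    rw [← h3]
    have h2' : fderiv ℝ (fun z => θ (c t z) ![v, z]) y u = _ := h2
    rw [h2', form_sub_left, form_swap _ y v, form_swap _ a v, form_swap (θ (c t y)) u v]
    simp
    ring
  refine ⟨fun y => ∫ t in (0 : ℝ)..1, G y t, fun y hy => ⟨contDiffAt_infty.2 fun n =>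
    contDiffAt_integral n Metric.isOpen_ball hG hy, fun v w => ?_⟩⟩
  have hI' : ∀ u, IntervalIntegrable (fun t => G' y t u) MeasureTheory.volume 0 1 := fun u =>
    (fderiv_integral_apply Metric.isOpen_ball hG hy u).1
  have hI'' : ∀ u v, IntervalIntegrable (fun t => G' y t u v) MeasureTheory.volume 0 1 := fun u v =>
    ⟨(hI' u).1.apply_continuousLinearMap v, (hI' u).2.apply_continuousLinearMap v⟩
  have happ : ∀ u v, fderiv ℝ (fun y => ∫ t in (0 : ℝ)..1, G y t) y u v =
      ∫ t in (0 : ℝ)..1, G' y t u v := by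
    intro u v
    rw [(fderiv_integral_apply Metric.isOpen_ball hG hy u).2,
      ContinuousLinearMap.intervalIntegral_apply (hI' u) v]
  rw [happ, happ, ← intervalIntegral.integral_sub (hI'' v w) (hI'' w v)]
  -- By closedness, the antisymmetrised derivative of the integrand is the `t`-derivative of `t² θ`
  -- along the ray; the endpoints give `θ(y)` and 0.
  have hd : ∀ t ∈ uIcc (0 : ℝ) 1, HasDerivAt (fun t => t ^ 2 * θ (c t y) ![v, w])
      (G' y t v w - G' y t w v) t := by
    intro t ht
    rw [uIcc_of_le zero_le_one] at ht
    have h0 := hmem y hy t ht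
    have h1 : HasDerivAt (fun t => c t y) (y - a) t := by
      have := ((hasDerivAt_id t).smul_const (y - a)).const_add a
      rwa [one_smul] at this
    have h2 : HasDerivAt (fun t => θ (c t y) ![v, w]) (fderiv ℝ θ (c t y) (y - a) ![v, w]) t := by
      rw [fderiv_form_apply (hθ _ h0).da]
      exact HasFDerivAt.comp_hasDerivAt (f := fun t => c t y) (l := fun z => θ z ![v, w]) t
        (contDiffAt_form_apply (hθ _ h0) v w).da.hasFDerivAt h1
    refine ((hasDerivAt_pow 2 t).mul h2).congr_deriv ?_
    rw [hval y hy t ht, hval y hy t ht]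
    have hc := (extDeriv_eq_zero_iff _).1 (hcl _ h0) (y - a) v w
    rw [form_swap (θ (c t y)) w v]
    push_cast
    linear_combination t ^ 2 * hc
  rw [intervalIntegral.integral_eq_sub_of_hasDerivAt hd ((hI'' v w).sub (hI'' w v))]
  simp [hcdef]

end Poincare

/-! ### Invariance of `F` yields symmetry operators. -/

section Sufficient

variable {e ζ m : ℝ} {V W : Set M} {A : M → M →L[ℝ] ℝ} {F : M → M [⋀^Fin 2]→L[ℝ] ℝ} {χ : M → ℝ}

/-- The primitive of the extended form is found on a ball in Minkowski space and pulled back by the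
retraction; second derivatives of the retraction cancel in the curl. -/
theorem exists_potential (hF : IsEMField F W) {a : M} {r : ℝ} (hr : Metric.ball a r ⊆ cone W) :
    ∃ A, IsPotential A F (Metric.ball a r ∩ dS) := by
  obtain ⟨A, hA⟩ := exists_primitive_form (fun y hy => hF.contDiffAt_cone (hr hy))
    fun y hy => hF.closed_cone (hr hy)
  refine ⟨A, fun y hy => ?_, fun y hy v w => ?_⟩
  · have h1 : ContDiffAt ℝ ∞ A (retr y) := by rw [retr_of_mem hy.2]; exact (hA y hy.1).1
    exact (h1.comp y (contDiffAt_retr (dS_neg hy.2))).clm_comp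
      ((contDiffAt_retr (dS_neg hy.2)).fderiv_right (m := ∞) (by simp))
  · have hy' := retr_of_mem hy.2
    have hn := dS_neg hy.2
    have h1 : HasFDerivAt (fun z => A (retr z)) ((fderiv ℝ A y).comp (fderiv ℝ retr y)) y := by
      have h2 : HasFDerivAt A (fderiv ℝ A y) (retr y) := by
        rw [hy']; exact (hA y hy.1).1.da.hasFDerivAt
      exact h2.comp y (differentiableAt_retr hn).hasFDerivAt
    have h3 : HasFDerivAt (fderiv ℝ retr) (fderiv ℝ (fderiv ℝ retr) y) y :=
      ((contDiffAt_retr hn).fderiv_right (m := ∞) (by simp)).da.hasFDerivAt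
    have h4 : ∀ v w, fderiv ℝ (ext₁ A) y v w =
        fderiv ℝ A y (fderiv ℝ retr y v) (fderiv ℝ retr y w) +
          A y (fderiv ℝ (fderiv ℝ retr) y v w) := by
      intro v w
      have h5 : fderiv ℝ (ext₁ A) y = _ := (h1.clm_comp h3).fderiv
      rw [h5]
      simp [hy', add_comm]
    rw [h4, h4, symm_snd (contDiffAt_retr hn) v w, add_sub_add_right_eq_sub, (hA y hy.1).2,
      ← ext₂_retr_apply (v := v) hn, hy']

/-- By Cartan's formula the contraction of a closed invariant form is closed, hence exact on a ball.
-/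
theorem exists_contraction_primitive (hF : IsEMField F W) {L : M →L[ℝ] M} (hL : IsSkew L)
    (h : LieInvariant L F W) {a : M} {r : ℝ} (hr : Metric.ball a r ⊆ cone W) :
    ∃ χ : M → ℝ, SmoothOn χ (Metric.ball a r ∩ dS) ∧ ∀ y ∈ Metric.ball a r ∩ dS, ∀ w,
      fderiv ℝ (fun z => χ (retr z)) y w = ext₂ F y ![w, L y] := by
  set κ : M → M →L[ℝ] ℝ := fun y =>
    ∑ j, ext₂ F y ![Pi.single j 1, L y] • ContinuousLinearMap.proj j with hκ
  have happ : ∀ y w, κ y w = ext₂ F y ![w, L y] := by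
    intro y w
    rw [form_swap, form_sum_right, hκ, ← Finset.sum_neg_distrib]
    simp only [_root_.sum_apply, _root_.smul_apply, ContinuousLinearMap.proj_apply, smul_eq_mul]
    refine Finset.sum_congr rfl fun j _ => ?_
    rw [form_swap]; ring
  have hs : ∀ y ∈ Metric.ball a r, ContDiffAt ℝ ∞ κ y := fun y hy =>
    ContDiffAt.sum fun j _ => ContDiffAt.smul (contDiffAt_form_apply_apply
      (hF.contDiffAt_cone (hr hy)) contDiffAt_const L.contDiff.contDiffAt) contDiffAt_const
  have hval : ∀ y ∈ Metric.ball a r, ∀ u w, fderiv ℝ κ y u w =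
      fderiv ℝ (ext₂ F) y u ![w, L y] + ext₂ F y ![w, L u] := by
    intro y hy u w
    have h1 : fderiv ℝ κ y u w = fderiv ℝ (fun z => κ z w) y u := by
      have := ((hs y hy).da.hasFDerivAt.clm_apply (hasFDerivAt_const w y)).fderiv
      rw [this]; simp
    simp only [h1, happ]
    exact fderiv_form_linear (hF.contDiffAt_cone (hr hy)).da L w u
  obtain ⟨f, hf⟩ := (convex_ball a r).exists_forall_hasFDerivAt_of_fderiv_symmetric
    Metric.isOpen_ball (show DifferentiableOn ℝ κ _ from
      fun y hy => (hs y hy).da.differentiableWithinAt) (by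
      intro y hy v w
      rw [hval y hy, hval y hy]
      have h1 := h.cone hF hL (hr hy) v w
      have h2 := (extDeriv_eq_zero_iff y).1 (hF.closed_cone (hr hy)) (L y) v w
      rw [lieDeriv, L.fderiv] at h1
      rw [form_swap _ w (L y), form_swap (ext₂ F y) w (L v)]
      rw [form_swap _ v (L y)]
      linarith)
  refine ⟨f, fun y hy => ?_, fun y hy w => ?_⟩
  · have h1 : ContDiffAt ℝ ∞ f (retr y) := by
      rw [retr_of_mem hy.2]; exact contDiffAt_of_hasFDerivAt Metric.isOpen_ball hf hs hy.1
    exact h1.comp y (contDiffAt_retr (dS_neg hy.2))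
  · have hn := dS_neg hy.2
    have h2 : HasFDerivAt f (κ y) (retr y) := by
      rw [retr_of_mem hy.2]; exact hf y hy.1
    have h3 : fderiv ℝ (fun z => f (retr z)) y = _ :=
      (h2.comp y (differentiableAt_retr hn).hasFDerivAt).fderiv
    rw [h3, ContinuousLinearMap.comp_apply, happ]
    conv_rhs => rw [← ext₂_retr_apply hn, fderiv_retr_tangent hy.2 (hL.self y)]
    rw [retr_of_mem hy.2]

theorem coneField_linear (L : M →L[ℝ] M) {y : M} (hy : mink y y < 0) : coneField L y = L y := by
  rw [coneField, ← map_smul, rad_smul_retr hy]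

theorem curv_smul {t : ℝ} (ht : 0 < t) (i j : Fin 4) (y : M) :
    curv e (ext₁ A) i j y = (t * t) • curv e (ext₁ A) i j (t • y) := by
  rw [curv, curv, pd_of_homogeneous (fun z => pot_smul ht j z) i,
    pd_of_homogeneous (fun z => pot_smul ht i z) j, smul_sub]

theorem zeroth_retr {t : ℝ} (ht : 0 < t) (y : M) : zeroth e χ (t • y) = zeroth e χ y := by
  simp only [zeroth, retr_smul ht]

theorem opY_smul (X : M → M) {t : ℝ} (ht : 0 < t) (i : Fin 4) (y : M) :
    opY e (ext₁ A) (fun j y => (coneField X y j : ℂ)) (zeroth e χ) i y =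
      t • opY e (ext₁ A) (fun j y => (coneField X y j : ℂ)) (zeroth e χ) i (t • y) := by
  rw [opY, opY, pd_of_homogeneous (s := 1) (t := t) (fun z => by rw [zeroth_retr ht, one_smul]) i y,
    one_mul, smul_sub, Finset.smul_sum]
  congr 1
  refine Finset.sum_congr rfl fun j _ => ?_
  rw [curv_smul ht, coneField_smul X ht y]
  have : (t : ℂ) ≠ 0 := by exact_mod_cast ht.ne'
  simp only [Pi.smul_apply, smul_eq_mul, Complex.real_smul]
  push_cast
  field_simp

/-- With `dχ = F(·, L)` the lower-order coefficients of the commutator vanish and second derivatives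
of a linear field are zero. What remains pairs the skew matrix of `L` with `2 D_j D_i - curv_ij`,
which is the symmetrised product `D_i D_j + D_j D_i`. -/
theorem isSymmetryOperator_of_contraction (hV : IsOpenIn V) (hA : IsPotential A F V)
    {L : M →L[ℝ] M} (hL : IsSkew L) (hχ : SmoothOn χ V)
    (h : ∀ y ∈ V, ∀ w, fderiv ℝ (fun z => χ (retr z)) y w = ext₂ F y ![w, L y]) :
    IsSymmetryOperator ζ m e A L χ V := by
  have hX : SmoothOn (L : M → M) V := fun y hy =>
    L.contDiff.contDiffAt.comp y (contDiffAt_retr (dS_neg (hV.subset hy)))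
  have ht : ∀ y ∈ V, mink y (L y) = 0 := fun y _ => hL.self y
  have hC := isOpen_cone hV
  -- Isometries commute with the operator, so the factor is `q = 0`.
  refine ⟨hX, ht, hχ, fun _ => 0, fun φ hφ x hx => ?_⟩
  have hxc := subset_cone hV.subset hx
  have ha : ∀ y ∈ cone V, ContDiffAt ℝ ∞ (ext₁ A) y := fun y hy => ext₁_cone hA.1 hy
  have hc : ∀ j, ∀ y ∈ cone V, ContDiffAt ℝ ∞ (fun y => (coneField L y j : ℂ)) y := fun j y hy =>
    contDiffAt_coneField_coe hX hy j
  have hb : ∀ y ∈ cone V, ContDiffAt ℝ ∞ (zeroth e χ) y := fun y hy => contDiffAt_zeroth hχ hy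
  have hf : ∀ y ∈ cone V, ContDiffAt ℝ ∞ (fun z => φ (retr z)) y := fun y hy => smoothOn_cone hφ hy
  rw [zero_mul, commutator_eq hV hA.1 hX ht hχ hφ hx, box_Op hC ha hc hb hf hxc]
  have hY : ∀ i, ∀ y ∈ cone V,
      opY e (ext₁ A) (fun j y => (coneField L y j : ℂ)) (zeroth e χ) i y = 0 := by
    intro i y hy
    rw [opY_smul _ (inv_pos.2 (rad_pos hy.1)), ← retr_eq, opY_eq hV hA hχ hy.2, defect, h _ hy.2]
    simp
  have hpd : ∀ i j, ∀ y ∈ cone V, pd i (fun y => (coneField L y j : ℂ)) y =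
      ((L (Pi.single i 1) j : ℝ) : ℂ) := by
    intro i j y hy
    have h1 : (fun y => (coneField L y j : ℂ)) =ᶠ[𝓝 y] fun y => ((L y j : ℝ) : ℂ) := by
      filter_upwards [hC.mem_nhds hy] with z hz
      rw [coneField_linear L hz.1]
    rw [pd_congr' h1, pd_ofReal (by fun_prop), pd, fderiv_comp_coord L.differentiableAt, L.fderiv]
  have hpp : ∀ i j, pd i (pd i (fun y => (coneField L y j : ℂ))) x = 0 := by
    intro i j
    have h1 : pd i (fun y => (coneField L y j : ℂ)) =ᶠ[𝓝 x] fun _ => ((L (Pi.single i 1) j : ℝ) : ℂ) := by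
      filter_upwards [hC.mem_nhds hxc] with z hz using hpd i j z hz
    rw [pd_congr' h1]
    simp [pd]
  have hpY : ∀ i, pd i (opY e (ext₁ A) (fun j y => (coneField L y j : ℂ)) (zeroth e χ) i) x = 0 := by
    intro i
    have h1 : opY e (ext₁ A) (fun j y => (coneField L y j : ℂ)) (zeroth e χ) i =ᶠ[𝓝 x] fun _ => 0 := by
      filter_upwards [hC.mem_nhds hxc] with z hz using hY i z hz
    rw [pd_congr' h1]
    simp [pd]
  have hsk := isSkew_iff.1 hL
  have hterm : ∀ i, (eta i : ℂ) * (2 * Op e (ext₁ A) (fun j => pd i (fun y => (coneField L y j : ℂ)))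
      (opY e (ext₁ A) (fun j y => (coneField L y j : ℂ)) (zeroth e χ) i)
      (Dc e (ext₁ A) i (fun z => φ (retr z))) x
        + Op e (ext₁ A) (fun j => pd i (pd i (fun y => (coneField L y j : ℂ))))
          (opY e (ext₁ A) (fun j => pd i (fun y => (coneField L y j : ℂ)))
            (opY e (ext₁ A) (fun j y => (coneField L y j : ℂ)) (zeroth e χ) i) i)
          (fun z => φ (retr z)) x) =
      ∑ j, ((eta i * L (Pi.single i 1) j : ℝ) : ℂ) *
        (2 * Dc e (ext₁ A) j (Dc e (ext₁ A) i (fun z => φ (retr z))) x -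
          curv e (ext₁ A) i j x * φ (retr x)) := by
    intro i
    simp only [Op, hpp, hY i x hxc]
    rw [opY, hpY]
    simp only [hpd _ _ x hxc, zero_mul, Finset.sum_const_zero, add_zero, zero_sub,
      Finset.mul_sum, Finset.sum_mul, neg_mul, ← sub_eq_add_neg,
      ← Finset.sum_sub_distrib]
    refine Finset.sum_congr rfl fun j _ => ?_
    push_cast
    ring
  rw [Finset.sum_congr rfl fun i _ => hterm i]
  have hanti : ∀ i j, ((eta i * L (Pi.single i 1) j : ℝ) : ℂ) =
      -((eta j * L (Pi.single j 1) i : ℝ) : ℂ) := by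
    intro i j
    have := hsk i j
    rw [← Complex.ofReal_neg]
    congr 1
    linear_combination (eta i * eta j) * this - eta i * L (Pi.single i 1) j * eta_mul_self j
      - eta j * L (Pi.single j 1) i * eta_mul_self i
  set S : Fin 4 → Fin 4 → ℂ := fun i j => ((eta i * L (Pi.single i 1) j : ℝ) : ℂ) *
        (2 * Dc e (ext₁ A) j (Dc e (ext₁ A) i (fun z => φ (retr z))) x -
          curv e (ext₁ A) i j x * φ (retr x)) with hS
  have hSS : ∀ i j, S i j = -S j i := by
    intro i j
    simp only [hS]
    rw [hanti i j, Dc_comm (ha x hxc) (hf x hxc) j i]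
    have : curv e (ext₁ A) j i x = - curv e (ext₁ A) i j x := by rw [curv, curv]; ring
    rw [this]
    ring
  have h2 : ∑ i, ∑ j, S i j = -∑ i, ∑ j, S i j := by
    conv_lhs => rw [Finset.sum_comm]
    simp only [← Finset.sum_neg_distrib]
    exact Finset.sum_congr rfl fun i _ => Finset.sum_congr rfl fun j _ => hSS j i
  exact self_eq_neg.1 h2

/-- Killing fields that preserve `F` are symmetry fields. -/
theorem isSymmetryField_of_lieInvariant (hW : IsOpenIn W) (hF : IsEMField F W) {L : M →L[ℝ] M}
    (hL : IsSkew L) (h : LieInvariant L F W) : IsSymmetryField ζ m e F W L := by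
  intro x hx
  obtain ⟨r, hr, hball⟩ := Metric.isOpen_iff.1 (isOpen_cone hW) x (subset_cone hW.subset hx)
  obtain ⟨A, hA⟩ := exists_potential hF hball
  obtain ⟨χ, hχ, hd⟩ := exists_contraction_primitive hF hL h hball
  have hV : IsOpenIn (Metric.ball x r ∩ dS) := ⟨_, Metric.isOpen_ball, rfl⟩
  refine ⟨_, hV, ⟨Metric.mem_ball_self hr, hW.subset hx⟩, fun y hy => ?_, A, χ, hA,
    isSymmetryOperator_of_contraction hV hA hL hχ hd⟩
  rw [← cone_inter_dS hW.subset]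
  exact ⟨hball hy.1, hy.2⟩

end Sufficient

/-! ### The spinor description of the Lorentz group -/

section Spinor

open scoped Matrix

/-- The Hermitian matrix of a vector in Minkowski space. -/
def herm (x : M) : Matrix (Fin 2) (Fin 2) ℂ :=
  !![(x 0 + x 3 : ℝ), ⟨x 1, -x 2⟩; ⟨x 1, x 2⟩, (x 0 - x 3 : ℝ)]

/-- The vector of a Hermitian matrix. -/
def unherm (A : Matrix (Fin 2) (Fin 2) ℂ) : M :=
  ![((A 0 0).re + (A 1 1).re) / 2, (A 1 0).re, (A 1 0).im, ((A 0 0).re - (A 1 1).re) / 2]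

theorem unherm_herm (x : M) : unherm (herm x) = x := by
  refine vec4_ext ?_ ?_ ?_ ?_ <;> simp [unherm, herm]

theorem herm_injective : Function.Injective herm := Function.LeftInverse.injective unherm_herm

theorem herm_unherm {A : Matrix (Fin 2) (Fin 2) ℂ} (h : Aᴴ = A) : herm (unherm A) = A := by
  have h1 := fun i j => congrFun (congrFun h i) j
  have h00 := h1 0 0
  have h11 := h1 1 1
  have h01 := h1 0 1
  simp only [Matrix.conjTranspose_apply, Complex.ext_iff, Complex.star_def, Complex.conj_re,
    Complex.conj_im] at h00 h11 h01
  ext i j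
  fin_cases i <;> fin_cases j <;> apply Complex.ext <;> simp [herm, unherm] <;> linarith

theorem conjTranspose_herm (x : M) : (herm x)ᴴ = herm x := by
  ext i j
  fin_cases i <;> fin_cases j <;> apply Complex.ext <;> simp [herm]

theorem herm_add (x y : M) : herm (x + y) = herm x + herm y := by
  ext i j
  fin_cases i <;> fin_cases j <;> apply Complex.ext <;> simp [herm] <;> ring_nf

theorem herm_smul (r : ℝ) (x : M) : herm (r • x) = r • herm x := by
  ext i j
  fin_cases i <;> fin_cases j <;> apply Complex.ext <;> simp [herm] <;> ring_nf

theorem herm_sub (x y : M) : herm (x - y) = herm x - herm y := by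
  rw [sub_eq_add_neg, ← neg_one_smul ℝ y, herm_add, herm_smul, neg_one_smul, sub_eq_add_neg]

theorem det_herm (x : M) : (herm x).det = (mink x x : ℝ) := by
  rw [Matrix.det_fin_two, mink_eq]
  apply Complex.ext <;> simp [herm] <;> ring

/-- The action `H ↦ g H gᴴ` on vectors. -/
def spin (g : Matrix (Fin 2) (Fin 2) ℂ) (x : M) : M := unherm (g * herm x * gᴴ)

theorem herm_spin (g : Matrix (Fin 2) (Fin 2) ℂ) (x : M) : herm (spin g x) = g * herm x * gᴴ :=
  herm_unherm (by simp [Matrix.conjTranspose_mul, conjTranspose_herm, Matrix.mul_assoc])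

theorem spin_spin {g h : Matrix (Fin 2) (Fin 2) ℂ} (H : g * h = 1) (x : M) :
    spin g (spin h x) = x := by
  apply herm_injective
  rw [herm_spin, herm_spin]
  calc g * (h * herm x * hᴴ) * gᴴ = (g * h) * herm x * (g * h)ᴴ := by
        simp only [Matrix.conjTranspose_mul, Matrix.mul_assoc]
    _ = herm x := by simp [H]

/-- The Lorentz transformation of an invertible matrix. -/
def spinEquiv (g h : Matrix (Fin 2) (Fin 2) ℂ) (H : g * h = 1) : M ≃L[ℝ] M :=
  LinearEquiv.toContinuousLinearEquiv
    { toFun := spin g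
      invFun := spin h
      left_inv := spin_spin (mul_eq_one_comm.1 H)
      right_inv := spin_spin H
      map_add' := fun x y => herm_injective (by
        simp only [herm_spin, herm_add, Matrix.mul_add, Matrix.add_mul])
      map_smul' := fun r x => herm_injective (by simp [herm_spin, herm_smul]) }

theorem isLorentz_of_self {τ : M ≃L[ℝ] M} (h : ∀ x, mink (τ x) (τ x) = mink x x) : IsLorentz τ := by
  intro x y
  have h1 := h (x + y)
  rw [map_add] at h1
  simp only [mink_add_left, mink_add_right, h, mink_comm (τ y) (τ x), mink_comm y x] at h1
  linarith

/-- The Minkowski square is the determinant of the Hermitian matrix and is multiplied by `|det g|²`,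
so a determinant of modulus 1 suffices. -/
theorem isLorentz_spinEquiv {g h : Matrix (Fin 2) (Fin 2) ℂ} (H : g * h = 1) (hg : ‖g.det‖ = 1) :
    IsLorentz (spinEquiv g h H) := by
  refine isLorentz_of_self fun x => ?_
  have h1 := det_herm (spin g x)
  rw [herm_spin, Matrix.det_mul, Matrix.det_mul, Matrix.det_conjTranspose, det_herm, mul_right_comm,
    Complex.star_def, Complex.mul_conj, Complex.normSq_eq_norm_sq, hg] at h1
  have h2 : mink (spin g x) (spin g x) = mink x x := by
    simp at h1
    exact_mod_cast h1.symm
  exact h2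

/-- Traceless complex `2 × 2` matrices `(p, b; c, -p)`. -/
abbrev Sl2 : Type := ℂ × ℂ × ℂ

/-- The matrix of an element of `Sl2`. -/
def Sl2.mat (x : Sl2) : Matrix (Fin 2) (Fin 2) ℂ := !![x.1, x.2.1; x.2.2, -x.1]

/-- The commutator in `Sl2`. -/
def Sl2.br (x y : Sl2) : Sl2 :=
  (x.2.1 * y.2.2 - y.2.1 * x.2.2, 2 * (x.1 * y.2.1 - y.1 * x.2.1), 2 * (x.2.2 * y.1 - y.2.2 * x.1))

theorem Sl2.mat_br (x y : Sl2) : (Sl2.br x y).mat = x.mat * y.mat - y.mat * x.mat := by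
  ext i j
  fin_cases i <;> fin_cases j <;> simp [Sl2.mat, Sl2.br] <;> ring

/-- The Killing field `H ↦ A H + H Aᴴ`. -/
def kill : Sl2 →ₗ[ℝ] (M → M) where
  toFun x := (2 * x.1.re) • J 0 3 + (2 * x.1.im) • J 1 2 + (x.2.1.re + x.2.2.re) • J 0 1 +
    (x.2.2.re - x.2.1.re) • J 1 3 + (x.2.2.im - x.2.1.im) • J 0 2 + (x.2.1.im + x.2.2.im) • J 2 3
  map_add' x y := by simp; module
  map_smul' r x := by simp; module

theorem kill_apply (x : Sl2) : kill x = (2 * x.1.re) • J 0 3 + (2 * x.1.im) • J 1 2 +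
    (x.2.1.re + x.2.2.re) • J 0 1 + (x.2.2.re - x.2.1.re) • J 1 3 + (x.2.2.im - x.2.1.im) • J 0 2 +
    (x.2.1.im + x.2.2.im) • J 2 3 := rfl

theorem Sl2.conjTranspose_mat (x : Sl2) :
    x.matᴴ = !![star x.1, star x.2.2; star x.2.1, -star x.1] := by
  ext i j
  fin_cases i <;> fin_cases j <;> simp [Sl2.mat]

theorem herm_kill (x : Sl2) (y : M) : herm (kill x y) = x.mat * herm y + herm y * x.matᴴ := by
  rw [Sl2.conjTranspose_mat]
  ext i j
  fin_cases i <;> fin_cases j <;> apply Complex.ext <;>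
    simp [herm, kill_apply, Sl2.mat, J, eta] <;> ring_nf

theorem kill_mem (x : Sl2) : kill x ∈ so13 := by
  rw [kill_apply]
  have := fun i j (r : ℝ) => so13.smul_mem r (J_mem i j)
  exact so13.add_mem (so13.add_mem (so13.add_mem (so13.add_mem (so13.add_mem (this _ _ _)
    (this _ _ _)) (this _ _ _)) (this _ _ _)) (this _ _ _)) (this _ _ _)

theorem J_swap (i j : Fin 4) : J i j = -J j i := by
  funext x
  simp [J]

theorem so13_le_range : so13 ≤ LinearMap.range kill := by
  have h : ∀ i j : Fin 4, i < j → J i j ∈ LinearMap.range kill := by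
    intro i j hij
    have e : ∀ x : Sl2, ∀ Y, kill x = Y → Y ∈ LinearMap.range kill := fun x Y h => ⟨x, h⟩
    fin_cases i <;> fin_cases j <;> first | exact absurd hij (by decide) | skip
    · exact e (0, 1 / 2, 1 / 2) (J 0 1) (by norm_num [kill_apply])
    · exact e (0, -(Complex.I / 2), Complex.I / 2) (J 0 2) (by norm_num [kill_apply])
    · exact e (1 / 2, 0, 0) (J 0 3) (by norm_num [kill_apply])
    · exact e (Complex.I / 2, 0, 0) (J 1 2) (by norm_num [kill_apply])
    · exact e (0, -(1 / 2), 1 / 2) (J 1 3) (by norm_num [kill_apply])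
    · exact e (0, Complex.I / 2, Complex.I / 2) (J 2 3) (by norm_num [kill_apply])
  refine Submodule.span_le.2 ?_
  rintro _ ⟨i, j, rfl⟩
  rcases lt_trichotomy i j with hij | rfl | hij
  · exact h i j hij
  · have : J i i = 0 := by funext x; simp [J]
    rw [this]
    exact Submodule.zero_mem _
  · rw [J_swap]
    exact Submodule.neg_mem _ (h j i hij)

/-- Vector field brackets reverse matrix commutators, hence the swapped arguments; subalgebras
correspond all the same. -/
theorem lieBracket_kill (x y : Sl2) :
    VectorField.lieBracket ℝ (kill x) (kill y) = kill (Sl2.br y x) := by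
  obtain ⟨K, -, hK⟩ := mem_so13_iff.1 (kill_mem x)
  obtain ⟨L, -, hL⟩ := mem_so13_iff.1 (kill_mem y)
  rw [← hK, ← hL, lieBracket_linear]
  funext v
  apply herm_injective
  have h1 : (L.comp K - K.comp L : M →L[ℝ] M) v = kill y (kill x v) - kill x (kill y v) := by
    rw [← hK, ← hL]; rfl
  rw [h1, herm_sub]
  simp only [herm_kill, Sl2.mat_br, Matrix.conjTranspose_sub, Matrix.conjTranspose_mul]
  noncomm_ring

/-- `𝔤` is conjugate to one of the listed algebras. -/
def Classified (𝔤 : Submodule ℝ Sl2) : Prop :=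
  ∃ (R : Row) (τ : M ≃L[ℝ] M), IsLorentz τ ∧ pushField τ '' (kill '' (𝔤 : Set Sl2)) = R.alg

/-- A symmetry of `Sl2` that is implemented by a Lorentz transformation. -/
def IsMove (f : Sl2 ≃ₗ[ℝ] Sl2) : Prop :=
  (∀ x y, f (Sl2.br x y) = Sl2.br (f x) (f y)) ∧
    ∃ τ : M ≃L[ℝ] M, IsLorentz τ ∧ ∀ x, pushField τ (kill (f x)) = kill x

/-- Lets the classification replace an algebra by a conjugate one in normal form. -/
theorem Classified.of_move {𝔤 : Submodule ℝ Sl2} {f : Sl2 ≃ₗ[ℝ] Sl2} (hf : IsMove f)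
    (h : Classified (𝔤.comap (f : Sl2 →ₗ[ℝ] Sl2))) : Classified 𝔤 := by
  obtain ⟨-, σ, hσ, hk⟩ := hf
  obtain ⟨R, τ, hτ, h⟩ := h
  refine ⟨R, σ.trans τ, fun x y => (hτ _ _).trans (hσ _ _), ?_⟩
  rw [← h]
  have h1 : ∀ X, pushField (σ.trans τ) X = pushField τ (pushField σ X) := fun X => rfl
  ext Y
  constructor
  · rintro ⟨_, ⟨x, hx, rfl⟩, rfl⟩
    refine ⟨_, ⟨f.symm x, by simpa using hx, rfl⟩, ?_⟩
    rw [h1, ← hk, f.apply_symm_apply]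
  · rintro ⟨_, ⟨x, hx, rfl⟩, rfl⟩
    exact ⟨_, ⟨f x, hx, rfl⟩, by rw [h1, hk]⟩

/-- Conjugation preserves commutators, and conjugating `A` in `H ↦ A H + H Aᴴ` amounts to
transporting the field by `H ↦ g H gᴴ`. -/
theorem isMove_of_conj {f : Sl2 ≃ₗ[ℝ] Sl2} {g h : Matrix (Fin 2) (Fin 2) ℂ} (H : g * h = 1)
    (hg : ‖g.det‖ = 1) (hf : ∀ x, (f x).mat = h * x.mat * g) : IsMove f := by
  have H' := mul_eq_one_comm.1 H
  have hinj : Function.Injective Sl2.mat := by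
    intro x y hxy
    have h1 := fun i j => congrFun (congrFun hxy i) j
    have h00 := h1 0 0
    have h01 := h1 0 1
    have h10 := h1 1 0
    simp [Sl2.mat] at h00 h01 h10
    exact Prod.ext h00 (Prod.ext h01 h10)
  have hm : ∀ A B : Matrix (Fin 2) (Fin 2) ℂ, (h * A * g) * (h * B * g) = h * (A * B) * g := by
    intro A B
    calc (h * A * g) * (h * B * g) = h * A * (g * h) * B * g := by simp only [Matrix.mul_assoc]
      _ = _ := by simp [H, Matrix.mul_assoc]
  refine ⟨fun x y => hinj ?_, spinEquiv g h H, isLorentz_spinEquiv H hg, fun x => funext fun v => ?_⟩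
  · rw [hf, Sl2.mat_br, Sl2.mat_br, hf, hf, hm, hm, Matrix.mul_sub, Matrix.sub_mul]
  · apply herm_injective
    change herm (spin g (kill (f x) (spin h v))) = _
    rw [herm_spin, herm_kill, herm_kill, herm_spin, hf]
    have hH : gᴴ * hᴴ = 1 := by rw [← Matrix.conjTranspose_mul, H', Matrix.conjTranspose_one]
    have hH' : hᴴ * gᴴ = 1 := by rw [← Matrix.conjTranspose_mul, H, Matrix.conjTranspose_one]
    calc g * (h * x.mat * g * (h * herm v * hᴴ) + h * herm v * hᴴ * (h * x.mat * g)ᴴ) * gᴴ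
        = (g * h) * x.mat * (g * h) * herm v * (hᴴ * gᴴ) +
          (g * h) * herm v * (hᴴ * gᴴ) * x.matᴴ * (hᴴ * gᴴ) := by
          simp only [Matrix.conjTranspose_mul]; noncomm_ring
      _ = _ := by simp [H, hH']

/-- Conjugation by a unipotent matrix. -/
def shear (t : ℂ) : Sl2 ≃ₗ[ℝ] Sl2 where
  toFun x := (x.1 + t * x.2.2, x.2.1 - 2 * t * x.1 - t ^ 2 * x.2.2, x.2.2)
  invFun x := (x.1 - t * x.2.2, x.2.1 + 2 * t * x.1 - t ^ 2 * x.2.2, x.2.2)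
  left_inv x := by ext <;> (simp; try ring_nf)
  right_inv x := by ext <;> (simp; try ring_nf)
  map_add' x y := by ext <;> simp <;> ring
  map_smul' r x := by ext <;> simp <;> ring

theorem shear_apply (t p b c : ℂ) :
    shear t (p, b, c) = (p + t * c, b - 2 * t * p - t ^ 2 * c, c) := rfl

theorem isMove_shear (t : ℂ) : IsMove (shear t) := by
  refine isMove_of_conj (g := !![1, -t; 0, 1]) (h := !![1, t; 0, 1]) ?_ ?_ ?_
  · ext i j; fin_cases i <;> fin_cases j <;> simp [Matrix.mul_apply]
  · simp [Matrix.det_fin_two]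
  · rintro ⟨p, b, c⟩
    ext i j
    fin_cases i <;> fin_cases j <;> simp [Matrix.mul_apply, Sl2.mat, shear_apply] <;> ring

/-- Conjugation by a diagonal matrix. -/
def scale (d : ℂ) (hd : d ≠ 0) : Sl2 ≃ₗ[ℝ] Sl2 where
  toFun x := (x.1, d ^ 2 * x.2.1, x.2.2 / d ^ 2)
  invFun x := (x.1, x.2.1 / d ^ 2, d ^ 2 * x.2.2)
  left_inv x := by ext1; · rfl
                   · ext1 <;> simp <;> field_simp
  right_inv x := by ext1; · rfl
                    · ext1 <;> simp <;> field_simp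
  map_add' x y := by ext1; · rfl
                     · ext1 <;> simp <;> ring
  map_smul' r x := by ext1; · rfl
                      · ext1 <;> simp <;> ring

theorem scale_apply {d : ℂ} (hd : d ≠ 0) (p b c : ℂ) :
    scale d hd (p, b, c) = (p, d ^ 2 * b, c / d ^ 2) := rfl

theorem isMove_scale {d : ℂ} (hd : d ≠ 0) : IsMove (scale d hd) := by
  refine isMove_of_conj (g := !![d⁻¹, 0; 0, d]) (h := !![d, 0; 0, d⁻¹]) ?_ ?_ ?_
  · ext i j; fin_cases i <;> fin_cases j <;> simp [Matrix.mul_apply, hd]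
  · simp [Matrix.det_fin_two, hd]
  · rintro ⟨p, b, c⟩
    ext i j
    fin_cases i <;> fin_cases j <;> simp [Matrix.mul_apply, Sl2.mat, scale_apply] <;> field_simp

/-- Conjugation by the Weyl element. -/
def flip : Sl2 ≃ₗ[ℝ] Sl2 where
  toFun x := (-x.1, x.2.2, x.2.1)
  invFun x := (-x.1, x.2.2, x.2.1)
  left_inv x := by simp
  right_inv x := by simp
  map_add' x y := by ext <;> simp <;> ring
  map_smul' r x := by ext <;> simp

theorem flip_apply (p b c : ℂ) : flip (p, b, c) = (-p, c, b) := rfl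

theorem isMove_flip : IsMove flip := by
  refine isMove_of_conj (g := !![0, 1; 1, 0]) (h := !![0, 1; 1, 0]) ?_ ?_ ?_
  · ext i j; fin_cases i <;> fin_cases j <;> simp [Matrix.mul_apply]
  · simp [Matrix.det_fin_two]
  · rintro ⟨p, b, c⟩
    ext i j
    fin_cases i <;> fin_cases j <;> simp [Matrix.mul_apply, Sl2.mat, flip_apply]

/-- Complex conjugation. -/
def bar : Sl2 ≃ₗ[ℝ] Sl2 where
  toFun x := (star x.1, star x.2.1, star x.2.2)
  invFun x := (star x.1, star x.2.1, star x.2.2)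
  left_inv x := by simp
  right_inv x := by simp
  map_add' x y := by simp
  map_smul' r x := by simp

theorem bar_apply (p b c : ℂ) : bar (p, b, c) = (star p, star b, star c) := rfl

/-- Entrywise conjugation of Hermitian matrices is the reflection of `x²`. It is not of the form `g
H gᴴ`, and it is what allows the sign of the parameter `a` to be normalised. -/
theorem isMove_bar : IsMove bar := by
  have h2 : Function.Involutive fun x : M => ![x 0, x 1, -x 2, x 3] := fun x => by
    refine vec4_ext ?_ ?_ ?_ ?_ <;> simp
  let τ : M ≃L[ℝ] M := LinearEquiv.toContinuousLinearEquiv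
    (LinearEquiv.ofInvolutive
      { toFun := fun x : M => ![x 0, x 1, -x 2, x 3]
        map_add' := fun x y => by refine vec4_ext ?_ ?_ ?_ ?_ <;> simp; ring
        map_smul' := fun r x => by refine vec4_ext ?_ ?_ ?_ ?_ <;> simp } h2)
  have hτ : ∀ x, τ x = ![x 0, x 1, -x 2, x 3] := fun x => rfl
  have hτ' : ∀ x, τ.symm x = ![x 0, x 1, -x 2, x 3] := fun x => rfl
  refine ⟨?_, τ, isLorentz_of_self fun x => ?_, fun x => funext fun v => ?_⟩
  · rintro ⟨p, b, c⟩ ⟨p', b', c'⟩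
    simp [bar_apply, Sl2.br]
  · rw [hτ, mink_eq, mink_eq]
    simp
  · rw [pushField, hτ, hτ']
    refine vec4_ext ?_ ?_ ?_ ?_ <;> simp [kill_apply, bar, J, eta] <;> ring

/-- The basis fields as elements of `Sl2`. -/
def Row.spinor : (R : Row) → Fin R.dim → Sl2
  | .g11 => ![(-1 / 2, 0, 0)]
  | .g12 => ![(-Complex.I / 2, 0, 0)]
  | .g13 a _ => ![(-(a + Complex.I) / 2, 0, 0)]
  | .g14 => ![(0, -1, 0)]
  | .g21 => ![(0, -1, 0), (0, Complex.I, 0)]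
  | .g22 => ![(-Complex.I / 2, 0, 0), (-1 / 2, 0, 0)]
  | .g23 => ![(0, -1, 0), (-1 / 2, 0, 0)]
  | .g31 => ![(0, -1, 0), (0, Complex.I, 0), (-1 / 2, 0, 0)]
  | .g32 => ![(0, -1, 0), (0, Complex.I, 0), (-Complex.I / 2, 0, 0)]
  | .g33 a _ => ![(0, -1, 0), (0, Complex.I, 0), (-(a + Complex.I) / 2, 0, 0)]
  | .g34 => ![(-Complex.I / 2, 0, 0), (0, -Complex.I / 2, -Complex.I / 2), (0, 1 / 2, -1 / 2)]
  | .g35 => ![(0, -1 / 2, -1 / 2), (-Complex.I / 2, 0, 0), (0, Complex.I / 2, -Complex.I / 2)]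
  | .g41 => ![(0, -1, 0), (0, Complex.I, 0), (-Complex.I / 2, 0, 0), (-1 / 2, 0, 0)]

theorem Row.gen_eq_kill (R : Row) : ∀ A, R.gen A = kill (R.spinor A) := by
  have n1 : J 1 3 - J 0 1 = kill (0, -1, 0) := by simp [kill_apply]; module
  have n2 : J 2 3 - J 0 2 = kill (0, Complex.I, 0) := by simp [kill_apply]; module
  have j03 : -J 0 3 = kill (-1 / 2, 0, 0) := by simp [kill_apply]; module
  have j12 : -J 1 2 = kill (-Complex.I / 2, 0, 0) := by simp [kill_apply]; module
  have jj : ∀ a : ℝ, -(J 1 2 + a • J 0 3) = kill (-(a + Complex.I) / 2, 0, 0) := fun a => by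
    simp [kill_apply]
    module
  have j23 : -J 2 3 = kill (0, -Complex.I / 2, -Complex.I / 2) := by
    norm_num [kill_apply]
  have j13 : -J 1 3 = kill (0, 1 / 2, -1 / 2) := by norm_num [kill_apply]
  have j01 : -J 0 1 = kill (0, -1 / 2, -1 / 2) := by norm_num [kill_apply]
  have j02 : -J 0 2 = kill (0, Complex.I / 2, -Complex.I / 2) := by norm_num [kill_apply]
  cases R with
  | g11 => exact Fin.forall_fin_one.2 j03
  | g12 => exact Fin.forall_fin_one.2 j12
  | g13 a _ => exact Fin.forall_fin_one.2 (jj a)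
  | g14 => exact Fin.forall_fin_one.2 n1
  | g21 => exact Fin.forall_fin_two.2 ⟨n1, n2⟩
  | g22 => exact Fin.forall_fin_two.2 ⟨j12, j03⟩
  | g23 => exact Fin.forall_fin_two.2 ⟨n1, j03⟩
  | g31 => exact forall_fin_three.2 ⟨n1, n2, j03⟩
  | g32 => exact forall_fin_three.2 ⟨n1, n2, j12⟩
  | g33 a _ => exact forall_fin_three.2 ⟨n1, n2, jj a⟩
  | g34 => exact forall_fin_three.2 ⟨j12, j23, j13⟩
  | g35 => exact forall_fin_three.2 ⟨j01, j12, j02⟩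
  | g41 => exact forall_fin_four.2 ⟨n1, n2, j12, j03⟩

theorem classified_of_basis {𝔤 : Submodule ℝ Sl2} (R : Row) (h1 : ∀ A, R.spinor A ∈ 𝔤)
    (h2 : ∀ x ∈ 𝔤, ∃ c : Fin R.dim → ℝ, ∑ A, c A • R.spinor A = x) : Classified 𝔤 := by
  have h3 : 𝔤 = Submodule.span ℝ (range R.spinor) := by
    refine le_antisymm (fun x hx => ?_) (Submodule.span_le.2 ?_)
    · exact (Submodule.mem_span_range_iff_exists_fun ℝ).2 (h2 x hx)
    · rintro _ ⟨A, rfl⟩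
      exact h1 A
  refine ⟨R, ContinuousLinearEquiv.refl ℝ M, fun _ _ => rfl, ?_⟩
  have h4 : pushField (ContinuousLinearEquiv.refl ℝ M) = id := rfl
  rw [h4, image_id, Row.alg, show R.gen = kill ∘ R.spinor from funext R.gen_eq_kill, range_comp,
    ← Submodule.map_span, ← h3, Submodule.map_coe]

end Spinor

/-! ### Classification of subalgebras of upper triangular matrices. -/

section Borel

variable {𝔤 : Submodule ℝ Sl2}

/-- Over `ℝ`, `ℂ` is two-dimensional: a second element not proportional to `n` completes a basis. -/
theorem line_or_top {N : Submodule ℝ ℂ} {n : ℂ} (hn : n ∈ N) (h0 : n ≠ 0) :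
    (∀ b ∈ N, ∃ r : ℝ, b = r * n) ∨ ∀ b, b ∈ N := by
  by_cases h : ∀ b ∈ N, ∃ r : ℝ, b = r * n
  · exact .inl h
  · push Not at h
    obtain ⟨b, hb, hr⟩ := h
    have him : (b / n).im ≠ 0 := by
      intro h
      refine hr (b / n).re ?_
      rw [show (((b / n).re : ℝ) : ℂ) = b / n from Complex.ext rfl h.symm, div_mul_cancel₀ _ h0]
    refine .inr fun z => ?_
    set s := (z / n).im / (b / n).im with hs
    set r := (z / n).re - s * (b / n).re with hr
    have h1 : z / n = r + s * (b / n) := by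
      apply Complex.ext
      · simp [hr]
      · simp [hs, him]
    have h2 : z = r • n + s • b := by
      rw [Complex.real_smul, Complex.real_smul]
      field_simp at h1
      linear_combination h1
    rw [h2]
    exact N.add_mem (N.smul_mem r hn) (N.smul_mem s hb)

/-- The projection to the diagonal. -/
def diagPart (𝔤 : Submodule ℝ Sl2) : Submodule ℝ ℂ := 𝔤.map (LinearMap.fst ℝ ℂ (ℂ × ℂ))

/-- The strictly upper triangular elements. -/
def nilPart (𝔤 : Submodule ℝ Sl2) : Submodule ℝ ℂ :=
  𝔤.comap ((LinearMap.inr ℝ ℂ (ℂ × ℂ)).comp (LinearMap.inl ℝ ℂ ℂ))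

theorem mem_diagPart {p b c : ℂ} (h : (p, b, c) ∈ 𝔤) : p ∈ diagPart 𝔤 := ⟨_, h, rfl⟩

theorem mem_nilPart {b : ℂ} : b ∈ nilPart 𝔤 ↔ ((0, b, 0) : Sl2) ∈ 𝔤 := Iff.rfl

theorem smul_sl2 (r : ℝ) (p b c : ℂ) : r • ((p, b, c) : Sl2) = (r * p, r * b, r * c) := by
  simp [Complex.real_smul]

theorem smul_mem_sl2 (r : ℝ) {p b c : ℂ} (h : ((p, b, c) : Sl2) ∈ 𝔤) :
    ((r * p, r * b, r * c) : Sl2) ∈ 𝔤 := smul_sl2 r p b c ▸ 𝔤.smul_mem r h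

theorem add_mem_sl2 {p b c p' b' c' : ℂ} (h : ((p, b, c) : Sl2) ∈ 𝔤) (h' : ((p', b', c') : Sl2) ∈ 𝔤) :
    ((p + p', b + b', c + c') : Sl2) ∈ 𝔤 := 𝔤.add_mem h h'

theorem IsBracketClosed.comap {f : Sl2 ≃ₗ[ℝ] Sl2} (hf : IsMove f)
    (hb : ∀ x ∈ 𝔤, ∀ y ∈ 𝔤, Sl2.br x y ∈ 𝔤) :
    ∀ x ∈ 𝔤.comap (f : Sl2 →ₗ[ℝ] Sl2), ∀ y ∈ 𝔤.comap (f : Sl2 →ₗ[ℝ] Sl2),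
      Sl2.br x y ∈ 𝔤.comap (f : Sl2 →ₗ[ℝ] Sl2) := fun x hx y hy => by
  change f (Sl2.br x y) ∈ 𝔤
  rw [hf.1]
  exact hb _ hx _ hy

/-- Here the algebra is the line through a diagonal element; the three normal forms of `d` are a
boost, a rotation and a loxodromic generator. -/
theorem classified_line {a : ℝ} (ha : 0 < a) {d : ℂ} (hd : d = 1 ∨ d = Complex.I ∨ d = a + Complex.I)
    (hc : ∀ x ∈ 𝔤, x.2.2 = 0) (hb : ∀ x ∈ 𝔤, x.2.1 = 0) (hm : ((d, 0, 0) : Sl2) ∈ 𝔤)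
    (hP : ∀ p ∈ diagPart 𝔤, ∃ r : ℝ, p = r * d) : Classified 𝔤 := by
  have key : ∀ x ∈ 𝔤, ∃ r : ℝ, x = (r * d, 0, 0) := by
    rintro ⟨p, b, c⟩ hx
    obtain ⟨r, rfl⟩ := hP p (mem_diagPart hx)
    exact ⟨r, by rw [show b = 0 from hb _ hx, show c = 0 from hc _ hx]⟩
  have hm' := smul_mem_sl2 (-(1 / 2)) hm
  have h2 : ∀ x ∈ 𝔤, ∃ c : Fin 1 → ℝ, ∑ A, c A • (![(-d / 2, 0, 0)] : Fin 1 → Sl2) A = x := by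
    intro x hx
    obtain ⟨r, rfl⟩ := key x hx
    exact ⟨![-2 * r], by simp; ring⟩
  have h1 : ∀ A, (![(-d / 2, 0, 0)] : Fin 1 → Sl2) A ∈ 𝔤 := by
    intro A
    fin_cases A
    convert hm' using 2
    · push_cast; ring
    · simp
  rcases hd with rfl | rfl | rfl
  · exact classified_of_basis .g11 h1 h2
  · exact classified_of_basis .g12 h1 h2
  · exact classified_of_basis (.g13 a ha) h1 h2

/-- The semidirect product of all null rotations with one diagonal direction. -/
theorem classified_line_nil {a : ℝ} (ha : 0 < a) {d : ℂ}
    (hd : d = 1 ∨ d = Complex.I ∨ d = a + Complex.I)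
    (hc : ∀ x ∈ 𝔤, x.2.2 = 0) (hN : ∀ b, b ∈ nilPart 𝔤) (hm : ((d, 0, 0) : Sl2) ∈ 𝔤)
    (hP : ∀ p ∈ diagPart 𝔤, ∃ r : ℝ, p = r * d) : Classified 𝔤 := by
  have hm' := smul_mem_sl2 (-(1 / 2)) hm
  have h2 : ∀ x ∈ 𝔤, ∃ c : Fin 3 → ℝ, ∑ A, c A •
      (![(0, -1, 0), (0, Complex.I, 0), (-d / 2, 0, 0)] : Fin 3 → Sl2) A = x := by
    rintro ⟨p, b, c⟩ hx
    obtain ⟨r, rfl⟩ := hP p (mem_diagPart hx)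
    obtain rfl : c = 0 := hc _ hx
    refine ⟨![-b.re, b.im, -2 * r], ?_⟩
    rw [Fin.sum_univ_three]
    simp [Complex.re_add_im]
    ring
  have h1 : ∀ A, (![(0, -1, 0), (0, Complex.I, 0), (-d / 2, 0, 0)] : Fin 3 → Sl2) A ∈ 𝔤 := by
    intro A
    fin_cases A
    · exact hN _
    · exact hN _
    · convert hm' using 2
      · push_cast; ring
      · simp
  rcases hd with rfl | rfl | rfl
  · exact classified_of_basis .g31 h1 h2
  · exact classified_of_basis .g32 h1 h2
  · exact classified_of_basis (.g33 a ha) h1 h2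

/-- Bracketing with `(d, 0, 0)` splits the algebra into its diagonal and nilpotent parts, and the
nilpotent part is stable under multiplication by every diagonal entry. Each part is zero, a real
line or all of `ℂ`, which enumerates the cases. -/
theorem classified_torus {a : ℝ} (ha : 0 < a) {d : ℂ}
    (hd : d = 1 ∨ d = Complex.I ∨ d = a + Complex.I) (hbr : ∀ x ∈ 𝔤, ∀ y ∈ 𝔤, Sl2.br x y ∈ 𝔤)
    (hc : ∀ x ∈ 𝔤, x.2.2 = 0) (hm : ((d, 0, 0) : Sl2) ∈ 𝔤) : Classified 𝔤 := by
  have hd0 : d ≠ 0 := by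
    rcases hd with rfl | rfl | rfl
    · exact one_ne_zero
    · exact Complex.I_ne_zero
    · intro h
      simpa using congrArg Complex.im h
  have hdb : ∀ p b c, ((p, b, c) : Sl2) ∈ 𝔤 → d * b ∈ nilPart 𝔤 := by
    intro p b c hx
    have h1 := smul_mem_sl2 (1 / 2) (hbr _ hm _ hx)
    obtain rfl : c = 0 := hc _ hx
    rw [mem_nilPart]
    convert h1 using 2
    · simp
    · push_cast
      simp
  have hpn : ∀ p b c n, ((p, b, c) : Sl2) ∈ 𝔤 → n ∈ nilPart 𝔤 → p * n ∈ nilPart 𝔤 := by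
    intro p b c n hx hn
    have h1 := smul_mem_sl2 (1 / 2) (hbr _ hx _ (mem_nilPart.1 hn))
    obtain rfl : c = 0 := hc _ hx
    rw [mem_nilPart]
    convert h1 using 2
    · simp
    · push_cast
      simp
  by_cases hN : ∃ n ∈ nilPart 𝔤, n ≠ 0
  · obtain ⟨n, hn, hn0⟩ := hN
    rcases line_or_top hn hn0 with hl | hN
    · obtain ⟨e, he⟩ : ∃ e : ℂ, e ^ 2 = n := IsSquare.exists_sq n (Complex.isSquare n) |>.imp
        fun _ h => h.symm
      have he0 : e ≠ 0 := fun h => hn0 (by rw [← he, h]; simp)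
      -- A real line in `ℂ` is stable only under multiplication by real numbers, which excludes the
      -- rotational and loxodromic directions.
      have hreal : ∀ p b c, ((p, b, c) : Sl2) ∈ 𝔤 → ∃ r : ℝ, p = r := by
        intro p b c hx
        obtain ⟨r, hr⟩ := hl _ (hpn p b c n hx hn)
        exact ⟨r, mul_right_cancel₀ hn0 hr⟩
      have hd1 : d = 1 := by
        obtain ⟨r, hr⟩ := hreal _ _ _ hm
        have him := congrArg Complex.im hr
        rcases hd with rfl | rfl | rfl
        · rfl
        · simp at him
        · simp at him
      subst hd1
      refine Classified.of_move (isMove_scale he0) (classified_of_basis .g23 (fun A => ?_) ?_)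
      · fin_cases A
        · change scale e he0 (0, -1, 0) ∈ 𝔤
          rw [scale_apply, he]
          simpa using smul_mem_sl2 (-1) hn
        · change scale e he0 (-1 / 2, 0, 0) ∈ 𝔤
          rw [scale_apply]
          convert smul_mem_sl2 (-1 / 2) hm using 2
          · simp
          · simp
      · rintro ⟨p, b, c⟩ hx
        change scale e he0 (p, b, c) ∈ 𝔤 at hx
        rw [scale_apply] at hx
        obtain ⟨r, rfl⟩ := hreal _ _ _ hx
        have hc0 : c / e ^ 2 = 0 := hc _ hx
        obtain ⟨s, hs⟩ := hl _ (hdb _ _ _ hx)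
        have hb : b = s := by
          rw [he, one_mul, mul_comm] at hs
          exact mul_right_cancel₀ hn0 hs
        obtain rfl : c = 0 := by simpa [he0] using hc0
        refine ⟨(![-s, -2 * r] : Fin 2 → ℝ), ?_⟩
        change ∑ A : Fin 2, _ = _
        rw [Fin.sum_univ_two]
        simp [hb, Row.spinor]
        ring
    · rcases line_or_top (mem_diagPart hm) hd0 with hP | hP
      · exact classified_line_nil ha hd hc hN hm hP
      · refine classified_of_basis .g41 ?_ ?_
        · have hp : ∀ p : ℂ, ((p, 0, 0) : Sl2) ∈ 𝔤 := by
            intro p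
            obtain ⟨⟨p', b, c⟩, hx, rfl⟩ := hP p
            obtain rfl : c = 0 := hc _ hx
            simpa using add_mem_sl2 hx (mem_nilPart.1 (hN (-b)))
          intro A
          fin_cases A
          · exact hN _
          · exact hN _
          · exact hp _
          · exact hp _
        · rintro ⟨p, b, c⟩ hx
          obtain rfl : c = 0 := hc _ hx
          refine ⟨(![-b.re, b.im, -2 * p.im, -2 * p.re] : Fin 4 → ℝ), ?_⟩
          change ∑ A : Fin 4, _ = _
          rw [Fin.sum_univ_four]
          simp [Row.spinor]
          linear_combination Complex.re_add_im p
  · push Not at hN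
    have hb : ∀ x ∈ 𝔤, x.2.1 = 0 := by
      rintro ⟨p, b, c⟩ hx
      exact (mul_eq_zero.1 (hN _ (hdb p b c hx))).resolve_left hd0
    rcases line_or_top (mem_diagPart hm) hd0 with hP | hP
    · exact classified_line ha hd hc hb hm hP
    · refine classified_of_basis .g22 ?_ ?_
      · have hp : ∀ p : ℂ, ((p, 0, 0) : Sl2) ∈ 𝔤 := by
          intro p
          obtain ⟨⟨p', b, c⟩, hx, rfl⟩ := hP p
          obtain rfl : c = 0 := hc _ hx
          obtain rfl : b = 0 := hb _ hx
          exact hx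
        intro A
        fin_cases A
        · exact hp _
        · exact hp _
      · rintro ⟨p, b, c⟩ hx
        obtain rfl : c = 0 := hc _ hx
        obtain rfl : b = 0 := hb _ hx
        refine ⟨(![-2 * p.im, -2 * p.re] : Fin 2 → ℝ), ?_⟩
        change ∑ A : Fin 2, _ = _
        rw [Fin.sum_univ_two]
        simp [Row.spinor]
        linear_combination Complex.re_add_im p

/-- Without diagonal entries the algebra is a real subspace of the null rotations; a line is scaled
to the standard one by a square root of `n`. -/
theorem classified_nil {n : ℂ} (hn0 : n ≠ 0) (hn : n ∈ nilPart 𝔤) (hc : ∀ x ∈ 𝔤, x.2.2 = 0)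
    (hp : ∀ x ∈ 𝔤, x.1 = 0) : Classified 𝔤 := by
  rcases line_or_top hn hn0 with hl | hN
  · obtain ⟨e, he⟩ : ∃ e : ℂ, e ^ 2 = n := IsSquare.exists_sq n (Complex.isSquare n) |>.imp
      fun _ h => h.symm
    have he0 : e ≠ 0 := fun h => hn0 (by rw [← he, h]; simp)
    refine Classified.of_move (isMove_scale he0) (classified_of_basis .g14 (fun A => ?_) ?_)
    · fin_cases A
      change scale e he0 (0, -1, 0) ∈ 𝔤
      rw [scale_apply, he]
      simpa using smul_mem_sl2 (-1) hn
    · rintro ⟨p, b, c⟩ hx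
      change scale e he0 (p, b, c) ∈ 𝔤 at hx
      rw [scale_apply] at hx
      have hc0 : c / e ^ 2 = 0 := hc _ hx
      obtain rfl : p = 0 := hp _ hx
      obtain rfl : c = 0 := by simpa [he0] using hc0
      rw [zero_div] at hx
      obtain ⟨s, hs⟩ := hl _ hx
      have hb : b = s := by
        change e ^ 2 * b = s * n at hs
        rw [he, mul_comm] at hs
        exact mul_right_cancel₀ hn0 hs
      refine ⟨(![-s] : Fin 1 → ℝ), ?_⟩
      change ∑ A : Fin 1, _ = _
      simp [hb, Row.spinor]
  · refine classified_of_basis .g21 ?_ ?_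
    · intro A
      fin_cases A
      · exact hN _
      · exact hN _
    · rintro ⟨p, b, c⟩ hx
      obtain rfl : p = 0 := hp _ hx
      obtain rfl : c = 0 := hc _ hx
      refine ⟨(![-b.re, b.im] : Fin 2 → ℝ), ?_⟩
      change ∑ A : Fin 2, _ = _
      rw [Fin.sum_univ_two]
      simp [Complex.re_add_im, Row.spinor]

/-- A nonzero algebra of upper triangular matrices is conjugate to a listed one. -/
theorem classified_borel (hbr : ∀ x ∈ 𝔤, ∀ y ∈ 𝔤, Sl2.br x y ∈ 𝔤) (hc : ∀ x ∈ 𝔤, x.2.2 = 0)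
    (hne : 𝔤 ≠ ⊥) : Classified 𝔤 := by
  obtain ⟨⟨n₁, n₂, n₃⟩, hn, hn0⟩ := Submodule.exists_mem_ne_zero_of_ne_bot hne
  obtain rfl : n₃ = 0 := hc _ hn
  by_cases hp : ∀ x ∈ 𝔤, x.1 = 0
  · obtain rfl : n₁ = 0 := hp _ hn
    exact classified_nil (n := n₂) (fun h => hn0 (by rw [h]; rfl)) hn hc hp
  push Not at hp
  obtain ⟨⟨p, b, c⟩, hx, hp0⟩ := hp
  obtain rfl : c = 0 := hc _ hx
  replace hp0 : p ≠ 0 := hp0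
  -- A triangular matrix with nonzero diagonal is diagonalised by a unipotent conjugation.
  refine Classified.of_move (isMove_shear (-(b / (2 * p)))) ?_
  have hm : ((p, 0, 0) : Sl2) ∈ 𝔤.comap (shear (-(b / (2 * p))) : Sl2 →ₗ[ℝ] Sl2) := by
    change shear (-(b / (2 * p))) (p, 0, 0) ∈ 𝔤
    have hs : 0 - 2 * -(b / (2 * p)) * p - (-(b / (2 * p))) ^ 2 * 0 = b := by
      field_simp
      ring
    rw [shear_apply, hs]
    simpa using hx
  have hbr' := IsBracketClosed.comap (isMove_shear (-(b / (2 * p)))) hbr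
  have hc' : ∀ x ∈ 𝔤.comap (shear (-(b / (2 * p))) : Sl2 →ₗ[ℝ] Sl2), x.2.2 = 0 := fun x hx =>
    hc (shear (-(b / (2 * p))) x) hx
  generalize 𝔤.comap (shear (-(b / (2 * p))) : Sl2 →ₗ[ℝ] Sl2) = 𝔥 at hm hbr' hc'
  have hm' := fun r : ℝ => smul_mem_sl2 r hm
  rcases eq_or_ne p.im 0 with h0 | h0
  · have hre : p = (p.re : ℝ) := Complex.ext rfl h0
    refine classified_torus one_pos (.inl rfl) hbr' hc' ?_
    convert hm' p.re⁻¹ using 2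
    · rw [Complex.ofReal_inv, ← hre, inv_mul_cancel₀ hp0]
    · simp
  · have hdir : ∀ a : ℝ, p.re = a * p.im → ((a + Complex.I, 0, 0) : Sl2) ∈ 𝔥 := by
      intro a ha
      convert hm' p.im⁻¹ using 2
      · apply Complex.ext <;> simp [ha] <;> field_simp
      · simp
    have hm2 := hdir (p.re / p.im) (by field_simp)
    rcases lt_trichotomy (p.re / p.im) 0 with ha | ha | ha
    -- Conjugation maps `-a + i` to the negative of `a + i`, so a negative ratio becomes positive.
    · refine Classified.of_move isMove_bar (classified_torus (neg_pos.2 ha) (.inr (.inr rfl))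
        (IsBracketClosed.comap isMove_bar hbr') (fun x hx => ?_) ?_)
      · have : star x.2.2 = 0 := hc' _ hx
        simpa using this
      · change bar _ ∈ 𝔥
        rw [bar_apply]
        convert smul_mem_sl2 (-1) hm2 using 2
        · simp [add_comm]
        · simp
    · rw [ha] at hm2
      exact classified_torus one_pos (.inr (.inl rfl)) hbr' hc' (by simpa using hm2)
    · exact classified_torus ha (.inr (.inr rfl)) hbr' hc' hm2

end Borel

/-! ### Subalgebras that need not be triangular: `sl(2, ℝ)` and the real forms without nilpotents.
-/

section Irreducible

variable {𝔤 : Submodule ℝ Sl2}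

theorem comap_ne_top {f : Sl2 ≃ₗ[ℝ] Sl2} (h : 𝔤 ≠ ⊤) : 𝔤.comap (f : Sl2 →ₗ[ℝ] Sl2) ≠ ⊤ := by
  intro h1
  refine h (Submodule.eq_top_iff'.2 fun x => ?_)
  have : f.symm x ∈ 𝔤.comap (f : Sl2 →ₗ[ℝ] Sl2) := h1 ▸ Submodule.mem_top
  simpa using this

/-- The real forms `su(2)` and `su(1,1)`. -/
theorem classified_real_form {ε : ℂ} (hε : ε = 1 ∨ ε = -1)
    (h : ∀ p b c : ℂ, ((p, b, c) : Sl2) ∈ 𝔤 ↔ p.re = 0 ∧ c = ε * star b) : Classified 𝔤 := by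
  rcases hε with rfl | rfl
  · refine classified_of_basis .g35 (forall_fin_three.2 ⟨?_, ?_, ?_⟩) ?_
    · exact (h _ _ _).2 (by simp)
    · exact (h _ _ _).2 (by simp)
    · exact (h _ _ _).2 (by simp)
    · rintro ⟨p, b, c⟩ hx
      obtain ⟨hp, rfl⟩ := (h _ _ _).1 hx
      refine ⟨(![-2 * b.re, -2 * p.im, 2 * b.im] : Fin 3 → ℝ), ?_⟩
      change ∑ A : Fin 3, _ = _
      rw [Fin.sum_univ_three]
      simp only [Row.spinor]
      ext1
      · apply Complex.ext <;> simp [hp] <;> ring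
      · ext1 <;> apply Complex.ext <;> simp <;> ring
  · refine classified_of_basis .g34 (forall_fin_three.2 ⟨?_, ?_, ?_⟩) ?_
    · exact (h _ _ _).2 (by simp)
    · exact (h _ _ _).2 (by simp [neg_div])
    · exact (h _ _ _).2 (by simp [neg_div])
    · rintro ⟨p, b, c⟩ hx
      obtain ⟨hp, rfl⟩ := (h _ _ _).1 hx
      refine ⟨(![-2 * p.im, -2 * b.im, 2 * b.re] : Fin 3 → ℝ), ?_⟩
      change ∑ A : Fin 3, _ = _
      rw [Fin.sum_univ_three]
      simp only [Row.spinor]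
      ext1
      · apply Complex.ext <;> simp [hp] <;> ring
      · ext1 <;> apply Complex.ext <;> simp <;> ring

theorem br_mk (p b c p' b' c' : ℂ) : Sl2.br (p, b, c) (p', b', c') =
    (b * c' - b' * c, 2 * (p * b' - p' * b), 2 * (c * p' - c' * p)) := rfl

/-- All upper nilpotents bracketed with one lower nilpotent give the whole diagonal, and the
diagonal then gives all lower nilpotents. -/
theorem eq_top_of_nilPart (hbr : ∀ x ∈ 𝔤, ∀ y ∈ 𝔤, Sl2.br x y ∈ 𝔤) (hN : ∀ b, b ∈ nilPart 𝔤) {b c : ℂ}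
    (hx : ((0, b, c) : Sl2) ∈ 𝔤) (hc : c ≠ 0) : 𝔤 = ⊤ := by
  have h1 : ((0, 0, c) : Sl2) ∈ 𝔤 := by
    simpa using add_mem_sl2 hx (mem_nilPart.1 (hN (-b)))
  have h2 : ∀ p : ℂ, ((p, 0, 0) : Sl2) ∈ 𝔤 := by
    intro p
    have := hbr _ (mem_nilPart.1 (hN (p / c))) _ h1
    rw [br_mk] at this
    simpa [hc] using this
  have h3 : ∀ q : ℂ, ((0, 0, q) : Sl2) ∈ 𝔤 := by
    intro q
    have := hbr _ h1 _ (h2 (q / (2 * c)))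
    rw [br_mk] at this
    convert this using 3
    · simp
    · simp
    · field_simp
      simp
  refine Submodule.eq_top_iff'.2 ?_
  rintro ⟨p, b, c⟩
  simpa using add_mem_sl2 (add_mem_sl2 (h2 p) (mem_nilPart.1 (hN b))) (h3 c)

/-- The Cayley transform conjugates `sl(2, ℝ)` to `su(1,1)`; it is composed here of shears, a
scaling and the Weyl element. -/
theorem classified_sl2_real (h : ∀ p b c : ℂ, ((p, b, c) : Sl2) ∈ 𝔤 ↔ p.im = 0 ∧ b.im = 0 ∧ c.im = 0) :
    Classified 𝔤 := by
  have h0 : (1 - Complex.I) ≠ 0 := fun h => by simpa using congrArg Complex.im h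
  have h2 : (1 - Complex.I) ^ 2 = -(2 * Complex.I) := by
    rw [sub_sq, Complex.I_sq]; ring
  refine Classified.of_move (isMove_shear (-Complex.I)) (Classified.of_move (isMove_scale h0)
    (Classified.of_move isMove_flip (Classified.of_move (isMove_shear (-1))
      (classified_real_form (.inl rfl) ?_))))
  intro p b c
  change shear (-Complex.I) (scale _ h0 (flip (shear (-1) (p, b, c)))) ∈ 𝔤 ↔ _
  have h3 : ∀ z : ℂ, z / -(2 * Complex.I) = z * (Complex.I / 2) := by
    intro z
    rw [div_eq_iff (by simp)]
    linear_combination z * Complex.I_sq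
  rw [shear_apply, flip_apply, scale_apply, shear_apply, h, h2, h3]
  simp only [one_mul, Complex.ext_iff]
  simp
  constructor
  · rintro ⟨h1, h2, h3⟩
    refine ⟨?_, ?_, ?_⟩ <;> linarith
  · rintro ⟨h1, h2, h3⟩
    refine ⟨?_, ?_, ?_⟩ <;> linarith

/-- Properness makes the upper nilpotents real multiples of `E`. Since `[E, [E, x]] = -2c E`, lower
entries are real; the standard triple is produced from `E` and the given element, and all other
entries are then seen to be real, so the algebra is exactly `sl(2, ℝ)`. -/
theorem classified_of_nilpotent (hbr : ∀ x ∈ 𝔤, ∀ y ∈ 𝔤, Sl2.br x y ∈ 𝔤) (htop : 𝔤 ≠ ⊤)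
    (hE : ((0, 1, 0) : Sl2) ∈ 𝔤) {b c : ℂ} (hX : ((0, b, c) : Sl2) ∈ 𝔤) (hc : c ≠ 0) :
    Classified 𝔤 := by
  have hreal : ∀ b ∈ nilPart 𝔤, b.im = 0 := by
    rcases line_or_top (N := nilPart 𝔤) (n := (1 : ℂ)) hE one_ne_zero with hl | hN
    · intro b hb
      obtain ⟨r, rfl⟩ := hl b hb
      rw [mul_one, Complex.ofReal_im]
    · exact absurd (eq_top_of_nilPart hbr hN hX hc) htop
  have hcr : ∀ p b c, ((p, b, c) : Sl2) ∈ 𝔤 → c.im = 0 := by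
    intro p b c hx
    have h1 := hbr _ hE _ (hbr _ hE _ hx)
    rw [br_mk, br_mk] at h1
    have h2 : ((0, -(2 * c), 0) : Sl2) ∈ 𝔤 := by
      convert h1 using 3 <;> ring
    simpa using hreal _ (mem_nilPart.2 h2)
  have hc0 := hcr _ _ _ hX
  have hcre : c = (c.re : ℝ) := Complex.ext rfl hc0
  have hH : ((1, 0, 0) : Sl2) ∈ 𝔤 := by
    have h1 := hbr _ hE _ hX
    rw [br_mk] at h1
    have h2 := smul_mem_sl2 c.re⁻¹ h1
    rw [Complex.ofReal_inv, ← hcre] at h2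
    simpa [hc] using h2
  have hF : ((0, 0, 1) : Sl2) ∈ 𝔤 := by
    have h1 := smul_mem_sl2 c.re⁻¹ hX
    rw [Complex.ofReal_inv, ← hcre, inv_mul_cancel₀ hc, mul_zero] at h1
    have h2 := hbr _ hH _ h1
    rw [br_mk] at h2
    have h3 := smul_mem_sl2 (1 / 2) (add_mem_sl2 h1 (smul_mem_sl2 (-1 / 2) h2))
    norm_num at h3
    have h4 := smul_mem_sl2 (-1 / 2) h2
    have h5 := smul_mem_sl2 (1 / 2) (add_mem_sl2 h1 h4)
    convert h5 using 3 <;> push_cast <;> ring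
  have hpr : ∀ p b c, ((p, b, c) : Sl2) ∈ 𝔤 → p.im = 0 := by
    intro p b c hx
    have h1 := hbr _ hE _ hx
    rw [br_mk] at h1
    have h2 : c = (c.re : ℝ) := Complex.ext rfl (hcr _ _ _ hx)
    have h3 := add_mem_sl2 h1 (smul_mem_sl2 (-c.re) hH)
    rw [Complex.ofReal_neg, ← h2] at h3
    have h4 : ((0, -(2 * p), 0) : Sl2) ∈ 𝔤 := by
      convert h3 using 3 <;> ring
    simpa using hreal _ (mem_nilPart.2 h4)
  refine classified_sl2_real fun p b c => ⟨fun hx => ⟨hpr _ _ _ hx, ?_, hcr _ _ _ hx⟩, ?_⟩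
  · have h2 : c = (c.re : ℝ) := Complex.ext rfl (hcr _ _ _ hx)
    have h3 : p = (p.re : ℝ) := Complex.ext rfl (hpr _ _ _ hx)
    have h4 := add_mem_sl2 (add_mem_sl2 hx (smul_mem_sl2 (-p.re) hH)) (smul_mem_sl2 (-c.re) hF)
    rw [Complex.ofReal_neg, Complex.ofReal_neg, ← h2, ← h3] at h4
    exact hreal b (by simpa [mem_nilPart] using h4)
  · rintro ⟨hp, hb, hc⟩
    have h2 : c = (c.re : ℝ) := Complex.ext rfl hc
    have h3 : p = (p.re : ℝ) := Complex.ext rfl hp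
    have h5 : b = (b.re : ℝ) := Complex.ext rfl hb
    have h4 := add_mem_sl2 (add_mem_sl2 (smul_mem_sl2 b.re hE) (smul_mem_sl2 p.re hH))
      (smul_mem_sl2 c.re hF)
    rw [← h2, ← h3, ← h5] at h4
    simpa using h4

/-- If the algebra is not triangular, a shear removes the diagonal entry of some element with `c ≠
0`, leaving upper nilpotents fixed, and a scaling normalises `n` to 1. -/
theorem classified_of_nilPart (hbr : ∀ x ∈ 𝔤, ∀ y ∈ 𝔤, Sl2.br x y ∈ 𝔤) (htop : 𝔤 ≠ ⊤) {n : ℂ}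
    (hn : n ∈ nilPart 𝔤) (h0 : n ≠ 0) : Classified 𝔤 := by
  by_cases hc : ∀ x ∈ 𝔤, x.2.2 = 0
  · refine classified_borel hbr hc fun h => h0 ?_
    rw [h] at hn
    exact congrArg (fun x : Sl2 => x.2.1) ((Submodule.mem_bot ℝ).1 (mem_nilPart.1 hn))
  push Not at hc
  obtain ⟨⟨p, b, c⟩, hx, hc⟩ := hc
  replace hc : c ≠ 0 := hc
  obtain ⟨e, he⟩ : ∃ e : ℂ, e ^ 2 = n := IsSquare.exists_sq n (Complex.isSquare n) |>.imp
    fun _ h => h.symm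
  have he0 : e ≠ 0 := fun h => h0 (by rw [← he, h]; simp)
  refine Classified.of_move (isMove_shear (p / c)) (Classified.of_move (isMove_scale he0) ?_)
  refine classified_of_nilpotent (IsBracketClosed.comap (isMove_scale he0)
    (IsBracketClosed.comap (isMove_shear (p / c)) hbr)) (comap_ne_top (comap_ne_top htop))
    (b := (b + 2 * (p / c) * 0 + (p / c) ^ 2 * c) / e ^ 2) (c := c * e ^ 2) ?_ ?_ (by simp [hc, he0])
  · change shear (p / c) (scale e he0 (0, 1, 0)) ∈ 𝔤
    rw [scale_apply, shear_apply, he]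
    simpa [mem_nilPart] using hn
  · change shear (p / c) (scale e he0 _) ∈ 𝔤
    rw [scale_apply, shear_apply]
    convert hx using 3
    · field_simp
      ring
    · field_simp
      ring
    · field_simp

/-- Minus the determinant is `p² + bc`, so the hypothesis excludes nilpotent elements. If the
algebra is not triangular, its diagonal elements turn out to be imaginary and `c` a fixed real
multiple `κ` of the conjugate of `b`. The sign of `κ` decides between `su(1,1)` and `su(2)`. -/
theorem classified_semisimple (hbr : ∀ x ∈ 𝔤, ∀ y ∈ 𝔤, Sl2.br x y ∈ 𝔤)
    (hnil : ∀ p b c : ℂ, ((p, b, c) : Sl2) ∈ 𝔤 → p ^ 2 + b * c = 0 → p = 0 ∧ b = 0 ∧ c = 0)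
    {d : ℂ} (hd : d ≠ 0) (hD : ((d, 0, 0) : Sl2) ∈ 𝔤) : Classified 𝔤 := by
  by_cases hc : ∀ x ∈ 𝔤, x.2.2 = 0
  · refine classified_borel hbr hc fun h => hd ?_
    rw [h] at hD
    exact congrArg (fun x : Sl2 => x.1) ((Submodule.mem_bot ℝ).1 hD)
  push Not at hc
  obtain ⟨⟨p, b, c⟩, hx, hc⟩ := hc
  replace hc : c ≠ 0 := hc
  have had : ∀ q p b c : ℂ, ((q, 0, 0) : Sl2) ∈ 𝔤 → ((p, b, c) : Sl2) ∈ 𝔤 →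
      ((0, q * b, -(q * c)) : Sl2) ∈ 𝔤 := by
    intro q p b c hq hx
    have h1 := smul_mem_sl2 (1 / 2) (hbr _ hq _ hx)

    convert h1 using 3 <;> push_cast <;> ring
  obtain ⟨β, γ, hY, hγ⟩ : ∃ β γ : ℂ, ((0, β, γ) : Sl2) ∈ 𝔤 ∧ γ ≠ 0 :=
    ⟨_, _, had d p b c hD hx, by simp [hd, hc]⟩
  have hβ : β ≠ 0 := fun h => hγ (hnil _ _ _ hY (by simp [h])).2.2
  -- If `q` is real, or else because `q` lies in the real span of `1` and `q²` when `Re q ≠ 0`, the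
  -- algebra contains both `(0, qβ, qγ)` and `(0, qβ, -qγ)`; their sum is a nonzero nilpotent.
  have him : ∀ q : ℂ, ((q, 0, 0) : Sl2) ∈ 𝔤 → q.re = 0 := by
    intro q hq
    by_contra hre
    have hq0 : q ≠ 0 := fun h => hre (by simp [h])
    have h1 := had q _ _ _ hq hY
    have h2 := had q _ _ _ hq h1
    have h3 : ((0, q * β, q * γ) : Sl2) ∈ 𝔤 := by
      by_cases hq2 : q.im = 0
      · have h4 : q = (q.re : ℝ) := Complex.ext rfl hq2
        have h5 := smul_mem_sl2 q.re hY
        rw [← h4] at h5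
        simpa using h5
      · have hq2' : (q ^ 2).im ≠ 0 := by
          rw [sq, Complex.mul_im]
          intro h
          have : q.re * q.im = 0 := by linarith
          exact (mul_ne_zero hre hq2) this
        set t := q.im / (q ^ 2).im with ht
        set r := q.re - t * (q ^ 2).re with hr
        have h4 : q = r + t * q ^ 2 := by
          apply Complex.ext
          · simp [hr]
          · simp [ht, hq2']
        have h5 := add_mem_sl2 (smul_mem_sl2 r hY) (smul_mem_sl2 t h2)
        convert h5 using 3
        · simp
        · linear_combination β * h4
        · linear_combination γ * h4
    have h4 := add_mem_sl2 h3 h1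
    have h5 := (hnil _ _ _ h4 (by ring)).2.1
    exact mul_ne_zero hq0 hβ (by linear_combination h5 / 2)
  have hI : ((Complex.I, 0, 0) : Sl2) ∈ 𝔤 := by
    have h1 := him d hD
    have h2 : d.im ≠ 0 := fun h => hd (Complex.ext h1 h)
    have h3 := smul_mem_sl2 d.im⁻¹ hD
    convert h3 using 3
    · apply Complex.ext <;> simp [h1, h2]
    · simp
    · simp
  have hY' := had _ _ _ _ hI hY
  -- The bracket of `(0, β, γ)` with its image under `ad i` is diagonal with entry `-2iβγ`, which
  -- must be imaginary.
  have hk : (β * γ).im = 0 := by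
    have h1 := hbr _ hY _ hY'
    rw [br_mk] at h1
    have h2 := him (-(2 * Complex.I * (β * γ))) (by convert h1 using 3 <;> ring)
    simp only [Complex.neg_re, Complex.mul_re, Complex.mul_im, Complex.I_re, Complex.I_im,
      Complex.re_ofNat, Complex.im_ofNat] at h2 ⊢
    linarith
  set κ : ℝ := (β * γ).re / Complex.normSq β with hκ
  have hns : (Complex.normSq β : ℂ) ≠ 0 := by
    exact_mod_cast (Complex.normSq_pos.2 hβ).ne'
  have hκγ : γ = κ * star β := by
    have h1 : β * γ = ((β * γ).re : ℝ) := Complex.ext rfl hk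
    have h2 : β * star β = Complex.normSq β := Complex.mul_conj β
    rw [hκ, Complex.ofReal_div, ← h1, ← h2]
    have h3 : star β ≠ 0 := star_ne_zero.2 hβ
    field_simp
  have hκ0 : κ ≠ 0 := fun h => hγ (by rw [hκγ, h]; simp)
  have hall : ∀ b : ℂ, ((0, b, κ * star b) : Sl2) ∈ 𝔤 := by
    intro b
    have h1 := add_mem_sl2 (smul_mem_sl2 (b / β).re hY) (smul_mem_sl2 (b / β).im hY')
    have h2 := Complex.re_add_im (b / β)
    have h3 : star (b / β) = ((b / β).re : ℂ) - (b / β).im * Complex.I := by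
      generalize b / β = z
      apply Complex.ext <;> simp
    have h4 : b = b / β * β := by field_simp
    convert h1 using 3
    · simp
    · linear_combination h4 - β * h2
    · rw [hκγ]
      have h5 : star b = star (b / β) * star β := by
        conv_lhs => rw [h4]
        exact star_mul' _ _
      linear_combination κ * h5 + κ * star β * h3
  have hmem : ∀ p b c : ℂ, ((p, b, c) : Sl2) ∈ 𝔤 ↔ p.re = 0 ∧ c = κ * star b := by
    intro p b c
    constructor
    · intro hx
      have h1 := had _ _ _ _ hI (had _ _ _ _ hI hx)
      have h2 : ((p, 0, 0) : Sl2) ∈ 𝔤 := by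
        convert add_mem_sl2 hx h1 using 3
        · simp
        · linear_combination -b * Complex.I_sq
        · linear_combination -c * Complex.I_sq
      have h3 : ((0, 0, c - κ * star b) : Sl2) ∈ 𝔤 := by
        have h4 := add_mem_sl2 (add_mem_sl2 hx (smul_mem_sl2 (-1) h2)) (smul_mem_sl2 (-1) (hall b))
        convert h4 using 3 <;> push_cast <;> ring
      exact ⟨him p h2, sub_eq_zero.1 (hnil _ _ _ h3 (by ring)).2.2⟩
    · rintro ⟨hp, rfl⟩
      have h1 := add_mem_sl2 (smul_mem_sl2 p.im hI) (hall b)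
      convert h1 using 3
      · apply Complex.ext <;> simp [hp]
      · simp
      · simp
  -- A scaling by `e` multiplies `κ` by `e⁴`, so a fourth root of `|κ|⁻¹` normalises it to `±1`.
  set e : ℝ := Real.sqrt (Real.sqrt |κ|⁻¹) with he
  have hκp : 0 < |κ|⁻¹ := inv_pos.2 (abs_pos.2 hκ0)
  have hep : 0 < e := Real.sqrt_pos.2 (Real.sqrt_pos.2 hκp)
  have he4 : e ^ 4 = |κ|⁻¹ := by
    rw [show e ^ 4 = (e ^ 2) ^ 2 by ring, he, Real.sq_sqrt (Real.sqrt_nonneg _), Real.sq_sqrt hκp.le]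
  have hec : (e : ℂ) ≠ 0 := by exact_mod_cast hep.ne'
  obtain ⟨ε, hε, hεκ⟩ : ∃ ε : ℝ, (ε = 1 ∨ ε = -1) ∧ e ^ 4 * κ = ε := by
    rw [he4]
    rcases lt_or_gt_of_ne hκ0 with h | h
    · exact ⟨-1, .inr rfl, by rw [abs_of_neg h]; field_simp⟩
    · exact ⟨1, .inl rfl, by rw [abs_of_pos h]; field_simp⟩
  refine Classified.of_move (isMove_scale hec) (classified_real_form (ε := (ε : ℂ))
    (by rcases hε with rfl | rfl <;> simp) fun p b c => ?_)
  change scale _ hec (p, b, c) ∈ 𝔤 ↔ _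
  have hεκ' : (e : ℂ) ^ 4 * κ = ε := by exact_mod_cast hεκ
  have hstar : star ((e : ℂ) ^ 2 * b) = (e : ℂ) ^ 2 * star b := by simp
  rw [scale_apply, hmem, hstar, div_eq_iff (pow_ne_zero 2 hec), ← hεκ']
  refine and_congr_right fun _ => ?_
  rw [show (κ : ℂ) * ((e : ℂ) ^ 2 * star b) * (e : ℂ) ^ 2 = (e : ℂ) ^ 4 * κ * star b by ring]

/-- Every nonzero proper real subalgebra of `Sl2` is conjugate to a listed one. -/
theorem classified_of_bracket_closed (hbr : ∀ x ∈ 𝔤, ∀ y ∈ 𝔤, Sl2.br x y ∈ 𝔤) (hbot : 𝔤 ≠ ⊥)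
    (htop : 𝔤 ≠ ⊤) : Classified 𝔤 := by
  by_cases hnil : ∀ p b c : ℂ, ((p, b, c) : Sl2) ∈ 𝔤 → p ^ 2 + b * c = 0 → p = 0 ∧ b = 0 ∧ c = 0
  · have key : ∀ {𝔥 : Submodule ℝ Sl2}, (∀ x ∈ 𝔥, ∀ y ∈ 𝔥, Sl2.br x y ∈ 𝔥) →
        (∀ p b c : ℂ, ((p, b, c) : Sl2) ∈ 𝔥 → p ^ 2 + b * c = 0 → p = 0 ∧ b = 0 ∧ c = 0) →
        ∀ p b : ℂ, p ≠ 0 → ((p, b, 0) : Sl2) ∈ 𝔥 → Classified 𝔥 := by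
      intro 𝔥 hbr hnil p b hp hx
      have hs := isMove_shear (-(b / (2 * p)))
      refine Classified.of_move hs (classified_semisimple (IsBracketClosed.comap hs hbr) ?_ hp ?_)
      · intro p' b' c' hx h
        have h1 := hnil _ _ _ (show shear (-(b / (2 * p))) (p', b', c') ∈ 𝔥 from hx)
          (by linear_combination h)
        obtain ⟨h1, h2, rfl⟩ := h1
        obtain rfl : p' = 0 := by simpa using h1
        exact ⟨rfl, by simpa using h2, rfl⟩
      · change shear (-(b / (2 * p))) (p, 0, 0) ∈ 𝔥
        rw [shear_apply]
        convert hx using 3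
        · simp
        · field_simp
          ring
    obtain ⟨⟨p, b, c⟩, hx, hx0⟩ := Submodule.exists_mem_ne_zero_of_ne_bot hbot
    have hdisc : p ^ 2 + b * c ≠ 0 := fun h => hx0 (by
      obtain ⟨rfl, rfl, rfl⟩ := hnil _ _ _ hx h; rfl)
    rcases eq_or_ne c 0 with rfl | hc
    · exact key hbr hnil p b (fun h => hdisc (by simp [h])) hx
    -- An eigenvalue of the element; the shear and the Weyl move below bring it to triangular form
    -- with diagonal entry `s`.
    obtain ⟨s, hs⟩ : ∃ s : ℂ, s ^ 2 = p ^ 2 + b * c :=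
      IsSquare.exists_sq _ (Complex.isSquare _) |>.imp fun _ h => h.symm
    have hs0 : s ≠ 0 := fun h => hdisc (by rw [← hs, h]; simp)
    have hm := isMove_shear ((p + s) / c)
    refine Classified.of_move hm (Classified.of_move isMove_flip (key
      (IsBracketClosed.comap isMove_flip (IsBracketClosed.comap hm hbr)) ?_ s c hs0 ?_))
    · intro p' b' c' hx h
      have h1 := hnil _ _ _ (show shear ((p + s) / c) (flip (p', b', c')) ∈ 𝔤 from hx)
        (by simp only [flip_apply]; linear_combination h)
      obtain ⟨h1, h2, h3⟩ := h1
      obtain rfl : b' = 0 := h3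
      obtain rfl : p' = 0 := by simpa [flip_apply] using h1
      exact ⟨rfl, rfl, by simpa [flip_apply] using h2⟩
    · change shear ((p + s) / c) (flip (s, c, 0)) ∈ 𝔤
      rw [flip_apply, shear_apply]
      convert hx using 3
      · field_simp
        ring
      · field_simp
        linear_combination hs
  · push Not at hnil
    obtain ⟨p, b, c, hx, h, h0⟩ := hnil
    rcases eq_or_ne c 0 with rfl | hc
    · obtain rfl : p = 0 := by simpa using h
      exact classified_of_nilPart hbr htop hx fun hb => h0 rfl hb rfl
    -- A nilpotent with `c ≠ 0` becomes strictly lower triangular under this shear, and strictly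
    -- upper after the Weyl move.
    have hm := isMove_shear (p / c)
    refine Classified.of_move hm (Classified.of_move isMove_flip (classified_of_nilPart
      (IsBracketClosed.comap isMove_flip (IsBracketClosed.comap hm hbr))
      (comap_ne_top (comap_ne_top htop)) (n := c) ?_ hc))
    change shear (p / c) (flip (0, c, 0)) ∈ 𝔤
    rw [flip_apply, shear_apply]
    convert hx using 3
    · field_simp
      ring
    · field_simp
      linear_combination -h

/-- Every nonzero proper subalgebra of `so(1,3)` is conjugate to a listed one. -/
theorem exists_row_of_isLieClosed {G : Submodule ℝ (M → M)} (hG : G ≤ so13) (hc : IsLieClosed G)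
    (hbot : G ≠ ⊥) (htop : G ≠ so13) : ∃ (R : Row) (τ : M ≃L[ℝ] M), IsLorentz τ ∧
      pushField τ '' (G : Set (M → M)) = R.alg := by
  have himg : kill '' (G.comap kill : Set Sl2) = G := by
    rw [Submodule.comap_coe, image_preimage_eq_iff]
    exact fun X hX => so13_le_range (hG hX)
  have hcl : Classified (G.comap kill) → ∃ (R : Row) (τ : M ≃L[ℝ] M), IsLorentz τ ∧
      pushField τ '' (G : Set (M → M)) = R.alg := by
    rintro ⟨R, τ, hτ, h⟩
    exact ⟨R, τ, hτ, by rw [← h, himg]⟩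
  refine hcl (classified_of_bracket_closed ?_ ?_ ?_)
  · intro x hx y hy
    rw [Submodule.mem_comap, ← lieBracket_kill]
    exact hc _ hy _ hx
  · intro h
    refine hbot ((Submodule.eq_bot_iff _).2 fun X hX => ?_)
    obtain ⟨x, rfl⟩ := so13_le_range (hG hX)
    have : x ∈ G.comap kill := hX
    rw [h, Submodule.mem_bot] at this
    rw [this, map_zero]
  · intro h
    refine htop (le_antisymm hG fun X hX => ?_)
    obtain ⟨x, rfl⟩ := so13_le_range hX
    have : x ∈ G.comap kill := h ▸ Submodule.mem_top
    exact this

end Irreducible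

/-! ### From coordinates to the hyperboloid: invariance in rectifying charts. -/

section Charts

variable {F : M → M [⋀^Fin 2]→L[ℝ] ℝ} {W : Set M} {ζ m e : ℝ}

theorem IsEMField.mono {V : Set M} (hF : IsEMField F W) (h : V ⊆ W) : IsEMField F V :=
  ⟨fun x hx => hF.1 x (h hx), fun x hx => hF.2 x (h hx)⟩

/-- A Killing field is determined by its values near a point of `dS`. -/
theorem eq_of_eventually_eq {K L : M →L[ℝ] M} {x : M} (hx : x ∈ dS)
    (h : ∀ᶠ y in 𝓝 x, y ∈ dS → K y = L y) : K = L := by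
  have hr : Filter.Tendsto retr (𝓝 x) (𝓝 x) := by
    have := (contDiffAt_retr (dS_neg hx)).continuousAt
    rwa [ContinuousAt, retr_of_mem hx] at this
  have h1 : (K : M → M) =ᶠ[𝓝 x] L := by
    filter_upwards [hr.eventually h, isOpen_neg.mem_nhds (dS_neg hx)] with y hy hn
    rw [← rad_smul_retr hn, map_smul, map_smul, hy (retr_mem hn)]
  have h2 := h1.fderiv_eq (𝕜 := ℝ)
  rwa [K.fderiv, L.fderiv] at h2

/-- For a Killing field, being a symmetry field is the same as preserving `F`. -/
theorem isSymmetryField_iff (he : e ≠ 0) (hW : IsOpenIn W) (hF : IsEMField F W) {L : M →L[ℝ] M}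
    (hL : IsSkew L) : IsSymmetryField ζ m e F W L ↔ LieInvariant L F W := by
  refine ⟨fun h x hx v w => ?_, isSymmetryField_of_lieInvariant hW hF hL⟩
  obtain ⟨K, -, hKe⟩ := h.exists_killing he hF hx
  rw [eq_of_eventually_eq (hW.subset hx) (hKe.mono fun y hy => hy.1)]
  exact hKe.self_of_nhds.2 v w

theorem Row.differentiableAt_coordGen (R : Row) (A : Fin R.dim) {p : Q} (hp : p ∈ R.coordDomain) :
    DifferentiableAt ℝ (R.coordGen A) p := by
  have ht (h : Real.cos (p 1) ≠ 0) : DifferentiableAt ℝ (fun p : Q => Real.tan (p 1)) p :=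
    DifferentiableAt.comp (g := Real.tan) p (Real.differentiableAt_tan.2 h)
      (differentiableAt_apply 1 p)
  have key : ∀ A, p ∈ R.coordDomain → ∀ i : Fin 3,
      DifferentiableAt ℝ (fun q => R.coordGen A q i) p := by
    refine Row.forall_gen (P := fun R A => p ∈ R.coordDomain → ∀ i : Fin 3,
      DifferentiableAt ℝ (fun q => R.coordGen A q i) p) ?_ ?_ ?_ ?_ ?_ ?_ ?_ ?_ ?_ ?_ ?_ ?_ ?_ R
    all_goals simp +contextual [Row.coordGen, Row.coordDomain, forall_fin_three]
    all_goals and_intros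
    all_goals intros
    all_goals and_intros
    all_goals try have ht := ht (by assumption)
    all_goals fun_prop
  exact differentiableAt_pi.2 (key A hp)

namespace Row.IsRectifying

variable {R : Row} {Ω : Set Q} {ψ : Q → M}

theorem contDiffAt (h : R.IsRectifying Ω ψ) {p : Q} (hp : p ∈ Ω) : ContDiffAt ℝ ∞ ψ p :=
  (h.smooth p hp).contDiffAt (h.isOpen.mem_nhds hp)

theorem retr_comp (h : R.IsRectifying Ω ψ) {p : Q} (hp : p ∈ Ω) : retr ∘ ψ =ᶠ[𝓝 p] ψ :=
  Filter.eventually_of_mem (h.isOpen.mem_nhds hp) fun _ hq => retr_of_mem (h.mapsTo hq)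

theorem fderiv_retr_fderiv (h : R.IsRectifying Ω ψ) {p : Q} (hp : p ∈ Ω) (q : Q) :
    fderiv ℝ retr (ψ p) (fderiv ℝ ψ p q) = fderiv ℝ ψ p q := by
  have h1 := (h.retr_comp hp).fderiv_eq (𝕜 := ℝ)
  rw [fderiv_comp p (differentiableAt_retr (dS_neg (h.mapsTo hp)))
    ((h.contDiffAt hp).differentiableAt (by simp))] at h1
  exact congrArg (fun l => l q) h1

/-- The tangent image has dimension 3 and is orthogonal to `ψ p`, whose square is not zero, so the
two span Minkowski space. -/
theorem surjective_fderiv (h : R.IsRectifying Ω ψ) {p : Q} (hp : p ∈ Ω) {t : ℝ} (ht : t ≠ 0)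
    (v : M) : ∃ (s : ℝ) (q : Q), v = s • ψ p + t • fderiv ℝ ψ p q := by
  set T : ℝ × Q →ₗ[ℝ] M := LinearMap.coprod (LinearMap.toSpanSingleton ℝ M (ψ p))
    (t • (fderiv ℝ ψ p : Q →ₗ[ℝ] M)) with hT
  have hinj : Function.Injective T := by
    refine (injective_iff_map_eq_zero T).2 fun ⟨s, q⟩ hq => ?_
    have hq : s • ψ p + t • fderiv ℝ ψ p q = 0 := by simpa [hT] using hq
    have h1 : mink (ψ p) (fderiv ℝ ψ p q) = 0 := by
      rw [← h.fderiv_retr_fderiv hp]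
      exact mink_fderiv_retr (dS_neg (h.mapsTo hp)) _
    have h2 : mink (ψ p) (s • ψ p + t • fderiv ℝ ψ p q) = -s := by
      rw [mink_add_right, mink_smul_right, mink_smul_right, h1, mem_dS_iff.1 (h.mapsTo hp)]
      ring
    have h3 : s = 0 := by
      rw [hq] at h2
      have : mink (ψ p) 0 = 0 := by simp [mink]
      linarith
    rw [h3, zero_smul, zero_add, smul_eq_zero] at hq
    have h4 : q = 0 := h.immersion p hp ((hq.resolve_left ht).trans (map_zero _).symm)
    rw [h3, h4]; rfl
  have hsurj := (LinearMap.injective_iff_surjective_of_finrank_eq_finrank (f := T) (by simp)).1 hinj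
  obtain ⟨⟨s, q⟩, hq⟩ := hsurj v
  exact ⟨s, q, by simpa [hT] using hq.symm⟩

/-- The map `(t, p) ↦ t ψ(p)` is a submersion for `t > 0`, so the cone over the image is open. -/
theorem isOpenIn_image (h : R.IsRectifying Ω ψ) : IsOpenIn (ψ '' Ω) := by
  set f : ℝ × Q → M := fun z => z.1 • ψ z.2 with hf
  refine ⟨f '' (Ioi 0 ×ˢ Ω), ?_, ?_⟩
  · rw [isOpen_iff_mem_nhds]
    rintro _ ⟨⟨t, p⟩, ⟨ht, hp⟩, rfl⟩
    have hd : HasStrictFDerivAt f (t • (fderiv ℝ ψ p).comp (ContinuousLinearMap.snd ℝ ℝ Q) +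
        (ContinuousLinearMap.fst ℝ ℝ Q).smulRight (ψ p)) (t, p) := by
      have h1 : HasStrictFDerivAt (fun z : ℝ × Q => ψ z.2)
          ((fderiv ℝ ψ p).comp (ContinuousLinearMap.snd ℝ ℝ Q)) (t, p) :=
        HasStrictFDerivAt.comp (g := ψ) (t, p) ((h.contDiffAt hp).hasStrictFDerivAt (by simp))
          hasStrictFDerivAt_snd
      exact HasStrictFDerivAt.smul (c := fun z : ℝ × Q => z.1) hasStrictFDerivAt_fst h1
    rw [← hd.map_nhds_eq_of_surj]
    · exact Filter.image_mem_map ((isOpen_Ioi.prod h.isOpen).mem_nhds ⟨ht, hp⟩)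
    · refine LinearMap.range_eq_top.2 fun v => ?_
      obtain ⟨s, q, hv⟩ := h.surjective_fderiv hp (ne_of_gt ht) v
      exact ⟨(s, q), by simp [hv, add_comm]⟩
  · ext x
    constructor
    · rintro ⟨p, hp, rfl⟩
      exact ⟨⟨(1, p), ⟨one_pos (α := ℝ), hp⟩, one_smul _ _⟩, h.mapsTo hp⟩
    · rintro ⟨⟨⟨t, p⟩, ⟨ht, hp⟩, rfl⟩, hx⟩
      refine ⟨p, hp, ?_⟩
      have h1 := retr_of_mem hx
      rwa [hf, retr_smul ht, retr_of_mem (h.mapsTo hp)] at h1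

theorem pullback_eq (h : R.IsRectifying Ω ψ) {p : Q} (hp : p ∈ Ω) :
    pullback ψ (ext₂ F) p = pullback ψ F p := by
  rw [ext₂, pullback_pullback ((h.contDiffAt hp).differentiableAt (by simp))
    (differentiableAt_retr (dS_neg (h.mapsTo hp))), pullback_congr (h.retr_comp hp)]

theorem pullback_eventuallyEq (h : R.IsRectifying Ω ψ) {p : Q} (hp : p ∈ Ω) :
    pullback ψ (ext₂ F) =ᶠ[𝓝 p] pullback ψ F :=
  Filter.eventually_of_mem (h.isOpen.mem_nhds hp) fun _ hq => h.pullback_eq hq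

theorem lieDeriv_eq (h : R.IsRectifying Ω ψ) (hF : IsEMField F (ψ '' Ω)) (A : Fin R.dim)
    {p : Q} (hp : p ∈ Ω) (v w : Q) :
    lieDeriv (R.coordGen A) (pullback ψ F) p v w =
      lieDeriv (R.gen A) (ext₂ F) (ψ p) (fderiv ℝ ψ p v) (fderiv ℝ ψ p w) := by
  rw [lieDeriv_congr (h.pullback_eventuallyEq hp).symm]
  exact lieDeriv_pullback (h.contDiffAt hp) ((hF.1 _ ⟨p, hp, rfl⟩).differentiableAt (by simp))
    (R.differentiableAt_coordGen A (h.subset hp)) (R.differentiable_gen A _)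
    (Filter.eventually_of_mem (h.isOpen.mem_nhds hp) fun q hq => h.related A q hq) v w

/-- In a rectifying chart, the invariant fields are exactly those of the listed form. -/
theorem lieInvariant_iff (h : R.IsRectifying Ω ψ) (hc : Convex ℝ Ω)
    (hF : IsEMField F (ψ '' Ω)) :
    (∀ A : Fin R.dim, LieInvariant (R.gen A) F (ψ '' Ω)) ↔ R.TableForm Ω (pullback ψ F) := by
  rw [← invariant_iff_tableForm R h.isOpen hc h.subset]
  constructor
  · refine fun hA => ⟨fun p hp => ?_, fun p hp => ?_, fun A p hp v w => ?_⟩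
    · exact (contDiffAt_pullback (h.contDiffAt hp) (hF.1 _ ⟨p, hp, rfl⟩)).congr_of_eventuallyEq
        (h.pullback_eventuallyEq hp).symm
    · rw [← (h.pullback_eventuallyEq hp).extDeriv_eq]
      have := extDeriv_pullback ((hF.1 _ ⟨p, hp, rfl⟩).differentiableAt (by simp)) (h.contDiffAt hp)
        (by simpa [minSmoothness] using two_le_infty)
      unfold pullback
      rw [this, hF.2 _ ⟨p, hp, rfl⟩]
      rfl
    · rw [h.lieDeriv_eq hF A hp, hA A _ ⟨p, hp, rfl⟩]
  · rintro ⟨-, -, hA⟩ A _ ⟨p, hp, rfl⟩ v w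
    have hx : ψ p ∈ cone (ψ '' Ω) := subset_cone h.isOpenIn_image.subset ⟨p, hp, rfl⟩
    have hneg := dS_neg (h.mapsTo hp)
    -- The derivative of the retraction projects to the tangent space, which the chart spans; hence
    -- testing on coordinate vectors suffices.
    have hproj : ∀ v, ∃ q, fderiv ℝ retr (ψ p) v = fderiv ℝ ψ p q := by
      intro v
      obtain ⟨s, q, rfl⟩ := h.surjective_fderiv hp one_ne_zero v
      exact ⟨q, by rw [map_add, map_smul, fderiv_retr_self hneg, smul_zero, zero_add, one_smul,
        h.fderiv_retr_fderiv hp]⟩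
    obtain ⟨v', hv⟩ := hproj v
    obtain ⟨w', hw⟩ := hproj w
    rw [← R.genL_coe, lieDeriv_retr hF (R.isSkew_genL A) hx, hv, hw, retr_of_mem (h.mapsTo hp),
      R.genL_coe, ← h.lieDeriv_eq hF A hp, hA A p hp]

theorem isSymmetryField_iff (h : R.IsRectifying Ω ψ) (he : e ≠ 0) (hc : Convex ℝ Ω)
    (hF : IsEMField F (ψ '' Ω)) :
    (∀ A : Fin R.dim, IsSymmetryField ζ m e F (ψ '' Ω) (R.gen A)) ↔
      R.TableForm Ω (pullback ψ F) := by
  rw [← h.lieInvariant_iff hc hF]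
  refine forall_congr' fun A => ?_
  rw [← R.genL_coe]
  exact DeSitter.isSymmetryField_iff he h.isOpenIn_image hF (R.isSkew_genL A)

end Row.IsRectifying

end Charts

/-! ### Equivariance under Lorentz transformations. -/

section Transport

variable {F : M → M [⋀^Fin 2]→L[ℝ] ℝ} {W : Set M} {ζ m e : ℝ} {τ : M ≃L[ℝ] M}

theorem IsLorentz.symm (hτ : IsLorentz τ) : IsLorentz τ.symm := fun x y => by
  rw [← hτ, τ.apply_symm_apply, τ.apply_symm_apply]

theorem IsLorentz.retr_apply (hτ : IsLorentz τ) (x : M) : retr (τ x) = τ (retr x) := by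
  rw [retr, retr, hτ, map_smul]

theorem IsLorentz.map_mem (hτ : IsLorentz τ) {x : M} (hx : x ∈ dS) : τ x ∈ dS :=
  (hτ x x).trans hx

theorem IsOpenIn.image (hτ : IsLorentz τ) (hW : IsOpenIn W) : IsOpenIn (τ '' W) := by
  obtain ⟨O, hO, rfl⟩ := hW
  refine ⟨τ '' O, τ.toHomeomorph.isOpenMap O hO, ?_⟩
  rw [image_inter τ.injective]
  congr 1
  ext x
  refine ⟨?_, fun hx => ⟨τ.symm x, hτ.symm.map_mem hx, τ.apply_symm_apply x⟩⟩
  rintro ⟨y, hy, rfl⟩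
  exact hτ.map_mem hy

/-- Lorentz transformations commute with the retraction, so extending and transporting a form can be
interchanged. -/
theorem ext₂_pushForm (hτ : IsLorentz τ) {x : M} (hx : mink x x < 0) :
    ext₂ (pushForm τ F) x = pullback τ.symm (ext₂ F) x := by
  have h1 : pushForm τ F = pullback τ.symm F := by
    funext y
    rw [pullback, τ.symm.fderiv]
    rfl
  have h2 : mink (τ.symm x) (τ.symm x) < 0 := by rwa [hτ.symm]
  rw [ext₂, ext₂, h1, pullback_pullback (differentiableAt_retr hx) τ.symm.differentiableAt,
    pullback_pullback τ.symm.differentiableAt (differentiableAt_retr h2)]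
  congr 1
  funext y
  exact (hτ.symm.retr_apply y).symm

theorem ext₂_pushForm_eventuallyEq (hτ : IsLorentz τ) {x : M} (hx : mink x x < 0) :
    ext₂ (pushForm τ F) =ᶠ[𝓝 x] pullback τ.symm (ext₂ F) :=
  Filter.eventually_of_mem (isOpen_neg.mem_nhds hx) fun _ hy => ext₂_pushForm hτ hy

theorem IsEMField.pushForm (hτ : IsLorentz τ) (hW : W ⊆ dS) (hF : IsEMField F W) :
    IsEMField (pushForm τ F) (τ '' W) := by
  refine ⟨?_, ?_⟩ <;> rintro _ ⟨x, hx, rfl⟩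
  all_goals
    have hs := τ.symm_apply_apply x
    have he := ext₂_pushForm_eventuallyEq (F := F) hτ (dS_neg (hτ.map_mem (hW hx)))
  · exact (contDiffAt_pullback τ.symm.contDiff.contDiffAt
      (by rw [hs]; exact hF.1 x hx)).congr_of_eventuallyEq he
  · rw [he.extDeriv_eq]
    have hd : DifferentiableAt ℝ (ext₂ F) (τ.symm (τ x)) := by
      rw [hs]
      exact (hF.1 x hx).differentiableAt (by simp)
    have := extDeriv_pullback (r := ∞) hd τ.symm.contDiff.contDiffAt
      (by simpa [minSmoothness] using two_le_infty)
    unfold pullback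
    rw [this, hs, hF.2 x hx]
    rfl

theorem LieInvariant.pushForm (hτ : IsLorentz τ) (hW : W ⊆ dS) (hF : IsEMField F W)
    {L : M →L[ℝ] M} (h : LieInvariant L F W) :
    LieInvariant (pushField τ L) (pushForm τ F) (τ '' W) := by
  rintro _ ⟨x, hx, rfl⟩ v w
  have hs := τ.symm_apply_apply x
  have hd : ∀ y, DifferentiableAt ℝ (pushField τ L) y := fun y =>
    ((τ : M →L[ℝ] M).comp (L.comp (τ.symm : M →L[ℝ] M))).differentiableAt
  rw [lieDeriv_congr (ext₂_pushForm_eventuallyEq hτ (dS_neg (hτ.map_mem (hW hx)))),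
    lieDeriv_pullback (Y := L) τ.symm.contDiff.contDiffAt
      (by rw [hs]; exact (hF.1 x hx).differentiableAt (by simp)) (hd _) L.differentiableAt, hs, h x hx]
  refine Filter.Eventually.of_forall fun y => ?_
  rw [τ.symm.fderiv]
  exact τ.symm_apply_apply _

/-- The listed form of a field that is preserved by a conjugate of a listed algebra. -/
theorem tableForm_pushForm (hτ : IsLorentz τ) (hW : IsOpenIn W) (hF : IsEMField F W) {R : Row}
    (hR : ∀ A, R.gen A ∈ pushField τ '' admissible F W) {Ω : Set Q} {ψ : Q → M}
    (hψ : R.IsRectifying Ω ψ) (hc : Convex ℝ Ω) (hsub : ψ '' Ω ⊆ τ '' W) :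
    R.TableForm Ω (pullback ψ (pushForm τ F)) := by
  refine (hψ.lieInvariant_iff hc ((hF.pushForm hτ hW.subset).mono hsub)).1 fun A x hx => ?_
  obtain ⟨X, ⟨hX, hXF⟩, hXA⟩ := hR A
  obtain ⟨L, -, rfl⟩ := mem_so13_iff.1 hX
  rw [← hXA]
  exact LieInvariant.pushForm hτ hW.subset hF hXF x (hsub hx)

end Transport

/-! ### The admissible algebra; symmetry fields on connected sets. -/

section Admissible

variable {F : M → M [⋀^Fin 2]→L[ℝ] ℝ} {W : Set M} {ζ m e : ℝ}

theorem lieDeriv_clm (L : M →L[ℝ] M) (θ : M → M [⋀^Fin 2]→L[ℝ] ℝ) (x v w : M) :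
    lieDeriv L θ x v w = fderiv ℝ θ x (L x) ![v, w] + θ x ![L v, w] + θ x ![v, L w] := by
  rw [lieDeriv, L.fderiv]

/-- Each invariance equation holds on an open cone and may be differentiated along the other field.
The second derivatives of the form cancel by symmetry, and the mixed terms are removed by the
undifferentiated equations. -/
theorem LieInvariant.bracket (hW : IsOpenIn W) (hF : IsEMField F W) {K L : M →L[ℝ] M}
    (hK : IsSkew K) (hL : IsSkew L) (hKF : LieInvariant K F W) (hLF : LieInvariant L F W) :
    LieInvariant (L.comp K - K.comp L : M →L[ℝ] M) F W := by
  intro x hx v w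
  have hxc : x ∈ DeSitter.cone W := subset_cone hW.subset hx
  have h1 : DifferentiableAt ℝ (ext₂ F) x := (hF.1 x hx).differentiableAt (by simp)
  have h2 : DifferentiableAt ℝ (fderiv ℝ (ext₂ F)) x :=
    ((hF.1 x hx).fderiv_right (m := ∞) (by simp)).differentiableAt (by simp)
  have key : ∀ T : M →L[ℝ] M, IsSkew T → LieInvariant T F W → ∀ u,
      fderiv ℝ (fderiv ℝ (ext₂ F)) x u (T x) ![v, w] + fderiv ℝ (ext₂ F) x (T u) ![v, w]
        + fderiv ℝ (ext₂ F) x u ![T v, w] + fderiv ℝ (ext₂ F) x u ![v, T w] = 0 := by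
    intro T hT hTF u
    have h3 := h2.hasFDerivAt.clm_apply T.hasFDerivAt
    have ev : ∀ a b : M, HasFDerivAt (fun y => ext₂ F y ![a, b])
        ((ContinuousAlternatingMap.apply ℝ M ℝ ![a, b]).comp (fderiv ℝ (ext₂ F) x)) x := fun a b =>
      (ContinuousAlternatingMap.apply ℝ M ℝ ![a, b]).hasFDerivAt.comp x h1.hasFDerivAt
    have h4 := (((ContinuousAlternatingMap.apply ℝ M ℝ ![v, w]).hasFDerivAt.comp x h3).add
      (ev (T v) w)).add (ev v (T w))
    have h5 : ∀ᶠ y in 𝓝 x, lieDeriv T (ext₂ F) y v w = (fun _ => (0 : ℝ)) y :=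
      Filter.eventually_of_mem ((isOpen_cone hW).mem_nhds hxc) fun y hy => hTF.cone hF hT hy v w
    simp only [lieDeriv_clm] at h5
    have h6 := h4.unique ((hasFDerivAt_const (0 : ℝ) x).congr_of_eventuallyEq h5)
    have h7 := congrArg (fun l => l u) h6
    simp only [add_apply, ContinuousLinearMap.comp_apply, zero_apply,
      ContinuousLinearMap.flip_apply, ContinuousAlternatingMap.apply_apply,
      ContinuousAlternatingMap.add_apply] at h7
    linarith
  have hs := symm_snd (hF.1 x hx) (L x) (K x)
  have hKL := key K hK hKF (L x)
  have hLK := key L hL hLF (K x)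
  have e1 := hLF x hx (K v) w
  have e2 := hLF x hx v (K w)
  have e3 := hKF x hx (L v) w
  have e4 := hKF x hx v (L w)
  rw [lieDeriv_clm] at e1 e2 e3 e4
  rw [lieDeriv_clm]
  simp only [sub_apply, ContinuousLinearMap.comp_apply, map_sub,
    ContinuousAlternatingMap.sub_apply, form_sub_left, form_sub_right]
  rw [hs] at hKL
  linarith

/-- The admissible algebra as a subspace of `so(1,3)`. -/
def admissibleAlg (F : M → M [⋀^Fin 2]→L[ℝ] ℝ) (W : Set M) : Submodule ℝ (M → M) where
  carrier := admissible F W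
  zero_mem' := ⟨so13.zero_mem, fun x _ v w => by
    have := lieDeriv_clm 0 (ext₂ F) x v w
    simpa [form_zero_left, form_zero_right] using this⟩
  add_mem' := by
    rintro X Y ⟨hX, hXF⟩ ⟨hY, hYF⟩
    refine ⟨so13.add_mem hX hY, fun x hx v w => ?_⟩
    obtain ⟨K, -, rfl⟩ := mem_so13_iff.1 hX
    obtain ⟨L, -, rfl⟩ := mem_so13_iff.1 hY
    have e1 := hXF x hx v w
    have e2 := hYF x hx v w
    rw [← FunLike.coe_add]
    rw [lieDeriv_clm] at e1 e2 ⊢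
    simp only [add_apply, map_add, ContinuousAlternatingMap.add_apply, form_add_left,
      form_add_right]
    linarith
  smul_mem' := by
    rintro c X ⟨hX, hXF⟩
    refine ⟨so13.smul_mem c hX, fun x hx v w => ?_⟩
    obtain ⟨K, -, rfl⟩ := mem_so13_iff.1 hX
    have e1 := hXF x hx v w
    rw [← FunLike.coe_smul]
    rw [lieDeriv_clm] at e1 ⊢
    simp only [smul_apply, map_smul, ContinuousAlternatingMap.smul_apply, form_smul_left,
      form_smul_right, smul_eq_mul]
    linear_combination c * e1

theorem isLieClosed_admissibleAlg (hW : IsOpenIn W) (hF : IsEMField F W) :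
    IsLieClosed (admissibleAlg F W) := by
  rintro X ⟨hX, hXF⟩ Y ⟨hY, hYF⟩
  obtain ⟨K, hK, rfl⟩ := mem_so13_iff.1 hX
  obtain ⟨L, hL, rfl⟩ := mem_so13_iff.1 hY
  rw [lieBracket_linear]
  exact ⟨mem_so13_of_isSkew (hK.bracket hL), hXF.bracket hW hF hK hL hYF⟩

theorem sum_eta_mink (a : M) : a = ∑ i, (eta i * mink a (Pi.single i 1)) • Pi.single i (1 : ℝ) := by
  conv_lhs => rw [pi_eq_sum_univ' a]
  refine Finset.sum_congr rfl fun i _ => ?_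
  rw [mink_single_right, ← mul_assoc, eta_mul_self, one_mul]

/-- A field that is preserved by all Killing fields vanishes. -/
theorem ext₂_eq_zero_of_forall (hW : W ⊆ dS) (h : ∀ L : M →L[ℝ] M, IsSkew L → LieInvariant L F W)
    {x : M} (hx : x ∈ W) : ext₂ F x = 0 := by
  have hn := dS_neg (hW hx)
  set P : M → M := fun v => v + mink x v • x with hP
  have hPx : ∀ v, mink (P v) x = 0 := by
    intro v
    rw [hP, mink_add_left, mink_smul_left, mink_comm v x, mem_dS_iff.1 (hW hx)]
    ring
  have hPs : ∀ v w, mink (P v) w = mink (P w) v := by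
    intro v w
    simp only [hP, mink_add_left, mink_smul_left]
    rw [mink_comm v w]; ring
  have hPl : ∀ v w, ext₂ F x ![P v, w] = ext₂ F x ![v, w] := by
    intro v w
    rw [hP, form_add_left, form_smul_left, ext₂_self_left hn, mul_zero, add_zero]
  -- Invariance under the infinitesimal rotation in the plane of the projections of `a` and `b`. It
  -- fixes `x`, so no derivative of the form appears.
  have hrot : ∀ a b v w, mink (P b) v * ext₂ F x ![a, w] - mink (P a) v * ext₂ F x ![b, w]
      + mink (P b) w * ext₂ F x ![v, a] - mink (P a) w * ext₂ F x ![v, b] = 0 := by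
    intro a b v w
    set L : M →L[ℝ] M := (minkL (P b)).smulRight (P a) - (minkL (P a)).smulRight (P b) with hL
    have hLv : ∀ y, L y = mink (P b) y • P a - mink (P a) y • P b := fun y => rfl
    have hsk : IsSkew L := by
      intro y z
      rw [hLv, hLv]
      simp only [sub_eq_add_neg, ← neg_smul, mink_add_left, mink_add_right, mink_smul_left,
        mink_smul_right]
      rw [mink_comm y, mink_comm y]
      ring
    have h1 := h L hsk x hx v w
    rw [lieDeriv_clm, hLv x, hPx, hPx, hLv, hLv, zero_smul, zero_smul, sub_zero, map_zero,
      form_sub_left, form_sub_right, form_smul_left, form_smul_left, form_smul_right,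
      form_smul_right, hPl, hPl, form_swap _ v (P a), form_swap _ v (P b), hPl, hPl,
      form_swap _ a v, form_swap _ b v] at h1
    rw [show (0 : M [⋀^Fin 2]→L[ℝ] ℝ) ![v, w] = 0 from rfl] at h1
    linarith
  have hcontr : ∀ a c, ∑ i, eta i * (mink (P a) (Pi.single i 1) * ext₂ F x ![Pi.single i 1, c])
      = ext₂ F x ![a, c] := by
    intro a c
    rw [← hPl a c, ← formBilin_apply]
    conv_rhs => rw [sum_eta_mink (P a)]
    rw [map_sum, LinearMap.sum_apply]
    refine Finset.sum_congr rfl fun i _ => ?_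
    rw [map_smul, LinearMap.smul_apply, formBilin_apply, smul_eq_mul, mul_assoc]
  apply form_ext
  intro a w
  have htr : ∑ i, eta i * mink (P (Pi.single i 1)) (Pi.single i 1) = 3 := by
    have h1 := mem_dS_iff.1 (hW hx)
    rw [mink_eq] at h1
    simp [hP, Fin.sum_univ_four, mink_eq, eta]
    linarith
  -- Contracting `b` with `v` leaves `(3 - 1 - 1) F(a, w) = 0`, where 3 is the trace of the tangent
  -- projection.
  have h1 : ∑ i, eta i * (mink (P (Pi.single i 1)) (Pi.single i 1) * ext₂ F x ![a, w]
      - mink (P a) (Pi.single i 1) * ext₂ F x ![Pi.single i 1, w]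
      + mink (P w) (Pi.single i 1) * ext₂ F x ![Pi.single i 1, a]) = 0 := by
    refine Finset.sum_eq_zero fun i _ => ?_
    have := hrot a (Pi.single i 1) (Pi.single i 1) w
    rw [form_self, mul_zero, sub_zero, hPs _ w] at this
    rw [this, mul_zero]
  simp only [mul_add, mul_sub, Finset.sum_add_distrib, Finset.sum_sub_distrib,
    ← mul_assoc, ← Finset.sum_mul] at h1
  simp only [mul_assoc, hcontr, htr] at h1
  rw [form_swap _ w a] at h1
  change _ = 0
  linarith

/-- On a connected open set, a symmetry field is the restriction of a single Killing field. -/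
theorem IsSymmetryField.exists_global_killing (he : e ≠ 0) (hW : IsOpenIn W)
    (hc : IsPreconnected W) (hF : IsEMField F W) {X : M → M} (h : IsSymmetryField ζ m e F W X)
    (hne : W.Nonempty) :
    ∃ L : M →L[ℝ] M, IsSkew L ∧ (∀ x ∈ W, X x = L x) ∧ LieInvariant L F W := by
  obtain ⟨x₀, hx₀⟩ := hne
  -- `N L` is the set where `X` has the germ of `L`. These sets are open, cover `W` and do not
  -- overlap on it, so connectedness leaves only one.
  set N : (M →L[ℝ] M) → Set M := fun L => {x | ∀ᶠ y in 𝓝 x, y ∈ dS → X y = L y} with hN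
  have hNo : ∀ L, IsOpen (N L) := fun L => isOpen_setOfPred_eventually_nhds
  have huniq : ∀ {K L x}, x ∈ W → x ∈ N K → x ∈ N L → K = L := by
    intro K L x hx hK hL
    refine eq_of_eventually_eq (hW.subset hx) ?_
    filter_upwards [hK, hL] with y h1 h2 hy
    rw [← h1 hy, h2 hy]
  obtain ⟨L, hL, hLe⟩ := h.exists_killing he hF hx₀
  have hall : W ⊆ N L := by
    by_contra hcon
    obtain ⟨x₁, hx₁, hx₁N⟩ := not_subset.1 hcon
    have hcov : W ⊆ N L ∪ ⋃ (K) (_ : K ≠ L), N K := by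
      intro x hx
      obtain ⟨K, -, hKe⟩ := h.exists_killing he hF hx
      have hxK : x ∈ N K := hKe.mono fun y hy => hy.1
      rcases eq_or_ne K L with rfl | hKL
      · exact .inl hxK
      · exact .inr (mem_iUnion₂.2 ⟨K, hKL, hxK⟩)
    obtain ⟨x, hx, hxL, hxK⟩ := hc _ _ (hNo L) (isOpen_biUnion fun K _ => hNo K) hcov
      ⟨x₀, hx₀, hLe.mono fun y hy => hy.1⟩ ⟨x₁, hx₁, (hcov hx₁).resolve_left hx₁N⟩
    obtain ⟨K, hKL, hxK⟩ := mem_iUnion₂.1 hxK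
    exact hKL (huniq hx hxK hxL)
  refine ⟨L, hL, fun x hx => (hall hx).self_of_nhds (hW.subset hx), fun x hx v w => ?_⟩
  obtain ⟨K, -, hKe⟩ := h.exists_killing he hF hx
  rw [huniq hx (hall hx) (hKe.mono fun y hy => hy.1)]
  exact hKe.self_of_nhds.2 v w

end Admissible

/-! ### Rectification of a single Killing field by its flow. -/

section FlowBox

/-- An immersion at a point is an injective immersion near it. -/
theorem exists_ball_immersion {ψ : Q → M} {U : Set Q} (hU : IsOpen U) (h0 : (0 : Q) ∈ U)
    (hψ : ContDiffOn ℝ ∞ ψ U) (hinj : Function.Injective (fderiv ℝ ψ 0)) :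
    ∃ r > 0, Metric.ball (0 : Q) r ⊆ U ∧ InjOn ψ (Metric.ball 0 r) ∧
      ∀ p ∈ Metric.ball (0 : Q) r, Function.Injective (fderiv ℝ ψ p) := by
  have hat : ∀ p ∈ U, ContDiffAt ℝ ∞ ψ p := fun p hp => (hψ p hp).contDiffAt (hU.mem_nhds hp)
  -- Composed with a left inverse of `Dψ(0)`, the map is near 0 a perturbation of the identity with
  -- derivative error at most `1/2`, hence injective together with its derivative.
  obtain ⟨A', hA'⟩ := LinearMap.exists_leftInverse_of_injective (fderiv ℝ ψ 0 : Q →ₗ[ℝ] M)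
    (LinearMap.ker_eq_bot.2 hinj)
  set A : M →L[ℝ] Q := LinearMap.toContinuousLinearMap A' with hA
  have hA0 : A.comp (fderiv ℝ ψ 0) = ContinuousLinearMap.id ℝ Q := by
    ext1 v
    exact congrArg (fun l => l v) hA'
  have hcont : ContinuousAt (fun p => A.comp (fderiv ℝ ψ p)) 0 :=
    (continuous_const.clm_comp continuous_id).continuousAt.comp
      ((hat 0 h0).fderiv_right (m := ∞) (by simp)).continuousAt
  have hev : ∀ᶠ p in 𝓝 (0 : Q), dist (A.comp (fderiv ℝ ψ p)) (ContinuousLinearMap.id ℝ Q) < 1 / 2 := by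
    have := Metric.tendsto_nhds.1 hcont (1 / 2) (by norm_num)
    simpa only [hA0] using this
  obtain ⟨r, hr, hball⟩ := Metric.mem_nhds_iff.1 (Filter.inter_mem hev (hU.mem_nhds h0))
  have hle : ∀ p ∈ Metric.ball (0 : Q) r,
      ‖A.comp (fderiv ℝ ψ p) - ContinuousLinearMap.id ℝ Q‖ ≤ 1 / 2 := fun p hp =>
    (dist_eq_norm (A.comp (fderiv ℝ ψ p)) _ ▸ (hball hp).1.le)
  refine ⟨r, hr, fun p hp => (hball hp).2, fun p hp q hq hpq => ?_, fun p hp => ?_⟩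
  · have hd : ∀ p ∈ Metric.ball (0 : Q) r, HasFDerivAt (A ∘ ψ) (A.comp (fderiv ℝ ψ p)) p := fun p hp =>
      A.hasFDerivAt.comp p ((hat p (hball hp).2).differentiableAt (by simp)).hasFDerivAt
    have h1 := Convex.norm_image_sub_le_of_norm_fderiv_le' (𝕜 := ℝ) (φ := ContinuousLinearMap.id ℝ Q)
      (C := 1 / 2) (fun p hp => (hd p hp).differentiableAt)
      (fun p hp => by rw [(hd p hp).fderiv]; exact hle p hp) (convex_ball 0 r) hp hq
    rw [Function.comp_apply, Function.comp_apply, hpq, sub_self, zero_sub, norm_neg,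
      ContinuousLinearMap.id_apply] at h1
    have h2 : ‖q - p‖ = 0 := le_antisymm (by linarith) (norm_nonneg _)
    exact (sub_eq_zero.1 (norm_eq_zero.1 h2)).symm
  · refine (injective_iff_map_eq_zero (fderiv ℝ ψ p)).2 fun v hv => ?_
    have h1 := (A.comp (fderiv ℝ ψ p) - ContinuousLinearMap.id ℝ Q).le_of_opNorm_le (hle p hp) v
    rw [sub_apply, ContinuousLinearMap.comp_apply, hv, map_zero, zero_sub,
      norm_neg, ContinuousLinearMap.id_apply] at h1
    exact norm_eq_zero.1 (le_antisymm (by linarith) (norm_nonneg _))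

theorem hasDerivAt_exp_apply (K : M →L[ℝ] M) (x : M) (t : ℝ) :
    HasDerivAt (fun s : ℝ => NormedSpace.exp (s • K) x) (K (NormedSpace.exp (t • K) x)) t := by
  have h := (hasDerivAt_exp_smul_const' (𝕂 := ℝ) K t).clm_apply (hasDerivAt_const t x)
  simpa using h

/-- The flow of a Killing field consists of isometries. -/
theorem IsSkew.mink_exp {K : M →L[ℝ] M} (hK : IsSkew K) (x : M) (t : ℝ) :
    mink (NormedSpace.exp (t • K) x) (NormedSpace.exp (t • K) x) = mink x x := by
  have hd : ∀ s : ℝ, HasDerivAt (fun s : ℝ =>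
      mink (NormedSpace.exp (s • K) x) (NormedSpace.exp (s • K) x)) 0 s := by
    intro s
    have h := (hasFDerivAt_mink_self (NormedSpace.exp (s • K) x)).comp_hasDerivAt s
      (hasDerivAt_exp_apply K x s)
    have h0 : (2 • minkL (NormedSpace.exp (s • K) x)) (K (NormedSpace.exp (s • K) x)) = 0 := by
      change 2 • mink _ _ = 0
      rw [hK.self, smul_zero]
    rwa [h0] at h
  have := is_const_of_deriv_eq_zero (fun s => (hd s).differentiableAt) (fun s => (hd s).deriv) t 0
  rw [this, zero_smul, NormedSpace.exp_zero]
  rfl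

/-- A Killing field can be rectified near every point where it does not vanish. -/
theorem exists_flowBox {K : M →L[ℝ] M} (hK : IsSkew K) {y : M} (hy : y ∈ dS) (hne : K y ≠ 0)
    {O : Set M} (hO : IsOpen O) (hyO : y ∈ O) :
    ∃ (Ω : Set Q) (ψ : Q → M), IsOpen Ω ∧ Convex ℝ Ω ∧ MapsTo ψ Ω dS ∧ ContDiffOn ℝ ∞ ψ Ω ∧
      InjOn ψ Ω ∧ (∀ p ∈ Ω, Function.Injective (fderiv ℝ ψ p)) ∧
      (∀ p ∈ Ω, fderiv ℝ ψ p ![1, 0, 0] = K (ψ p)) ∧ y ∈ ψ '' Ω ∧ ψ '' Ω ⊆ O := by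
  have hli : LinearIndependent ℝ ![y, K y] := by
    refine LinearIndependent.pair_iff.2 fun s t hst => ?_
    have h1 : mink y (s • y + t • K y) = -s := by
      rw [mink_add_right, mink_smul_right, mink_smul_right, hK.self, mem_dS_iff.1 hy]
      ring
    have h2 : s = 0 := by
      rw [hst] at h1
      have : mink y 0 = 0 := by simp [mink]
      linarith
    rw [h2, zero_smul, zero_add] at hst
    exact ⟨h2, (smul_eq_zero.1 hst).resolve_right hne⟩
  -- `v` and `w` complete `y` and `K y` to a basis, so the affine slice `y + p₁ v + p₂ w` is
  -- transverse both to the ray and to the flow.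
  obtain ⟨v, hv⟩ := exists_linearIndependent_cons_of_lt_finrank hli (by simp)
  obtain ⟨w, hw⟩ := exists_linearIndependent_cons_of_lt_finrank hv (by simp)
  set a : Q → M := fun p => y + p 1 • v + p 2 • w with ha
  have ha' : ∀ p, HasFDerivAt a ((ContinuousLinearMap.proj (R := ℝ) (φ := fun _ : Fin 3 => ℝ) 1).smulRight v
      + (ContinuousLinearMap.proj (R := ℝ) (φ := fun _ : Fin 3 => ℝ) 2).smulRight w) p := by
    intro p
    have h1 := ((ContinuousLinearMap.proj (R := ℝ) (φ := fun _ : Fin 3 => ℝ) 1).smulRight v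
      + (ContinuousLinearMap.proj (R := ℝ) (φ := fun _ : Fin 3 => ℝ) 2).smulRight w).hasFDerivAt
      (x := p)
    refine (h1.const_add y).congr_of_eventuallyEq (Filter.Eventually.of_forall fun q => ?_)
    simp [ha, add_assoc]
  have hac : ContDiff ℝ ∞ a := by
    simp only [ha]
    fun_prop
  -- The first coordinate is the time of the linear flow; the slice is first retracted to `dS`, and
  -- the flow preserves `dS`.
  set ψ : Q → M := fun p => NormedSpace.exp (p 0 • K) (retr (a p)) with hψ
  set U : Set Q := a ⁻¹' {x | mink x x < 0} with hU
  have hUo : IsOpen U := isOpen_neg.preimage hac.continuous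
  have ha0 : a 0 = y := by simp [ha]
  have hU0 : (0 : Q) ∈ U := by
    change mink (a 0) (a 0) < 0
    rw [ha0]
    exact dS_neg hy
  have hψ0 : ψ 0 = y := by
    simp [hψ, ha0, retr_of_mem hy]
  have hψd : ∀ p ∈ U, ContDiffAt ℝ ∞ ψ p := by
    intro p hp
    have h1 : ContDiffAt ℝ ∞ (fun p : Q => NormedSpace.exp (p 0 • K)) p :=
      ContDiffAt.comp (g := NormedSpace.exp) (f := fun p : Q => p 0 • K) p
        (NormedSpace.exp_analytic (𝕂 := ℝ) (p 0 • K)).contDiffAt (by fun_prop)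
    exact h1.clm_apply ((contDiffAt_retr hp).comp p hac.contDiffAt)
  have hψ' : ∀ p ∈ U, ∀ q, fderiv ℝ ψ p q = NormedSpace.exp (p 0 • K)
      (fderiv ℝ retr (a p) (q 1 • v + q 2 • w)) + q 0 • K (ψ p) := by
    intro p hp q
    have h1 : HasFDerivAt (fun p : Q => NormedSpace.exp (p 0 • K)) _ p :=
      HasFDerivAt.comp (g := fun s : ℝ => NormedSpace.exp (s • K)) (f := fun p : Q => p 0) p
        (hasDerivAt_exp_smul_const' (𝕂 := ℝ) K (p 0)).hasFDerivAt (hasFDerivAt_apply 0 p)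
    have h2 := (differentiableAt_retr hp).hasFDerivAt.comp p (ha' p)
    have h3 := (h1.clm_apply h2).fderiv
    rw [hψ]
    refine (congrArg (fun l => l q) h3).trans ?_
    simp
  have hinj : Function.Injective (fderiv ℝ ψ 0) := by
    refine (injective_iff_map_eq_zero _).2 fun q hq => ?_
    rw [hψ' 0 hU0, hψ0, ha0, fderiv_retr_of_mem hy] at hq
    have hq' : q 1 • v + q 2 • w + mink y (q 1 • v + q 2 • w) • y + q 0 • K y = 0 := by
      simpa using hq
    have h4 := Fintype.linearIndependent_iff.1 hw ![q 2, q 1, mink y (q 1 • v + q 2 • w), q 0]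
      (by
        rw [← hq']
        simp [Fin.sum_univ_succ]
        abel)
    have e0 := h4 0
    have e1 := h4 1
    have e3 := h4 3
    funext i
    fin_cases i
    · exact e3
    · exact e1
    · exact e0
  have hVo : IsOpen (U ∩ ψ ⁻¹' O) :=
    ContinuousOn.isOpen_inter_preimage (fun p hp => (hψd p hp).continuousAt.continuousWithinAt) hUo hO
  obtain ⟨r, hr, hsub, hio, him⟩ := exists_ball_immersion hVo ⟨hU0, by rwa [mem_preimage, hψ0]⟩
    (fun p hp => (hψd p hp.1).contDiffWithinAt) hinj
  refine ⟨Metric.ball 0 r, ψ, Metric.isOpen_ball, convex_ball 0 r, fun p hp => ?_,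
    fun p hp => (hψd p (hsub hp).1).contDiffWithinAt, hio, him, fun p hp => ?_,
    ⟨0, Metric.mem_ball_self hr, hψ0⟩, ?_⟩
  · exact (hK.mink_exp _ _).trans (retr_mem (hsub hp).1)
  · rw [hψ' p (hsub hp).1]
    simp
  · rintro _ ⟨p, hp, rfl⟩
    exact (hsub hp).2

theorem Row.coord_of_dim_eq_one {R : Row} (hR : R.dim = 1) :
    R.coordDomain = univ ∧ ∀ A p, R.coordGen A p = ![1, 0, 0] := by
  cases R <;> simp [Row.dim] at hR
  all_goals
    refine ⟨rfl, ?_⟩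
    change ∀ A : Fin 1, ∀ p, _ = _
    rw [Fin.forall_fin_one]
    exact fun _ => rfl

/-- A one-dimensional row asks only that its generator be `∂₀`, which the flow box provides. -/
theorem Row.exists_isRectifying {R : Row} (hR : R.dim = 1) (A : Fin R.dim) {y : M} (hy : y ∈ dS)
    (hne : R.gen A y ≠ 0) {O : Set M} (hO : IsOpen O) (hyO : y ∈ O) :
    ∃ (Ω : Set Q) (ψ : Q → M), R.IsRectifying Ω ψ ∧ Convex ℝ Ω ∧ y ∈ ψ '' Ω ∧ ψ '' Ω ⊆ O := by
  rw [← R.genL_coe] at hne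
  obtain ⟨Ω, ψ, h1, h2, h3, h4, h5, h6, h7, h8, h9⟩ := exists_flowBox (R.isSkew_genL A) hy hne hO hyO
  obtain ⟨hd, hg⟩ := Row.coord_of_dim_eq_one hR
  refine ⟨Ω, ψ, ⟨h1, by rw [hd]; exact subset_univ _, h3, h4, h5, h6, fun B p hp => ?_⟩, h2, h8, h9⟩
  have : B = A := by
    have := B.2; have := A.2
    exact Fin.ext (by omega)
  rw [this, hg, h7 p hp, R.genL_coe]

end FlowBox

section Main

variable {F : M → M [⋀^Fin 2]→L[ℝ] ℝ} {W : Set M} {ζ m e : ℝ}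

theorem Row.dim_eq_finrank (R : Row) : Module.finrank ℝ R.alg = R.dim := by
  rw [Row.alg, finrank_span_eq_card R.linearIndependent_gen, Fintype.card_fin]

/-- The four-dimensional listed algebra lies inside `so(1,3)`. -/
theorem so13_ne_of_finrank {G : Submodule ℝ (M → M)} (h : Module.finrank ℝ G ≤ 1) : G ≠ so13 := by
  rintro rfl
  have : FiniteDimensional ℝ so13 := FiniteDimensional.span_of_finite ℝ
    ((Set.finite_range fun z : Fin 4 × Fin 4 => J z.1 z.2).subset fun X ⟨i, j, hX⟩ =>
      ⟨(i, j), hX.symm⟩)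
  have h1 := Submodule.finrank_mono (R := ℝ) Row.g41.alg_le
  rw [Row.dim_eq_finrank] at h1
  have : Row.g41.dim = 4 := rfl
  omega

/-- The classification of the admissible algebras of nonzero symmetry. -/
theorem exists_row_admissible (hW : IsOpenIn W) (hF : IsEMField F W) {L : M →L[ℝ] M}
    (hL : IsSkew L) (hL0 : L ≠ 0) (hLF : LieInvariant L F W) :
    ∃ (R : Row) (τ : M ≃L[ℝ] M), IsLorentz τ ∧
      (R.alg : Set (M → M)) ⊆ pushField τ '' admissible F W ∧
      ((∃ x ∈ W, ext₂ F x ≠ 0) → pushField τ '' admissible F W = R.alg) := by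
  have hle : admissibleAlg F W ≤ so13 := fun X hX => hX.1
  by_cases htop : admissibleAlg F W = so13
  -- If every Killing field is admissible, the form vanishes on `W`; the four-dimensional row, whose
  -- table form is zero, is contained in the admissible algebra.
  · refine ⟨.g41, ContinuousLinearEquiv.refl ℝ M, fun _ _ => rfl, fun X hX => ?_, ?_⟩
    · have hX' : X ∈ admissibleAlg F W := htop ▸ Row.g41.alg_le hX
      exact ⟨X, hX', rfl⟩
    · rintro ⟨x, hx, hne⟩
      refine absurd (ext₂_eq_zero_of_forall hW.subset (fun K hK => ?_) hx) hne
      have hK' : (K : M → M) ∈ admissibleAlg F W := htop ▸ mem_so13_of_isSkew hK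
      exact hK'.2
  · have hbot : admissibleAlg F W ≠ ⊥ := by
      intro h
      have h1 : (L : M → M) ∈ admissibleAlg F W := ⟨mem_so13_of_isSkew hL, hLF⟩
      rw [h, Submodule.mem_bot] at h1
      exact hL0 (ContinuousLinearMap.ext fun x => congrFun h1 x)
    obtain ⟨R, τ, hτ, h⟩ := exists_row_of_isLieClosed hle (isLieClosed_admissibleAlg hW hF) hbot htop
    exact ⟨R, τ, hτ, h.ge, fun _ => h⟩

/-- A Killing field is conjugate to a multiple of one of the listed one-dimensional bases. -/
theorem exists_row_of_isSkew {L : M →L[ℝ] M} (hL : IsSkew L) (hL0 : L ≠ 0) :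
    ∃ (R : Row) (τ : M ≃L[ℝ] M) (_ : Fin R.dim) (c : ℝ), R.dim = 1 ∧ IsLorentz τ ∧ c ≠ 0 ∧
      ∀ A, R.gen A = pushField τ (c • (L : M → M)) := by
  set G : Submodule ℝ (M → M) := Submodule.span ℝ {(L : M → M)} with hG
  have hne : (L : M → M) ≠ 0 := fun h => hL0 (ContinuousLinearMap.ext fun x => congrFun h x)
  have hGle : G ≤ so13 := (Submodule.span_singleton_le_iff_mem _ _).2 (mem_so13_of_isSkew hL)
  have hGc : IsLieClosed G := by
    have := isLieClosed_one ![L] (fun A => by fin_cases A; exact hL)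
    rwa [show range (fun A => ((![L] : Fin 1 → M →L[ℝ] M) A : M → M)) = {(L : M → M)} by
      rw [range_unique]; rfl] at this
  have hfin : Module.finrank ℝ G = 1 := finrank_span_singleton hne
  obtain ⟨R, τ, hτ, h⟩ := exists_row_of_isLieClosed hGle hGc
    (by rw [hG, Ne, Submodule.span_singleton_eq_bot]; exact hne) (so13_ne_of_finrank hfin.le)
  have hmem : ∀ A, ∃ c : ℝ, R.gen A = pushField τ (c • (L : M → M)) := by
    intro A
    have h1 : R.gen A ∈ (R.alg : Set (M → M)) := Submodule.subset_span ⟨A, rfl⟩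
    rw [← h] at h1
    obtain ⟨X, hX, hXA⟩ := h1
    -- Every generator is the transport of a multiple of `L`, which will force the row to have
    -- dimension 1.
    obtain ⟨c, rfl⟩ := Submodule.mem_span_singleton.1 hX
    exact ⟨c, hXA.symm⟩
  have hdim : R.dim = 1 := by
    have h1 : R.alg ≤ Submodule.span ℝ {pushField τ L} := by
      refine Submodule.span_le.2 ?_
      rintro _ ⟨A, rfl⟩
      obtain ⟨c, hc⟩ := hmem A
      refine Submodule.mem_span_singleton.2 ⟨c, ?_⟩
      rw [hc]
      funext x
      simp [pushField]
    have h2 := Submodule.finrank_mono (R := ℝ) h1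
    have h3 := finrank_span_le_card (R := ℝ) ({pushField τ L} : Set (M → M))
    rw [R.dim_eq_finrank] at h2
    have h4 : 0 < R.dim := by cases R <;> simp [Row.dim]
    simp at h3
    omega
  set A₀ : Fin R.dim := ⟨0, by omega⟩
  obtain ⟨c, hc⟩ := hmem A₀
  refine ⟨R, τ, A₀, c, hdim, hτ, ?_, fun A => ?_⟩
  · rintro rfl
    refine R.linearIndependent_gen.ne_zero A₀ (hc.trans ?_)
    funext x
    simp [pushField]
  · rw [← hc]
    congr 1
    exact Fin.ext (by have := A.2; have := A₀.2; omega)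

/-- Only the line spanned by `L` is used, so any point where `L` does not vanish has a rectifying
chart for a one-dimensional row. -/
theorem exists_dense_rectified (hW : IsOpenIn W) (hF : IsEMField F W) {L : M →L[ℝ] M}
    (hL : IsSkew L) (hL0 : L ≠ 0) (hLF : LieInvariant L F W) :
    ∃ (R : Row) (τ : M ≃L[ℝ] M), IsLorentz τ ∧ ∃ W₀ ⊆ W, IsOpenIn W₀ ∧ W ⊆ closure W₀ ∧
      ∀ x ∈ W₀, ∃ (Ω : Set Q) (ψ : Q → M), R.IsRectifying Ω ψ ∧ Convex ℝ Ω ∧ τ x ∈ ψ '' Ω ∧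
        ψ '' Ω ⊆ τ '' W ∧ R.TableForm Ω (pullback ψ (pushForm τ F)) := by
  obtain ⟨R, τ, A₀, c, hdim, hτ, hc, hgen⟩ := exists_row_of_isSkew hL hL0
  refine ⟨R, τ, hτ, {x | L x ≠ 0} ∩ W, inter_subset_right,
    isOpenIn_inter hW (isOpen_ne_fun L.continuous continuous_const), fun x hx => ?_, ?_⟩
  · by_contra hcl
    -- Density: a point of `W` outside the closure has a neighbourhood in `dS` on which `L`
    -- vanishes, and a Killing field with zero germ is zero.
    refine hL0 (eq_of_eventually_eq (hW.subset hx) ?_)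
    filter_upwards [isClosed_closure.isOpen_compl.mem_nhds hcl,
      (isOpen_cone hW).mem_nhds (subset_cone hW.subset hx)] with y hy hyc hyd
    by_contra hLy
    exact hy (subset_closure ⟨hLy, (cone_inter_dS hW.subset).subset ⟨hyc, hyd⟩⟩)
  · rintro x ⟨hLx, hx⟩
    obtain ⟨O, hO, hOW⟩ := hW.image hτ
    have hxO : τ x ∈ O ∩ dS := hOW ▸ ⟨x, hx, rfl⟩
    have hne : R.gen A₀ (τ x) ≠ 0 := by
      rw [hgen]
      change τ (c • L (τ.symm (τ x))) ≠ 0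
      rw [τ.symm_apply_apply]
      exact fun h => smul_ne_zero hc hLx (τ.map_eq_zero_iff.1 h)
    obtain ⟨Ω, ψ, hψ, hconv, hmem, hsub⟩ := R.exists_isRectifying hdim A₀ hxO.2 hne hO hxO.1
    have hsub' : ψ '' Ω ⊆ τ '' W := by
      rw [hOW]
      exact subset_inter hsub hψ.mapsTo.image_subset
    refine ⟨Ω, ψ, hψ, hconv, hmem, hsub', tableForm_pushForm hτ hW hF (fun A => ?_) hψ hconv hsub'⟩
    exact ⟨_, (admissibleAlg F W).smul_mem c ⟨mem_so13_of_isSkew hL, hLF⟩, (hgen A).symm⟩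

end Main

end DeSitter

end

theorem mainTheorem1 (ζ m e : ℝ) (he : e ≠ 0) :
    -- the listed subalgebras, their bases and ranks, and their rectifying coordinates
    (∀ R : DeSitter.Row,
      LinearIndependent ℝ R.gen ∧ R.alg ≤ DeSitter.so13 ∧ DeSitter.IsLieClosed R.alg ∧
      IsGreatest {k : ℕ | ∃ x ∈ DeSitter.dS,
        k = Module.finrank ℝ (Submodule.span ℝ (Set.range fun A => R.gen A x))} R.rank ∧
      R.IsRectifying R.chartDomain R.chart) ∧
    -- every nonzero proper subalgebra of `so(1,3)` is conjugate to a listed one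
    (∀ G : Submodule ℝ (DeSitter.M → DeSitter.M), G ≤ DeSitter.so13 → DeSitter.IsLieClosed G →
      G ≠ ⊥ → G ≠ DeSitter.so13 →
      ∃ (R : DeSitter.Row) (τ : DeSitter.M ≃L[ℝ] DeSitter.M), DeSitter.IsLorentz τ ∧
        DeSitter.pushField τ '' (G : Set (DeSitter.M → DeSitter.M)) = R.alg) ∧
    -- the closed invariant 2-forms, in coordinates
    (∀ (R : DeSitter.Row) (Ω : Set DeSitter.Q), IsOpen Ω → Convex ℝ Ω → Ω ⊆ R.coordDomain →
      ∀ θ : DeSitter.Q → DeSitter.Q [⋀^Fin 2]→L[ℝ] ℝ,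
        ((∀ p ∈ Ω, ContDiffAt ℝ ∞ θ p) ∧ (∀ p ∈ Ω, extDeriv θ p = 0) ∧
          ∀ (A : Fin R.dim), ∀ p ∈ Ω, ∀ v w : DeSitter.Q,
            DeSitter.lieDeriv (R.coordGen A) θ p v w = 0) ↔
        R.TableForm Ω θ) ∧
    -- the invariant electromagnetic fields on de Sitter space, in every rectifying chart
    (∀ (R : DeSitter.Row) (Ω : Set DeSitter.Q) (ψ : DeSitter.Q → DeSitter.M),
      R.IsRectifying Ω ψ → Convex ℝ Ω →
      ∀ F : DeSitter.M → DeSitter.M [⋀^Fin 2]→L[ℝ] ℝ, DeSitter.IsEMField F (ψ '' Ω) →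
        ((∀ A : Fin R.dim, DeSitter.LieInvariant (R.gen A) F (ψ '' Ω)) ↔
          R.TableForm Ω (DeSitter.pullback ψ F)) ∧
        ((∀ A : Fin R.dim, DeSitter.IsSymmetryField ζ m e F (ψ '' Ω) (R.gen A)) ↔
          R.TableForm Ω (DeSitter.pullback ψ F))) ∧
    -- up to isometry, these are all fields with a nontrivial first-order symmetry algebra
    (∀ (W : Set DeSitter.M) (F : DeSitter.M → DeSitter.M [⋀^Fin 2]→L[ℝ] ℝ),
      DeSitter.IsOpenIn W → IsPreconnected W → DeSitter.IsEMField F W →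
      DeSitter.AdmitsNontrivialSymmetry ζ m e F W →
      (∃ (R : DeSitter.Row) (τ : DeSitter.M ≃L[ℝ] DeSitter.M), DeSitter.IsLorentz τ ∧
        (R.alg : Set (DeSitter.M → DeSitter.M)) ⊆
          DeSitter.pushField τ '' DeSitter.admissible F W ∧
        ((∃ x ∈ W, DeSitter.ext₂ F x ≠ 0) →
          DeSitter.pushField τ '' DeSitter.admissible F W = R.alg) ∧
        ∀ (Ω : Set DeSitter.Q) (ψ : DeSitter.Q → DeSitter.M),
          R.IsRectifying Ω ψ → Convex ℝ Ω → ψ '' Ω ⊆ τ '' W →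
          R.TableForm Ω (DeSitter.pullback ψ (DeSitter.pushForm τ F))) ∧
      (∃ (R : DeSitter.Row) (τ : DeSitter.M ≃L[ℝ] DeSitter.M), DeSitter.IsLorentz τ ∧
        ∃ W₀ ⊆ W, DeSitter.IsOpenIn W₀ ∧ W ⊆ closure W₀ ∧
          ∀ x ∈ W₀, ∃ (Ω : Set DeSitter.Q) (ψ : DeSitter.Q → DeSitter.M),
            R.IsRectifying Ω ψ ∧ Convex ℝ Ω ∧ τ x ∈ ψ '' Ω ∧ ψ '' Ω ⊆ τ '' W ∧
            R.TableForm Ω (DeSitter.pullback ψ (DeSitter.pushForm τ F)))) := by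
  refine ⟨fun R => ⟨R.linearIndependent_gen, R.alg_le, R.isLieClosed_alg, R.isGreatest_rank,
    R.isRectifying_chart⟩, fun G => DeSitter.exists_row_of_isLieClosed,
    fun R Ω hΩ hc hd θ => DeSitter.invariant_iff_tableForm R hΩ hc hd,
    fun R Ω ψ h hc F hF => ⟨h.lieInvariant_iff hc hF, h.isSymmetryField_iff he hc hF⟩, ?_⟩
  -- The nontrivial symmetry field is one global Killing field `L`, nonzero since `X` is nonzero at
  -- `x`; both conclusions follow from this single invariance.
  rintro W F hW hWc hF ⟨X, hX, x, hx, hXx⟩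
  obtain ⟨L, hL, hXL, hLF⟩ := hX.exists_global_killing he hW hWc hF ⟨x, hx⟩
  have hL0 : L ≠ 0 := by
    rintro rfl
    exact hXx (hXL x hx)
  refine ⟨?_, DeSitter.exists_dense_rectified hW hF hL hL0 hLF⟩
  obtain ⟨R, τ, hτ, hsub, heq⟩ := DeSitter.exists_row_admissible hW hF hL hL0 hLF
  exact ⟨R, τ, hτ, hsub, heq, fun Ω ψ hψ hc hs => DeSitter.tableForm_pushForm hτ hW hF
    (fun A => hsub (Submodule.subset_span ⟨A, rfl⟩)) hψ hc hs⟩
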